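/- **Setting.** Let $N,M\ge 1$. Agents $k=1,\dots,N$ have twice-differentiable risks $J_k:\mathbb R^M\to\mathbb R$ with a common minimizer $w^o$ and $0<\nu_d I\le\nabla^2J_k(w)\le\delta_d I$ for all $w$. Let $A_1=[a_{1,\ell k}]$, $A_2=[a_{2,\ell k}]$ be left-stochastic $N\times N$ matrices (nonnegative entries, columns adding up to one) with $P=A_1A_2$ primitive, and let $p$ be the Perron vector: $Pp=p$, $\mathbb 1^{\sf T}p=1$. The step-sizes are $\mu_k=\mu_{\max}\tau_k$ with fixed ratios $0<\tau_k\le1$, $\max_k\tau_k=1$. From random initial estimates $w_{k,-1}$ with finite fourth-order moments, the agents run, for $i\ge0$, $$\phi_{k,i-1}=\sum_\ell a_{1,\ell k}w_{\ell,i-1},\quad \psi_{k,i}=\phi_{k,i-1}-\mu_k\Gamma_{k,i}\widehat{\nabla J}_{k,i}(\phi_{k,i-1}),\quad w_{k,i}=\sum_\ell a_{2,\ell k}\psi_{\ell,i},$$ where $\Gamma_{k,i}=\mathrm{diag}\{r_{k,i}(1),\dots,r_{k,i}(M)\}$, $r_{k,i}(m)\in\{0,1\}$, $\mathrm{Prob}(r_{k,i}(m)=0)=r_k\in[0,1)$.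 Let $\mathcal F_{i-1}$ be generated by all $w_{k,j},\Gamma_{k,j}$ with $j\le i-1$; an iterate is an $\mathcal F_{i-1}$-measurable random vector with finite fourth-order moment. Put $s_{k,i}(w)=\widehat{\nabla J}_{k,i}(w)-\nabla J_k(w)$ and $R_{s,k,i}(w)=\mathbb E[s_{k,i}(w)s_{k,i}(w)^{\sf T}|\mathcal F_{i-1}]$. Assume that, for all small $\mu_{\max}$, with constants independent of $\mu_{\max}$ and $i$: 1. the variables $r_{k,i}(m)$ of one time $i$ are independent of each other, and as a family independent of $\mathcal F_{i-1}$ together with the approximate gradients $\widehat{\nabla J}_{k,i}(w_k)$ at iterates $w_k$, $k=1,\dots,N$; 2. for all iterates $w,w'$, almost surely, $\mathbb E[s_{k,i}(w)|\mathcal F_{i-1}]=0$, $\mathbb E[s_{k,i}(w)s_{\ell,i}(w')^{\sf T}|\mathcal F_{i-1}]=0$ for $k\ne\ell$, and $\mathbb E[\|s_{k,i}(w)\|^4|\mathcal F_{i-1}]\le\beta_k^4\|w\|^4+\sigma_{s,k}^4$; 3. $\|\nabla^2J_k(w^o+v)-\nabla^2J_k(w^o)\|\le\kappa_c\|v\|$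 for all $\|v\|\le\varepsilon$, and for all iterates $w$, almost surely where $\|w-w^o\|\le\varepsilon$, $\|R_{s,k,i}(w)-R_{s,k,i}(w^o)\|\le\kappa_d\|w-w^o\|^\gamma$, with some $0<\gamma\le4$; 4. $R_{s,k,i}(w^o)\to G_k$ almost surely as $i\to\infty$, with constant matrices $G_k$ that do not depend on $\mu_{\max}$. **Notation.** $\widetilde w_{k,i}=w^o-w_{k,i}$, $q=\mathrm{diag}\{\mu_1,\dots,\mu_N\}A_2p$, $H_k=\nabla^2J_k(w^o)$, $G_k'=\mathbb E[\Gamma_{k,i}G_k\Gamma_{k,i}]$, $S=\sum_kq_k(1-r_k)H_k$, $\bar J=(\sum_kq_k)^{-1}\sum_kq_kJ_k$, $\bar H=(\sum_kq_k)^{-1}\sum_kq_kH_k$, and $$\mathrm{MSD}_k=\mu_{\max}\Big(\lim_{\mu_{\max}\to0}\limsup_{i\to\infty}\tfrac1{\mu_{\max}}\mathbb E\|\widetilde w_{k,i}\|^2\Big),\qquad \mathrm{ER}_k=\mu_{\max}\Big(\lim_{\mu_{\max}\to0}\limsup_{i\to\infty}\tfrac1{\mu_{\max}}\mathbb E\{\bar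 J(w_{k,i})-\bar J(w^o)\}\Big),$$ with network averages $\mathrm{MSD}_{av}=\frac1N\sum_k\mathrm{MSD}_k$, $\mathrm{ER}_{av}=\frac1N\sum_k\mathrm{ER}_k$. The long-term model of the error dynamics is $\widetilde w'_i=B'_i\widetilde w'_{i-1}+\mathcal A_2^{\sf T}\mathcal M\Gamma_is_i$ with $B'_i=\mathcal A_2^{\sf T}(I-\mathcal M\Gamma_i\mathcal H)\mathcal A_1^{\sf T}$, where $\mathcal A_j=A_j\otimes I_M$, $\mathcal M=\mathrm{diag}\{\mu_k\}\otimes I_M$, $\Gamma_i=\mathrm{diag}\{\Gamma_{k,i}\}$, $\mathcal H=\mathrm{diag}\{H_k\}$, and $s_i$ stacks the $s_{k,i}(\phi_{k,i-1})$; let $F=\mathbb E[B'_i\otimes B'_i]^{\sf T}$. For a vector $x$ write $\|x\|^2_{F^{i+1}}$ for the square $x^{\sf T}\Sigma x$, where $\Sigma$ is the matrix with $\mathrm{vec}(\Sigma)=F^{i+1}\mathrm{vec}(I)$. **Theorem.** All the moments above are finite, the limits exist, and for every agent $k$ $$\mathrm{MSD}_k=\mathrm{MSD}_{av}=\tfrac12\mathrm{Tr}\Big(S^{-1}\sum_{k}q_k^2G_k'\Big),\qquad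 \mathrm{ER}_k=\mathrm{ER}_{av}=\tfrac12\mathrm{Tr}\Big(X\sum_{k}q_k^2G_k'\Big),$$ where $X$ is the unique solution of the Lyapunov equation $XS+SX=\bar H$. Moreover, for every square-integrable initial error $\widetilde w'_{-1}$ that is $\mathcal F_{-1}$-measurable (here $\mathcal F_{-1}$ is the $\sigma$-algebra of the initial estimates), the long-term model satisfies $\mathbb E\|\widetilde w'_i\|^2=\mathbb E\|\widetilde w'_{-1}\|^2_{F^{i+1}}+c_i$ with $c_i$ independent of the initial error. As $\mu_{\max}\to0$, the convergence rate of the error variances is $$\alpha=1-2\lambda_{\min}\Big(\sum_{k}q_k(1-r_k)H_k\Big)+O\big(\mu_{\max}^{(N+1)/N}\big);$$ this holds both for $\alpha=\rho(F)$ (the spectral radius of $F$) and, for each agent $k$, for the slowest exponential rate, over all deterministic initial errors, at which $\mathbb E\|\widetilde w'_{k,i}\|^2$ approaches its part that does not depend on the initial error. -/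

import Mathlib

open MeasureTheory ProbabilityTheory Filter Topology
open scoped Kronecker Matrix

noncomputable section

namespace CoordDiffusion

/-- Vectors of `ℝ^M` with the Euclidean norm. -/
abbrev Vec (M : ℕ) : Type := EuclideanSpace ℝ (Fin M)

/-- The Hessian matrix of `f` at `x`, i.e. the Jacobian matrix of the gradient. -/
def hessian {M : ℕ} (f : Vec M → ℝ) (x : Vec M) : Matrix (Fin M) (Fin M) ℝ :=
  Matrix.of fun a b => (fderiv ℝ (gradient f) x (EuclideanSpace.single b 1)) a

/-- The norm of a square matrix induced by the Euclidean norm. -/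
def specNorm {M : ℕ} (A : Matrix (Fin M) (Fin M) ℝ) : ℝ :=
  ‖Matrix.toEuclideanCLM (n := Fin M) (𝕜 := ℝ) A‖

/-- The smallest real eigenvalue; it is applied to symmetric matrices only. -/
def lambdaMin {M : ℕ} (A : Matrix (Fin M) (Fin M) ℝ) : ℝ := sInf (spectrum ℝ A)

/-- The spectral radius of a real matrix (over its complex eigenvalues). -/
def specRadius {ι : Type*} [Fintype ι] [DecidableEq ι] (A : Matrix ι ι ℝ) : ℝ :=
  (spectralRadius ℂ (A.map (algebraMap ℝ ℂ))).toReal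

/-- The combination weights `a_{ℓ k}` are nonnegative and add up to one over `ℓ`. -/
def IsLeftStochastic {N : ℕ} (A : Matrix (Fin N) (Fin N) ℝ) : Prop :=
  (∀ l k, 0 ≤ A l k) ∧ ∀ k, ∑ l, A l k = 1

/-- All the data of a network of `N` agents that estimates a vector of `ℝ^M`. Iterations are
numbered `0, 1, 2, …`, and the step-size of agent `k` is `μ * τ k`, where `μ` is the largest
step-size. A weight is zero between agents that are not neighbors. -/
structure Model (N M : ℕ) (Ω : Type*) where
  /-- the individual risks `J_k` -/
  J : Fin N → Vec M → ℝ
  /-- the common minimizer -/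
  wo : Vec M
  /-- the combination matrix used before adaptation -/
  A₁ : Matrix (Fin N) (Fin N) ℝ
  /-- the combination matrix used after adaptation -/
  A₂ : Matrix (Fin N) (Fin N) ℝ
  /-- the ratios of the step-sizes to the largest one -/
  τ : Fin N → ℝ
  /-- the missing probabilities -/
  r : Fin N → ℝ
  /-- `gradEst k i ω w`: the approximate gradient of `J_k` at `w` that is available at
  iteration `i` -/
  gradEst : Fin N → ℕ → Ω → Vec M → Vec M
  /-- `mask k i m`: the indicator variable of the `m`-th coordinate -/
  mask : Fin N → ℕ → Fin M → Ω → ℝ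
  /-- the initial estimates -/
  winit : Fin N → Ω → Vec M

variable {N M : ℕ} {Ω : Type*}

namespace Model

/-- Combination before adaptation, `φ_k = ∑_ℓ a_{1,ℓk} w_ℓ`. -/
def combine (D : Model N M Ω) (w : Fin N → Ω → Vec M) (k : Fin N) (ω : Ω) : Vec M :=
  ∑ l, D.A₁ l k • w l ω

/-- The approximate gradient with its missing entries replaced by zero. -/
def maskedGrad (D : Model N M Ω) (k : Fin N) (i : ℕ) (ω : Ω) (v : Vec M) : Vec M :=
  WithLp.toLp 2 fun m => D.mask k i m ω * D.gradEst k i ω v m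

/-- The iterates of the coordinate-descent diffusion strategy with largest step-size `μ`:
`iter μ 0` holds the initial estimates and `iter μ (i + 1)` the estimates at the end of
iteration `i`. -/
def iter (D : Model N M Ω) (μ : ℝ) : ℕ → Fin N → Ω → Vec M
  | 0 => D.winit
  | i + 1 => fun k ω => ∑ l, D.A₂ l k •
      (D.combine (D.iter μ i) l ω -
        (μ * D.τ l) • D.maskedGrad l i ω (D.combine (D.iter μ i) l ω))

/-- The information available just before iteration `i`: it is generated by all estimates computed
so far (including the initial ones) and all indicator variables used so far. -/
@[reducible] def past (D : Model N M Ω) (μ : ℝ) (i : ℕ) : MeasurableSpace Ω :=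
  (⨆ (j : ℕ) (_ : j ≤ i) (k : Fin N),
      MeasurableSpace.comap (D.iter μ j k) (inferInstance : MeasurableSpace (Vec M))) ⊔
  (⨆ (j : ℕ) (_ : j < i) (k : Fin N) (m : Fin M),
      MeasurableSpace.comap (D.mask k j m) (inferInstance : MeasurableSpace ℝ))

/-- The gradient noise, based on the complete approximate gradient. -/
def noise (D : Model N M Ω) (k : Fin N) (i : ℕ) (ω : Ω) (v : Vec M) : Vec M :=
  D.gradEst k i ω v - gradient (D.J k) v

/-- The Hessian of `J_k` at the minimizer. -/
def H (D : Model N M Ω) (k : Fin N) : Matrix (Fin M) (Fin M) ℝ := hessian (D.J k) D.wo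

/-- The vector `q = diag(μ_1, …, μ_N) A₂ p`. -/
def q (D : Model N M Ω) (p : Fin N → ℝ) (μ : ℝ) (k : Fin N) : ℝ := μ * D.τ k * (D.A₂ *ᵥ p) k

/-- The matrix `∑ q_k (1 - r_k) H_k`. -/
def S (D : Model N M Ω) (p : Fin N → ℝ) (μ : ℝ) : Matrix (Fin M) (Fin M) ℝ :=
  ∑ k, (D.q p μ k * (1 - D.r k)) • D.H k

/-- The normalized aggregate cost. -/
def Jbar (D : Model N M Ω) (p : Fin N → ℝ) (μ : ℝ) (v : Vec M) : ℝ :=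
  (∑ k, D.q p μ k)⁻¹ * ∑ k, D.q p μ k * D.J k v

/-- The normalized aggregate Hessian at the minimizer. -/
def Hbar (D : Model N M Ω) (p : Fin N → ℝ) (μ : ℝ) : Matrix (Fin M) (Fin M) ℝ :=
  (∑ k, D.q p μ k)⁻¹ • ∑ k, D.q p μ k • D.H k

/-! ### The long-term model of the error dynamics -/

/-- The block diagonal matrix `diag(H_1, …, H_N)`. -/
def blockH (D : Model N M Ω) : Matrix (Fin N × Fin M) (Fin N × Fin M) ℝ :=
  Matrix.of fun x y => if x.1 = y.1 then D.H x.1 x.2 y.2 else 0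

/-- The product of the block diagonal matrices of the step-sizes and of the masks at
iteration `i`. -/
def stepMask (D : Model N M Ω) (μ : ℝ) (i : ℕ) (ω : Ω) :
    Matrix (Fin N × Fin M) (Fin N × Fin M) ℝ :=
  Matrix.diagonal fun x => μ * D.τ x.1 * D.mask x.1 i x.2 ω

/-- The transition matrix `B'_i = 𝒜₂ᵀ (I - ℳ Γ_i ℋ) 𝒜₁ᵀ`. -/
def B (D : Model N M Ω) (μ : ℝ) (i : ℕ) (ω : Ω) : Matrix (Fin N × Fin M) (Fin N × Fin M) ℝ :=
  (D.A₂ ⊗ₖ (1 : Matrix (Fin M) (Fin M) ℝ))ᵀ * (1 - D.stepMask μ i ω * D.blockH) *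
    (D.A₁ ⊗ₖ (1 : Matrix (Fin M) (Fin M) ℝ))ᵀ

/-- The gradient noises `s_{k,i}(φ_{k,i-1})` of all agents along the algorithm, stacked. -/
def noiseVec (D : Model N M Ω) (μ : ℝ) (i : ℕ) (ω : Ω) : Fin N × Fin M → ℝ :=
  fun x => D.noise x.1 i ω (D.combine (D.iter μ i) x.1 ω) x.2

/-- The long-term model of the network error vector, started from `x₀`:
`x_{i+1} = B'_i x_i + 𝒜₂ᵀ ℳ Γ_i s_i`. -/
def longTerm (D : Model N M Ω) (μ : ℝ) (x₀ : Ω → Fin N × Fin M → ℝ) :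
    ℕ → Ω → Fin N × Fin M → ℝ
  | 0 => x₀
  | i + 1 => fun ω => D.B μ i ω *ᵥ D.longTerm μ x₀ i ω +
      (D.A₂ ⊗ₖ (1 : Matrix (Fin M) (Fin M) ℝ))ᵀ *ᵥ (D.stepMask μ i ω *ᵥ D.noiseVec μ i ω)

variable [MeasurableSpace Ω]

/-- The conditional covariance matrix `R_{s,k,i}(v)` of the gradient noise at the iterate `v`. -/
def noiseCov (D : Model N M Ω) (P : Measure Ω) (μ : ℝ) (k : Fin N) (i : ℕ) (v : Ω → Vec M)
    (ω : Ω) : Matrix (Fin M) (Fin M) ℝ :=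
  Matrix.of fun a b =>
    (P[fun ω' => D.noise k i ω' (v ω') a * D.noise k i ω' (v ω') b | D.past μ i]) ω

/-- The matrix `E[Γ_{k,i} G Γ_{k,i}]`. -/
def maskedCov (D : Model N M Ω) (P : Measure Ω) (k : Fin N) (i : ℕ)
    (G : Matrix (Fin M) (Fin M) ℝ) : Matrix (Fin M) (Fin M) ℝ :=
  Matrix.of fun a b =>
    ∫ ω, (Matrix.diagonal (fun m => D.mask k i m ω) * G *
      Matrix.diagonal (fun m => D.mask k i m ω)) a b ∂P

/-- The matrix `∑ q_k² G'_k`, with the masks of iteration `i`. -/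
def maskedCovSum (D : Model N M Ω) (P : Measure Ω) (p : Fin N → ℝ)
    (G : Fin N → Matrix (Fin M) (Fin M) ℝ) (μ : ℝ) (i : ℕ) : Matrix (Fin M) (Fin M) ℝ :=
  ∑ k, D.q p μ k ^ 2 • D.maskedCov P k i (G k)

/-- The matrix `ℱ = E[B'_i ⊗ B'_i]ᵀ`. (The block Kronecker product is the Kronecker product up to
the order in which the pairs of indices are listed.) -/
def F (D : Model N M Ω) (P : Measure Ω) (μ : ℝ) (i : ℕ) :
    Matrix ((Fin N × Fin M) × (Fin N × Fin M)) ((Fin N × Fin M) × (Fin N × Fin M)) ℝ :=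
  (Matrix.of fun x y => ∫ ω, (D.B μ i ω ⊗ₖ D.B μ i ω) x y ∂P)ᵀ

/-- The second moment of the block of agent `k` in the long-term model. -/
def longTermVar (D : Model N M Ω) (P : Measure Ω) (μ : ℝ) (x₀ : Ω → Fin N × Fin M → ℝ)
    (k : Fin N) (i : ℕ) : ℝ :=
  ∫ ω, ∑ m, D.longTerm μ x₀ i ω (k, m) ^ 2 ∂P

/-- The convergence rate of the error variance of agent `k`: the slowest exponential rate, over all
initial errors `x`, at which the error variance of the long-term model approaches the part of it
that does not depend on the initial error. -/
def rate (D : Model N M Ω) (P : Measure Ω) (μ : ℝ) (k : Fin N) : ENNReal :=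
  ⨆ x : Fin N × Fin M → ℝ, limsup (fun i : ℕ =>
    ENNReal.ofReal (|D.longTermVar P μ (fun _ => x) k i - D.longTermVar P μ 0 k i| ^
      ((1 : ℝ) / i))) atTop

end Model

/-- The weighted square `‖x‖²_σ`, where `σ` lists the entries of the weighting matrix. -/
def weightedSq {ι : Type*} [Fintype ι] (x : ι → ℝ) (σ : ι × ι → ℝ) : ℝ :=
  ∑ a, ∑ b, x a * σ (a, b) * x b

/-- The identity matrix listed as a vector. -/
def vecOne (ι : Type*) [DecidableEq ι] : ι × ι → ℝ := fun x => (1 : Matrix ι ι ℝ) x.1 x.2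

/-- `D μ` is the steady-state value to first order in `μ` of the sequences `V μ 0, V μ 1, …`:
`D μ = μ (lim_{μ → 0} limsup_{i → ∞} V μ i / μ)`, where the limit exists and is finite. -/
def IsFirstOrderValue (V : ℝ → ℕ → ℝ) (D : ℝ → ℝ) : Prop :=
  ∃ L : ℝ,
    Tendsto (fun μ : ℝ => limsup (fun i : ℕ => ((1 / μ * V μ i : ℝ) : EReal)) atTop)
      (𝓝[>] 0) (𝓝 (L : EReal)) ∧
    ∀ μ : ℝ, 0 < μ → D μ = μ * L

/-! ### Assumptions -/

/-- The network, the step-sizes and the missing probabilities. -/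
structure NetworkConditions (D : Model N M Ω) : Prop where
  A₁_stoch : IsLeftStochastic D.A₁
  A₂_stoch : IsLeftStochastic D.A₂
  primitive : (D.A₁ * D.A₂).IsPrimitive
  τ_pos : ∀ k, 0 < D.τ k
  τ_le : ∀ k, D.τ k ≤ 1
  τ_max : ∃ k, D.τ k = 1
  r_nonneg : ∀ k, 0 ≤ D.r k
  r_lt : ∀ k, D.r k < 1

/-- The risks are twice differentiable, with a common minimizer and uniformly bounded Hessians:
`0 < ν I ≤ ∇²J_k(w) ≤ δ I`. -/
structure CostConditions (D : Model N M Ω) : Prop where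
  diff : ∀ k, Differentiable ℝ (D.J k)
  diff_grad : ∀ k, Differentiable ℝ (gradient (D.J k))
  minimizer : ∀ k v, D.J k D.wo ≤ D.J k v
  hess_bounds : ∃ ν δ : ℝ, 0 < ν ∧ ν ≤ δ ∧ ∀ k v,
    (hessian (D.J k) v - ν • 1).PosSemidef ∧ (δ • 1 - hessian (D.J k) v).PosSemidef

/-- Measurability, and finite fourth-order moments of the initial estimates. -/
structure Regularity [MeasurableSpace Ω] (D : Model N M Ω) (P : Measure Ω) : Prop where
  gradEst_meas : ∀ k i, Measurable (Function.uncurry (D.gradEst k i))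
  mask_meas : ∀ k i m, Measurable (D.mask k i m)
  winit_meas : ∀ k, Measurable (D.winit k)
  winit_mem : ∀ k, MemLp (D.winit k) 4 P

/-- An iterate is a random vector that is determined by the past; it has a finite fourth-order
moment, so that the conditional moments below are finite. -/
def IsIterate [MeasurableSpace Ω] (D : Model N M Ω) (P : Measure Ω) (μ : ℝ) (i : ℕ)
    (v : Ω → Vec M) : Prop :=
  Measurable[D.past μ i] v ∧ MemLp v 4 P

/-- Bernoulli masks. The masks of an iteration are independent of each other, and jointly
independent of the past and of the approximate gradients at the iterates. -/
structure MaskConditions [MeasurableSpace Ω] (D : Model N M Ω) (P : Measure Ω) (μbar : ℝ) :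
    Prop where
  zero_or_one : ∀ k i m ω, D.mask k i m ω = 0 ∨ D.mask k i m ω = 1
  prob_zero : ∀ k i m, P {ω | D.mask k i m ω = 0} = ENNReal.ofReal (D.r k)
  indep_coord : ∀ i, Pairwise fun x y : Fin N × Fin M =>
    IndepFun (D.mask x.1 i x.2) (D.mask y.1 i y.2) P
  indep_past : ∀ μ ∈ Set.Ioo 0 μbar, ∀ i, ∀ v : Fin N → Ω → Vec M,
    (∀ k, IsIterate D P μ i (v k)) →
    Indep
      (⨆ (k : Fin N) (m : Fin M),
        MeasurableSpace.comap (D.mask k i m) (inferInstance : MeasurableSpace ℝ))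
      (D.past μ i ⊔ ⨆ k : Fin N,
        MeasurableSpace.comap (fun ω => D.gradEst k i ω (v k ω))
          (inferInstance : MeasurableSpace (Vec M))) P

/-- The gradient noise has zero conditional mean, is conditionally uncorrelated across agents, and
has a bounded conditional fourth-order moment. -/
structure NoiseConditions [MeasurableSpace Ω] (D : Model N M Ω) (P : Measure Ω) (μbar : ℝ) :
    Prop where
  zero_mean : ∀ μ ∈ Set.Ioo 0 μbar, ∀ k i v, IsIterate D P μ i v →
    P[fun ω => D.noise k i ω (v ω) | D.past μ i] =ᵐ[P] 0
  uncorrelated : ∀ μ ∈ Set.Ioo 0 μbar, ∀ k l i v v', k ≠ l →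
    IsIterate D P μ i v → IsIterate D P μ i v' → ∀ a b,
    P[fun ω => D.noise k i ω (v ω) a * D.noise l i ω (v' ω) b | D.past μ i] =ᵐ[P] 0
  fourth_moment : ∃ β σ : Fin N → ℝ, (∀ k, 0 ≤ β k) ∧ (∀ k, 0 ≤ σ k) ∧
    ∀ μ ∈ Set.Ioo 0 μbar, ∀ k i v, IsIterate D P μ i v →
      MemLp (fun ω => D.noise k i ω (v ω)) 4 P ∧
      P[fun ω => ‖D.noise k i ω (v ω)‖ ^ 4 | D.past μ i] ≤ᵐ[P]
        fun ω => β k ^ 4 * ‖v ω‖ ^ 4 + σ k ^ 4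

/-- Local Lipschitz continuity at the minimizer of the Hessians, and local Hölder continuity of the
conditional covariance matrices of the gradient noise. -/
structure SmoothnessConditions [MeasurableSpace Ω] (D : Model N M Ω) (P : Measure Ω)
    (μbar : ℝ) : Prop where
  hess : ∃ ε κ : ℝ, 0 < ε ∧ 0 ≤ κ ∧ ∀ k v, ‖v‖ ≤ ε →
    specNorm (hessian (D.J k) (D.wo + v) - hessian (D.J k) D.wo) ≤ κ * ‖v‖
  cov : ∃ ε κ γ : ℝ, 0 < ε ∧ 0 ≤ κ ∧ 0 < γ ∧ γ ≤ 4 ∧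
    ∀ μ ∈ Set.Ioo 0 μbar, ∀ k i v, IsIterate D P μ i v → ∀ᵐ ω ∂P, ‖v ω - D.wo‖ ≤ ε →
      specNorm (D.noiseCov P μ k i v ω - D.noiseCov P μ k i (fun _ => D.wo) ω)
        ≤ κ * ‖v ω - D.wo‖ ^ γ

/-- `G k` is the limit of the conditional covariance matrices of the gradient noise at the
minimizer. -/
def IsLimitCov [MeasurableSpace Ω] (D : Model N M Ω) (P : Measure Ω) (μbar : ℝ)
    (G : Fin N → Matrix (Fin M) (Fin M) ℝ) : Prop :=
  ∀ μ ∈ Set.Ioo 0 μbar, ∀ k, ∀ᵐ ω ∂P,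
    Tendsto (fun i => D.noiseCov P μ k i (fun _ => D.wo) ω) atTop (𝓝 (G k))

/-- `p` is the Perron eigenvector of `A₁ A₂`, with entries that add up to one. -/
def IsPerronVector (D : Model N M Ω) (p : Fin N → ℝ) : Prop :=
  (D.A₁ * D.A₂) *ᵥ p = p ∧ ∑ k, p k = 1

end CoordDiffusion

end

open CoordDiffusion

/-!
The errors of the network split into their average with the Perron weights `p` and the disagreement
between the agents. The combination step leaves the average alone, so that `avg p` of the errors
moves in iteration `i` by `-μ • push`, where the push collects the masked approximate gradients
with the weights of `q`. The disagreement is measured by a seminorm that every combination step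
contracts (`ConsensusGauge`). It exists because the powers of a primitive stochastic matrix
converge to the Perron projection, by Dobrushin's contraction; summing the plain disagreement along
finitely many steps yields a contraction at each single step.

*Performance.* The strong monotonicity of the gradients and the moment conditions on the noise give
coupled recursions for the fourth moments of the average and of the disagreement, which settle at
`O(μ²)` and `O(μ⁴)` (`Setting.exists_fourth_moment_bound`). At this scale the mean push is the
linear map `Shat` of the average up to `o(μ)` (`Setting.steady_drift`), and the covariance of the
push settles at the masked noise covariance `Khat` at the minimizer (`Setting.steady_push_mul`).
Along eigenvectors of `Shat` with eigenvalues `a` and `b` the second moments of the average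
therefore obey scalar recursions with rate `1 - μ (a + b)`, and `1 / μ` times these moments tends
to the entry of `Khat` divided by `a + b` (`Setting.steady_avg_mul`). The Lyapunov equation cancels
the denominators: for `X S + S X = Q` the quadratic form of `Q` has the steady value `Tr (X Khat)`,
at the average and, as the disagreement is of higher order, at every agent
(`Setting.steady_agent`). The mean-square deviation is the case `Q = I`, where `X = S⁻¹ / 2`; the
excess risk is the case of half the aggregate Hessian. All limits are iterated: first `i → ∞`, then
`μ → 0` (`SteadyLimit`).

*Variance relation.* In the long-term model the masks of an iteration are independent of the state,
so second moments are propagated by `Fᵀ` (`Setting.moments_mulVec`). The noise is uncorrelated with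
the state and adds a term that does not depend on the initial error (`Setting.sum_longTermVar`).

*Rates.* The transient part of the second moments is the second moment of the run without noise,
`Model.freeRun`, and these runs realize the powers of `Fᵀ` (`Setting.moments_freeRun`). From above,
a weighted sum of the second moments of average and disagreement decays at least at the rate
`1 - 2 μ λ + O(μ²)`, with the smallest eigenvalue `λ` of `Shat` (`Setting.exists_freeRun_le`).
From below, a second moment is at least the square of the mean, and the mean run that starts from
an eigenvector of `λ` stays in a cone around the eigenspace, where it decays no faster than
`1 - μ λ - O(μ²)` per step (`exists_slow_mode`). Gelfand's formula turns these bounds into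
bounds for the spectral radius of `F` (`specRadius_mem_Icc`), and taking roots turns them into
bounds for the rates of the agents (`Setting.rate_mem_Icc`). The resulting error `O(μ²)` is at
least as small as the claimed one, since `(N + 1) / N ≤ 2`.
-/

namespace CoordDiffusion

/-! ### Stochastic matrices and the consensus gauge -/

section Stochastic

variable {N M : ℕ}

/-- Every agent replaces its vector by the combination of all vectors with weights `A l k`. -/
noncomputable def mix (A : Matrix (Fin N) (Fin N) ℝ) (x : Fin N → Vec M) (k : Fin N) : Vec M :=
  ∑ l, A l k • x l

/-- The weighted average of the vectors of all agents. -/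
noncomputable def avg (p : Fin N → ℝ) (x : Fin N → Vec M) : Vec M := ∑ k, p k • x k

lemma mix_add (A : Matrix (Fin N) (Fin N) ℝ) (x y : Fin N → Vec M) :
    mix A (x + y) = mix A x + mix A y := by
  funext k; simp [mix, smul_add, Finset.sum_add_distrib]

lemma avg_add (p : Fin N → ℝ) (x y : Fin N → Vec M) : avg p (x + y) = avg p x + avg p y := by
  simp [avg, smul_add, Finset.sum_add_distrib]

lemma avg_sub (p : Fin N → ℝ) (x y : Fin N → Vec M) : avg p (x - y) = avg p x - avg p y := by
  simp [avg, smul_sub, Finset.sum_sub_distrib]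

lemma mix_mix (A B : Matrix (Fin N) (Fin N) ℝ) (x : Fin N → Vec M) :
    mix B (mix A x) = mix (A * B) x := by
  funext k
  simp only [mix, Matrix.mul_apply, Finset.smul_sum, Finset.sum_smul, smul_smul]
  rw [Finset.sum_comm]
  exact Finset.sum_congr rfl fun l _ => Finset.sum_congr rfl fun j _ => by rw [mul_comm]

lemma avg_mix (p : Fin N → ℝ) (A : Matrix (Fin N) (Fin N) ℝ) (x : Fin N → Vec M) :
    avg p (mix A x) = avg (A *ᵥ p) x := by
  simp only [avg, mix, Matrix.mulVec, dotProduct, Finset.smul_sum, Finset.sum_smul, smul_smul]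
  rw [Finset.sum_comm]
  exact Finset.sum_congr rfl fun l _ => Finset.sum_congr rfl fun j _ => by rw [mul_comm]

lemma mix_one (x : Fin N → Vec M) : mix 1 x = x := by
  funext k; simp [mix, Matrix.one_apply]

lemma IsLeftStochastic.mul {A B : Matrix (Fin N) (Fin N) ℝ} (hA : IsLeftStochastic A)
    (hB : IsLeftStochastic B) : IsLeftStochastic (A * B) := by
  refine ⟨fun l k => ?_, fun k => ?_⟩
  · rw [Matrix.mul_apply]
    exact Finset.sum_nonneg fun j _ => mul_nonneg (hA.1 _ _) (hB.1 _ _)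
  · simp only [Matrix.mul_apply]
    rw [Finset.sum_comm]
    simp only [← Finset.sum_mul, hA.2, one_mul, hB.2]

lemma IsLeftStochastic.pow {A : Matrix (Fin N) (Fin N) ℝ} (hA : IsLeftStochastic A) (n : ℕ) :
    IsLeftStochastic (A ^ n) := by
  induction n with
  | zero =>
    refine ⟨fun l k => ?_, fun k => ?_⟩
    · rw [pow_zero, Matrix.one_apply]; split_ifs <;> norm_num
    · simp [Matrix.one_apply]
  | succ n ih => rw [pow_succ]; exact ih.mul hA

lemma IsLeftStochastic.sum_mulVec {A : Matrix (Fin N) (Fin N) ℝ} (hA : IsLeftStochastic A)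
    (v : Fin N → ℝ) : ∑ k, (A *ᵥ v) k = ∑ k, v k := by
  simp only [Matrix.mulVec, dotProduct]
  rw [Finset.sum_comm]
  simp only [← Finset.sum_mul, hA.2, one_mul]

lemma IsLeftStochastic.le_one {A : Matrix (Fin N) (Fin N) ℝ} (hA : IsLeftStochastic A)
    (l k : Fin N) : A l k ≤ 1 := by
  rw [← hA.2 k]
  exact Finset.single_le_sum (f := fun l => A l k) (fun j _ => hA.1 j k) (Finset.mem_univ l)

/-- Convex combinations stay in every ball that contains the vectors of all agents. -/
lemma norm_mix_sub_le {A : Matrix (Fin N) (Fin N) ℝ} (hA : IsLeftStochastic A)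
    (x : Fin N → Vec M) (c : Vec M) (r : ℝ) (h : ∀ l, ‖x l - c‖ ≤ r) (k : Fin N) :
    ‖mix A x k - c‖ ≤ r := by
  have : mix A x k - c = ∑ l, A l k • (x l - c) := by
    simp only [mix, smul_sub, Finset.sum_sub_distrib, ← Finset.sum_smul, hA.2, one_smul]
  rw [this]
  calc _ ≤ ∑ l, ‖A l k • (x l - c)‖ := norm_sum_le _ _
    _ ≤ ∑ l, A l k * r := Finset.sum_le_sum fun l _ => by
        rw [norm_smul, Real.norm_of_nonneg (hA.1 l k)]
        exact mul_le_mul_of_nonneg_left (h l) (hA.1 l k)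
    _ = r := by rw [← Finset.sum_mul, hA.2, one_mul]

lemma norm_mix_le {A : Matrix (Fin N) (Fin N) ℝ} (hA : IsLeftStochastic A)
    (x : Fin N → Vec M) (k : Fin N) : ‖mix A x k‖ ≤ ∑ l, ‖x l‖ := by
  calc _ ≤ ∑ l, ‖A l k • x l‖ := norm_sum_le _ _
    _ ≤ ∑ l, ‖x l‖ := Finset.sum_le_sum fun l _ => by
        rw [norm_smul, Real.norm_of_nonneg (hA.1 l k)]
        exact mul_le_of_le_one_left (norm_nonneg _) (hA.le_one l k)

/-- Dobrushin's contraction: on vectors whose entries add up to zero, the positive part that all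
columns have in common acts as zero. -/
lemma IsLeftStochastic.sum_abs_mulVec_le {A : Matrix (Fin N) (Fin N) ℝ} (hA : IsLeftStochastic A)
    {c : ℝ} (hc : ∀ l k, c ≤ A l k) {v : Fin N → ℝ} (hv : ∑ k, v k = 0) :
    ∑ k, |(A *ᵥ v) k| ≤ (1 - N * c) * ∑ k, |v k| := by
  have h1 : ∀ k, |(A *ᵥ v) k| ≤ ∑ l, (A k l - c) * |v l| := by
    intro k
    have : (A *ᵥ v) k = ∑ l, (A k l - c) * v l := by
      simp only [Matrix.mulVec, dotProduct, sub_mul, Finset.sum_sub_distrib, ← Finset.mul_sum, hv]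
      ring
    rw [this]
    refine (Finset.abs_sum_le_sum_abs _ _).trans (Finset.sum_le_sum fun l _ => ?_)
    rw [abs_mul, abs_of_nonneg (sub_nonneg.2 (hc k l))]
  refine (Finset.sum_le_sum fun k _ => h1 k).trans (le_of_eq ?_)
  rw [Finset.sum_comm, Finset.mul_sum]
  refine Finset.sum_congr rfl fun l _ => ?_
  rw [← Finset.sum_mul, Finset.sum_sub_distrib, hA.2]
  simp

/-- The powers of a primitive stochastic matrix converge to the rank-one Perron projection. -/
lemma IsLeftStochastic.exists_pow_near {A : Matrix (Fin N) (Fin N) ℝ} (hA : IsLeftStochastic A)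
    (hprim : A.IsPrimitive) {p : Fin N → ℝ} (hp : A *ᵥ p = p) (hp1 : ∑ k, p k = 1)
    {η : ℝ} (hη : 0 < η) : ∃ n, 0 < n ∧ ∀ l k, |(A ^ n) l k - p l| ≤ η := by
  obtain ⟨n₀, hn₀, hpos⟩ := hprim.exists_pos_pow
  have hne : Nonempty (Fin N) := by
    by_contra h
    rw [not_nonempty_iff] at h
    simp at hp1
  obtain ⟨⟨l₀, k₀⟩, hmin⟩ := Finite.exists_min (fun x : Fin N × Fin N => (A ^ n₀) x.1 x.2)
  -- the smallest entry of a positive power of `A` is the part common to all its columns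
  set c := (A ^ n₀) l₀ k₀ with hc
  have hc0 : 0 < c := hpos _ _
  have hAn := hA.pow n₀
  have hNc : (N : ℝ) * c ≤ 1 := by
    rw [← hAn.2 k₀]
    calc (N : ℝ) * c = ∑ _l : Fin N, c := by simp
      _ ≤ _ := Finset.sum_le_sum fun l _ => hmin (l, k₀)
  have hN : (0 : ℝ) < N := by
    have := Fin.pos l₀
    exact_mod_cast this
  set θ := 1 - N * c with hθ
  have hθ0 : 0 ≤ θ := by linarith
  have hθ1 : θ < 1 := by nlinarith
  have hpn : ∀ j, (A ^ j) *ᵥ p = p := by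
    intro j
    induction j with
    | zero => simp
    | succ j ih => rw [pow_succ, ← Matrix.mulVec_mulVec, hp, ih]
  have hiter : ∀ (v : Fin N → ℝ), ∑ k, v k = 0 → ∀ j : ℕ,
      ∑ k, |(((A ^ n₀) ^ j) *ᵥ v) k| ≤ θ ^ j * ∑ k, |v k| := by
    intro v hv j
    induction j with
    | zero => simp
    | succ j ih =>
      rw [pow_succ', ← Matrix.mulVec_mulVec]
      have h0 : ∑ k, (((A ^ n₀) ^ j) *ᵥ v) k = 0 := by rw [(hAn.pow j).sum_mulVec, hv]
      refine (hAn.sum_abs_mulVec_le (fun l k => hmin (l, k)) h0).trans ?_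
      rw [pow_succ', mul_assoc]
      exact mul_le_mul_of_nonneg_left ih hθ0
  set K := 1 + ∑ k, |p k| with hK
  have hK0 : 0 < K := by positivity
  obtain ⟨j, hj⟩ := exists_pow_lt_of_lt_one (div_pos hη hK0) hθ1
  replace hj : θ ^ (j + 1) < η / K := (pow_le_pow_of_le_one hθ0 hθ1.le j.le_succ).trans_lt hj
  refine ⟨n₀ * (j + 1), by positivity, fun l k => ?_⟩
  -- the column `k` of a power of `A`, minus `p`, is the image of `e_k - p`, whose entries add up
  -- to zero
  have hv : ∑ i, (Pi.single k 1 - p : Fin N → ℝ) i = 0 := by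
    simp [Finset.sum_sub_distrib, hp1]
  have h1 := hiter _ hv (j + 1)
  have h2 : (A ^ (n₀ * (j + 1))) l k - p l = (((A ^ n₀) ^ (j + 1)) *ᵥ (Pi.single k 1 - p)) l := by
    rw [← pow_mul, Matrix.mulVec_sub, hpn]
    simp
  rw [h2]
  refine (Finset.single_le_sum (f := fun l => |(((A ^ n₀) ^ (j + 1)) *ᵥ (Pi.single k 1 - p)) l|)
    (fun i _ => abs_nonneg _) (Finset.mem_univ l)).trans (h1.trans ?_)
  have h3 : ∑ i, |(Pi.single k 1 - p : Fin N → ℝ) i| ≤ K := by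
    calc _ ≤ ∑ i, (|(Pi.single k 1 : Fin N → ℝ) i| + |p i|) :=
          Finset.sum_le_sum fun i _ => abs_sub _ _
      _ = K := by
          rw [Finset.sum_add_distrib, hK]
          congr 1
          rw [Finset.sum_eq_single k] <;> simp +contextual
  calc _ ≤ (η / K) * K :=
        mul_le_mul hj.le h3 (Finset.sum_nonneg fun i _ => abs_nonneg _) (by positivity)
    _ = η := by field_simp

lemma IsLeftStochastic.perron_nonneg {A : Matrix (Fin N) (Fin N) ℝ} (hA : IsLeftStochastic A)
    (hprim : A.IsPrimitive) {p : Fin N → ℝ} (hp : A *ᵥ p = p) (hp1 : ∑ k, p k = 1) (k : Fin N) :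
    0 ≤ p k := by
  refine le_of_forall_pos_le_add fun η hη => ?_
  obtain ⟨n, -, hn⟩ := hA.exists_pow_near hprim hp hp1 hη
  have := abs_le.1 (hn k k)
  have := (hA.pow n).1 k k
  linarith

/-- A seminorm on network states that measures the disagreement between the agents and that one
combination step with the matrix `A` contracts. -/
structure ConsensusGauge (M : ℕ) (A : Matrix (Fin N) (Fin N) ℝ) (p : Fin N → ℝ) where
  /-- the seminorm -/
  V : (Fin N → Vec M) → ℝ
  /-- the contraction factor -/
  ρ : ℝ
  /-- the constant in the comparison with the norm -/
  C : ℝ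
  ρ_nonneg : 0 ≤ ρ
  ρ_lt : ρ < 1
  C_nonneg : 0 ≤ C
  cont : Continuous V
  nonneg : ∀ x, 0 ≤ V x
  add_le : ∀ x y, V (x + y) ≤ V x + V y
  le_sum : ∀ x, V x ≤ C * ∑ k, ‖x k‖
  dist_le : ∀ x k, ‖x k - avg p x‖ ≤ V x
  contract : ∀ x, V (mix A x) ≤ ρ * V x

@[fun_prop]
lemma continuous_mix (A : Matrix (Fin N) (Fin N) ℝ) :
    Continuous (mix A : (Fin N → Vec M) → Fin N → Vec M) := by
  unfold mix; fun_prop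

@[fun_prop]
lemma continuous_avg (p : Fin N → ℝ) : Continuous (avg p : (Fin N → Vec M) → Vec M) := by
  unfold avg; fun_prop

/-- Summing the disagreement along finitely many combination steps turns the contraction after
many steps into a contraction at every step. -/
lemma IsLeftStochastic.exists_consensusGauge (M : ℕ) {A : Matrix (Fin N) (Fin N) ℝ}
    (hA : IsLeftStochastic A) (hprim : A.IsPrimitive) {p : Fin N → ℝ} (hp : A *ᵥ p = p)
    (hp1 : ∑ k, p k = 1) : Nonempty (ConsensusGauge M A p) := by
  have hN : (0 : ℝ) < N := by
    rcases Nat.eq_zero_or_pos N with rfl | h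
    · simp at hp1
    · exact_mod_cast h
  have hp0 := hA.perron_nonneg hprim hp hp1
  -- this accuracy makes `n` combination steps halve the disagreement `V₀`
  obtain ⟨n, hn0, hn⟩ := hA.exists_pow_near hprim hp hp1 (η := 1 / (2 * N)) (by positivity)
  set V₀ : (Fin N → Vec M) → ℝ := fun x => ∑ k, ‖x k - avg p x‖ with hV₀
  have hV₀_nonneg : ∀ x, 0 ≤ V₀ x := fun x => Finset.sum_nonneg fun k _ => norm_nonneg _
  have havg : ∀ (j : ℕ) (x : Fin N → Vec M), avg p (mix (A ^ j) x) = avg p x := by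
    intro j x
    rw [avg_mix]
    congr 1
    induction j with
    | zero => simp
    | succ j ih => rw [pow_succ, ← Matrix.mulVec_mulVec, hp, ih]
  have hdiff : ∀ (j : ℕ) (x : Fin N → Vec M) (k : Fin N),
      mix (A ^ j) x k - avg p x = ∑ l, ((A ^ j) l k - p l) • (x l - avg p x) := by
    intro j x k
    have h1 := (hA.pow j).2 k
    simp only [sub_smul, smul_sub, Finset.sum_sub_distrib, ← Finset.sum_smul, h1, hp1, one_smul]
    simp [mix, avg]
  have hV₀_le : ∀ (j : ℕ) (x : Fin N → Vec M) (η : ℝ), (∀ l k, |(A ^ j) l k - p l| ≤ η) →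
      V₀ (mix (A ^ j) x) ≤ (N * η) * V₀ x := by
    intro j x η hη
    simp only [hV₀, havg]
    calc ∑ k, ‖mix (A ^ j) x k - avg p x‖ ≤ ∑ _k : Fin N, η * ∑ l, ‖x l - avg p x‖ := by
          refine Finset.sum_le_sum fun k _ => ?_
          rw [hdiff, Finset.mul_sum]
          refine (norm_sum_le _ _).trans (Finset.sum_le_sum fun l _ => ?_)
          rw [norm_smul]
          exact mul_le_mul_of_nonneg_right (hη l k) (norm_nonneg _)
      _ = _ := by simp; ring
  have hp_le : ∀ l, p l ≤ 1 := fun l => by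
    rw [← hp1]; exact Finset.single_le_sum (fun j _ => hp0 j) (Finset.mem_univ l)
  have hV₀_le1 : ∀ (j : ℕ) (x : Fin N → Vec M), V₀ (mix (A ^ j) x) ≤ N * V₀ x := by
    intro j x
    have := hV₀_le j x 1 (fun l k => abs_le.2 ⟨by
      have := (hA.pow j).1 l k; have := hp_le l; linarith, by
      have := (hA.pow j).le_one l k; have := hp0 l; linarith⟩)
    simpa using this
  set V : (Fin N → Vec M) → ℝ := fun x => ∑ j ∈ Finset.range n, V₀ (mix (A ^ j) x) with hV
  have hVle : ∀ x, V x ≤ (n * N) * V₀ x := by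
    intro x
    have : ∑ j ∈ Finset.range n, V₀ (mix (A ^ j) x) ≤ ∑ _j ∈ Finset.range n, N * V₀ x :=
      Finset.sum_le_sum fun j _ => hV₀_le1 j x
    simp only [Finset.sum_const, Finset.card_range, nsmul_eq_mul] at this
    simp only [hV]
    linarith
  have hn1 : (1 : ℝ) ≤ n := by exact_mod_cast hn0
  have hN1 : (1 : ℝ) ≤ N := by
    have : 0 < N := by exact_mod_cast hN
    exact_mod_cast this
  have hK : (1 : ℝ) ≤ n * N := by nlinarith
  have hnN : (0 : ℝ) < n * N := by linarith
  have hV₀V : ∀ x, V₀ x ≤ V x := by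
    intro x
    have := Finset.single_le_sum (f := fun j => V₀ (mix (A ^ j) x)) (fun j _ => hV₀_nonneg _)
      (Finset.mem_range.2 hn0)
    simpa [mix_one] using this
  -- the sum over `n` steps telescopes: one step trades the term `V₀ x` for `V₀ (Aⁿ x) ≤ V₀ x / 2`
  have hVstep : ∀ x, V (mix A x) ≤ V x - 1 / 2 * V₀ x := by
    intro x
    have h1 : V (mix A x) = ∑ j ∈ Finset.range n, V₀ (mix (A ^ (j + 1)) x) := by
      simp only [hV, mix_mix, pow_succ']
    have h2 := Finset.sum_range_succ (fun j => V₀ (mix (A ^ j) x)) n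
    rw [Finset.sum_range_succ'] at h2
    have h3 := hV₀_le n x _ hn
    have h4 : (N : ℝ) * (1 / (2 * N)) = 1 / 2 := by field_simp
    rw [h4] at h3
    rw [pow_zero, mix_one] at h2
    rw [h1]
    simp only [hV]
    linarith
  have hnorm_avg : ∀ x : Fin N → Vec M, ‖avg p x‖ ≤ ∑ k, ‖x k‖ := fun x =>
    (norm_sum_le _ _).trans (Finset.sum_le_sum fun l _ => by
      rw [norm_smul, Real.norm_of_nonneg (hp0 l)]
      exact mul_le_of_le_one_left (norm_nonneg _) (hp_le l))
  have hV₀_sum : ∀ x : Fin N → Vec M, V₀ x ≤ (1 + N) * ∑ k, ‖x k‖ := fun x => by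
    calc V₀ x ≤ ∑ k, (‖x k‖ + ∑ k, ‖x k‖) := Finset.sum_le_sum fun k _ =>
          (norm_sub_le _ _).trans (add_le_add_right (hnorm_avg x) _)
      _ = _ := by simp [Finset.sum_add_distrib]; ring
  refine ⟨{ V := V, ρ := 1 - 1 / 2 / (n * N), C := n * N * (1 + N), ρ_nonneg := ?_, ρ_lt := ?_,
            C_nonneg := by positivity, cont := ?_, nonneg := ?_, add_le := ?_, le_sum := ?_,
            dist_le := ?_, contract := ?_ }⟩
  · rw [sub_nonneg, div_le_one hnN]; linarith
  · have : (0 : ℝ) < 1 / 2 / (n * N) := div_pos (by norm_num) hnN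
    linarith
  · simp only [hV, hV₀]; fun_prop
  · exact fun x => Finset.sum_nonneg fun j _ => hV₀_nonneg _
  · intro x y
    simp only [hV, ← Finset.sum_add_distrib]
    refine Finset.sum_le_sum fun j _ => ?_
    simp only [hV₀, ← Finset.sum_add_distrib]
    refine Finset.sum_le_sum fun k _ => ?_
    rw [mix_add, avg_add, Pi.add_apply, add_sub_add_comm]
    exact norm_add_le _ _
  · intro x
    refine (hVle x).trans ?_
    rw [mul_assoc (n * N : ℝ)]
    exact mul_le_mul_of_nonneg_left (hV₀_sum x) hnN.le
  · intro x k
    exact (Finset.single_le_sum (f := fun k => ‖x k - avg p x‖) (fun j _ => norm_nonneg _)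
      (Finset.mem_univ k)).trans (hV₀V x)
  · intro x
    refine (hVstep x).trans ?_
    have h1 : V x / (n * N) ≤ V₀ x := by
      rw [div_le_iff₀ hnN, mul_comm]; exact hVle x
    have h2 : (1 - 1 / 2 / ((n : ℝ) * N)) * V x = V x - 1 / 2 * (V x / (n * N)) := by ring
    rw [h2]
    linarith

end Stochastic

end CoordDiffusion

namespace CoordDiffusion

/-! ### Consequences of the Hessian bounds -/

section Costs

open scoped InnerProductSpace

variable {N M : ℕ} {Ω : Type*}

/-- A matrix as a linear map of the Euclidean space. -/
noncomputable abbrev op (A : Matrix (Fin M) (Fin M) ℝ) : Vec M →L[ℝ] Vec M :=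
  Matrix.toEuclideanCLM (n := Fin M) (𝕜 := ℝ) A

lemma op_apply (A : Matrix (Fin M) (Fin M) ℝ) (v : Vec M) (m : Fin M) :
    op A v m = ∑ j, A m j * v j := by
  rw [op, Matrix.ofLp_toEuclideanCLM]
  rfl

lemma inner_vec (u v : Vec M) : ⟪u, v⟫_ℝ = ∑ m, u m * v m := by
  simp [PiLp.inner_apply, mul_comm]

lemma norm_sq_vec (v : Vec M) : ‖v‖ ^ 2 = ∑ m, v m ^ 2 := by
  rw [EuclideanSpace.norm_sq_eq]; simp

lemma abs_coord_le (v : Vec M) (m : Fin M) : |v m| ≤ ‖v‖ := by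
  simpa using PiLp.norm_apply_le v m

lemma inner_op_comm {A : Matrix (Fin M) (Fin M) ℝ} (hA : A.IsHermitian) (u v : Vec M) :
    ⟪op A u, v⟫_ℝ = ⟪u, op A v⟫_ℝ := by
  simp only [inner_vec, op_apply, Finset.sum_mul, Finset.mul_sum]
  rw [Finset.sum_comm]
  refine Finset.sum_congr rfl fun i _ => Finset.sum_congr rfl fun j _ => ?_
  have : A j i = A i j := by simpa using hA.apply i j
  rw [this]; ring

lemma inner_op_eq (A : Matrix (Fin M) (Fin M) ℝ) (v : Vec M) :
    ⟪v, op A v⟫_ℝ = (v.ofLp) ⬝ᵥ (A *ᵥ v.ofLp) := by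
  rw [inner_vec]
  simp only [op_apply]
  rfl

/-- The derivative of the gradient is the linear map of the Hessian matrix. -/
lemma fderiv_gradient_eq (f : Vec M → ℝ) (x : Vec M) :
    fderiv ℝ (gradient f) x = op (hessian f x) := by
  refine ContinuousLinearMap.coe_injective ((EuclideanSpace.basisFun (Fin M) ℝ).toBasis.ext ?_)
  intro b
  ext a
  simp [op_apply, hessian]

/-- The quadratic form of a matrix between two multiples of the identity. -/
lemma inner_op_bounds {A : Matrix (Fin M) (Fin M) ℝ} {ν δ : ℝ} (h1 : (A - ν • 1).PosSemidef)
    (h2 : (δ • 1 - A).PosSemidef) (v : Vec M) :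
    ν * ‖v‖ ^ 2 ≤ ⟪v, op A v⟫_ℝ ∧ ⟪v, op A v⟫_ℝ ≤ δ * ‖v‖ ^ 2 := by
  have e1 := (Matrix.posSemidef_iff_dotProduct_mulVec.1 h1).2 v.ofLp
  have e2 := (Matrix.posSemidef_iff_dotProduct_mulVec.1 h2).2 v.ofLp
  have e3 : v.ofLp ⬝ᵥ v.ofLp = ‖v‖ ^ 2 := by
    rw [norm_sq_vec]; simp [dotProduct, pow_two]
  simp only [star_trivial, Matrix.sub_mulVec, dotProduct_sub, Matrix.smul_mulVec,
    Matrix.one_mulVec, dotProduct_smul, smul_eq_mul, e3] at e1 e2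
  rw [inner_op_eq]
  constructor <;> linarith

lemma isHermitian_of_sub_smul_one {A : Matrix (Fin M) (Fin M) ℝ} {ν : ℝ}
    (h1 : (A - ν • 1).PosSemidef) : A.IsHermitian := by
  have h := h1.isHermitian.add (Matrix.isHermitian_one.smul (k := ν) (by simp [IsSelfAdjoint]))
  simpa using h

/-- The norm of a symmetric matrix between `ν I` and `δ I`, by polarization of its quadratic
form. -/
lemma norm_op_le {A : Matrix (Fin M) (Fin M) ℝ} {ν δ : ℝ} (hν : 0 < ν) (hδ : 0 < δ)
    (h1 : (A - ν • 1).PosSemidef) (h2 : (δ • 1 - A).PosSemidef) : ‖op A‖ ≤ δ := by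
  refine ContinuousLinearMap.opNorm_le_bound _ hδ.le fun x => ?_
  have hA := isHermitian_of_sub_smul_one h1
  have key : ∀ y : Vec M, 2 * ⟪op A x, y⟫_ℝ ≤ δ * (‖x‖ ^ 2 + ‖y‖ ^ 2) := by
    intro y
    have e1 := (inner_op_bounds h1 h2 (x + y)).2
    have e2 := (inner_op_bounds h1 h2 (x - y)).1
    have e3 : ⟪x + y, op A (x + y)⟫_ℝ - ⟪x - y, op A (x - y)⟫_ℝ = 4 * ⟪op A x, y⟫_ℝ := by
      simp only [map_add, map_sub, inner_add_left, inner_add_right, inner_sub_left,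
        inner_sub_right]
      rw [← inner_op_comm hA x y, real_inner_comm (op A x) y]; ring
    have e4 : ‖x + y‖ ^ 2 ≤ 2 * (‖x‖ ^ 2 + ‖y‖ ^ 2) := by
      have := parallelogram_law_with_norm ℝ x y
      nlinarith [mul_self_nonneg ‖x - y‖]
    have : 0 ≤ ν * ‖x - y‖ ^ 2 := by positivity
    nlinarith
  have h := key (δ⁻¹ • op A x)
  rw [inner_smul_right, norm_smul, real_inner_self_eq_norm_sq, Real.norm_of_nonneg
    (by positivity)] at h
  have h' : ‖op A x‖ ^ 2 ≤ (δ * ‖x‖) ^ 2 := by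
    have e : δ * (‖x‖ ^ 2 + (δ⁻¹ * ‖op A x‖) ^ 2) = δ * ‖x‖ ^ 2 + δ⁻¹ * ‖op A x‖ ^ 2 := by
      field_simp
    rw [e] at h
    have h3 : δ⁻¹ * ‖op A x‖ ^ 2 ≤ δ * ‖x‖ ^ 2 := by linarith
    calc ‖op A x‖ ^ 2 = δ * (δ⁻¹ * ‖op A x‖ ^ 2) := by field_simp
      _ ≤ δ * (δ * ‖x‖ ^ 2) := mul_le_mul_of_nonneg_left h3 hδ.le
      _ = _ := by ring
  exact le_of_sq_le_sq h' (by positivity)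

/-- The analytic facts about the risks near and away from the minimizer that drive the error
recursions: `∇J_k` is Lipschitz and strongly monotone, and the first- and second-order expansions
at the minimizer hold globally. -/
structure CostBounds (D : Model N M Ω) (ν δ C : ℝ) : Prop where
  ν_pos : 0 < ν
  δ_pos : 0 < δ
  C_nonneg : 0 ≤ C
  lip : ∀ k x y, ‖gradient (D.J k) x - gradient (D.J k) y‖ ≤ δ * ‖x - y‖
  grad_wo : ∀ k, gradient (D.J k) D.wo = 0
  mono : ∀ k v, ⟪v, gradient (D.J k) (D.wo - v)⟫_ℝ ≤ -(ν * ‖v‖ ^ 2)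
  expand : ∀ k v, ‖gradient (D.J k) (D.wo - v) + op (D.H k) v‖ ≤ C * ‖v‖ ^ 2
  expand_risk : ∀ k v, |D.J k (D.wo - v) - D.J k D.wo - 1 / 2 * ⟪v, op (D.H k) v⟫_ℝ|
    ≤ C * ‖v‖ ^ 3
  herm : ∀ k, (D.H k).IsHermitian
  hess_lower : ∀ k v, ν * ‖v‖ ^ 2 ≤ ⟪v, op (D.H k) v⟫_ℝ
  hess_norm : ∀ k, ‖op (D.H k)‖ ≤ δ

/-- The bounds follow by integrating along segments. The local Lipschitz bound on the Hessians
becomes a global expansion of the gradients: farther than `ε` from the minimizer the error of the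
expansion is at most linear in the distance, hence at most quadratic. -/
lemma CostConditions.exists_bounds {D : Model N M Ω} (h : CostConditions D)
    (hs : ∃ ε κ : ℝ, 0 < ε ∧ 0 ≤ κ ∧ ∀ k v, ‖v‖ ≤ ε →
      specNorm (hessian (D.J k) (D.wo + v) - hessian (D.J k) D.wo) ≤ κ * ‖v‖) :
    ∃ ν δ C, CostBounds D ν δ C := by
  obtain ⟨ν, δ, hν, hνδ, hb⟩ := h.hess_bounds
  obtain ⟨ε, κ, hε, hκ, hloc⟩ := hs
  have hδ : 0 < δ := hν.trans_le hνδ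
  have hder : ∀ k x, HasFDerivAt (gradient (D.J k)) (op (hessian (D.J k) x)) x := fun k x => by
    rw [← fderiv_gradient_eq]; exact (h.diff_grad k x).hasFDerivAt
  have hlip : ∀ k x y, ‖gradient (D.J k) x - gradient (D.J k) y‖ ≤ δ * ‖x - y‖ := fun k x y =>
    convex_univ.norm_image_sub_le_of_norm_hasFDerivWithin_le
      (fun z _ => (hder k z).hasFDerivWithinAt)
      (fun z _ => norm_op_le hν hδ (hb k z).1 (hb k z).2) (Set.mem_univ y) (Set.mem_univ x)
  have hgrad : ∀ k, gradient (D.J k) D.wo = 0 := fun k => by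
    have : fderiv ℝ (D.J k) D.wo = 0 :=
      IsLocalMin.fderiv_eq_zero (Filter.Eventually.of_forall (h.minimizer k))
    simp [gradient, this]
  -- `κ` serves up to the distance `ε`, and `2 δ / ε` beyond it
  set C := κ + 2 * δ / ε with hC
  have hC0 : 0 ≤ C := by positivity
  have hexp : ∀ k v, ‖gradient (D.J k) (D.wo + v) - op (D.H k) v‖ ≤ C * ‖v‖ ^ 2 := by
    intro k v
    rcases le_or_gt ‖v‖ ε with hv | hv
    · have hd : ∀ w : Vec M, HasFDerivAt (fun w => gradient (D.J k) (D.wo + w) - op (D.H k) w)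
          (op (hessian (D.J k) (D.wo + w)) - op (D.H k)) w := by
        intro w
        have h1 : HasFDerivAt (fun w => gradient (D.J k) (D.wo + w))
          (op (hessian (D.J k) (D.wo + w))) w := by
          have := (hder k (D.wo + w)).comp w ((hasFDerivAt_id w).const_add D.wo)
          rw [ContinuousLinearMap.comp_id] at this
          exact this
        exact h1.sub (op (D.H k)).hasFDerivAt
      have := (convex_closedBall (0 : Vec M) ‖v‖).norm_image_sub_le_of_norm_hasFDerivWithin_le
        (f := fun w => gradient (D.J k) (D.wo + w) - op (D.H k) w) (C := κ * ‖v‖)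
        (x := 0) (y := v)
        (fun w _ => (hd w).hasFDerivWithinAt) (fun w hw => by
          rw [mem_closedBall_zero_iff] at hw
          have := hloc k w (hw.trans hv)
          rw [specNorm, map_sub] at this
          exact this.trans (mul_le_mul_of_nonneg_left hw hκ)) (by simp) (by simp)
      simp only [add_zero, hgrad, map_zero, sub_zero] at this
      refine this.trans ?_
      have : 0 ≤ 2 * δ / ε := by positivity
      nlinarith [sq_nonneg ‖v‖]
    · have h1 := hlip k (D.wo + v) D.wo
      rw [hgrad, sub_zero, add_sub_cancel_left] at h1
      have h2 : ‖op (D.H k) v‖ ≤ δ * ‖v‖ :=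
        (op (D.H k)).le_of_opNorm_le (norm_op_le hν hδ (hb k _).1 (hb k _).2) v
      have h3 : ‖v‖ ≤ ‖v‖ ^ 2 / ε := by
        rw [le_div_iff₀ hε]; nlinarith [norm_nonneg v]
      calc _ ≤ ‖gradient (D.J k) (D.wo + v)‖ + ‖op (D.H k) v‖ := norm_sub_le _ _
        _ ≤ 2 * δ * ‖v‖ := by linarith
        _ ≤ 2 * δ * (‖v‖ ^ 2 / ε) := by gcongr
        _ ≤ κ * ‖v‖ ^ 2 + 2 * δ * (‖v‖ ^ 2 / ε) := by
            have : 0 ≤ κ * ‖v‖ ^ 2 := by positivity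
            linarith
        _ = C * ‖v‖ ^ 2 := by rw [hC]; ring
  have hrisk : ∀ k v, |D.J k (D.wo + v) - D.J k D.wo - 1 / 2 * ⟪v, op (D.H k) v⟫_ℝ|
      ≤ C * ‖v‖ ^ 3 := by
    intro k v
    set g : ℝ → ℝ := fun t => D.J k (D.wo + t • v) - D.J k D.wo
      - t ^ 2 / 2 * ⟪v, op (D.H k) v⟫_ℝ with hg
    have hgd : ∀ t : ℝ, HasDerivAt g
        (⟪gradient (D.J k) (D.wo + t • v) - op (D.H k) (t • v), v⟫_ℝ) t := by
      intro t
      have h1 : HasDerivAt (fun t : ℝ => D.wo + t • v) v t := by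
        simpa using ((hasDerivAt_id t).smul_const v).const_add D.wo
      have h2 := (h.diff k (D.wo + t • v)).hasFDerivAt.comp_hasDerivAt t h1
      have h3 : HasDerivAt (fun t : ℝ => t ^ 2 / 2 * ⟪v, op (D.H k) v⟫_ℝ)
          (t * ⟪v, op (D.H k) v⟫_ℝ) t := by
        refine (((hasDerivAt_pow 2 t).div_const 2).mul_const ⟪v, op (D.H k) v⟫_ℝ).congr_deriv ?_
        norm_num
      refine ((h2.sub_const (D.J k D.wo)).sub h3).congr_deriv ?_
      rw [inner_sub_left, inner_gradient_left, map_smul, inner_smul_left,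
        real_inner_comm]
      simp
    have := norm_image_sub_le_of_norm_deriv_le_segment_01' (f := g) (C := C * ‖v‖ ^ 3)
      (fun t _ => (hgd t).hasDerivWithinAt) (fun t ht => by
        refine (norm_inner_le_norm _ _).trans ?_
        have h5 := hexp k (t • v)
        have h6 : ‖t • v‖ ≤ ‖v‖ := by
          rw [norm_smul, Real.norm_of_nonneg ht.1]
          exact mul_le_of_le_one_left (norm_nonneg _) ht.2.le
        calc _ ≤ C * ‖t • v‖ ^ 2 * ‖v‖ := by gcongr
          _ ≤ C * ‖v‖ ^ 2 * ‖v‖ := by gcongr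
          _ = _ := by ring)
    simpa [hg, Real.norm_eq_abs] using this
  have hmono : ∀ k v, ν * ‖v‖ ^ 2 ≤ ⟪v, gradient (D.J k) (D.wo + v)⟫_ℝ := by
    intro k v
    have hgd : ∀ t : ℝ, HasDerivAt (fun t : ℝ => ⟪v, gradient (D.J k) (D.wo + t • v)⟫_ℝ)
        (⟪v, op (hessian (D.J k) (D.wo + t • v)) v⟫_ℝ) t := by
      intro t
      have h1 : HasDerivAt (fun t : ℝ => D.wo + t • v) v t := by
        simpa using ((hasDerivAt_id t).smul_const v).const_add D.wo
      have h2 := (hder k (D.wo + t • v)).comp_hasDerivAt t h1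
      simpa using (hasDerivAt_const t v).inner ℝ h2
    have := mul_sub_le_image_sub_of_le_deriv (f := fun t : ℝ =>
      ⟪v, gradient (D.J k) (D.wo + t • v)⟫_ℝ) (C := ν * ‖v‖ ^ 2)
      (fun t => (hgd t).differentiableAt) (fun t => by
        rw [(hgd t).deriv]
        exact (inner_op_bounds (hb k _).1 (hb k _).2 v).1) (x := 0) (y := 1) zero_le_one
    simpa [hgrad] using this
  refine ⟨ν, δ, C, hν, hδ, hC0, hlip, hgrad, fun k v => ?_, fun k v => ?_, fun k v => ?_,
    fun k => isHermitian_of_sub_smul_one (hb k _).1,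
    fun k v => (inner_op_bounds (hb k _).1 (hb k _).2 v).1,
    fun k => norm_op_le hν hδ (hb k _).1 (hb k _).2⟩
  · have := hmono k (-v)
    rw [norm_neg, inner_neg_left, ← sub_eq_add_neg] at this
    linarith
  · have := hexp k (-v)
    rw [norm_neg, map_neg, sub_neg_eq_add, ← sub_eq_add_neg] at this
    exact this
  · have := hrisk k (-v)
    rw [norm_neg, map_neg, inner_neg_neg, ← sub_eq_add_neg] at this
    exact this

end Costs

end CoordDiffusion

namespace CoordDiffusion

/-! ### Continuous functions of polynomial growth -/

section Growth

variable {E : Type*} [NormedAddCommGroup E]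

/-- Continuous functions that grow at most like `‖z‖ ^ n`. They turn random vectors with finite
`n`-th moment into integrable random variables. -/
def PolyGrowth (n : ℕ) (F : E → ℝ) : Prop :=
  Continuous F ∧ ∃ C, 0 ≤ C ∧ ∀ z, |F z| ≤ C * (1 + ‖z‖) ^ n

namespace PolyGrowth

variable {n m : ℕ} {F G : E → ℝ}

lemma mono (hF : PolyGrowth n F) (h : n ≤ m) : PolyGrowth m F := by
  obtain ⟨hc, C, hC, hb⟩ := hF
  refine ⟨hc, C, hC, fun z => (hb z).trans ?_⟩
  have : 1 ≤ 1 + ‖z‖ := by linarith [norm_nonneg z]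
  exact mul_le_mul_of_nonneg_left (pow_le_pow_right₀ this h) hC

lemma add (hF : PolyGrowth n F) (hG : PolyGrowth n G) : PolyGrowth n (fun z => F z + G z) := by
  obtain ⟨hc, C, hC, hb⟩ := hF
  obtain ⟨hc', C', hC', hb'⟩ := hG
  refine ⟨hc.add hc', C + C', by positivity, fun z => (abs_add_le _ _).trans ?_⟩
  rw [add_mul]
  exact add_le_add (hb z) (hb' z)

lemma mul (hF : PolyGrowth n F) (hG : PolyGrowth m G) :
    PolyGrowth (n + m) (fun z => F z * G z) := by
  obtain ⟨hc, C, hC, hb⟩ := hF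
  obtain ⟨hc', C', hC', hb'⟩ := hG
  refine ⟨hc.mul hc', C * C', by positivity, fun z => ?_⟩
  rw [abs_mul, pow_add, mul_mul_mul_comm]
  exact mul_le_mul (hb z) (hb' z) (abs_nonneg _) (by positivity)

lemma const (c : ℝ) : PolyGrowth n (fun _ : E => c) :=
  ⟨continuous_const, |c|, abs_nonneg c, fun z => by
    have : 1 ≤ (1 + ‖z‖) ^ n := one_le_pow₀ (by linarith [norm_nonneg z])
    exact le_mul_of_one_le_right (abs_nonneg c) this⟩

lemma const_mul (c : ℝ) (hF : PolyGrowth n F) : PolyGrowth n (fun z => c * F z) := by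
  have := (const (E := E) (n := 0) c).mul hF
  rwa [zero_add] at this

lemma pow (hF : PolyGrowth n F) (j : ℕ) : PolyGrowth (n * j) (fun z => F z ^ j) := by
  induction j with
  | zero => simpa using const (E := E) (n := 0) 1
  | succ j ih => simpa only [pow_succ, mul_add, mul_one] using ih.mul hF

lemma sum {ι : Type*} (s : Finset ι) {F : ι → E → ℝ} (hF : ∀ i ∈ s, PolyGrowth n (F i)) :
    PolyGrowth n (fun z => ∑ i ∈ s, F i z) := by
  classical
  induction s using Finset.induction_on with
  | empty => simpa using const (E := E) (n := n) 0
  | insert a s ha ih =>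
    simp only [Finset.sum_insert ha]
    exact (hF a (Finset.mem_insert_self _ _)).add
      (ih fun i hi => hF i (Finset.mem_insert_of_mem hi))

lemma of_le (hc : Continuous F) {C : ℝ} (h : ∀ z, |F z| ≤ C * ‖z‖) : PolyGrowth 1 F :=
  ⟨hc, |C|, abs_nonneg _, fun z => by
    rw [pow_one]
    calc |F z| ≤ C * ‖z‖ := h z
      _ ≤ |C| * ‖z‖ := mul_le_mul_of_nonneg_right (le_abs_self C) (norm_nonneg z)
      _ ≤ |C| * (1 + ‖z‖) := mul_le_mul_of_nonneg_left (by linarith) (abs_nonneg C)⟩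

lemma of_norm_le {E' : Type*} [NormedAddCommGroup E'] {f : E → E'} (hc : Continuous f) {C : ℝ}
    (h : ∀ z, ‖f z‖ ≤ C * ‖z‖) : PolyGrowth 1 (fun z => ‖f z‖) :=
  of_le hc.norm fun z => by rw [abs_norm]; exact h z

lemma comp {E' : Type*} [NormedAddCommGroup E'] (hF : PolyGrowth n F) {f : E' → E}
    (hf : PolyGrowth 1 (fun z => ‖f z‖)) (hc : Continuous f) : PolyGrowth n (fun z => F (f z)) := by
  obtain ⟨hFc, C, hC, hb⟩ := hF
  obtain ⟨-, C', hC', hb'⟩ := hf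
  refine ⟨hFc.comp hc, C * (1 + C') ^ n, by positivity, fun z => (hb _).trans ?_⟩
  rw [mul_assoc, ← mul_pow]
  have := hb' z
  rw [abs_norm, pow_one] at this
  refine mul_le_mul_of_nonneg_left (pow_le_pow_left₀ (by positivity) ?_ n) hC
  nlinarith [norm_nonneg z]

lemma integrable {Ω : Type*} [MeasurableSpace Ω] {P : Measure Ω} [IsFiniteMeasure P]
    [MeasurableSpace E] [OpensMeasurableSpace E] {X : Ω → E} (hX : MemLp X n P)
    (hF : PolyGrowth n F) : Integrable (fun ω => F (X ω)) P := by
  obtain ⟨hc, C, hC, hb⟩ := hF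
  have h1 : MemLp (fun ω => 1 + ‖X ω‖) n P := (memLp_const (1 : ℝ)).add hX.norm
  have h2 : Integrable (fun ω => C * ‖1 + ‖X ω‖‖ ^ n) P := h1.integrable_norm_pow'.const_mul C
  refine h2.mono' (hc.comp_aestronglyMeasurable hX.1) (Eventually.of_forall fun ω => ?_)
  have h3 : ‖1 + ‖X ω‖‖ = 1 + ‖X ω‖ := Real.norm_of_nonneg (by positivity)
  rw [h3]
  exact hb (X ω)

end PolyGrowth

end Growth

/-! ### One step of the recursion, path by path -/

section Step

variable {N M : ℕ} {Ω : Type*}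

/-- Entrywise product of a vector with a list of weights. -/
def hmul (g : Fin M → ℝ) (v : Vec M) : Vec M := WithLp.toLp 2 fun m => g m * v m

@[simp] lemma hmul_apply (g : Fin M → ℝ) (v : Vec M) (m : Fin M) : hmul g v m = g m * v m := rfl

lemma norm_hmul_le {g : Fin M → ℝ} (hg : ∀ m, |g m| ≤ 1) (v : Vec M) : ‖hmul g v‖ ≤ ‖v‖ := by
  refine le_of_sq_le_sq ?_ (norm_nonneg v)
  rw [norm_sq_vec, norm_sq_vec]
  refine Finset.sum_le_sum fun m _ => ?_
  rw [hmul_apply, mul_pow]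
  exact mul_le_of_le_one_left (sq_nonneg _) ((sq_le_one_iff_abs_le_one _).2 (hg m))

namespace Model

/-- One step of the error recursion, with masks `g` and descent directions `d`. -/
noncomputable def next (D : Model N M Ω) (μ : ℝ) (g : Fin N → Fin M → ℝ) (x d : Fin N → Vec M) :
    Fin N → Vec M :=
  mix D.A₂ (fun l => mix D.A₁ x l - (μ * D.τ l) • hmul (g l) (d l))

/-- The vector `q` per unit of the largest step-size. -/
noncomputable def qhat (D : Model N M Ω) (p : Fin N → ℝ) (k : Fin N) : ℝ :=
  D.τ k * (D.A₂ *ᵥ p) k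

lemma q_eq (D : Model N M Ω) (p : Fin N → ℝ) (μ : ℝ) (k : Fin N) :
    D.q p μ k = μ * D.qhat p k := mul_assoc _ _ _

lemma avg_next (D : Model N M Ω) {p : Fin N → ℝ} (hp : (D.A₁ * D.A₂) *ᵥ p = p) (μ : ℝ)
    (g : Fin N → Fin M → ℝ) (x d : Fin N → Vec M) :
    avg p (D.next μ g x d) = avg p x - μ • ∑ l, D.qhat p l • hmul (g l) (d l) := by
  have h : (fun l => mix D.A₁ x l - (μ * D.τ l) • hmul (g l) (d l)) =
      mix D.A₁ x - fun l => (μ * D.τ l) • hmul (g l) (d l) := rfl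
  rw [next, avg_mix, h, avg_sub, avg_mix, Matrix.mulVec_mulVec, hp]
  congr 1
  rw [avg, Finset.smul_sum]
  refine Finset.sum_congr rfl fun l _ => ?_
  rw [smul_smul, smul_smul, qhat]
  congr 1
  ring

end Model

lemma IsPerronVector.nonneg {D : Model N M Ω} {p : Fin N → ℝ} (hp : IsPerronVector D p)
    (hnet : NetworkConditions D) (k : Fin N) : 0 ≤ p k :=
  (hnet.A₁_stoch.mul hnet.A₂_stoch).perron_nonneg hnet.primitive hp.1 hp.2 k

lemma IsPerronVector.le_one {D : Model N M Ω} {p : Fin N → ℝ} (hp : IsPerronVector D p)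
    (hnet : NetworkConditions D) (k : Fin N) : p k ≤ 1 := by
  rw [← hp.2]
  exact Finset.single_le_sum (fun j _ => hp.nonneg hnet j) (Finset.mem_univ k)

lemma A₂_mulVec_nonneg {D : Model N M Ω} {p : Fin N → ℝ} (hp : IsPerronVector D p)
    (hnet : NetworkConditions D) (k : Fin N) : 0 ≤ (D.A₂ *ᵥ p) k := by
  rw [Matrix.mulVec, dotProduct]
  exact Finset.sum_nonneg fun j _ => mul_nonneg (hnet.A₂_stoch.1 _ _) (hp.nonneg hnet j)

lemma qhat_nonneg {D : Model N M Ω} {p : Fin N → ℝ} (hp : IsPerronVector D p)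
    (hnet : NetworkConditions D) (k : Fin N) : 0 ≤ D.qhat p k :=
  mul_nonneg (hnet.τ_pos k).le (A₂_mulVec_nonneg hp hnet k)

lemma qhat_le_one {D : Model N M Ω} {p : Fin N → ℝ} (hp : IsPerronVector D p)
    (hnet : NetworkConditions D) (k : Fin N) : D.qhat p k ≤ 1 := by
  have h1 : (D.A₂ *ᵥ p) k ≤ 1 := by
    rw [← hp.2, Matrix.mulVec, dotProduct]
    exact Finset.sum_le_sum fun j _ =>
      mul_le_of_le_one_left (hp.nonneg hnet j) (hnet.A₂_stoch.le_one k j)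
  exact mul_le_one₀ (hnet.τ_le k) (A₂_mulVec_nonneg hp hnet k) h1

lemma exists_qhat_pos {D : Model N M Ω} {p : Fin N → ℝ} (hp : IsPerronVector D p)
    (hnet : NetworkConditions D) : ∃ k, 0 < D.qhat p k := by
  by_contra! h
  have h0 : ∀ k, (D.A₂ *ᵥ p) k = 0 := fun k => by
    have h1 : D.τ k * (D.A₂ *ᵥ p) k = 0 := le_antisymm (h k) (qhat_nonneg hp hnet k)
    exact (mul_eq_zero.1 h1).resolve_left (hnet.τ_pos k).ne'
  have := hnet.A₂_stoch.sum_mulVec p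
  rw [hp.2] at this
  simp [h0] at this

lemma norm_avg_le {D : Model N M Ω} {p : Fin N → ℝ} (hp : IsPerronVector D p)
    (hnet : NetworkConditions D) (x : Fin N → Vec M) : ‖avg p x‖ ≤ ∑ k, ‖x k‖ :=
  (norm_sum_le _ _).trans (Finset.sum_le_sum fun l _ => by
    rw [norm_smul, Real.norm_of_nonneg (hp.nonneg hnet l)]
    exact mul_le_of_le_one_left (norm_nonneg _) (hp.le_one hnet l))

lemma ConsensusGauge.next_le {D : Model N M Ω} {p : Fin N → ℝ}
    (W : ConsensusGauge M (D.A₁ * D.A₂) p) (hnet : NetworkConditions D) {μ : ℝ} (hμ : 0 ≤ μ)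
    {g : Fin N → Fin M → ℝ} (hg : ∀ l m, |g l m| ≤ 1) (x d : Fin N → Vec M) :
    W.V (D.next μ g x d) ≤ W.ρ * W.V x + μ * (W.C * N) * ∑ l, ‖d l‖ := by
  set y : Fin N → Vec M := fun l => (-(μ * D.τ l)) • hmul (g l) (d l) with hy
  have h : (fun l => mix D.A₁ x l - (μ * D.τ l) • hmul (g l) (d l)) = mix D.A₁ x + y := by
    funext l; simp [hy, sub_eq_add_neg]
  rw [Model.next, h, mix_add, mix_mix]
  refine (W.add_le _ _).trans (add_le_add (W.contract x) ((W.le_sum _).trans ?_))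
  have hyl : ∑ l, ‖y l‖ ≤ μ * ∑ l, ‖d l‖ := by
    rw [Finset.mul_sum]
    refine Finset.sum_le_sum fun l _ => ?_
    rw [hy, norm_smul, norm_neg, Real.norm_of_nonneg (mul_nonneg hμ (hnet.τ_pos l).le)]
    exact mul_le_mul (mul_le_of_le_one_right hμ (hnet.τ_le l)) (norm_hmul_le (hg l) _)
      (norm_nonneg _) hμ
  calc W.C * ∑ k, ‖mix D.A₂ y k‖ ≤ W.C * ∑ _k : Fin N, ∑ l, ‖y l‖ :=
        mul_le_mul_of_nonneg_left (Finset.sum_le_sum fun k _ => norm_mix_le hnet.A₂_stoch y k)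
          W.C_nonneg
    _ = W.C * N * ∑ l, ‖y l‖ := by simp; ring
    _ ≤ W.C * N * (μ * ∑ l, ‖d l‖) :=
        mul_le_mul_of_nonneg_left hyl (mul_nonneg W.C_nonneg N.cast_nonneg)
    _ = _ := by ring

end Step

end CoordDiffusion

namespace CoordDiffusion

/-! ### Measurability and fourth moments along the algorithm -/

section Algorithm

variable {N M : ℕ} {Ω : Type*}

namespace Model

/-- The errors `w^o - w_k` of all agents before iteration `i`. -/
def err (D : Model N M Ω) (μ : ℝ) (i : ℕ) (ω : Ω) : Fin N → Vec M :=
  fun k => D.wo - D.iter μ i k ω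

/-- The gradient noises of all agents along the algorithm. -/
noncomputable def noiseAt (D : Model N M Ω) (μ : ℝ) (i : ℕ) (ω : Ω) : Fin N → Vec M :=
  fun k => D.noise k i ω (D.combine (D.iter μ i) k ω)

/-- The masks of iteration `i`. -/
def maskAt (D : Model N M Ω) (i : ℕ) (ω : Ω) : Fin N → Fin M → ℝ := fun k m => D.mask k i m ω

/-- The descent directions of the agents in terms of the errors `x` and the noises `s`. -/
noncomputable def descent (D : Model N M Ω) (x s : Fin N → Vec M) : Fin N → Vec M :=
  fun k => -(gradient (D.J k) (D.wo - mix D.A₁ x k) + s k)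

/-- The information carried by the masks of iteration `i`. -/
@[reducible] def maskAlg (D : Model N M Ω) (i : ℕ) : MeasurableSpace Ω :=
  ⨆ (k : Fin N) (m : Fin M),
    MeasurableSpace.comap (D.mask k i m) (inferInstance : MeasurableSpace ℝ)

/-- The past together with the approximate gradients that the agents evaluate at iteration `i`. -/
@[reducible] def avail (D : Model N M Ω) (μ : ℝ) (i : ℕ) : MeasurableSpace Ω :=
  D.past μ i ⊔ ⨆ k : Fin N,
    MeasurableSpace.comap (fun ω => D.gradEst k i ω (D.combine (D.iter μ i) k ω))
      (inferInstance : MeasurableSpace (Vec M))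

lemma combine_eq (D : Model N M Ω) (hA : IsLeftStochastic D.A₁) (μ : ℝ) (i : ℕ) (k : Fin N)
    (ω : Ω) : D.combine (D.iter μ i) k ω = D.wo - mix D.A₁ (D.err μ i ω) k := by
  simp only [combine, mix, err, smul_sub, Finset.sum_sub_distrib, ← Finset.sum_smul, hA.2,
    one_smul, sub_sub_cancel]

lemma err_succ (D : Model N M Ω) (hnet : NetworkConditions D) (μ : ℝ) (i : ℕ) (ω : Ω) :
    D.err μ (i + 1) ω = D.next μ (D.maskAt i ω) (D.err μ i ω)
      (D.descent (D.err μ i ω) (D.noiseAt μ i ω)) := by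
  funext k
  have h : ∀ l, D.combine (D.iter μ i) l ω -
        (μ * D.τ l) • D.maskedGrad l i ω (D.combine (D.iter μ i) l ω) = D.wo -
      (mix D.A₁ (D.err μ i ω) l - (μ * D.τ l) • hmul (D.maskAt i ω l)
        (D.descent (D.err μ i ω) (D.noiseAt μ i ω) l)) := by
    intro l
    have h1 : D.maskedGrad l i ω (D.combine (D.iter μ i) l ω) = -hmul (D.maskAt i ω l)
        (D.descent (D.err μ i ω) (D.noiseAt μ i ω) l) := by
      ext m
      simp [maskedGrad, descent, noiseAt, noise, maskAt, ← D.combine_eq hnet.A₁_stoch]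
    rw [h1, D.combine_eq hnet.A₁_stoch]
    module
  change D.wo - ∑ l, D.A₂ l k • _ = mix D.A₂ _ k
  rw [Finset.sum_congr rfl fun l _ => congrArg (fun v => D.A₂ l k • v) (h l)]
  simp only [smul_sub (_ : ℝ) D.wo, Finset.sum_sub_distrib, ← Finset.sum_smul,
    hnet.A₂_stoch.2, one_smul, sub_sub_cancel]
  rfl

end Model

lemma past_mono (D : Model N M Ω) (μ : ℝ) {i j : ℕ} (hij : i ≤ j) : D.past μ i ≤ D.past μ j := by
  refine sup_le_sup (iSup_mono fun n => iSup_le fun hn => ?_)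
    (iSup_mono fun n => iSup_le fun hn => ?_)
  · exact le_iSup_of_le (hn.trans hij) le_rfl
  · exact le_iSup_of_le (hn.trans_le hij) le_rfl

lemma past_le_avail (D : Model N M Ω) (μ : ℝ) (i : ℕ) : D.past μ i ≤ D.avail μ i := le_sup_left

lemma maskAlg_le_past (D : Model N M Ω) (μ : ℝ) (i : ℕ) : D.maskAlg i ≤ D.past μ (i + 1) :=
  le_sup_of_le_right <| iSup_le fun k => iSup_le fun m =>
    le_iSup_of_le i <| le_iSup_of_le i.lt_succ_self <| le_iSup_of_le k <| le_iSup_of_le m le_rfl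

lemma measurable_iter_past (D : Model N M Ω) (μ : ℝ) (i : ℕ) (k : Fin N) :
    Measurable[D.past μ i] (D.iter μ i k) := by
  refine Measurable.mono (comap_measurable (D.iter μ i k)) ?_ le_rfl
  exact le_sup_of_le_left <| le_iSup_of_le i <| le_iSup_of_le le_rfl <| le_iSup_of_le k le_rfl

lemma measurable_mask_maskAlg (D : Model N M Ω) (i : ℕ) (k : Fin N) (m : Fin M) :
    Measurable[D.maskAlg i] (D.mask k i m) :=
  Measurable.mono (comap_measurable (D.mask k i m))
    (le_iSup_of_le k <| le_iSup_of_le m le_rfl) le_rfl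

lemma measurable_err_past (D : Model N M Ω) (μ : ℝ) (i : ℕ) :
    Measurable[D.past μ i] (D.err μ i) :=
  @measurable_pi_lambda _ _ _ (D.past μ i) _ _ fun k =>
    (measurable_iter_past D μ i k).const_sub D.wo

lemma measurable_combine_past (D : Model N M Ω) (μ : ℝ) (i : ℕ) (k : Fin N) :
    Measurable[D.past μ i] (D.combine (D.iter μ i) k) := by
  unfold Model.combine
  exact Finset.measurable_sum _ fun j _ => (measurable_iter_past D μ i j).const_smul (D.A₁ j k)

lemma measurable_comp_past {E : Type*} [TopologicalSpace E] [MeasurableSpace E] [BorelSpace E]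
    {F : (Fin N → Vec M) → E} (hF : Continuous F) (D : Model N M Ω) (μ : ℝ) (i : ℕ) :
    Measurable[D.past μ i] (fun ω => F (D.err μ i ω)) :=
  hF.measurable.comp (measurable_err_past D μ i)

variable [MeasurableSpace Ω]

/-- The standing assumptions. -/
structure Setting (D : Model N M Ω) (P : Measure Ω) (μbar : ℝ) : Prop where
  net : NetworkConditions D
  cost : CostConditions D
  reg : Regularity D P
  mask : MaskConditions D P μbar
  noise : NoiseConditions D P μbar
  smooth : SmoothnessConditions D P μbar

namespace Setting

variable {D : Model N M Ω} {P : Measure Ω} {μbar μ : ℝ}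

lemma continuous_grad (h : Setting D P μbar) (k : Fin N) : Continuous (gradient (D.J k)) :=
  (h.cost.diff_grad k).continuous

lemma exists_bounds (h : Setting D P μbar) : ∃ ν δ C, CostBounds D ν δ C :=
  h.cost.exists_bounds h.smooth.hess

lemma measurable_iter (h : Setting D P μbar) (μ : ℝ) (i : ℕ) (k : Fin N) :
    Measurable (D.iter μ i k) := by
  induction i generalizing k with
  | zero => exact h.reg.winit_meas k
  | succ i ih =>
    have h1 : ∀ l, Measurable (D.combine (D.iter μ i) l) := fun l => by
      unfold Model.combine
      exact Finset.measurable_sum _ fun j _ => (ih j).const_smul (D.A₁ j l)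
    have h2 : ∀ l, Measurable (fun ω => D.gradEst l i ω (D.combine (D.iter μ i) l ω)) := fun l =>
      (h.reg.gradEst_meas l i).comp (measurable_id.prodMk (h1 l))
    have h3 : ∀ l, Measurable fun ω => D.maskedGrad l i ω (D.combine (D.iter μ i) l ω) := by
      intro l
      unfold Model.maskedGrad
      refine (WithLp.measurable_toLp 2 _).comp (measurable_pi_lambda _ fun m => ?_)
      exact (h.reg.mask_meas l i m).mul
        ((measurable_pi_apply m).comp ((WithLp.measurable_ofLp 2 _).comp (h2 l)))
    simp only [Model.iter]
    exact Finset.measurable_sum _ fun l _ =>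
      ((h1 l).sub ((h3 l).const_smul (μ * D.τ l))).const_smul (D.A₂ l k)

lemma past_le (h : Setting D P μbar) (μ : ℝ) (i : ℕ) :
    D.past μ i ≤ (inferInstance : MeasurableSpace Ω) := by
  refine sup_le (iSup_le fun j => iSup_le fun _ => iSup_le fun k => ?_)
    (iSup_le fun j => iSup_le fun _ => iSup_le fun k => iSup_le fun m => ?_)
  · exact (h.measurable_iter μ j k).comap_le
  · exact (h.reg.mask_meas k j m).comap_le

end Setting

namespace Setting

variable {D : Model N M Ω} {P : Measure Ω} {μbar μ : ℝ}

lemma measurable_noiseAt (h : Setting D P μbar) (μ : ℝ) (i : ℕ) :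
    Measurable[D.avail μ i] (D.noiseAt μ i) := by
  refine @measurable_pi_lambda _ _ _ (D.avail μ i) _ _ fun k => ?_
  refine Measurable.sub (Measurable.mono (comap_measurable _) ?_ le_rfl)
    ((h.continuous_grad k).measurable.comp
      ((measurable_combine_past D μ i k).mono (past_le_avail D μ i) le_rfl))
  exact le_sup_of_le_right <| le_iSup_of_le k le_rfl

lemma measurable_gradEst_iter (h : Setting D P μbar) (μ : ℝ) (i : ℕ) (k : Fin N) :
    Measurable (fun ω => D.gradEst k i ω (D.combine (D.iter μ i) k ω)) :=
  (h.reg.gradEst_meas k i).comp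
    (measurable_id.prodMk ((measurable_combine_past D μ i k).mono (h.past_le μ i) le_rfl))

lemma avail_le (h : Setting D P μbar) (μ : ℝ) (i : ℕ) :
    D.avail μ i ≤ (inferInstance : MeasurableSpace Ω) :=
  sup_le (h.past_le μ i) (iSup_le fun k => (h.measurable_gradEst_iter μ i k).comap_le)

lemma maskAlg_le (h : Setting D P μbar) (i : ℕ) :
    D.maskAlg i ≤ (inferInstance : MeasurableSpace Ω) :=
  iSup_le fun k => iSup_le fun m => (h.reg.mask_meas k i m).comap_le

lemma abs_mask_le (h : Setting D P μbar) (k : Fin N) (i : ℕ) (m : Fin M) (ω : Ω) :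
    |D.mask k i m ω| ≤ 1 := by
  rcases h.mask.zero_or_one k i m ω with h | h <;> simp [h]

lemma measurable_comp_avail (h : Setting D P μbar)
    {F : (Fin N → Vec M) × (Fin N → Vec M) → ℝ} (hF : Continuous F) (μ : ℝ) (i : ℕ) :
    Measurable[D.avail μ i] (fun ω => F (D.err μ i ω, D.noiseAt μ i ω)) :=
  hF.measurable.comp (((measurable_err_past D μ i).mono (past_le_avail D μ i) le_rfl).prodMk
    (h.measurable_noiseAt μ i))

lemma isIterate_combine (hit : ∀ k, MemLp (D.iter μ i k) 4 P) (k : Fin N) :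
    IsIterate D P μ i (D.combine (D.iter μ i) k) := by
  refine ⟨measurable_combine_past D μ i k, ?_⟩
  unfold Model.combine
  exact memLp_finsetSum _ fun j _ => (hit j).const_smul (D.A₁ j k)

variable [IsProbabilityMeasure P]

/-- Finite fourth moments pass from one iteration to the next, because the gradients are Lipschitz
and the noise at an iterate has a finite fourth moment. -/
lemma memLp_iter (h : Setting D P μbar) (hμ : μ ∈ Set.Ioo 0 μbar) (i : ℕ) (k : Fin N) :
    MemLp (D.iter μ i k) 4 P := by
  induction i generalizing k with
  | zero => exact h.reg.winit_mem k
  | succ i ih =>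
    obtain ⟨β, σ, -, -, hs⟩ := h.noise.fourth_moment
    obtain ⟨ν, δ, C, hb⟩ := h.exists_bounds
    have h1 : ∀ l, MemLp (D.combine (D.iter μ i) l) 4 P := fun l => (isIterate_combine ih l).2
    have h2 : ∀ l, MemLp (fun ω => D.noise l i ω (D.combine (D.iter μ i) l ω)) 4 P := fun l =>
      (hs μ hμ l i _ (isIterate_combine ih l)).1
    have h3 : ∀ l, MemLp (fun ω => gradient (D.J l) (D.combine (D.iter μ i) l ω)) 4 P := by
      intro l
      refine ((h1 l).sub (memLp_const D.wo)).of_le_mul (c := δ)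
        ((h.continuous_grad l).comp_aestronglyMeasurable (h1 l).1)
        (Eventually.of_forall fun ω => ?_)
      have := hb.lip l (D.combine (D.iter μ i) l ω) D.wo
      rwa [hb.grad_wo, sub_zero] at this
    have h4 : ∀ l, MemLp (fun ω => D.gradEst l i ω (D.combine (D.iter μ i) l ω)) 4 P := by
      intro l
      have := (h2 l).add (h3 l)
      refine this.ae_eq (ae_of_all _ fun ω => ?_)
      simp [Model.noise]
    have h5 : ∀ l, MemLp (fun ω => D.maskedGrad l i ω (D.combine (D.iter μ i) l ω)) 4 P := by
      intro l
      refine (h4 l).of_le ?_ (Eventually.of_forall fun ω =>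
        norm_hmul_le (fun m => h.abs_mask_le l i m ω) _)
      unfold Model.maskedGrad
      refine Measurable.aestronglyMeasurable ?_
      refine (WithLp.measurable_toLp 2 _).comp (measurable_pi_lambda _ fun m => ?_)
      exact (h.reg.mask_meas l i m).mul
        ((measurable_pi_apply m).comp ((WithLp.measurable_ofLp 2 _).comp
          (h.measurable_gradEst_iter μ i l)))
    simp only [Model.iter]
    exact memLp_finsetSum _ fun l _ =>
      ((h1 l).sub ((h5 l).const_smul (μ * D.τ l))).const_smul (D.A₂ l k)

lemma memLp_err (h : Setting D P μbar) (hμ : μ ∈ Set.Ioo 0 μbar) (i : ℕ) :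
    MemLp (D.err μ i) 4 P :=
  memLp_pi_iff.2 fun k => (memLp_const D.wo).sub (h.memLp_iter hμ i k)

lemma isIterate (h : Setting D P μbar) (hμ : μ ∈ Set.Ioo 0 μbar) (i : ℕ) (k : Fin N) :
    IsIterate D P μ i (D.combine (D.iter μ i) k) :=
  isIterate_combine (fun k => h.memLp_iter hμ i k) k

lemma memLp_noiseAt (h : Setting D P μbar) (hμ : μ ∈ Set.Ioo 0 μbar) (i : ℕ) :
    MemLp (D.noiseAt μ i) 4 P := by
  obtain ⟨β, σ, -, -, hs⟩ := h.noise.fourth_moment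
  exact memLp_pi_iff.2 fun k => (hs μ hμ k i _ (h.isIterate hμ i k)).1

end Setting

end Algorithm

end CoordDiffusion

namespace CoordDiffusion

/-! ### Expectations over the masks and the gradient noise -/

section Expectations

variable {N M : ℕ} {Ω : Type*} [MeasurableSpace Ω]

/-- The mean of the product of two masks of the same iteration. -/
noncomputable def Model.maskCorr (D : Model N M Ω) (x y : Fin N × Fin M) : ℝ :=
  if x = y then 1 - D.r x.1 else (1 - D.r x.1) * (1 - D.r y.1)

namespace Setting

variable {D : Model N M Ω} {P : Measure Ω} {μbar μ : ℝ} [IsProbabilityMeasure P]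

/-- The masks of an iteration are independent of everything that is known when they are drawn, the
approximate gradients of the iteration included. -/
lemma integral_mul_of_maskAlg (h : Setting D P μbar) (hμ : μ ∈ Set.Ioo 0 μbar) (i : ℕ)
    {g Y : Ω → ℝ} (hg : Measurable[D.maskAlg i] g) (hY : Measurable[D.avail μ i] Y) :
    ∫ ω, g ω * Y ω ∂P = (∫ ω, g ω ∂P) * ∫ ω, Y ω ∂P := by
  have hind := h.mask.indep_past μ hμ i (fun k => D.combine (D.iter μ i) k)
    (fun k => h.isIterate hμ i k)
  have : IndepFun g Y P := by
    rw [IndepFun_iff_Indep]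
    exact indep_of_indep_of_le_left (indep_of_indep_of_le_right hind hY.comap_le) hg.comap_le
  exact this.integral_mul_eq_mul_integral (hg.mono (h.maskAlg_le i) le_rfl).aestronglyMeasurable
    (hY.mono (h.avail_le μ i) le_rfl).aestronglyMeasurable

lemma integrable_mask (h : Setting D P μbar) (k : Fin N) (i : ℕ) (m : Fin M) :
    Integrable (D.mask k i m) P :=
  Integrable.of_bound (h.reg.mask_meas k i m).aestronglyMeasurable 1
    (Eventually.of_forall fun ω => h.abs_mask_le k i m ω)

lemma integral_mask (h : Setting D P μbar) (k : Fin N) (i : ℕ) (m : Fin M) :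
    ∫ ω, D.mask k i m ω ∂P = 1 - D.r k := by
  have hs : MeasurableSet {ω | D.mask k i m ω = 0} :=
    h.reg.mask_meas k i m (measurableSet_singleton 0)
  have h1 : ∀ ω, D.mask k i m ω = 1 - {ω | D.mask k i m ω = 0}.indicator (fun _ => (1 : ℝ)) ω := by
    intro ω
    rcases h.mask.zero_or_one k i m ω with h0 | h0 <;> simp [Set.indicator, h0]
  rw [integral_congr_ae (Eventually.of_forall h1), integral_sub (integrable_const 1)
    ((integrable_const (1 : ℝ)).indicator hs), integral_indicator hs]
  simp [Measure.real, h.mask.prob_zero, h.net.r_nonneg]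

lemma integral_mask_mul_mask (h : Setting D P μbar) (i : ℕ) (x y : Fin N × Fin M) :
    ∫ ω, D.mask x.1 i x.2 ω * D.mask y.1 i y.2 ω ∂P = D.maskCorr x y := by
  rw [Model.maskCorr]
  split_ifs with hxy
  · subst hxy
    rw [← h.integral_mask x.1 i x.2]
    refine integral_congr_ae (Eventually.of_forall fun ω => ?_)
    rcases h.mask.zero_or_one x.1 i x.2 ω with h0 | h0 <;> simp [h0]
  · rw [← h.integral_mask x.1 i x.2, ← h.integral_mask y.1 i y.2]
    exact (h.mask.indep_coord i hxy).integral_mul_eq_mul_integral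
      (h.reg.mask_meas _ _ _).aestronglyMeasurable (h.reg.mask_meas _ _ _).aestronglyMeasurable

lemma integral_mask_mul (h : Setting D P μbar) (hμ : μ ∈ Set.Ioo 0 μbar) (i : ℕ) (k : Fin N)
    (m : Fin M) {Y : Ω → ℝ} (hY : Measurable[D.avail μ i] Y) :
    ∫ ω, D.mask k i m ω * Y ω ∂P = (1 - D.r k) * ∫ ω, Y ω ∂P := by
  rw [h.integral_mul_of_maskAlg hμ i (measurable_mask_maskAlg D i k m) hY, h.integral_mask]

lemma integral_mask_mul_mask_mul (h : Setting D P μbar) (hμ : μ ∈ Set.Ioo 0 μbar) (i : ℕ)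
    (x y : Fin N × Fin M) {Y : Ω → ℝ} (hY : Measurable[D.avail μ i] Y) :
    ∫ ω, D.mask x.1 i x.2 ω * D.mask y.1 i y.2 ω * Y ω ∂P = D.maskCorr x y * ∫ ω, Y ω ∂P := by
  rw [← h.integral_mask_mul_mask i]
  exact h.integral_mul_of_maskAlg hμ i
    ((measurable_mask_maskAlg D i x.1 x.2).mul (measurable_mask_maskAlg D i y.1 y.2)) hY

lemma memLp_state (h : Setting D P μbar) (hμ : μ ∈ Set.Ioo 0 μbar) (i : ℕ) :
    MemLp (fun ω => (D.err μ i ω, D.noiseAt μ i ω)) ((4 : ℕ) : ENNReal) P := by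
  have h4 : ((4 : ℕ) : ENNReal) = 4 := by norm_num
  rw [h4]
  exact memLp_prod_iff.2 ⟨h.memLp_err hμ i, h.memLp_noiseAt hμ i⟩

lemma integrable_state (h : Setting D P μbar) (hμ : μ ∈ Set.Ioo 0 μbar) (i : ℕ)
    {F : (Fin N → Vec M) × (Fin N → Vec M) → ℝ} (hF : PolyGrowth 4 F) :
    Integrable (fun ω => F (D.err μ i ω, D.noiseAt μ i ω)) P :=
  hF.integrable (h.memLp_state hμ i)

lemma integrable_err (h : Setting D P μbar) (hμ : μ ∈ Set.Ioo 0 μbar) (i : ℕ)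
    {F : (Fin N → Vec M) → ℝ} (hF : PolyGrowth 4 F) :
    Integrable (fun ω => F (D.err μ i ω)) P := by
  have h4 : ((4 : ℕ) : ENNReal) = 4 := by norm_num
  exact hF.integrable (by rw [h4]; exact h.memLp_err hμ i)

/-- The gradient noise is orthogonal to the past. -/
lemma integral_mul_noise (h : Setting D P μbar) (hμ : μ ∈ Set.Ioo 0 μbar) (i : ℕ) (k : Fin N)
    (m : Fin M) {f : Ω → ℝ} (hf : Measurable[D.past μ i] f)
    (hint : Integrable (fun ω => f ω * D.noiseAt μ i ω k m) P) :
    ∫ ω, f ω * D.noiseAt μ i ω k m ∂P = 0 := by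
  have hs : MemLp (fun ω => D.noiseAt μ i ω k) 4 P := memLp_pi_iff.1 (h.memLp_noiseAt hμ i) k
  have hsi : Integrable (fun ω => D.noiseAt μ i ω k) P := hs.integrable (by norm_num)
  have hsm : Integrable (fun ω => D.noiseAt μ i ω k m) P :=
    (EuclideanSpace.proj (𝕜 := ℝ) m).integrable_comp hsi
  have h1 : P[fun ω => D.noiseAt μ i ω k m | D.past μ i] =ᵐ[P] 0 := by
    have e1 := ContinuousLinearMap.comp_condExp_comm (m := D.past μ i) hsi
      (EuclideanSpace.proj (𝕜 := ℝ) m)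
    have e2 := h.noise.zero_mean μ hμ k i _ (h.isIterate hμ i k)
    refine e1.symm.trans ?_
    filter_upwards [e2] with ω hω
    have : (P[fun ω => D.noiseAt μ i ω k | D.past μ i]) ω = 0 := hω
    simp [this]
  have h2 := condExp_mul_of_stronglyMeasurable_left (m := D.past μ i) (μ := P)
    hf.stronglyMeasurable hint hsm
  rw [← integral_condExp (h.past_le μ i)]
  refine (integral_congr_ae (h2.trans ?_)).trans (integral_zero Ω ℝ)
  filter_upwards [h1] with ω hω
  simp [hω]

/-- Conditional second and fourth moments of the gradient noise at an iterate. The second moment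
is bounded through `‖s‖² ≤ (t + t⁻¹ ‖s‖⁴) / 2` with `t = 1 + ‖v‖²`. -/
lemma exists_noise_bound (h : Setting D P μbar) : ∃ K : ℝ, 0 ≤ K ∧
    ∀ μ ∈ Set.Ioo 0 μbar, ∀ k i v, IsIterate D P μ i v →
      P[fun ω => ‖D.noise k i ω (v ω)‖ ^ 2 | D.past μ i] ≤ᵐ[P] (fun ω => K * (1 + ‖v ω‖ ^ 2)) ∧
      P[fun ω => ‖D.noise k i ω (v ω)‖ ^ 4 | D.past μ i] ≤ᵐ[P] fun ω => K * (1 + ‖v ω‖ ^ 4) := by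
  obtain ⟨β, σ, hβ, hσ, hs⟩ := h.noise.fourth_moment
  set K₀ := ∑ k, (β k ^ 4 + σ k ^ 4) with hK₀
  have hK₀k : ∀ k, β k ^ 4 + σ k ^ 4 ≤ K₀ := fun k =>
    Finset.single_le_sum (f := fun k => β k ^ 4 + σ k ^ 4) (fun j _ => by positivity)
      (Finset.mem_univ k)
  have hK₀0 : 0 ≤ K₀ := Finset.sum_nonneg fun j _ => by positivity
  refine ⟨1 + K₀, by positivity, fun μ hμ k i v hv => ?_⟩
  obtain ⟨hmem, hle⟩ := hs μ hμ k i v hv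
  have h44 : MemLp (fun ω => D.noise k i ω (v ω)) ((4 : ℕ) : ENNReal) P := by
    have h4 : ((4 : ℕ) : ENNReal) = 4 := by norm_num
    rwa [h4]
  have hint4 : Integrable (fun ω => ‖D.noise k i ω (v ω)‖ ^ 4) P := h44.integrable_norm_pow'
  have hint2 : Integrable (fun ω => ‖D.noise k i ω (v ω)‖ ^ 2) P :=
    (hmem.mono_exponent (by norm_num : (2 : ENNReal) ≤ 4)).integrable_norm_pow two_ne_zero
  have hv2 : Integrable (fun ω => ‖v ω‖ ^ 2) P :=
    (hv.2.mono_exponent (by norm_num : (2 : ENNReal) ≤ 4)).integrable_norm_pow two_ne_zero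
  set w : Ω → ℝ := fun ω => (1 + ‖v ω‖ ^ 2)⁻¹ with hw
  have hw0 : ∀ ω, 0 < w ω := fun ω => by simp only [hw]; positivity
  have hw1 : ∀ ω, w ω ≤ 1 := fun ω =>
    inv_le_one_of_one_le₀ (by have := sq_nonneg ‖v ω‖; linarith)
  have hwm : Measurable[D.past μ i] w := by
    have hc : Continuous fun z : Vec M => (1 + ‖z‖ ^ 2)⁻¹ :=
      Continuous.inv₀ (by fun_prop) fun z => by positivity
    exact hc.measurable.comp hv.1
  have hwint : Integrable (w * fun ω => ‖D.noise k i ω (v ω)‖ ^ 4) P := by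
    refine hint4.mono' ((hwm.mono (h.past_le μ i) le_rfl).aestronglyMeasurable.mul hint4.1)
      (Eventually.of_forall fun ω => ?_)
    rw [Pi.mul_apply, Real.norm_of_nonneg (mul_nonneg (hw0 ω).le (by positivity))]
    exact mul_le_of_le_one_left (by positivity) (hw1 ω)
  refine ⟨?_, ?_⟩
  · have h1 : P[fun ω => ‖D.noise k i ω (v ω)‖ ^ 2 | D.past μ i] ≤ᵐ[P]
        P[(fun ω => 1 / 2 * (1 + ‖v ω‖ ^ 2)) +
          (1 / 2 : ℝ) • (w * fun ω => ‖D.noise k i ω (v ω)‖ ^ 4) | D.past μ i] := by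
      refine condExp_mono hint2 ((((integrable_const 1).add hv2).const_mul _).add
        (hwint.smul (1 / 2 : ℝ))) (Eventually.of_forall fun ω => ?_)
      simp only [Pi.add_apply, Pi.smul_apply, Pi.mul_apply, smul_eq_mul]
      set a := ‖D.noise k i ω (v ω)‖ ^ 2 with ha
      have ha4 : ‖D.noise k i ω (v ω)‖ ^ 4 = a ^ 2 := by rw [ha]; ring
      have hwi : w ω * (1 + ‖v ω‖ ^ 2) = 1 := inv_mul_cancel₀ (by positivity)
      rw [ha4]
      nlinarith [mul_nonneg (hw0 ω).le (sq_nonneg (a - (1 + ‖v ω‖ ^ 2)))]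
    have h2 := condExp_add (m := D.past μ i)
      (((integrable_const (1 : ℝ)).add hv2).const_mul (1 / 2)) (hwint.smul (1 / 2 : ℝ))
    have h3 := condExp_smul (μ := P) (1 / 2 : ℝ) (w * fun ω => ‖D.noise k i ω (v ω)‖ ^ 4)
      (D.past μ i)
    have h4 := condExp_mul_of_stronglyMeasurable_left (m := D.past μ i) (μ := P)
      hwm.stronglyMeasurable hwint hint4
    have h5 : P[fun ω => 1 / 2 * (1 + ‖v ω‖ ^ 2) | D.past μ i] =
        fun ω => 1 / 2 * (1 + ‖v ω‖ ^ 2) := by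
      refine condExp_of_stronglyMeasurable (h.past_le μ i) ?_
        (((integrable_const (1 : ℝ)).add hv2).const_mul (1 / 2))
      have hc : Continuous fun z : Vec M => 1 / 2 * (1 + ‖z‖ ^ 2) := by fun_prop
      exact (hc.measurable.comp hv.1).stronglyMeasurable
    filter_upwards [h1, h2, h3, h4, hle] with ω e1 e2 e3 e4 e5
    refine e1.trans ?_
    have e2' : (P[(fun ω => 1 / 2 * (1 + ‖v ω‖ ^ 2)) +
          (1 / 2 : ℝ) • (w * fun ω => ‖D.noise k i ω (v ω)‖ ^ 4) | D.past μ i]) ω =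
        (P[fun ω => 1 / 2 * (1 + ‖v ω‖ ^ 2) | D.past μ i]) ω +
        (P[(1 / 2 : ℝ) • (w * fun ω => ‖D.noise k i ω (v ω)‖ ^ 4) | D.past μ i]) ω := e2
    rw [e2', h5, e3, Pi.smul_apply, e4, Pi.mul_apply, smul_eq_mul]
    have e6 : w ω * (β k ^ 4 * ‖v ω‖ ^ 4 + σ k ^ 4) ≤ K₀ * (1 + ‖v ω‖ ^ 2) := by
      have hwi : w ω * (1 + ‖v ω‖ ^ 2) = 1 := inv_mul_cancel₀ (by positivity)
      have e7 : β k ^ 4 * ‖v ω‖ ^ 4 + σ k ^ 4 ≤ K₀ * (1 + ‖v ω‖ ^ 2) ^ 2 := by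
        have hk := hK₀k k
        have a1 : 0 ≤ β k ^ 4 := by positivity
        have a2 : 0 ≤ σ k ^ 4 := by positivity
        have a3 : ‖v ω‖ ^ 4 ≤ (1 + ‖v ω‖ ^ 2) ^ 2 := by nlinarith [sq_nonneg ‖v ω‖]
        have a4 : 1 ≤ (1 + ‖v ω‖ ^ 2) ^ 2 := by nlinarith [sq_nonneg ‖v ω‖]
        calc _ ≤ β k ^ 4 * (1 + ‖v ω‖ ^ 2) ^ 2 + σ k ^ 4 * (1 + ‖v ω‖ ^ 2) ^ 2 :=
              add_le_add (mul_le_mul_of_nonneg_left a3 a1) (le_mul_of_one_le_right a2 a4)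
          _ = (β k ^ 4 + σ k ^ 4) * (1 + ‖v ω‖ ^ 2) ^ 2 := by ring
          _ ≤ _ := mul_le_mul_of_nonneg_right hk (by positivity)
      calc _ ≤ w ω * (K₀ * (1 + ‖v ω‖ ^ 2) ^ 2) := mul_le_mul_of_nonneg_left e7 (hw0 ω).le
        _ = (w ω * (1 + ‖v ω‖ ^ 2)) * (K₀ * (1 + ‖v ω‖ ^ 2)) := by ring
        _ = _ := by rw [hwi, one_mul]
    have e8 := mul_le_mul_of_nonneg_left e5 (hw0 ω).le
    have : 0 ≤ K₀ * (1 + ‖v ω‖ ^ 2) := by positivity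
    have : 0 ≤ (1 + ‖v ω‖ ^ 2) := by positivity
    linarith
  · filter_upwards [hle] with ω e
    refine e.trans ?_
    have hk := hK₀k k
    have a1 : 0 ≤ β k ^ 4 := by positivity
    have a2 : 0 ≤ σ k ^ 4 := by positivity
    nlinarith [pow_nonneg (norm_nonneg (v ω)) 4]

end Setting

end Expectations

end CoordDiffusion

namespace CoordDiffusion

/-! ### Scalar recursions -/

section Scalar

/-- A linear recursion with rate `θ` ends up below its fixed point `b / (1 - θ)`, up to `ε`. -/
lemma eventually_le_of_recursion {a : ℕ → ℝ} {θ b ε : ℝ} (hθ0 : 0 ≤ θ) (hθ : θ < 1) (hε : 0 < ε)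
    (h : ∀ᶠ i in atTop, a (i + 1) ≤ θ * a i + b) : ∀ᶠ i in atTop, a i ≤ b / (1 - θ) + ε := by
  obtain ⟨n, hn⟩ := eventually_atTop.1 h
  set L := b / (1 - θ) with hL
  have hb : b = (1 - θ) * L := by rw [hL]; field_simp [sub_ne_zero.2 hθ.ne']
  have h1 : ∀ j, a (n + j) - L ≤ θ ^ j * (a n - L) := by
    intro j
    induction j with
    | zero => simp
    | succ j ih =>
      have := hn (n + j) (Nat.le_add_right _ _)
      have e : a (n + (j + 1)) - L ≤ θ * (a (n + j) - L) := by
        rw [← add_assoc]; rw [hb] at this; linarith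
      refine e.trans ((mul_le_mul_of_nonneg_left ih hθ0).trans (le_of_eq ?_))
      rw [pow_succ']; ring
  have h2 : Tendsto (fun j : ℕ => θ ^ j * (a n - L)) atTop (𝓝 0) := by
    simpa using (tendsto_pow_atTop_nhds_zero_of_lt_one hθ0 hθ).mul_const (a n - L)
  obtain ⟨J, hJ⟩ := eventually_atTop.1 (h2.eventually (gt_mem_nhds hε))
  refine eventually_atTop.2 ⟨n + J, fun i hi => ?_⟩
  obtain ⟨j, rfl⟩ := Nat.exists_eq_add_of_le ((Nat.le_add_right n J).trans hi)
  have := h1 j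
  have := hJ j (by omega)
  linarith

/-- A contraction with a small perturbation, raised to a power. -/
lemma exists_pow_add_le (n : ℕ) (hn : n ≠ 0) {ρ ρ' : ℝ} (hρ0 : 0 ≤ ρ) (hρ : ρ < ρ')
    (hρ' : ρ' ≤ 1) :
    ∃ K, 0 ≤ K ∧ ∀ v z : ℝ, 0 ≤ v → 0 ≤ z → (ρ * v + z) ^ n ≤ ρ' * v ^ n + K * z ^ n := by
  have hd : 0 < ρ' - ρ := sub_pos.2 hρ
  have h0 : 0 ≤ ρ' := hρ0.trans hρ.le
  refine ⟨(ρ / (ρ' - ρ) + 1) ^ n, by positivity, fun v z hv hz => ?_⟩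
  -- either `z` fits into the gap between the two rates, or `z` controls `v`
  rcases le_or_gt z ((ρ' - ρ) * v) with h | h
  · have h1 : (ρ * v + z) ^ n ≤ (ρ' * v) ^ n := by gcongr; linarith
    have h2 : ρ' ^ n ≤ ρ' := pow_le_of_le_one h0 hρ' hn
    have h3 : ρ' ^ n * v ^ n ≤ ρ' * v ^ n := mul_le_mul_of_nonneg_right h2 (by positivity)
    rw [mul_pow] at h1
    have h4 : 0 ≤ (ρ / (ρ' - ρ) + 1) ^ n * z ^ n := by positivity
    linarith
  · have h1 : v ≤ z / (ρ' - ρ) := by rw [le_div_iff₀ hd]; linarith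
    have h2 : ρ * v + z ≤ (ρ / (ρ' - ρ) + 1) * z := by
      have := mul_le_mul_of_nonneg_left h1 hρ0
      calc _ ≤ ρ * (z / (ρ' - ρ)) + z := by linarith
        _ = _ := by ring
    have h3 : (ρ * v + z) ^ n ≤ ((ρ / (ρ' - ρ) + 1) * z) ^ n := by gcongr
    rw [mul_pow] at h3
    have h4 : 0 ≤ ρ' * v ^ n := by positivity
    linarith

lemma cube_mul_le {η u v : ℝ} (hη : 0 < η) (hu : 0 ≤ u) (hv : 0 ≤ v) :
    u ^ 3 * v ≤ η * u ^ 4 + 1 / η ^ 3 * v ^ 4 := by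
  rcases le_or_gt v (η * u) with h | h
  · have : u ^ 3 * v ≤ u ^ 3 * (η * u) := by gcongr
    have : 0 ≤ 1 / η ^ 3 * v ^ 4 := by positivity
    nlinarith
  · have h1 : u ≤ v / η := by rw [le_div_iff₀ hη]; linarith
    have h2 : u ^ 3 * v ≤ (v / η) ^ 3 * v := by gcongr
    have h3 : (v / η) ^ 3 * v = 1 / η ^ 3 * v ^ 4 := by field_simp
    have : 0 ≤ η * u ^ 4 := by positivity
    linarith

lemma add_add_pow_four_le (a b c : ℝ) :
    (a + b + c) ^ 4 ≤ 27 * (a ^ 4 + b ^ 4 + c ^ 4) := by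
  have f1 : (a + b + c) ^ 2 ≤ 3 * (a ^ 2 + b ^ 2 + c ^ 2) := by
    nlinarith [sq_nonneg (a - b), sq_nonneg (a - c), sq_nonneg (b - c)]
  have f2 : (a ^ 2 + b ^ 2 + c ^ 2) ^ 2 ≤ 3 * (a ^ 4 + b ^ 4 + c ^ 4) := by
    nlinarith [sq_nonneg (a ^ 2 - b ^ 2), sq_nonneg (a ^ 2 - c ^ 2), sq_nonneg (b ^ 2 - c ^ 2)]
  calc (a + b + c) ^ 4 = ((a + b + c) ^ 2) ^ 2 := by ring
    _ ≤ (3 * (a ^ 2 + b ^ 2 + c ^ 2)) ^ 2 := by gcongr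
    _ = 9 * (a ^ 2 + b ^ 2 + c ^ 2) ^ 2 := by ring
    _ ≤ _ := by linarith

/-- Two coupled recursions, a slow one for `a` and a fast one for `b`, settle at the levels `μ²`
and `μ⁴`. -/
lemma eventually_le_of_coupled {c K ρ : ℝ} (hc : 0 < c) (hK : 0 ≤ K) (hρ0 : 0 ≤ ρ) (hρ : ρ < 1) :
    ∃ K' : ℝ, 0 ≤ K' ∧ ∃ μ₀ : ℝ, 0 < μ₀ ∧ ∀ μ ∈ Set.Ioo 0 μ₀, ∀ a b : ℕ → ℝ,
      (∀ i, 0 ≤ a i) → (∀ i, 0 ≤ b i) →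
      (∀ i, a (i + 1) ≤ (1 - c * μ) * a i + K * μ * b i + K * μ ^ 3) →
      (∀ i, b (i + 1) ≤ ρ * b i + K * μ ^ 4 * (1 + a i)) →
      ∀ᶠ i in atTop, a i ≤ K' * μ ^ 2 ∧ b i ≤ K' * μ ^ 4 := by
  set L := 2 * K / (1 - ρ) with hL
  have h1ρ : 0 < 1 - ρ := sub_pos.2 hρ
  have hL0 : 0 ≤ L := by positivity
  set K₂ := K + L * K with hK₂
  have hK₂0 : 0 ≤ K₂ := by positivity
  set K₃ := K₂ / (c / 2) + 1 with hK₃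
  have hK₃0 : 0 ≤ K₃ := by positivity
  set K₄ := K * (1 + K₃) / (1 - ρ) + 1 with hK₄
  have hK₄0 : 0 ≤ K₄ := by positivity
  refine ⟨K₃ + K₄, by positivity, min 1 (min (1 / c) (min ((1 - ρ) / c) (c / (2 * (L * K + 1))))),
    by positivity, ?_⟩
  rintro μ ⟨hμ, hμ₀⟩ a b ha hb hra hrb
  obtain ⟨m1, hμ₀⟩ := lt_min_iff.1 hμ₀
  obtain ⟨m2, hμ₀⟩ := lt_min_iff.1 hμ₀
  obtain ⟨m3, m4⟩ := lt_min_iff.1 hμ₀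
  rw [lt_div_iff₀ hc] at m2 m3
  rw [lt_div_iff₀ (by positivity)] at m4
  -- with the weight `L μ` the fast contraction of `b` pays for its influence on `a`
  have hT : ∀ i, a (i + 1) + L * μ * b (i + 1) ≤
      (1 - c / 2 * μ) * (a i + L * μ * b i) + K₂ * μ ^ 3 := by
    intro i
    have e1 := hra i
    have e2 := mul_le_mul_of_nonneg_left (hrb i) (mul_nonneg hL0 hμ.le)
    have e3 : K * μ * b i = L * μ * b i * ((1 - ρ) / 2) := by rw [hL]; field_simp
    have e4 : L * μ * b i * ((1 - ρ) / 2) + L * μ * (ρ * b i) ≤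
        (1 - c / 2 * μ) * (L * μ * b i) := by
      have : 0 ≤ L * μ * b i := mul_nonneg (mul_nonneg hL0 hμ.le) (hb i)
      nlinarith
    have e5 : L * μ * (K * μ ^ 4 * a i) ≤ c / 2 * μ * a i := by
      have h4 : μ ^ 4 ≤ μ := pow_le_of_le_one hμ.le m1.le (by norm_num)
      have h5 : L * K * μ ^ 4 ≤ c / 2 := by
        have : L * K * μ ^ 4 ≤ L * K * μ := by gcongr
        nlinarith
      have := mul_le_mul_of_nonneg_right h5 (mul_nonneg hμ.le (ha i))
      nlinarith
    have e6 : L * μ * (K * μ ^ 4) ≤ L * K * μ ^ 3 := by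
      have h4 : μ ^ 5 ≤ μ ^ 3 := pow_le_pow_of_le_one hμ.le m1.le (by norm_num)
      have : L * K * μ ^ 5 ≤ L * K * μ ^ 3 := by gcongr
      nlinarith
    rw [hK₂]
    nlinarith
  have hcμ : 0 < c / 2 * μ := by positivity
  have hTe := eventually_le_of_recursion (a := fun i => a i + L * μ * b i) (θ := 1 - c / 2 * μ)
    (b := K₂ * μ ^ 3) (ε := μ ^ 2) (by nlinarith) (by linarith) (by positivity)
    (Eventually.of_forall hT)
  have hae : ∀ᶠ i in atTop, a i ≤ K₃ * μ ^ 2 := by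
    filter_upwards [hTe] with i hi
    have e1 : K₂ * μ ^ 3 / (1 - (1 - c / 2 * μ)) + μ ^ 2 = K₃ * μ ^ 2 := by
      rw [hK₃]; field_simp; ring
    have e2 : 0 ≤ L * μ * b i := mul_nonneg (mul_nonneg hL0 hμ.le) (hb i)
    linarith
  -- once `a` is bounded, `b` obeys a recursion of its own, with drive `O(μ⁴)`
  have hbe := eventually_le_of_recursion (a := b) (θ := ρ) (b := K * μ ^ 4 * (1 + K₃))
    (ε := μ ^ 4) hρ0 hρ (by positivity) (by
      filter_upwards [hae] with i hi
      have : μ ^ 2 ≤ 1 := pow_le_one₀ hμ.le m1.le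
      have h2 : a i ≤ K₃ := hi.trans (mul_le_of_le_one_right hK₃0 this)
      have h3 : K * μ ^ 4 * (1 + a i) ≤ K * μ ^ 4 * (1 + K₃) := by gcongr
      linarith [hrb i])
  filter_upwards [hae, hbe] with i h1 h2
  have e1 : K * μ ^ 4 * (1 + K₃) / (1 - ρ) + μ ^ 4 = K₄ * μ ^ 4 := by rw [hK₄]; ring
  have e2 : 0 ≤ K₄ * μ ^ 2 := by positivity
  have e3 : 0 ≤ K₃ * μ ^ 4 := by positivity
  constructor
  · linarith
  · linarith

end Scalar

end CoordDiffusion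

namespace CoordDiffusion

/-! ### Fourth moments of the errors -/

section FourthMoments

open scoped InnerProductSpace

variable {N M : ℕ} {Ω : Type*}

lemma norm_sub_pow_four_le (x g : Vec M) :
    ‖x - g‖ ^ 4 ≤ ‖x‖ ^ 4 - 4 * (‖x‖ ^ 2 * ⟪x, g⟫_ℝ) + 8 * (‖x‖ ^ 2 * ‖g‖ ^ 2) + 3 * ‖g‖ ^ 4 := by
  have h1 : ‖x - g‖ ^ 4 = (‖x‖ ^ 2 - 2 * ⟪x, g⟫_ℝ + ‖g‖ ^ 2) ^ 2 := by
    rw [← norm_sub_sq_real]; ring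
  have h2 := abs_real_inner_le_norm x g
  have h3 : ⟪x, g⟫_ℝ ^ 2 ≤ ‖x‖ ^ 2 * ‖g‖ ^ 2 := by
    rw [← mul_pow]; exact sq_le_sq' (by linarith [neg_abs_le ⟪x, g⟫_ℝ]) (by
      linarith [le_abs_self ⟪x, g⟫_ℝ])
  have h4 : -⟪x, g⟫_ℝ ≤ ‖x‖ * ‖g‖ := by linarith [neg_abs_le ⟪x, g⟫_ℝ]
  have h5 : -⟪x, g⟫_ℝ * ‖g‖ ^ 2 ≤ ‖x‖ * ‖g‖ * ‖g‖ ^ 2 :=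
    mul_le_mul_of_nonneg_right h4 (by positivity)
  rw [h1]
  nlinarith [mul_nonneg (sq_nonneg ‖g‖) (sq_nonneg (‖x‖ - ‖g‖))]

lemma inner_sum_hmul (c : Fin N → ℝ) (g : Fin N → Fin M → ℝ) (d : Fin N → Vec M) (v : Vec M) :
    ⟪v, ∑ l, c l • hmul (g l) (d l)⟫_ℝ = ∑ l, c l * ∑ m, g l m * (v m * d l m) := by
  rw [inner_sum]
  refine Finset.sum_congr rfl fun l _ => ?_
  rw [inner_smul_right, inner_vec]
  congr 1
  exact Finset.sum_congr rfl fun m _ => by rw [hmul_apply]; ring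

lemma norm_sum_hmul_le {c : Fin N → ℝ} (hc0 : ∀ l, 0 ≤ c l) (hc1 : ∀ l, c l ≤ 1)
    {g : Fin N → Fin M → ℝ} (hg : ∀ l m, |g l m| ≤ 1) (d : Fin N → Vec M) :
    ‖∑ l, c l • hmul (g l) (d l)‖ ≤ ∑ l, ‖d l‖ :=
  (norm_sum_le _ _).trans (Finset.sum_le_sum fun l _ => by
    rw [norm_smul, Real.norm_of_nonneg (hc0 l)]
    exact (mul_le_of_le_one_left (norm_nonneg _) (hc1 l)).trans (norm_hmul_le (hg l) _))

lemma PolyGrowth.fst {n : ℕ} {F : (Fin N → Vec M) → ℝ} (hF : PolyGrowth n F) :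
    PolyGrowth n (fun z : (Fin N → Vec M) × (Fin N → Vec M) => F z.1) :=
  hF.comp (PolyGrowth.of_norm_le continuous_fst (C := 1) fun z => by
    rw [one_mul]; exact norm_fst_le z) continuous_fst

lemma sum_norm_le (x : Fin N → Vec M) : ∑ k, ‖x k‖ ≤ N * ‖x‖ := by
  calc ∑ k, ‖x k‖ ≤ ∑ _k : Fin N, ‖x‖ := Finset.sum_le_sum fun k _ => norm_le_pi_norm x k
    _ = N * ‖x‖ := by simp

lemma growth_avg {D : Model N M Ω} {p : Fin N → ℝ} (hp : IsPerronVector D p)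
    (hnet : NetworkConditions D) : PolyGrowth 1 (fun x : Fin N → Vec M => ‖avg p x‖) :=
  PolyGrowth.of_norm_le (continuous_avg p) fun x => (norm_avg_le hp hnet x).trans (sum_norm_le x)

lemma growth_coord (m : Fin M) : PolyGrowth 1 (fun v : Vec M => v m) :=
  PolyGrowth.of_le (by fun_prop) (C := 1) fun v => by rw [one_mul]; exact abs_coord_le v m

lemma growth_avg_coord {D : Model N M Ω} {p : Fin N → ℝ} (hp : IsPerronVector D p)
    (hnet : NetworkConditions D) (m : Fin M) :
    PolyGrowth 1 (fun x : Fin N → Vec M => avg p x m) :=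
  (growth_coord m).comp (growth_avg hp hnet) (continuous_avg p)

lemma growth_mix {A : Matrix (Fin N) (Fin N) ℝ} (hA : IsLeftStochastic A) (k : Fin N) :
    PolyGrowth 1 (fun x : Fin N → Vec M => ‖mix A x k‖) :=
  PolyGrowth.of_norm_le (by fun_prop) fun x => (norm_mix_le hA x k).trans (sum_norm_le x)

lemma ConsensusGauge.growth {A : Matrix (Fin N) (Fin N) ℝ} {p : Fin N → ℝ}
    (W : ConsensusGauge M A p) : PolyGrowth 1 W.V :=
  PolyGrowth.of_le W.cont (C := W.C * N) fun x => by
    rw [abs_of_nonneg (W.nonneg x), mul_assoc]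
    exact (W.le_sum x).trans (mul_le_mul_of_nonneg_left (sum_norm_le x) W.C_nonneg)

lemma ConsensusGauge.mix_sub_le {A B : Matrix (Fin N) (Fin N) ℝ} {p : Fin N → ℝ}
    (W : ConsensusGauge M A p) (hB : IsLeftStochastic B) (x : Fin N → Vec M) (k : Fin N) :
    ‖mix B x k - avg p x‖ ≤ W.V x :=
  norm_mix_sub_le hB x _ _ (W.dist_le x) k

lemma ConsensusGauge.mix_le {A B : Matrix (Fin N) (Fin N) ℝ} {p : Fin N → ℝ}
    (W : ConsensusGauge M A p) (hB : IsLeftStochastic B) (x : Fin N → Vec M) (k : Fin N) :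
    ‖mix B x k‖ ≤ ‖avg p x‖ + W.V x := by
  have h1 := W.mix_sub_le hB x k
  have h2 := norm_le_norm_add_norm_sub' (mix B x k) (avg p x)
  linarith

lemma CostBounds.grad_le {D : Model N M Ω} {ν δ C : ℝ} (hb : CostBounds D ν δ C) (k : Fin N)
    (v : Vec M) : ‖gradient (D.J k) (D.wo - v)‖ ≤ δ * ‖v‖ := by
  have := hb.lip k (D.wo - v) D.wo
  rwa [hb.grad_wo, sub_zero, sub_sub_cancel_left, norm_neg] at this

section

variable {D : Model N M Ω} {ν δ C : ℝ}

lemma continuous_grad_mix (hg : ∀ k, Continuous (gradient (D.J k))) (k : Fin N) :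
    Continuous (fun x : Fin N → Vec M => gradient (D.J k) (D.wo - mix D.A₁ x k)) :=
  (hg k).comp (by fun_prop)

lemma growth_grad (hb : CostBounds D ν δ C) (hnet : NetworkConditions D)
    (hg : ∀ k, Continuous (gradient (D.J k))) (k : Fin N) :
    PolyGrowth 1 (fun x : Fin N → Vec M => ‖gradient (D.J k) (D.wo - mix D.A₁ x k)‖) :=
  PolyGrowth.of_norm_le (continuous_grad_mix hg k) (C := δ * N) fun x => by
    rw [mul_assoc]
    exact (hb.grad_le k _).trans (mul_le_mul_of_nonneg_left
      ((norm_mix_le hnet.A₁_stoch x k).trans (sum_norm_le x)) hb.δ_pos.le)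

lemma growth_grad_coord (hb : CostBounds D ν δ C) (hnet : NetworkConditions D)
    (hg : ∀ k, Continuous (gradient (D.J k))) (k : Fin N) (m : Fin M) :
    PolyGrowth 1 (fun x : Fin N → Vec M => gradient (D.J k) (D.wo - mix D.A₁ x k) m) :=
  (growth_coord m).comp (growth_grad hb hnet hg k) (continuous_grad_mix hg k)

lemma growth_noise (k : Fin N) :
    PolyGrowth 1 (fun z : (Fin N → Vec M) × (Fin N → Vec M) => ‖z.2 k‖) :=
  PolyGrowth.of_norm_le (by fun_prop) (C := 1) fun z => by
    rw [one_mul]; exact (norm_le_pi_norm z.2 k).trans (norm_snd_le z)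

lemma growth_noise_coord (k : Fin N) (m : Fin M) :
    PolyGrowth 1 (fun z : (Fin N → Vec M) × (Fin N → Vec M) => z.2 k m) :=
  (growth_coord m).comp (growth_noise k) (by fun_prop)

lemma growth_descent_coord (hb : CostBounds D ν δ C) (hnet : NetworkConditions D)
    (hg : ∀ k, Continuous (gradient (D.J k))) (k : Fin N) (m : Fin M) :
    PolyGrowth 1 (fun z : (Fin N → Vec M) × (Fin N → Vec M) => D.descent z.1 z.2 k m) := by
  have := ((growth_grad_coord hb hnet hg k m).fst.add (growth_noise_coord k m)).const_mul (-1)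
  simpa [Model.descent] using this

lemma growth_descent (hb : CostBounds D ν δ C) (hnet : NetworkConditions D)
    (hg : ∀ k, Continuous (gradient (D.J k))) (k : Fin N) :
    PolyGrowth 1 (fun z : (Fin N → Vec M) × (Fin N → Vec M) => ‖D.descent z.1 z.2 k‖) := by
  have h1 : Continuous (fun z : (Fin N → Vec M) × (Fin N → Vec M) => D.descent z.1 z.2 k) :=
    (((continuous_grad_mix hg k).comp continuous_fst).add (by fun_prop)).neg
  refine PolyGrowth.of_norm_le h1 (C := δ * N + 1) fun z => ?_
  rw [Model.descent, norm_neg, add_mul, one_mul, mul_assoc]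
  refine (norm_add_le _ _).trans (add_le_add ((hb.grad_le k _).trans ?_)
    ((norm_le_pi_norm z.2 k).trans (norm_snd_le z)))
  refine mul_le_mul_of_nonneg_left ((norm_mix_le hnet.A₁_stoch z.1 k).trans ?_) hb.δ_pos.le
  exact (sum_norm_le z.1).trans (mul_le_mul_of_nonneg_left (norm_fst_le z) N.cast_nonneg)

lemma sum_descent_le (hb : CostBounds D ν δ C) (hnet : NetworkConditions D) {p : Fin N → ℝ}
    (W : ConsensusGauge M (D.A₁ * D.A₂) p) (x s : Fin N → Vec M) :
    ∑ l, ‖D.descent x s l‖ ≤ N * δ * ‖avg p x‖ + N * δ * W.V x + ∑ l, ‖s l‖ := by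
  calc _ ≤ ∑ l, (δ * (‖avg p x‖ + W.V x) + ‖s l‖) := by
        refine Finset.sum_le_sum fun l _ => ?_
        rw [Model.descent, norm_neg]
        refine (norm_add_le _ _).trans (add_le_add ((hb.grad_le l _).trans ?_) le_rfl)
        exact mul_le_mul_of_nonneg_left (W.mix_le hnet.A₁_stoch x l) hb.δ_pos.le
    _ = _ := by rw [Finset.sum_add_distrib]; simp; ring

end

variable [MeasurableSpace Ω]

namespace Setting

variable {D : Model N M Ω} {P : Measure Ω} {μbar : ℝ} [IsProbabilityMeasure P]

/-- The masks of an iteration act in the mean like their expected values. -/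
lemma integral_masked_sum (h : Setting D P μbar) {μ : ℝ} (hμ : μ ∈ Set.Ioo 0 μbar) (i : ℕ)
    (c : Fin N → ℝ) {Y : Fin N → Fin M → Ω → ℝ} (hY : ∀ l m, Measurable[D.avail μ i] (Y l m))
    (hint : ∀ l m, Integrable (Y l m) P) :
    Integrable (fun ω => ∑ l, c l * ∑ m, D.maskAt i ω l m * Y l m ω) P ∧
    ∫ ω, ∑ l, c l * ∑ m, D.maskAt i ω l m * Y l m ω ∂P =
      ∑ l, c l * (1 - D.r l) * ∑ m, ∫ ω, Y l m ω ∂P := by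
  have h1 : ∀ l m, Integrable (fun ω => D.maskAt i ω l m * Y l m ω) P := fun l m =>
    (hint l m).bdd_mul (c := 1) (h.reg.mask_meas l i m).aestronglyMeasurable
      (Eventually.of_forall fun ω => h.abs_mask_le l i m ω)
  have h2 : ∀ l, Integrable (fun ω => c l * ∑ m, D.maskAt i ω l m * Y l m ω) P := fun l =>
    (integrable_finsetSum Finset.univ fun m _ => h1 l m).const_mul _
  refine ⟨integrable_finsetSum Finset.univ fun l _ => h2 l, ?_⟩
  rw [integral_finsetSum Finset.univ fun l _ => h2 l]
  refine Finset.sum_congr rfl fun l _ => ?_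
  rw [integral_const_mul, integral_finsetSum Finset.univ fun m _ => h1 l m, mul_assoc,
    Finset.mul_sum Finset.univ _ (1 - D.r l)]
  congr 1
  refine Finset.sum_congr rfl fun m _ => ?_
  exact h.integral_mask_mul hμ i l m (hY l m)

/-- Moments of the gradient noise along the algorithm, weighted by functions of the past. -/
lemma exists_noise_moments (h : Setting D P μbar) {p : Fin N → ℝ}
    (W : ConsensusGauge M (D.A₁ * D.A₂) p) (hp : IsPerronVector D p) : ∃ K : ℝ, 0 ≤ K ∧
    ∀ μ ∈ Set.Ioo 0 μbar, ∀ i l,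
      (∀ F : (Fin N → Vec M) → ℝ, PolyGrowth 2 F → (∀ x, 0 ≤ F x) →
        ∫ ω, F (D.err μ i ω) * ‖D.noiseAt μ i ω l‖ ^ 2 ∂P ≤
          K * ∫ ω, F (D.err μ i ω) *
            (1 + ‖avg p (D.err μ i ω)‖ ^ 2 + W.V (D.err μ i ω) ^ 2) ∂P) ∧
      ∫ ω, ‖D.noiseAt μ i ω l‖ ^ 4 ∂P ≤
        K * ∫ ω, (1 + ‖avg p (D.err μ i ω)‖ ^ 4 + W.V (D.err μ i ω) ^ 4) ∂P := by
  obtain ⟨K, hK, hbd⟩ := h.exists_noise_bound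
  set w := ‖D.wo‖ with hw
  have hw0 : 0 ≤ w := norm_nonneg _
  refine ⟨K * (3 + 3 * w ^ 2 + 27 + 27 * w ^ 4), by positivity, fun μ hμ i l => ?_⟩
  obtain ⟨hb2, hb4⟩ := hbd μ hμ l i _ (h.isIterate hμ i l)
  have hcomb : ∀ ω, ‖D.combine (D.iter μ i) l ω‖ ≤
      w + ‖avg p (D.err μ i ω)‖ + W.V (D.err μ i ω) := fun ω => by
    rw [D.combine_eq h.net.A₁_stoch]
    have := W.mix_le h.net.A₁_stoch (D.err μ i ω) l
    have := norm_sub_le D.wo (mix D.A₁ (D.err μ i ω) l)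
    linarith
  have hU := growth_avg hp h.net (M := M)
  have hV := W.growth
  refine ⟨fun F hF hF0 => ?_, ?_⟩
  · have hint : Integrable ((fun ω => F (D.err μ i ω)) * fun ω => ‖D.noiseAt μ i ω l‖ ^ 2) P :=
      h.integrable_state hμ i (hF.fst.mul ((growth_noise l).pow 2))
    have hint2 : Integrable (fun ω => ‖D.noiseAt μ i ω l‖ ^ 2) P :=
      h.integrable_state hμ i (((growth_noise l).pow 2).mono (by norm_num))
    rw [← integral_condExp (h.past_le μ i), ← integral_const_mul]
    have h2 := condExp_mul_of_stronglyMeasurable_left (m := D.past μ i) (μ := P)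
      (measurable_comp_past hF.1 D μ i).stronglyMeasurable hint hint2
    refine integral_mono_ae integrable_condExp ?_ ?_
    · refine Integrable.const_mul ?_ _
      exact h.integrable_err hμ i
        (hF.mul (m := 2) (((PolyGrowth.const 1).add (hU.pow 2)).add (hV.pow 2)))
    · filter_upwards [h2, hb2] with ω e1 e2
      refine (e1.trans_le ?_)
      rw [Pi.mul_apply]
      have e3 : 1 + ‖D.combine (D.iter μ i) l ω‖ ^ 2 ≤ (3 + 3 * w ^ 2 + 27 + 27 * w ^ 4) *
          (1 + ‖avg p (D.err μ i ω)‖ ^ 2 + W.V (D.err μ i ω) ^ 2) := by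
        set a := ‖avg p (D.err μ i ω)‖
        set b := W.V (D.err μ i ω)
        have ha : 0 ≤ a := norm_nonneg _
        have hb : 0 ≤ b := W.nonneg _
        have e5 : ‖D.combine (D.iter μ i) l ω‖ ^ 2 ≤ (w + a + b) ^ 2 :=
          pow_le_pow_left₀ (norm_nonneg _) (hcomb ω) 2
        have e6 : (w + a + b) ^ 2 ≤ 3 * (w ^ 2 + a ^ 2 + b ^ 2) := by
          nlinarith [sq_nonneg (w - a), sq_nonneg (w - b), sq_nonneg (a - b)]
        have e7 : 0 ≤ (3 * w ^ 2 + 27 + 27 * w ^ 4) * (a ^ 2 + b ^ 2) := by positivity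
        have e8 : 0 ≤ w ^ 4 := by positivity
        nlinarith
      have e4 := hF0 (D.err μ i ω)
      calc _ ≤ F (D.err μ i ω) * (K * (1 + ‖D.combine (D.iter μ i) l ω‖ ^ 2)) :=
            mul_le_mul_of_nonneg_left e2 e4
        _ ≤ F (D.err μ i ω) * (K * ((3 + 3 * w ^ 2 + 27 + 27 * w ^ 4) *
          (1 + ‖avg p (D.err μ i ω)‖ ^ 2 + W.V (D.err μ i ω) ^ 2))) := by gcongr
        _ = _ := by ring
  · rw [← integral_condExp (h.past_le μ i), ← integral_const_mul]
    refine integral_mono_ae integrable_condExp ?_ ?_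
    · refine Integrable.const_mul ?_ _
      exact h.integrable_err hμ i (((PolyGrowth.const 1).add (hU.pow 4)).add (hV.pow 4))
    · filter_upwards [hb4] with ω e2
      refine e2.trans ?_
      have e3 : 1 + ‖D.combine (D.iter μ i) l ω‖ ^ 4 ≤ (3 + 3 * w ^ 2 + 27 + 27 * w ^ 4) *
          (1 + ‖avg p (D.err μ i ω)‖ ^ 4 + W.V (D.err μ i ω) ^ 4) := by
        set a := ‖avg p (D.err μ i ω)‖
        set b := W.V (D.err μ i ω)
        have ha : 0 ≤ a := norm_nonneg _
        have hb : 0 ≤ b := W.nonneg _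
        have e5 : ‖D.combine (D.iter μ i) l ω‖ ^ 4 ≤ (w + a + b) ^ 4 :=
          pow_le_pow_left₀ (norm_nonneg _) (hcomb ω) 4
        have e6 := add_add_pow_four_le w a b
        have e7 : 0 ≤ (3 + 3 * w ^ 2 + 27 * w ^ 4) * (a ^ 4 + b ^ 4) := by positivity
        have e8 : 0 ≤ w ^ 2 := by positivity
        nlinarith
      calc _ ≤ K * ((3 + 3 * w ^ 2 + 27 + 27 * w ^ 4) *
          (1 + ‖avg p (D.err μ i ω)‖ ^ 4 + W.V (D.err μ i ω) ^ 4)) := by gcongr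
        _ = _ := by ring

end Setting

end FourthMoments

end CoordDiffusion

namespace CoordDiffusion

section FourthMoments

open scoped InnerProductSpace

variable {N M : ℕ} {Ω : Type*}

lemma sum_pow_four_le (f : Fin N → ℝ) : (∑ l, f l) ^ 4 ≤ (N : ℝ) ^ 3 * ∑ l, f l ^ 4 := by
  have h1 := sq_sum_le_card_mul_sum_sq (s := Finset.univ) (f := f)
  have h2 := sq_sum_le_card_mul_sum_sq (s := Finset.univ) (f := fun l => f l ^ 2)
  simp only [Finset.card_univ, Fintype.card_fin, ← pow_mul] at h1 h2
  calc (∑ l, f l) ^ 4 = ((∑ l, f l) ^ 2) ^ 2 := by ring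
    _ ≤ (N * ∑ l, f l ^ 2) ^ 2 := by gcongr
    _ = (N : ℝ) ^ 2 * (∑ l, f l ^ 2) ^ 2 := by ring
    _ ≤ (N : ℝ) ^ 2 * (N * ∑ l, f l ^ (2 * 2)) := by gcongr
    _ = _ := by ring

variable [MeasurableSpace Ω]

namespace Setting

variable {D : Model N M Ω} {P : Measure Ω} {μbar : ℝ} [IsProbabilityMeasure P]

/-- Moments of the total size of the descent directions. -/
lemma exists_descent_moments (h : Setting D P μbar) {p : Fin N → ℝ}
    (W : ConsensusGauge M (D.A₁ * D.A₂) p) (hp : IsPerronVector D p) : ∃ K : ℝ, 0 ≤ K ∧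
    ∀ μ ∈ Set.Ioo 0 μbar, ∀ i,
      (∀ F : (Fin N → Vec M) → ℝ, PolyGrowth 2 F → (∀ x, 0 ≤ F x) →
        ∫ ω, F (D.err μ i ω) * (∑ l, ‖D.descent (D.err μ i ω) (D.noiseAt μ i ω) l‖) ^ 2 ∂P ≤
          K * ∫ ω, F (D.err μ i ω) *
            (1 + ‖avg p (D.err μ i ω)‖ ^ 2 + W.V (D.err μ i ω) ^ 2) ∂P) ∧
      ∫ ω, (∑ l, ‖D.descent (D.err μ i ω) (D.noiseAt μ i ω) l‖) ^ 4 ∂P ≤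
        K * ∫ ω, (1 + ‖avg p (D.err μ i ω)‖ ^ 4 + W.V (D.err μ i ω) ^ 4) ∂P := by
  obtain ⟨K, hK, hmom⟩ := h.exists_noise_moments W hp
  obtain ⟨ν, δ, C, hb⟩ := h.exists_bounds
  set A := N * δ with hA
  have hA0 : 0 ≤ A := mul_nonneg N.cast_nonneg hb.δ_pos.le
  have hU := growth_avg hp h.net (M := M)
  have hV := W.growth
  have hd := fun l => growth_descent hb h.net h.continuous_grad l
  have hds := PolyGrowth.sum Finset.univ fun l _ => hd l
  refine ⟨(3 * A ^ 2 + 3 * N * (N * K)) + (27 * A ^ 4 + 27 * N ^ 3 * (N * K)), by positivity,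
    fun μ hμ i => ⟨fun F hF hF0 => ?_, ?_⟩⟩
  · set I := ∫ ω, F (D.err μ i ω) *
            (1 + ‖avg p (D.err μ i ω)‖ ^ 2 + W.V (D.err μ i ω) ^ 2) ∂P with hI
    have hI0 : 0 ≤ I := integral_nonneg fun ω => mul_nonneg (hF0 _) (by positivity)
    have i1 : Integrable (fun ω => F (D.err μ i ω) *
            (1 + ‖avg p (D.err μ i ω)‖ ^ 2 + W.V (D.err μ i ω) ^ 2)) P :=
      h.integrable_err hμ i
        (hF.mul (m := 2) (((PolyGrowth.const 1).add (hU.pow 2)).add (hV.pow 2)))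
    have i2 : ∀ l, Integrable (fun ω => F (D.err μ i ω) * ‖D.noiseAt μ i ω l‖ ^ 2) P := fun l =>
      h.integrable_state hμ i (hF.fst.mul ((growth_noise l).pow 2))
    have i3 := integrable_finsetSum Finset.univ fun l (_ : l ∈ Finset.univ) => i2 l
    have i4 : Integrable (fun ω => F (D.err μ i ω) *
        (∑ l, ‖D.descent (D.err μ i ω) (D.noiseAt μ i ω) l‖) ^ 2) P :=
      h.integrable_state hμ i (hF.fst.mul (hds.pow 2))
    calc _ ≤ ∫ ω, (3 * A ^ 2 * (F (D.err μ i ω) *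
            (1 + ‖avg p (D.err μ i ω)‖ ^ 2 + W.V (D.err μ i ω) ^ 2)) +
            3 * N * ∑ l, F (D.err μ i ω) * ‖D.noiseAt μ i ω l‖ ^ 2) ∂P := by
          refine integral_mono i4 ((i1.const_mul _).add (i3.const_mul _)) fun ω => ?_
          have e1 := sum_descent_le hb h.net W (D.err μ i ω) (D.noiseAt μ i ω)
          rw [← hA] at e1
          have e2 := sq_sum_le_card_mul_sum_sq (s := Finset.univ)
            (f := fun l => ‖D.noiseAt μ i ω l‖)
          simp only [Finset.card_univ, Fintype.card_fin] at e2
          set S := ∑ l, ‖D.noiseAt μ i ω l‖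
          set a := ‖avg p (D.err μ i ω)‖
          set b := W.V (D.err μ i ω)
          have e3 : (∑ l, ‖D.descent (D.err μ i ω) (D.noiseAt μ i ω) l‖) ^ 2 ≤
              (A * a + A * b + S) ^ 2 :=
            pow_le_pow_left₀ (Finset.sum_nonneg fun l _ => norm_nonneg _) e1 2
          have e4 : (A * a + A * b + S) ^ 2 ≤ 3 * A ^ 2 * (1 + a ^ 2 + b ^ 2) +
              3 * N * ∑ l, ‖D.noiseAt μ i ω l‖ ^ 2 := by
            nlinarith [sq_nonneg (A * a - A * b), sq_nonneg (A * a - S), sq_nonneg (A * b - S),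
              sq_nonneg A]
          have e5 := mul_le_mul_of_nonneg_left (e3.trans e4) (hF0 (D.err μ i ω))
          simp only [← Finset.mul_sum]
          refine e5.trans (le_of_eq ?_)
          ring
      _ = 3 * A ^ 2 * I + 3 * N * ∑ l, ∫ ω, F (D.err μ i ω) * ‖D.noiseAt μ i ω l‖ ^ 2 ∂P := by
          rw [integral_add (i1.const_mul _) (i3.const_mul _), integral_const_mul,
            integral_const_mul, integral_finsetSum _ fun l _ => i2 l]
      _ ≤ 3 * A ^ 2 * I + 3 * N * ∑ _l : Fin N, K * I := by
          gcongr with l _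
          exact (hmom μ hμ i l).1 F hF hF0
      _ = (3 * A ^ 2 + 3 * N * (N * K)) * I := by simp; ring
      _ ≤ _ := by
          have : 0 ≤ (27 * A ^ 4 + 27 * N ^ 3 * (N * K)) * I := by positivity
          linarith
  · set I := ∫ ω, (1 + ‖avg p (D.err μ i ω)‖ ^ 4 + W.V (D.err μ i ω) ^ 4) ∂P with hI
    have hI0 : 0 ≤ I := integral_nonneg fun ω => by positivity
    have i1 : Integrable (fun ω =>
            (1 + ‖avg p (D.err μ i ω)‖ ^ 4 + W.V (D.err μ i ω) ^ 4)) P :=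
      h.integrable_err hμ i (((PolyGrowth.const 1).add (hU.pow 4)).add (hV.pow 4))
    have i2 : ∀ l, Integrable (fun ω => ‖D.noiseAt μ i ω l‖ ^ 4) P := fun l =>
      h.integrable_state hμ i ((growth_noise l).pow 4)
    have i3 := integrable_finsetSum Finset.univ fun l (_ : l ∈ Finset.univ) => i2 l
    have i4 : Integrable (fun ω =>
        (∑ l, ‖D.descent (D.err μ i ω) (D.noiseAt μ i ω) l‖) ^ 4) P :=
      h.integrable_state hμ i (hds.pow 4)
    calc _ ≤ ∫ ω, (27 * A ^ 4 *
            (1 + ‖avg p (D.err μ i ω)‖ ^ 4 + W.V (D.err μ i ω) ^ 4) +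
            27 * N ^ 3 * ∑ l, ‖D.noiseAt μ i ω l‖ ^ 4) ∂P := by
          refine integral_mono i4 ((i1.const_mul _).add (i3.const_mul _)) fun ω => ?_
          have e1 := sum_descent_le hb h.net W (D.err μ i ω) (D.noiseAt μ i ω)
          rw [← hA] at e1
          have e2 := sum_pow_four_le (fun l => ‖D.noiseAt μ i ω l‖)
          set S := ∑ l, ‖D.noiseAt μ i ω l‖
          set a := ‖avg p (D.err μ i ω)‖
          set b := W.V (D.err μ i ω)
          refine (pow_le_pow_left₀ (Finset.sum_nonneg fun l _ => norm_nonneg _) e1 4).trans ?_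
          refine (add_add_pow_four_le _ _ _).trans ?_
          have : 0 ≤ A ^ 4 := by positivity
          rw [mul_pow, mul_pow]
          linarith
      _ = 27 * A ^ 4 * I + 27 * N ^ 3 * ∑ l, ∫ ω, ‖D.noiseAt μ i ω l‖ ^ 4 ∂P := by
          rw [integral_add (i1.const_mul _) (i3.const_mul _), integral_const_mul,
            integral_const_mul, integral_finsetSum _ fun l _ => i2 l]
      _ ≤ 27 * A ^ 4 * I + 27 * N ^ 3 * ∑ _l : Fin N, K * I := by
          gcongr with l _
          exact (hmom μ hμ i l).2
      _ = (27 * A ^ 4 + 27 * N ^ 3 * (N * K)) * I := by simp; ring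
      _ ≤ _ := by
          have : 0 ≤ (3 * A ^ 2 + 3 * N * (N * K)) * I := by positivity
          linarith

/-- The mean pull of the masked gradients towards the minimizer. -/
lemma integral_pull_ge (h : Setting D P μbar) {p : Fin N → ℝ}
    (W : ConsensusGauge M (D.A₁ * D.A₂) p) (hp : IsPerronVector D p) {ν δ C : ℝ}
    (hb : CostBounds D ν δ C) {μ : ℝ} (hμ : μ ∈ Set.Ioo 0 μbar) (i : ℕ) :
    (∑ l, D.qhat p l * (1 - D.r l)) *
      (ν / 2 * ∫ ω, ‖avg p (D.err μ i ω)‖ ^ 4 ∂P -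
        8 * δ ^ 4 / ν ^ 3 * ∫ ω, W.V (D.err μ i ω) ^ 4 ∂P) ≤
    ∫ ω, ‖avg p (D.err μ i ω)‖ ^ 2 * ⟪avg p (D.err μ i ω), ∑ l, D.qhat p l •
      hmul (D.maskAt i ω l) (D.descent (D.err μ i ω) (D.noiseAt μ i ω) l)⟫_ℝ ∂P := by
  have hU := growth_avg hp h.net (M := M)
  have hV := W.growth
  have hν := hb.ν_pos
  have hδ := hb.δ_pos
  set Y : Fin N → Fin M → Ω → ℝ := fun l m ω => ‖avg p (D.err μ i ω)‖ ^ 2 *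
    avg p (D.err μ i ω) m * D.descent (D.err μ i ω) (D.noiseAt μ i ω) l m with hYdef
  have hYg : ∀ l m, PolyGrowth 4 (fun z : (Fin N → Vec M) × (Fin N → Vec M) =>
      ‖avg p z.1‖ ^ 2 * avg p z.1 m * D.descent z.1 z.2 l m) := fun l m =>
    (((hU.fst.pow 2).mul (growth_avg_coord hp h.net m).fst).mul
      (growth_descent_coord hb h.net h.continuous_grad l m))
  have e1 : ∀ ω, ‖avg p (D.err μ i ω)‖ ^ 2 * ⟪avg p (D.err μ i ω), ∑ l, D.qhat p l •
      hmul (D.maskAt i ω l) (D.descent (D.err μ i ω) (D.noiseAt μ i ω) l)⟫_ℝ =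
      ∑ l, D.qhat p l * ∑ m, D.maskAt i ω l m * Y l m ω := by
    intro ω
    rw [inner_sum_hmul, Finset.mul_sum]
    refine Finset.sum_congr rfl fun l _ => ?_
    rw [Finset.mul_sum, Finset.mul_sum, Finset.mul_sum]
    refine Finset.sum_congr rfl fun m _ => ?_
    simp only [hYdef]
    ring
  simp only [e1]
  rw [(h.integral_masked_sum hμ i (D.qhat p) (fun l m => h.measurable_comp_avail (hYg l m).1 μ i)
    (fun l m => h.integrable_state hμ i (hYg l m))).2, Finset.sum_mul]
  refine Finset.sum_le_sum fun l _ => mul_le_mul_of_nonneg_left ?_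
    (mul_nonneg (qhat_nonneg hp h.net l) (by linarith [h.net.r_lt l]))
  have e2 : ∀ m, ∫ ω, Y l m ω ∂P = -∫ ω, ‖avg p (D.err μ i ω)‖ ^ 2 *
      avg p (D.err μ i ω) m * gradient (D.J l) (D.wo - mix D.A₁ (D.err μ i ω) l) m ∂P := by
    intro m
    have g1 := (hU.pow 2).mul (growth_avg_coord hp h.net (M := M) m)
    have i1 := h.integrable_err hμ i (g1.mul (growth_grad_coord hb h.net h.continuous_grad l m))
    have i2 : Integrable (fun ω => ‖avg p (D.err μ i ω)‖ ^ 2 * avg p (D.err μ i ω) m *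
        D.noiseAt μ i ω l m) P := h.integrable_state hμ i (g1.fst.mul (growth_noise_coord l m))
    have e3 := h.integral_mul_noise hμ i l m (measurable_comp_past g1.1 D μ i) i2
    have e4 : ∀ ω, Y l m ω = -(‖avg p (D.err μ i ω)‖ ^ 2 *
      avg p (D.err μ i ω) m * gradient (D.J l) (D.wo - mix D.A₁ (D.err μ i ω) l) m) -
      ‖avg p (D.err μ i ω)‖ ^ 2 * avg p (D.err μ i ω) m * D.noiseAt μ i ω l m := by
      intro ω; simp [hYdef, Model.descent]; ring
    simp only [e4]
    refine (integral_sub i1.neg i2).trans ?_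
    rw [e3, sub_zero]
    exact integral_neg _
  refine le_of_le_of_eq ?_ (Finset.sum_congr rfl fun m _ => (e2 m).symm)
  rw [Finset.sum_neg_distrib, ← integral_finsetSum _ fun m _ => h.integrable_err hμ i
    (((hU.pow 2).mul (growth_avg_coord hp h.net m)).mul
      (growth_grad_coord hb h.net h.continuous_grad l m)), ← integral_neg, ← integral_const_mul,
    ← integral_const_mul, ← integral_sub ((h.integrable_err hμ i (hU.pow 4)).const_mul _)
      ((h.integrable_err hμ i (hV.pow 4)).const_mul _)]
  refine integral_mono (((h.integrable_err hμ i (hU.pow 4)).const_mul _).sub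
      ((h.integrable_err hμ i (hV.pow 4)).const_mul _)) (Integrable.neg
        (integrable_finsetSum _ fun m _ => h.integrable_err hμ i
    (((hU.pow 2).mul (growth_avg_coord hp h.net m)).mul
      (growth_grad_coord hb h.net h.continuous_grad l m)))) fun ω => ?_
  set x := avg p (D.err μ i ω) with hx
  set v := W.V (D.err μ i ω) with hv
  have hv0 : 0 ≤ v := W.nonneg _
  set y := mix D.A₁ (D.err μ i ω) l with hy
  have e5 : ∑ m, ‖x‖ ^ 2 * x m * gradient (D.J l) (D.wo - y) m =
      ‖x‖ ^ 2 * ⟪x, gradient (D.J l) (D.wo - y)⟫_ℝ := by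
    rw [inner_vec, Finset.mul_sum]
    exact Finset.sum_congr rfl fun m _ => by ring
  rw [e5]
  have e6 : ⟪x, gradient (D.J l) (D.wo - y)⟫_ℝ ≤ -(ν * ‖x‖ ^ 2) + δ * ‖x‖ * v := by
    have f1 := hb.mono l x
    have f2 := hb.lip l (D.wo - y) (D.wo - x)
    rw [sub_sub_sub_cancel_left] at f2
    have f3 := W.mix_sub_le h.net.A₁_stoch (D.err μ i ω) l
    rw [norm_sub_rev] at f3
    have f4 := real_inner_le_norm x (gradient (D.J l) (D.wo - y) - gradient (D.J l) (D.wo - x))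
    rw [inner_sub_right] at f4
    have f5 : ‖x‖ * ‖gradient (D.J l) (D.wo - y) - gradient (D.J l) (D.wo - x)‖ ≤
        ‖x‖ * (δ * v) := by
      refine mul_le_mul_of_nonneg_left (f2.trans ?_) (norm_nonneg _)
      exact mul_le_mul_of_nonneg_left f3 hδ.le
    linarith
  have e7 := mul_le_mul_of_nonneg_left e6 (sq_nonneg ‖x‖)
  -- this weight spends half of the strong monotonicity on the disagreement
  have e8 := cube_mul_le (η := ν / (2 * δ)) (by positivity) (norm_nonneg x) hv0
  have e9 : δ * (ν / (2 * δ) * ‖x‖ ^ 4 + 1 / (ν / (2 * δ)) ^ 3 * v ^ 4) =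
      ν / 2 * ‖x‖ ^ 4 + 8 * δ ^ 4 / ν ^ 3 * v ^ 4 := by field_simp; ring
  have e10 := mul_le_mul_of_nonneg_left e8 hδ.le
  rw [e9] at e10
  nlinarith

end Setting

end FourthMoments

end CoordDiffusion

namespace CoordDiffusion

section FourthMoments

open scoped InnerProductSpace

variable {N M : ℕ} {Ω : Type*}

lemma pull_pos (hnet : NetworkConditions D) {p : Fin N → ℝ} (hp : IsPerronVector D p) :
    0 < ∑ l, D.qhat p l * (1 - D.r l) := by
  obtain ⟨k, hk⟩ := exists_qhat_pos hp hnet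
  refine Finset.sum_pos' (fun l _ => mul_nonneg (qhat_nonneg hp hnet l) ?_) ⟨k, Finset.mem_univ k,
    mul_pos hk ?_⟩
  · linarith [hnet.r_lt l]
  · linarith [hnet.r_lt k]

lemma integral_linear₃ [MeasurableSpace Ω] {P : Measure Ω} {f g k : Ω → ℝ} (a b c : ℝ)
    (hf : Integrable f P) (hg : Integrable g P) (hk : Integrable k P) :
    ∫ ω, (a * f ω + b * g ω + c * k ω) ∂P =
      a * ∫ ω, f ω ∂P + b * ∫ ω, g ω ∂P + c * ∫ ω, k ω ∂P := by
  have h1 : Integrable (fun ω => a * f ω + b * g ω) P := (hf.const_mul a).add (hg.const_mul b)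
  rw [integral_add h1 (hk.const_mul c), integral_add (hf.const_mul a) (hg.const_mul b)]
  simp only [integral_const_mul]

lemma integrable_linear₃ [MeasurableSpace Ω] {P : Measure Ω} {f g k : Ω → ℝ} (a b c : ℝ)
    (hf : Integrable f P) (hg : Integrable g P) (hk : Integrable k P) :
    Integrable (fun ω => a * f ω + b * g ω + c * k ω) P :=
  ((hf.const_mul a).add (hg.const_mul b)).add (hk.const_mul c)

variable [MeasurableSpace Ω]

namespace Setting

variable {D : Model N M Ω} {P : Measure Ω} {μbar : ℝ} [IsProbabilityMeasure P]

/-- One step of the fourth moment of the disagreement. -/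
lemma exists_gauge_step (h : Setting D P μbar) {p : Fin N → ℝ}
    (W : ConsensusGauge M (D.A₁ * D.A₂) p) (hp : IsPerronVector D p) :
    ∃ K ρ : ℝ, 0 ≤ K ∧ 0 ≤ ρ ∧ ρ < 1 ∧ ∀ μ ∈ Set.Ioo 0 μbar, ∀ i,
      ∫ ω, W.V (D.err μ (i + 1) ω) ^ 4 ∂P ≤ ρ * ∫ ω, W.V (D.err μ i ω) ^ 4 ∂P +
        K * μ ^ 4 * (1 + ∫ ω, ‖avg p (D.err μ i ω)‖ ^ 4 ∂P + ∫ ω, W.V (D.err μ i ω) ^ 4 ∂P) := by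
  obtain ⟨KR, hKR, hR⟩ := h.exists_descent_moments W hp
  obtain ⟨ν, δ, C, hb⟩ := h.exists_bounds
  have hU := growth_avg hp h.net (M := M)
  have hV := W.growth
  have hds := PolyGrowth.sum Finset.univ fun l _ => growth_descent hb h.net h.continuous_grad l
  have hρ1 := W.ρ_lt
  have hρ0 := W.ρ_nonneg
  set ρ₁ := (1 + W.ρ) / 2 with hρ₁
  obtain ⟨K₁, hK₁, hpow⟩ := exists_pow_add_le 4 (by norm_num) hρ0
    (show W.ρ < ρ₁ by rw [hρ₁]; linarith) (show ρ₁ ≤ 1 by rw [hρ₁]; linarith)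
  set E := W.C * N with hE
  have hE0 : 0 ≤ E := mul_nonneg W.C_nonneg N.cast_nonneg
  refine ⟨K₁ * E ^ 4 * KR, ρ₁, by positivity, by positivity, by rw [hρ₁]; linarith,
    fun μ hμ i => ?_⟩
  have hμ0 : 0 < μ := hμ.1
  have ia : Integrable (fun ω => ‖avg p (D.err μ i ω)‖ ^ 4) P := h.integrable_err hμ i (hU.pow 4)
  have ib : Integrable (fun ω => W.V (D.err μ i ω) ^ 4) P := h.integrable_err hμ i (hV.pow 4)
  have hR4 := (hR μ hμ i).2
  have hI4 := integral_linear₃ 1 1 1 (integrable_const (1 : ℝ)) ia ib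
  simp only [one_mul, integral_const, probReal_univ, smul_eq_mul, mul_one] at hI4
  rw [hI4] at hR4
  set R : Ω → ℝ := fun ω => ∑ l, ‖D.descent (D.err μ i ω) (D.noiseAt μ i ω) l‖ with hRdef
  have hRnn : ∀ ω, 0 ≤ R ω := fun ω => Finset.sum_nonneg fun l _ => norm_nonneg _
  have iR4 : Integrable (fun ω => R ω ^ 4) P := h.integrable_state hμ i (hds.pow 4)
  have e1 : ∫ ω, W.V (D.err μ (i + 1) ω) ^ 4 ∂P ≤
      ∫ ω, (ρ₁ * W.V (D.err μ i ω) ^ 4 + K₁ * E ^ 4 * μ ^ 4 * R ω ^ 4) ∂P := by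
    refine integral_mono (h.integrable_err hμ (i + 1) (hV.pow 4))
      ((ib.const_mul _).add (iR4.const_mul _)) fun ω => ?_
    simp only
    rw [D.err_succ h.net]
    have f1 := W.next_le h.net hμ0.le (fun l m => h.abs_mask_le l i m ω) (D.err μ i ω)
      (D.descent (D.err μ i ω) (D.noiseAt μ i ω))
    rw [← hE] at f1
    have f2 := hpow (W.V (D.err μ i ω)) (μ * E * R ω) (W.nonneg _)
      (mul_nonneg (mul_nonneg hμ0.le hE0) (hRnn ω))
    refine (pow_le_pow_left₀ (W.nonneg _) f1 4).trans (f2.trans (le_of_eq ?_))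
    ring
  rw [integral_add (ib.const_mul _) (iR4.const_mul _), integral_const_mul,
    integral_const_mul] at e1
  refine e1.trans (add_le_add le_rfl ?_)
  calc _ ≤ K₁ * E ^ 4 * μ ^ 4 * (KR * _) := mul_le_mul_of_nonneg_left hR4 (by positivity)
    _ = _ := by ring

/-- One step of the fourth moment of the network average. -/
lemma exists_avg_step (h : Setting D P μbar) {p : Fin N → ℝ}
    (W : ConsensusGauge M (D.A₁ * D.A₂) p) (hp : IsPerronVector D p) :
    ∃ c K L : ℝ, 0 < c ∧ 0 ≤ K ∧ 0 ≤ L ∧ ∀ μ ∈ Set.Ioo 0 μbar, ∀ i,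
      ∫ ω, ‖avg p (D.err μ (i + 1) ω)‖ ^ 4 ∂P ≤
        (1 - c * μ) * ∫ ω, ‖avg p (D.err μ i ω)‖ ^ 4 ∂P +
          K * μ * ∫ ω, W.V (D.err μ i ω) ^ 4 ∂P +
          L * μ ^ 2 * ∫ ω, (‖avg p (D.err μ i ω)‖ ^ 2 *
            (1 + ‖avg p (D.err μ i ω)‖ ^ 2 + W.V (D.err μ i ω) ^ 2)) ∂P +
          L * μ ^ 4 * (1 + ∫ ω, ‖avg p (D.err μ i ω)‖ ^ 4 ∂P +
            ∫ ω, W.V (D.err μ i ω) ^ 4 ∂P) := by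
  obtain ⟨KR, hKR, hR⟩ := h.exists_descent_moments W hp
  obtain ⟨ν, δ, C, hb⟩ := h.exists_bounds
  have hν := hb.ν_pos
  have hδ := hb.δ_pos
  have hU := growth_avg hp h.net (M := M)
  have hV := W.growth
  have hds := PolyGrowth.sum Finset.univ fun l _ => growth_descent hb h.net h.continuous_grad l
  set κ := ∑ l, D.qhat p l * (1 - D.r l) with hκ
  have hκ0 : 0 < κ := pull_pos h.net hp
  refine ⟨2 * κ * ν, 4 * κ * (8 * δ ^ 4 / ν ^ 3), 8 * KR, by positivity, by positivity,
    by positivity, fun μ hμ i => ?_⟩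
  have hμ0 : 0 < μ := hμ.1
  have ia : Integrable (fun ω => ‖avg p (D.err μ i ω)‖ ^ 4) P := h.integrable_err hμ i (hU.pow 4)
  have ib : Integrable (fun ω => W.V (D.err μ i ω) ^ 4) P := h.integrable_err hμ i (hV.pow 4)
  obtain ⟨hR2, hR4⟩ := hR μ hμ i
  have hI4 := integral_linear₃ 1 1 1 (integrable_const (1 : ℝ)) ia ib
  simp only [one_mul, integral_const, probReal_univ, smul_eq_mul, mul_one] at hI4
  rw [hI4] at hR4
  have hR2' := hR2 (fun x => ‖avg p x‖ ^ 2) (hU.pow 2) (fun x => by positivity)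
  set R : Ω → ℝ := fun ω => ∑ l, ‖D.descent (D.err μ i ω) (D.noiseAt μ i ω) l‖ with hRdef
  have iR4 : Integrable (fun ω => R ω ^ 4) P := h.integrable_state hμ i (hds.pow 4)
  set G : Ω → Vec M := fun ω => ∑ l, D.qhat p l •
    hmul (D.maskAt i ω l) (D.descent (D.err μ i ω) (D.noiseAt μ i ω) l) with hG
  have hpull := h.integral_pull_ge W hp hb hμ i
  rw [← hκ] at hpull
  have iT : Integrable (fun ω => ‖avg p (D.err μ i ω)‖ ^ 2 *
      ⟪avg p (D.err μ i ω), G ω⟫_ℝ) P := by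
    have hYg : ∀ l m, PolyGrowth 4 (fun z : (Fin N → Vec M) × (Fin N → Vec M) =>
        ‖avg p z.1‖ ^ 2 * avg p z.1 m * D.descent z.1 z.2 l m) := fun l m =>
      (((hU.fst.pow 2).mul (growth_avg_coord hp h.net m).fst).mul
        (growth_descent_coord hb h.net h.continuous_grad l m))
    refine (h.integral_masked_sum hμ i (D.qhat p)
      (fun l m => h.measurable_comp_avail (hYg l m).1 μ i)
      (fun l m => h.integrable_state hμ i (hYg l m))).1.congr (Eventually.of_forall fun ω => ?_)
    simp only [hG]
    rw [inner_sum_hmul, Finset.mul_sum]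
    refine Finset.sum_congr rfl fun l _ => ?_
    rw [Finset.mul_sum, Finset.mul_sum, Finset.mul_sum]
    exact Finset.sum_congr rfl fun m _ => by ring
  have iQ : Integrable (fun ω => ‖avg p (D.err μ i ω)‖ ^ 2 * R ω ^ 2) P :=
    h.integrable_state hμ i ((hU.fst.pow 2).mul (hds.pow 2))
  have iS := integrable_linear₃ (-(4 * μ)) (8 * μ ^ 2) (3 * μ ^ 4) iT iQ iR4
  have e1 : ∫ ω, ‖avg p (D.err μ (i + 1) ω)‖ ^ 4 ∂P ≤
      ∫ ω, (‖avg p (D.err μ i ω)‖ ^ 4 + (-(4 * μ) * (‖avg p (D.err μ i ω)‖ ^ 2 *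
        ⟪avg p (D.err μ i ω), G ω⟫_ℝ) + 8 * μ ^ 2 * (‖avg p (D.err μ i ω)‖ ^ 2 * R ω ^ 2) +
        3 * μ ^ 4 * R ω ^ 4)) ∂P := by
    refine integral_mono (h.integrable_err hμ (i + 1) (hU.pow 4)) (ia.add iS) fun ω => ?_
    simp only
    rw [D.err_succ h.net, D.avg_next hp.1]
    have f1 := norm_sub_pow_four_le (avg p (D.err μ i ω)) (μ • G ω)
    have f2 : ‖G ω‖ ≤ R ω := norm_sum_hmul_le (qhat_nonneg hp h.net) (qhat_le_one hp h.net)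
      (fun l m => h.abs_mask_le l i m ω) _
    rw [inner_smul_right, norm_smul, Real.norm_of_nonneg hμ0.le, mul_pow, mul_pow] at f1
    have f3 : ‖G ω‖ ^ 2 ≤ R ω ^ 2 := pow_le_pow_left₀ (norm_nonneg _) f2 2
    have f4 : ‖G ω‖ ^ 4 ≤ R ω ^ 4 := pow_le_pow_left₀ (norm_nonneg _) f2 4
    have f5 : ‖avg p (D.err μ i ω)‖ ^ 2 * (μ ^ 2 * ‖G ω‖ ^ 2) ≤
        ‖avg p (D.err μ i ω)‖ ^ 2 * (μ ^ 2 * R ω ^ 2) := by gcongr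
    have f6 : μ ^ 4 * ‖G ω‖ ^ 4 ≤ μ ^ 4 * R ω ^ 4 := by gcongr
    refine f1.trans ?_
    linarith
  rw [integral_add ia iS, integral_linear₃ _ _ _ iT iQ iR4] at e1
  have e3 := mul_le_mul_of_nonneg_left hR2' (show 0 ≤ 8 * μ ^ 2 by positivity)
  have e4 := mul_le_mul_of_nonneg_left hR4 (show 0 ≤ 3 * μ ^ 4 by positivity)
  have e5 := mul_le_mul_of_nonneg_left hpull (show 0 ≤ 4 * μ by positivity)
  have e6 : 0 ≤ 5 * μ ^ 4 * (KR * (1 + ∫ ω, ‖avg p (D.err μ i ω)‖ ^ 4 ∂P +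
      ∫ ω, W.V (D.err μ i ω) ^ 4 ∂P)) := by
    have : 0 ≤ ∫ ω, ‖avg p (D.err μ i ω)‖ ^ 4 ∂P := integral_nonneg fun ω => by positivity
    have : 0 ≤ ∫ ω, W.V (D.err μ i ω) ^ 4 ∂P := integral_nonneg fun ω =>
      pow_nonneg (W.nonneg _) 4
    positivity
  linarith

/-- The lower moments in a step of the fourth moment are absorbed by the contraction. -/
lemma integral_sq_mul_le (h : Setting D P μbar) {p : Fin N → ℝ}
    (W : ConsensusGauge M (D.A₁ * D.A₂) p) (hp : IsPerronVector D p) {μ : ℝ}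
    (hμ : μ ∈ Set.Ioo 0 μbar) (i : ℕ) {t : ℝ} (ht : 0 < t) :
    ∫ ω, (‖avg p (D.err μ i ω)‖ ^ 2 *
      (1 + ‖avg p (D.err μ i ω)‖ ^ 2 + W.V (D.err μ i ω) ^ 2)) ∂P ≤
    (t + 2) * ∫ ω, ‖avg p (D.err μ i ω)‖ ^ 4 ∂P + 1 * ∫ ω, W.V (D.err μ i ω) ^ 4 ∂P +
      1 / t * ∫ _ω, (1 : ℝ) ∂P := by
  have hU := growth_avg hp h.net (M := M)
  have hV := W.growth
  have ia : Integrable (fun ω => ‖avg p (D.err μ i ω)‖ ^ 4) P := h.integrable_err hμ i (hU.pow 4)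
  have ib : Integrable (fun ω => W.V (D.err μ i ω) ^ 4) P := h.integrable_err hμ i (hV.pow 4)
  have iF : Integrable (fun ω => ‖avg p (D.err μ i ω)‖ ^ 2 *
      (1 + ‖avg p (D.err μ i ω)‖ ^ 2 + W.V (D.err μ i ω) ^ 2)) P :=
    h.integrable_err hμ i
      ((hU.pow 2).mul (m := 2) (((PolyGrowth.const 1).add (hU.pow 2)).add (hV.pow 2)))
  rw [← integral_linear₃ _ _ _ ia ib (integrable_const (1 : ℝ))]
  refine integral_mono iF (integrable_linear₃ _ _ _ ia ib (integrable_const (1 : ℝ))) fun ω => ?_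
  simp only
  set u := ‖avg p (D.err μ i ω)‖
  set v := W.V (D.err μ i ω)
  have f4 : u ^ 2 ≤ t * u ^ 4 + 1 / t := by
    have : t * u ^ 4 + 1 / t - u ^ 2 = 1 / t * (t * u ^ 2 - 1 / 2) ^ 2 + 3 / 4 * (1 / t) := by
      field_simp; ring
    have h0 : 0 ≤ 1 / t * (t * u ^ 2 - 1 / 2) ^ 2 + 3 / 4 * (1 / t) := by positivity
    linarith
  have f5 : u ^ 2 * v ^ 2 ≤ u ^ 4 + v ^ 4 := by
    nlinarith [sq_nonneg (u ^ 2 - v ^ 2), sq_nonneg (u ^ 2), sq_nonneg (v ^ 2)]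
  linarith

/-- The recursions of the fourth moments of the network average and of the disagreement. -/
lemma exists_fourth_moment_recursion (h : Setting D P μbar) {p : Fin N → ℝ}
    (W : ConsensusGauge M (D.A₁ * D.A₂) p) (hp : IsPerronVector D p) :
    ∃ c K ρ μ₀ : ℝ, 0 < c ∧ 0 ≤ K ∧ 0 ≤ ρ ∧ ρ < 1 ∧ 0 < μ₀ ∧
    ∀ μ ∈ Set.Ioo 0 μbar, μ < μ₀ → ∀ i,
      ∫ ω, ‖avg p (D.err μ (i + 1) ω)‖ ^ 4 ∂P ≤
        (1 - c * μ) * ∫ ω, ‖avg p (D.err μ i ω)‖ ^ 4 ∂P +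
          K * μ * ∫ ω, W.V (D.err μ i ω) ^ 4 ∂P + K * μ ^ 3 ∧
      ∫ ω, W.V (D.err μ (i + 1) ω) ^ 4 ∂P ≤ ρ * ∫ ω, W.V (D.err μ i ω) ^ 4 ∂P +
        K * μ ^ 4 * (1 + ∫ ω, ‖avg p (D.err μ i ω)‖ ^ 4 ∂P) := by
  obtain ⟨Kb, ρ, hKb, hρ0, hρ, hV⟩ := h.exists_gauge_step W hp
  obtain ⟨c, K, L, hc, hK, hL, hU⟩ := h.exists_avg_step W hp
  set Ka := K + 2 * L + 4 * L * (L + 1) / c + L with hKa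
  have hKa0 : 0 ≤ Ka := by positivity
  have h1ρ : 0 < 1 - ρ := sub_pos.2 hρ
  refine ⟨c / 2, Ka + Kb, (1 + ρ) / 2, min 1 (min (c / (12 * L + 1)) ((1 - ρ) / (2 * Kb + 1))),
    by positivity, by positivity, by linarith, by linarith,
    lt_min one_pos (lt_min (by positivity) (by positivity)), fun μ hμ hμ₀ i => ?_⟩
  obtain ⟨m1, hμ₀⟩ := lt_min_iff.1 hμ₀
  obtain ⟨m2, m3⟩ := lt_min_iff.1 hμ₀
  rw [lt_div_iff₀ (by positivity)] at m2 m3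
  have hμ0 : 0 < μ := hμ.1
  have e1 := hU μ hμ i
  have e2 := hV μ hμ i
  -- `L μ² t ≤ c μ / 4` for this `t`, so that the second moment is absorbed by the contraction and
  -- leaves a drive of order `L μ² / t = O(μ³)`
  have e3 := h.integral_sq_mul_le W hp hμ i (t := c / (4 * (L + 1) * μ)) (by positivity)
  simp only [integral_const, probReal_univ, smul_eq_mul, mul_one] at e3
  set a := ∫ ω, ‖avg p (D.err μ i ω)‖ ^ 4 ∂P with ha
  set b := ∫ ω, W.V (D.err μ i ω) ^ 4 ∂P with hbdef
  have ha0 : 0 ≤ a := integral_nonneg fun ω => by positivity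
  have hb0 : 0 ≤ b := integral_nonneg fun ω => pow_nonneg (W.nonneg _) 4
  have h4 : μ ^ 4 ≤ μ := pow_le_of_le_one hμ0.le m1.le (by norm_num)
  have h2 : μ ^ 2 ≤ μ := pow_le_of_le_one hμ0.le m1.le (by norm_num)
  have h43 : μ ^ 4 ≤ μ ^ 3 := pow_le_pow_of_le_one hμ0.le m1.le (by norm_num)
  have h42 : μ ^ 4 ≤ μ ^ 2 := pow_le_pow_of_le_one hμ0.le m1.le (by norm_num)
  constructor
  · have f1 := mul_le_mul_of_nonneg_left e3 (show 0 ≤ L * μ ^ 2 by positivity)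
    have f2 : L * μ ^ 2 * ((c / (4 * (L + 1) * μ) + 2) * a + 1 * b +
        1 / (c / (4 * (L + 1) * μ))) = c / 4 * μ * (L / (L + 1)) * a + 2 * L * μ ^ 2 * a +
        L * μ ^ 2 * b + 4 * L * (L + 1) / c * μ ^ 3 := by field_simp
    rw [f2] at f1
    have f3 : c / 4 * μ * (L / (L + 1)) * a ≤ c / 4 * μ * 1 * a := by
      gcongr
      rw [div_le_one (by positivity)]; linarith
    have f4 : 3 * L * μ ^ 2 * a ≤ c / 4 * μ * a := by
      have := mul_le_mul_of_nonneg_right (show 3 * L * μ ≤ c / 4 by linarith)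
        (mul_nonneg hμ0.le ha0)
      linarith
    have f5 : L * μ ^ 4 * a ≤ L * μ ^ 2 * a := by gcongr
    have f6 : L * μ ^ 2 * b ≤ L * μ * b := by gcongr
    have f7 : L * μ ^ 4 * b ≤ L * μ * b := by gcongr
    have f8 : L * μ ^ 4 ≤ L * μ ^ 3 := by gcongr
    have f9 : 0 ≤ Kb * μ * b + (4 * L * (L + 1) / c + L) * (μ * b) := by positivity
    have f10 : 0 ≤ Kb * μ ^ 3 + (K + 2 * L) * μ ^ 3 := by positivity
    rw [hKa]
    linarith
  · have f1 : Kb * μ ^ 4 * b ≤ (1 - ρ) / 2 * b := by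
      have g1 : Kb * μ ^ 4 ≤ Kb * μ := by gcongr
      have g2 : Kb * μ ^ 4 ≤ (1 - ρ) / 2 := by linarith
      gcongr
    have f2 : 0 ≤ Ka * μ ^ 4 * (1 + a) := by positivity
    linarith

/-- Fourth-order stability: for small step-sizes the fourth moment of the network average settles
at `O(μ²)` and the one of the disagreement at `O(μ⁴)`. -/
lemma exists_fourth_moment_bound (h : Setting D P μbar) {p : Fin N → ℝ}
    (W : ConsensusGauge M (D.A₁ * D.A₂) p) (hp : IsPerronVector D p) :
    ∃ K μ₀ : ℝ, 0 ≤ K ∧ 0 < μ₀ ∧ ∀ μ ∈ Set.Ioo 0 μbar, μ < μ₀ → ∀ᶠ i in atTop,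
      ∫ ω, ‖avg p (D.err μ i ω)‖ ^ 4 ∂P ≤ K * μ ^ 2 ∧
      ∫ ω, W.V (D.err μ i ω) ^ 4 ∂P ≤ K * μ ^ 4 := by
  obtain ⟨c, K, ρ, μ₀, hc, hK, hρ0, hρ, hμ₀, hrec⟩ := h.exists_fourth_moment_recursion W hp
  obtain ⟨K', hK', μ₁, hμ₁, hcoup⟩ := eventually_le_of_coupled hc hK hρ0 hρ
  refine ⟨K', min μ₀ μ₁, hK', lt_min hμ₀ hμ₁, fun μ hμ hlt => ?_⟩
  obtain ⟨m1, m2⟩ := lt_min_iff.1 hlt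
  exact hcoup μ ⟨hμ.1, m2⟩ (fun i => ∫ ω, ‖avg p (D.err μ i ω)‖ ^ 4 ∂P)
    (fun i => ∫ ω, W.V (D.err μ i ω) ^ 4 ∂P) (fun i => integral_nonneg fun ω => by positivity)
    (fun i => integral_nonneg fun ω => pow_nonneg (W.nonneg _) 4)
    (fun i => (hrec μ hμ m1 i).1) (fun i => (hrec μ hμ m1 i).2)

end Setting

end FourthMoments

end CoordDiffusion

namespace CoordDiffusion

/-! ### Steady-state limits -/

section Steady

/-- `V μ i` is close to `L` once `μ` is small and then `i` is large. -/
def SteadyLimit (V : ℝ → ℕ → ℝ) (L : ℝ) : Prop :=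
  ∀ η : ℝ, 0 < η → ∀ᶠ μ in 𝓝[>] (0 : ℝ), ∀ᶠ i in atTop, |V μ i - L| ≤ η

namespace SteadyLimit

variable {V W : ℝ → ℕ → ℝ} {L L' : ℝ}

lemma congr (hV : SteadyLimit V L) (h : ∀ᶠ μ in 𝓝[>] (0 : ℝ), ∀ᶠ i in atTop, W μ i = V μ i) :
    SteadyLimit W L := fun η hη => by
  filter_upwards [hV η hη, h] with μ h1 h2
  filter_upwards [h1, h2] with i h3 h4
  rwa [h4]

lemma add (hV : SteadyLimit V L) (hW : SteadyLimit W L') :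
    SteadyLimit (fun μ i => V μ i + W μ i) (L + L') := fun η hη => by
  filter_upwards [hV (η / 2) (by positivity), hW (η / 2) (by positivity)] with μ h1 h2
  filter_upwards [h1, h2] with i h3 h4
  rw [add_sub_add_comm]
  exact (abs_add_le _ _).trans (by linarith)

lemma const (c : ℝ) : SteadyLimit (fun _ _ => c) c := fun η hη => by simp [hη.le]

lemma const_mul (c : ℝ) (hV : SteadyLimit V L) : SteadyLimit (fun μ i => c * V μ i) (c * L) :=
  fun η hη => by
  filter_upwards [hV (η / (|c| + 1)) (by positivity)] with μ h1
  filter_upwards [h1] with i h3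
  rw [← mul_sub, abs_mul]
  rw [le_div_iff₀ (by positivity)] at h3
  nlinarith [abs_nonneg c, abs_nonneg (V μ i - L)]

lemma sum {ι : Type*} (s : Finset ι) {V : ι → ℝ → ℕ → ℝ} {L : ι → ℝ}
    (hV : ∀ j ∈ s, SteadyLimit (V j) (L j)) :
    SteadyLimit (fun μ i => ∑ j ∈ s, V j μ i) (∑ j ∈ s, L j) := by
  classical
  induction s using Finset.induction_on with
  | empty => simpa using const 0
  | insert a s ha ih =>
    simp only [Finset.sum_insert ha]
    exact (hV a (Finset.mem_insert_self _ _)).add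
      (ih fun i hi => hV i (Finset.mem_insert_of_mem hi))

lemma of_abs_le (hW : SteadyLimit W 0)
    (h : ∀ᶠ μ in 𝓝[>] (0 : ℝ), ∀ᶠ i in atTop, |V μ i - L| ≤ W μ i) : SteadyLimit V L :=
  fun η hη => by
  filter_upwards [hW η hη, h] with μ h1 h2
  filter_upwards [h1, h2] with i h3 h4
  rw [sub_zero] at h3
  exact h4.trans ((le_abs_self _).trans h3)

/-- It is enough to bound a nonnegative quantity by `C η + K_η μ` for every `η`. -/
lemma of_le_add {V : ℝ → ℕ → ℝ} (C : ℝ) (hV : ∀ μ i, 0 < μ → 0 ≤ V μ i)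
    (h : ∀ η : ℝ, 0 < η → ∃ K : ℝ, ∀ᶠ μ in 𝓝[>] (0 : ℝ), ∀ᶠ i in atTop,
      V μ i ≤ C * η + K * μ) : SteadyLimit V 0 := by
  intro η hη
  obtain ⟨K, hK⟩ := h (η / (2 * (|C| + 1))) (by positivity)
  have h1 : ∀ᶠ μ in 𝓝[>] (0 : ℝ), μ ∈ Set.Ioo 0 (η / (2 * (|K| + 1))) :=
    Ioo_mem_nhdsGT (by positivity)
  filter_upwards [hK, h1] with μ hμ hμ1
  filter_upwards [hμ] with i hi
  rw [sub_zero, abs_of_nonneg (hV μ i hμ1.1)]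
  refine hi.trans ?_
  have e1 : C * (η / (2 * (|C| + 1))) ≤ η / 2 := by
    have : C * (η / (2 * (|C| + 1))) ≤ (|C| + 1) * (η / (2 * (|C| + 1))) := by
      have := le_abs_self C
      gcongr
      linarith
    refine this.trans (le_of_eq ?_)
    field_simp
  have e2 : K * μ ≤ η / 2 := by
    have h3 : K * μ ≤ (|K| + 1) * (η / (2 * (|K| + 1))) := by
      have := le_abs_self K
      exact mul_le_mul (by linarith) hμ1.2.le hμ1.1.le (by positivity)
    refine h3.trans (le_of_eq ?_)
    field_simp
  linarith

/-- The steady state of a scalar linear recursion with rate `1 - μ Λ` and drive `μ² (k + o(1))`. -/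
lemma of_recursion {f e : ℝ → ℕ → ℝ} {Λ k : ℝ} (hΛ : 0 < Λ) (he : SteadyLimit e 0)
    (hf : ∀ᶠ μ in 𝓝[>] (0 : ℝ), ∀ i, f μ (i + 1) = (1 - μ * Λ) * f μ i + μ ^ 2 * (k + e μ i)) :
    SteadyLimit (fun μ i => 1 / μ * f μ i) (k / Λ) := by
  intro η hη
  have h1 : ∀ᶠ μ in 𝓝[>] (0 : ℝ), μ ∈ Set.Ioo 0 (1 / Λ) := Ioo_mem_nhdsGT (by positivity)
  filter_upwards [he (η * Λ / 2) (by positivity), hf, h1] with μ h2 h3 ⟨hμ, hμ1⟩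
  rw [lt_div_iff₀ hΛ] at hμ1
  have h4 : ∀ᶠ i in atTop, |f μ (i + 1) - μ * (k / Λ)| ≤
      (1 - μ * Λ) * |f μ i - μ * (k / Λ)| + μ ^ 2 * (η * Λ / 2) := by
    filter_upwards [h2] with i hi
    rw [sub_zero] at hi
    have : f μ (i + 1) - μ * (k / Λ) = (1 - μ * Λ) * (f μ i - μ * (k / Λ)) + μ ^ 2 * e μ i := by
      rw [h3]; field_simp; ring
    rw [this]
    refine (abs_add_le _ _).trans ?_
    rw [abs_mul, abs_mul, abs_of_nonneg (show 0 ≤ 1 - μ * Λ by linarith),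
      abs_of_nonneg (sq_nonneg μ)]
    gcongr
  have h5 := eventually_le_of_recursion (a := fun i => |f μ i - μ * (k / Λ)|)
    (show 0 ≤ 1 - μ * Λ by linarith) (by nlinarith) (show 0 < μ * η / 2 by positivity) h4
  filter_upwards [h5] with i hi
  have e1 : 1 / μ * f μ i - k / Λ = 1 / μ * (f μ i - μ * (k / Λ)) := by field_simp
  have e2 : μ ^ 2 * (η * Λ / 2) / (1 - (1 - μ * Λ)) + μ * η / 2 = μ * η := by
    field_simp; ring
  rw [e2] at hi
  rw [e1, abs_mul, abs_of_pos (by positivity)]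
  calc _ ≤ 1 / μ * (μ * η) := by gcongr
    _ = η := by field_simp

/-- The iterated limit in the definition of the performance measures. -/
lemma tendsto_limsup (hV : SteadyLimit V L) :
    Tendsto (fun μ : ℝ => limsup (fun i : ℕ => ((V μ i : ℝ) : EReal)) atTop)
      (𝓝[>] 0) (𝓝 (L : EReal)) := by
  refine tendsto_order.2 ⟨fun a ha => ?_, fun a ha => ?_⟩
  · obtain ⟨q, hq1, hq2⟩ := EReal.lt_iff_exists_real_btwn.1 ha
    rw [EReal.coe_lt_coe_iff] at hq2
    filter_upwards [hV (L - q) (by linarith)] with μ hμ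
    refine hq1.trans_le (le_limsup_of_frequently_le (Eventually.frequently ?_))
    filter_upwards [hμ] with i hi
    rw [EReal.coe_le_coe_iff]
    linarith [(abs_le.1 hi).1]
  · obtain ⟨q, hq1, hq2⟩ := EReal.lt_iff_exists_real_btwn.1 ha
    rw [EReal.coe_lt_coe_iff] at hq1
    filter_upwards [hV (q - L) (by linarith)] with μ hμ
    refine (limsup_le_of_le (by isBoundedDefault) ?_).trans_lt hq2
    filter_upwards [hμ] with i hi
    rw [EReal.coe_le_coe_iff]
    linarith [(abs_le.1 hi).2]

end SteadyLimit

end Steady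

section SecondOrder

open scoped InnerProductSpace

variable {N M : ℕ} {Ω : Type*} [MeasurableSpace Ω]

namespace Setting

variable {D : Model N M Ω} {P : Measure Ω} {μbar : ℝ} [IsProbabilityMeasure P]

/-- Sizes of the moments in the steady state. -/
lemma exists_moment_bounds (h : Setting D P μbar) (hμbar : 0 < μbar) {p : Fin N → ℝ}
    (W : ConsensusGauge M (D.A₁ * D.A₂) p) (hp : IsPerronVector D p) :
    ∃ K : ℝ, 0 ≤ K ∧ ∀ᶠ μ in 𝓝[>] (0 : ℝ), μ ∈ Set.Ioo 0 μbar ∧ μ < 1 ∧ ∀ᶠ i in atTop,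
      ∫ ω, ‖avg p (D.err μ i ω)‖ ^ 4 ∂P ≤ K * μ ^ 2 ∧
      ∫ ω, W.V (D.err μ i ω) ^ 4 ∂P ≤ K * μ ^ 4 ∧
      ∫ ω, ‖avg p (D.err μ i ω)‖ ^ 2 ∂P ≤ K * μ ∧
      ∫ ω, W.V (D.err μ i ω) ^ 2 ∂P ≤ K * μ ^ 2 := by
  obtain ⟨K, μ₀, hK, hμ₀, hbd⟩ := h.exists_fourth_moment_bound W hp
  refine ⟨K + 1, by positivity, ?_⟩
  have h1 : ∀ᶠ μ in 𝓝[>] (0 : ℝ), μ ∈ Set.Ioo 0 (min μbar (min μ₀ 1)) :=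
    Ioo_mem_nhdsGT (by positivity)
  filter_upwards [h1] with μ hμ
  obtain ⟨m0, hm⟩ := hμ
  obtain ⟨m1, hm⟩ := lt_min_iff.1 hm
  obtain ⟨m2, m3⟩ := lt_min_iff.1 hm
  have hμ : μ ∈ Set.Ioo 0 μbar := ⟨m0, m1⟩
  refine ⟨hμ, m3, ?_⟩
  have hU := growth_avg hp h.net (M := M)
  have hV := W.growth
  -- `z² ≤ (t + t⁻¹ z⁴) / 2`, so that the fourth moment controls the second one
  have key : ∀ (i : ℕ) (F : (Fin N → Vec M) → ℝ), PolyGrowth 1 F → ∀ t : ℝ, 0 < t →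
      ∫ ω, F (D.err μ i ω) ^ 4 ∂P ≤ K * t ^ 2 → ∫ ω, F (D.err μ i ω) ^ 2 ∂P ≤ (K + 1) * t := by
    intro i F hF t ht hle
    have i4 := h.integrable_err hμ i (hF.pow 4)
    have i2 := h.integrable_err hμ i ((hF.pow 2).mono (by norm_num))
    have e1 : ∫ ω, F (D.err μ i ω) ^ 2 ∂P ≤ ∫ ω, (1 / t * F (D.err μ i ω) ^ 4 + t) ∂P := by
      refine integral_mono i2 ((i4.const_mul _).add (integrable_const t)) fun ω => ?_
      simp only
      set z := F (D.err μ i ω)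
      have : 1 / t * z ^ 4 + t - z ^ 2 = 1 / t * ((z ^ 2 - t / 2) ^ 2 + 3 / 4 * t ^ 2) := by
        field_simp; ring
      have h0 : 0 ≤ 1 / t * ((z ^ 2 - t / 2) ^ 2 + 3 / 4 * t ^ 2) := by positivity
      linarith
    rw [integral_add (i4.const_mul _) (integrable_const t), integral_const_mul] at e1
    simp only [integral_const, probReal_univ, smul_eq_mul, one_mul] at e1
    have e2 : 1 / t * ∫ ω, F (D.err μ i ω) ^ 4 ∂P ≤ 1 / t * (K * t ^ 2) := by gcongr
    have e3 : 1 / t * (K * t ^ 2) = K * t := by field_simp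
    linarith
  filter_upwards [hbd μ hμ m2] with i hi
  refine ⟨hi.1.trans ?_, hi.2.trans ?_, key i _ hU μ m0 hi.1, key i _ hV (μ ^ 2) (by positivity) ?_⟩
  · have : 0 ≤ μ ^ 2 := by positivity
    nlinarith
  · have : 0 ≤ μ ^ 4 := by positivity
    nlinarith
  · rw [← pow_mul]; exact hi.2

/-- `E ‖x̄‖ (v + (‖x̄‖ + v)²) = o(μ)`, where `v` is the disagreement. -/
lemma steady_cross (h : Setting D P μbar) (hμbar : 0 < μbar) {p : Fin N → ℝ}
    (W : ConsensusGauge M (D.A₁ * D.A₂) p) (hp : IsPerronVector D p) :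
    SteadyLimit (fun μ i => 1 / μ * ∫ ω, (‖avg p (D.err μ i ω)‖ + W.V (D.err μ i ω)) *
      (W.V (D.err μ i ω) + (‖avg p (D.err μ i ω)‖ + W.V (D.err μ i ω)) ^ 2) ∂P) 0 := by
  obtain ⟨K, hK, hbd⟩ := h.exists_moment_bounds hμbar W hp
  have hU := growth_avg hp h.net (M := M)
  have hV := W.growth
  have hUV := hU.add hV
  refine SteadyLimit.of_le_add (4 * K) (fun μ i hμ => ?_) fun η hη => ?_
  · refine mul_nonneg (by positivity) (integral_nonneg fun ω => ?_)
    have := W.nonneg (D.err μ i ω)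
    positivity
  refine ⟨4 * K * η + (1 / η * K + 16 / η * K), ?_⟩
  filter_upwards [hbd] with μ ⟨hμ, hμ1, hμi⟩
  filter_upwards [hμi] with i hi
  obtain ⟨a4, b4, a2, b2⟩ := hi
  have hμ0 := hμ.1
  have iF : Integrable (fun ω => (‖avg p (D.err μ i ω)‖ + W.V (D.err μ i ω)) *
      (W.V (D.err μ i ω) + (‖avg p (D.err μ i ω)‖ + W.V (D.err μ i ω)) ^ 2)) P :=
    h.integrable_err hμ i ((hUV.mul ((hV.mono (by norm_num)).add (hUV.pow 2))).mono (by norm_num))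
  have i4 := h.integrable_err hμ i (hU.pow 4)
  have j4 := h.integrable_err hμ i (hV.pow 4)
  have i2 := h.integrable_err hμ i ((hU.pow 2).mono (by norm_num : 1 * 2 ≤ 4))
  have j2 := h.integrable_err hμ i ((hV.pow 2).mono (by norm_num : 1 * 2 ≤ 4))
  have s1 := integrable_linear₃ (4 * η) (4 * η) (1 / η) i2 j2 j2
  have s2 := integrable_linear₃ (8 / η) (8 / η) 0 i4 j4 j4
  have e1 : ∫ ω, (‖avg p (D.err μ i ω)‖ + W.V (D.err μ i ω)) *
      (W.V (D.err μ i ω) + (‖avg p (D.err μ i ω)‖ + W.V (D.err μ i ω)) ^ 2) ∂P ≤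
      ∫ ω, ((4 * η * ‖avg p (D.err μ i ω)‖ ^ 2 + 4 * η * W.V (D.err μ i ω) ^ 2 +
        1 / η * W.V (D.err μ i ω) ^ 2) + (8 / η * ‖avg p (D.err μ i ω)‖ ^ 4 +
        8 / η * W.V (D.err μ i ω) ^ 4 + 0 * W.V (D.err μ i ω) ^ 4)) ∂P := by
    refine integral_mono iF (s1.add s2) fun ω => ?_
    simp only
    set u := ‖avg p (D.err μ i ω)‖
    set v := W.V (D.err μ i ω)
    set t := u + v with ht
    have t2 : t ^ 2 ≤ 2 * (u ^ 2 + v ^ 2) := by rw [ht]; nlinarith [sq_nonneg (u - v)]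
    have t4 : t ^ 4 ≤ 8 * (u ^ 4 + v ^ 4) := by
      calc t ^ 4 = (t ^ 2) ^ 2 := by ring
        _ ≤ (2 * (u ^ 2 + v ^ 2)) ^ 2 := by gcongr
        _ ≤ _ := by nlinarith [sq_nonneg (u ^ 2 - v ^ 2)]
    have f1 : t * v ≤ η * t ^ 2 + 1 / η * v ^ 2 := by
      have : η * t ^ 2 + 1 / η * v ^ 2 - t * v =
        1 / η * ((η * t - v / 2) ^ 2 + 3 / 4 * v ^ 2) := by field_simp; ring
      have h0 : 0 ≤ 1 / η * ((η * t - v / 2) ^ 2 + 3 / 4 * v ^ 2) := by positivity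
      linarith
    have f2 : t * t ^ 2 ≤ η * t ^ 2 + 1 / η * t ^ 4 := by
      have : η * t ^ 2 + 1 / η * t ^ 4 - t * t ^ 2 =
        1 / η * t ^ 2 * ((η - t / 2) ^ 2 + 3 / 4 * t ^ 2) := by field_simp; ring
      have h0 : 0 ≤ 1 / η * t ^ 2 * ((η - t / 2) ^ 2 + 3 / 4 * t ^ 2) := by positivity
      linarith
    have f3 : η * t ^ 2 ≤ η * (2 * (u ^ 2 + v ^ 2)) := by gcongr
    have f4 : 1 / η * t ^ 4 ≤ 1 / η * (8 * (u ^ 4 + v ^ 4)) := by gcongr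
    have f5 : 1 / η * (8 * (u ^ 4 + v ^ 4)) = 8 / η * u ^ 4 + 8 / η * v ^ 4 := by ring
    linarith
  rw [integral_add s1 s2, integral_linear₃ _ _ _ i2 j2 j2, integral_linear₃ _ _ _ i4 j4 j4] at e1
  have g1 : 4 * η * ∫ ω, ‖avg p (D.err μ i ω)‖ ^ 2 ∂P ≤ 4 * η * (K * μ) := by gcongr
  have g2 : 4 * η * ∫ ω, W.V (D.err μ i ω) ^ 2 ∂P ≤ 4 * η * (K * μ ^ 2) := by gcongr
  have g3 : 1 / η * ∫ ω, W.V (D.err μ i ω) ^ 2 ∂P ≤ 1 / η * (K * μ ^ 2) := by gcongr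
  have g4 : 8 / η * ∫ ω, ‖avg p (D.err μ i ω)‖ ^ 4 ∂P ≤ 8 / η * (K * μ ^ 2) := by gcongr
  have g5 : 8 / η * ∫ ω, W.V (D.err μ i ω) ^ 4 ∂P ≤ 8 / η * (K * μ ^ 2) := by
    have : μ ^ 4 ≤ μ ^ 2 := pow_le_pow_of_le_one hμ0.le hμ1.le (by norm_num)
    have : K * μ ^ 4 ≤ K * μ ^ 2 := by gcongr
    have := b4.trans this
    gcongr
  have e2 := mul_le_mul_of_nonneg_left e1 (show 0 ≤ 1 / μ by positivity)
  refine e2.trans ?_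
  have g6 : 1 / μ * (4 * η * (K * μ) + 4 * η * (K * μ ^ 2) + 1 / η * (K * μ ^ 2) +
      (8 / η * (K * μ ^ 2) + 8 / η * (K * μ ^ 2))) =
      4 * K * η + (4 * K * η + (1 / η * K + 16 / η * K)) * μ := by field_simp; ring
  rw [← g6]
  gcongr 1 / μ * ?_
  linarith

end Setting

end SecondOrder

end CoordDiffusion

namespace CoordDiffusion

/-! ### The covariance of the gradient noise in the steady state -/

section NoiseCovariance

variable {N M : ℕ} {Ω : Type*}

lemma abs_entry_le_specNorm (A : Matrix (Fin M) (Fin M) ℝ) (a b : Fin M) :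
    |A a b| ≤ specNorm A := by
  have h1 : op A (EuclideanSpace.single b 1) a = A a b := by simp [op_apply]
  rw [← h1]
  refine (abs_coord_le _ a).trans (((op A).le_opNorm _).trans (le_of_eq ?_))
  simp [specNorm]

/-- The covariances of the stacked gradient noises at the minimizer, in the limit. -/
def stackedCov (G : Fin N → Matrix (Fin M) (Fin M) ℝ) (x y : Fin N × Fin M) : ℝ :=
  if x.1 = y.1 then G x.1 x.2 y.2 else 0

variable [MeasurableSpace Ω]

namespace Setting

variable {D : Model N M Ω} {P : Measure Ω} {μbar : ℝ} [IsProbabilityMeasure P]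

/-- The entries of a conditional covariance are bounded by the conditional second moment of the
norm. -/
lemma exists_noiseCov_bound (h : Setting D P μbar) : ∃ K : ℝ, 0 ≤ K ∧
    ∀ μ ∈ Set.Ioo 0 μbar, ∀ k i v, IsIterate D P μ i v → ∀ a b, ∀ᵐ ω ∂P,
      |D.noiseCov P μ k i v ω a b| ≤ K * (1 + ‖v ω‖ ^ 2) := by
  obtain ⟨K, hK, hbd⟩ := h.exists_noise_bound
  obtain ⟨β, σ, -, -, hs⟩ := h.noise.fourth_moment
  refine ⟨K, hK, fun μ hμ k i v hv a b => ?_⟩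
  have hm2 : MemLp (fun ω => D.noise k i ω (v ω)) 2 P :=
    (hs μ hμ k i v hv).1.mono_exponent (by norm_num)
  have hc : ∀ a, MemLp (fun ω => D.noise k i ω (v ω) a) 2 P := fun a =>
    (EuclideanSpace.proj (𝕜 := ℝ) a).comp_memLp' hm2
  have hint : Integrable (fun ω => D.noise k i ω (v ω) a * D.noise k i ω (v ω) b) P :=
    (hc a).integrable_mul (hc b)
  have hint2 : Integrable (fun ω => ‖D.noise k i ω (v ω)‖ ^ 2) P :=
    hm2.integrable_norm_pow two_ne_zero
  have hle : ∀ ω, |D.noise k i ω (v ω) a * D.noise k i ω (v ω) b| ≤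
      ‖D.noise k i ω (v ω)‖ ^ 2 := fun ω => by
    rw [abs_mul, sq]
    exact mul_le_mul (abs_coord_le _ a) (abs_coord_le _ b) (abs_nonneg _) (norm_nonneg _)
  have h1 := condExp_mono (m := D.past μ i) hint hint2
    (Eventually.of_forall fun ω => (le_abs_self _).trans (hle ω))
  have h2 := condExp_mono (m := D.past μ i) hint2.neg hint
    (Eventually.of_forall fun ω => (abs_le.1 (hle ω)).1)
  have h3 := condExp_neg (μ := P) (fun ω => ‖D.noise k i ω (v ω)‖ ^ 2) (D.past μ i)
  filter_upwards [(hbd μ hμ k i v hv).1, h1, h2, h3] with ω e0 e1 e2 e3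
  rw [e3] at e2
  exact (abs_le.2 ⟨e2, e1⟩).trans e0

lemma isIterate_wo (D : Model N M Ω) (P : Measure Ω) [IsProbabilityMeasure P] (μ : ℝ) (i : ℕ) :
    IsIterate D P μ i (fun _ => D.wo) := ⟨measurable_const, memLp_const _⟩

/-- The almost sure limit of the covariances at the minimizer is also a limit in the mean, by
dominated convergence. -/
lemma tendsto_integral_noiseCov (h : Setting D P μbar) {G : Fin N → Matrix (Fin M) (Fin M) ℝ}
    (hG : IsLimitCov D P μbar G) {μ : ℝ} (hμ : μ ∈ Set.Ioo 0 μbar) (k : Fin N) (a b : Fin M) :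
    Tendsto (fun i => ∫ ω, D.noiseCov P μ k i (fun _ => D.wo) ω a b ∂P) atTop (𝓝 (G k a b)) := by
  obtain ⟨K, hK, hbd⟩ := h.exists_noiseCov_bound
  have : ∫ _ω, G k a b ∂P = G k a b := by simp
  rw [← this]
  refine tendsto_integral_of_dominated_convergence (fun _ => K * (1 + ‖D.wo‖ ^ 2))
    (fun i => ?_) (integrable_const _) (fun i => ?_) ?_
  · exact (integrable_condExp (m := D.past μ i)).aestronglyMeasurable
  · exact hbd μ hμ k i _ (isIterate_wo D P μ i) a b
  · filter_upwards [hG μ hμ k] with ω hω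
    exact (tendsto_pi_nhds.1 ((tendsto_pi_nhds.1 hω) a)) b

/-- Away from the minimizer the covariance of the noise differs from the one at the minimizer by at
most `η` plus a multiple of the squared distance. -/
lemma exists_noiseCov_sub_le (h : Setting D P μbar) {η : ℝ} (hη : 0 < η) : ∃ K : ℝ, 0 ≤ K ∧
    ∀ μ ∈ Set.Ioo 0 μbar, ∀ k i v, IsIterate D P μ i v → ∀ a b, ∀ᵐ ω ∂P,
      |D.noiseCov P μ k i v ω a b - D.noiseCov P μ k i (fun _ => D.wo) ω a b| ≤
        η + K * ‖v ω - D.wo‖ ^ 2 := by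
  obtain ⟨K, hK, hbd⟩ := h.exists_noiseCov_bound
  obtain ⟨ε, κ, γ, hε, hκ, hγ, -, hcov⟩ := h.smooth.cov
  -- up to the distance `ε'` the Hölder bound is at most `η`; beyond it `1 ≤ ‖v - w°‖² / ε'²`
  set ε' := min ε ((η / (κ + 1)) ^ (1 / γ)) with hε'
  have hε'0 : 0 < ε' := lt_min hε (by positivity)
  have hε'γ : κ * ε' ^ γ ≤ η := by
    have h1 : ε' ^ γ ≤ η / (κ + 1) := by
      calc ε' ^ γ ≤ ((η / (κ + 1)) ^ (1 / γ)) ^ γ :=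
            Real.rpow_le_rpow hε'0.le (min_le_right _ _) hγ.le
        _ = η / (κ + 1) := by
            rw [← Real.rpow_mul (by positivity), one_div_mul_cancel hγ.ne', Real.rpow_one]
    calc κ * ε' ^ γ ≤ (κ + 1) * (η / (κ + 1)) := by gcongr; linarith
      _ = η := by field_simp
  refine ⟨K * (2 + 3 * ‖D.wo‖ ^ 2) / ε' ^ 2 + 2 * K, by positivity,
    fun μ hμ k i v hv a b => ?_⟩
  filter_upwards [hbd μ hμ k i v hv a b, hbd μ hμ k i _ (isIterate_wo D P μ i) a b,
    hcov μ hμ k i v hv] with ω e1 e2 e3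
  rcases le_or_gt ‖v ω - D.wo‖ ε' with hle | hgt
  · have e4 := e3 (hle.trans (min_le_left _ _))
    have e5 := abs_entry_le_specNorm
      (D.noiseCov P μ k i v ω - D.noiseCov P μ k i (fun _ => D.wo) ω) a b
    rw [Matrix.sub_apply] at e5
    have e6 : κ * ‖v ω - D.wo‖ ^ γ ≤ κ * ε' ^ γ := by gcongr
    have : 0 ≤ (K * (2 + 3 * ‖D.wo‖ ^ 2) / ε' ^ 2 + 2 * K) * ‖v ω - D.wo‖ ^ 2 := by positivity
    linarith
  · set d := ‖v ω - D.wo‖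
    set w := ‖D.wo‖
    have e4 : ‖v ω‖ ^ 2 ≤ 2 * d ^ 2 + 2 * w ^ 2 := by
      have : ‖v ω‖ ≤ d + w := norm_le_norm_sub_add (v ω) D.wo
      nlinarith [norm_nonneg (v ω), sq_nonneg (d - w)]
    have e5 : 1 ≤ d ^ 2 / ε' ^ 2 := by
      rw [one_le_div (by positivity)]; gcongr
    have e6 := abs_sub (D.noiseCov P μ k i v ω a b) (D.noiseCov P μ k i (fun _ => D.wo) ω a b)
    have e7 : K * (2 + 3 * w ^ 2) * 1 ≤ K * (2 + 3 * w ^ 2) * (d ^ 2 / ε' ^ 2) := by gcongr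
    have e8 : K * ‖v ω‖ ^ 2 ≤ K * (2 * d ^ 2 + 2 * w ^ 2) := by gcongr
    calc _ ≤ _ := e6
      _ ≤ K * (1 + ‖v ω‖ ^ 2) + K * (1 + w ^ 2) := add_le_add e1 e2
      _ ≤ K * (2 + 3 * w ^ 2) * (d ^ 2 / ε' ^ 2) + 2 * K * d ^ 2 := by linarith
      _ = (K * (2 + 3 * w ^ 2) / ε' ^ 2 + 2 * K) * d ^ 2 := by ring
      _ ≤ _ := by linarith

/-- The covariances of the gradient noises settle at their limits at the minimizer. -/
lemma steady_noise_mul (h : Setting D P μbar) (hμbar : 0 < μbar) {p : Fin N → ℝ}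
    (W : ConsensusGauge M (D.A₁ * D.A₂) p) (hp : IsPerronVector D p)
    {G : Fin N → Matrix (Fin M) (Fin M) ℝ} (hG : IsLimitCov D P μbar G) (x y : Fin N × Fin M) :
    SteadyLimit (fun μ i => ∫ ω, D.noiseAt μ i ω x.1 x.2 * D.noiseAt μ i ω y.1 y.2 ∂P)
      (stackedCov G x y) := by
  obtain ⟨k, a⟩ := x
  obtain ⟨l, b⟩ := y
  have hev : ∀ᶠ μ in 𝓝[>] (0 : ℝ), μ ∈ Set.Ioo 0 μbar := Ioo_mem_nhdsGT hμbar
  rcases ne_or_eq k l with hkl | rfl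
  · rw [stackedCov, if_neg hkl]
    refine (SteadyLimit.const 0).congr ?_
    filter_upwards [hev] with μ hμ
    refine Eventually.of_forall fun i => ?_
    rw [← integral_condExp (h.past_le μ i)]
    exact (integral_congr_ae (h.noise.uncorrelated μ hμ k l i _ _ hkl (h.isIterate hμ i k)
      (h.isIterate hμ i l) a b)).trans (integral_zero Ω ℝ)
  rw [stackedCov, if_pos rfl]
  have h1 : SteadyLimit (fun μ i => ∫ ω, D.noiseCov P μ k i (fun _ => D.wo) ω a b ∂P)
      (G k a b) := fun η hη => by
    filter_upwards [hev] with μ hμ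
    filter_upwards [(h.tendsto_integral_noiseCov hG hμ k a b).eventually
      (Metric.closedBall_mem_nhds _ hη)] with i hi
    exact hi
  have h2 : SteadyLimit (fun μ i => |∫ ω, (D.noiseCov P μ k i (D.combine (D.iter μ i) k) ω a b -
      D.noiseCov P μ k i (fun _ => D.wo) ω a b) ∂P|) 0 := by
    obtain ⟨K, hK, hbd⟩ := h.exists_moment_bounds hμbar W hp
    refine SteadyLimit.of_le_add 1 (fun μ i _ => abs_nonneg _) fun η hη => ?_
    obtain ⟨C, hC, hle⟩ := h.exists_noiseCov_sub_le hη
    refine ⟨4 * C * K, ?_⟩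
    filter_upwards [hbd] with μ ⟨hμ, hμ1, hμi⟩
    filter_upwards [hμi] with i ⟨_, _, a2, b2⟩
    have i2 := h.integrable_err hμ i (((growth_avg hp h.net (M := M)).pow 2).mono
      (by norm_num : 1 * 2 ≤ 4))
    have j2 := h.integrable_err hμ i ((W.growth.pow 2).mono (by norm_num : 1 * 2 ≤ 4))
    have e1 := integral_linear₃ η (2 * C) (2 * C) (integrable_const (1 : ℝ)) i2 j2
    simp only [integral_const, probReal_univ, smul_eq_mul, mul_one] at e1
    refine (abs_integral_le_integral_abs).trans ?_
    have e2 : ∫ ω, |D.noiseCov P μ k i (D.combine (D.iter μ i) k) ω a b -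
        D.noiseCov P μ k i (fun _ => D.wo) ω a b| ∂P ≤ ∫ ω, (η + 2 * C *
        ‖avg p (D.err μ i ω)‖ ^ 2 + 2 * C * W.V (D.err μ i ω) ^ 2) ∂P := by
      refine integral_mono_ae (Integrable.abs (integrable_condExp.sub integrable_condExp))
        (by simpa using integrable_linear₃ η (2 * C) (2 * C) (integrable_const (1 : ℝ)) i2 j2) ?_
      filter_upwards [hle μ hμ k i _ (h.isIterate hμ i k) a b] with ω e3
      refine e3.trans ?_
      have e4 : ‖D.combine (D.iter μ i) k ω - D.wo‖ ≤
          ‖avg p (D.err μ i ω)‖ + W.V (D.err μ i ω) := by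
        rw [D.combine_eq h.net.A₁_stoch, sub_sub_cancel_left, norm_neg]
        exact W.mix_le h.net.A₁_stoch _ k
      have e5 : ‖D.combine (D.iter μ i) k ω - D.wo‖ ^ 2 ≤
          2 * ‖avg p (D.err μ i ω)‖ ^ 2 + 2 * W.V (D.err μ i ω) ^ 2 := by
        refine (pow_le_pow_left₀ (norm_nonneg _) e4 2).trans ?_
        nlinarith [sq_nonneg (‖avg p (D.err μ i ω)‖ - W.V (D.err μ i ω))]
      have := mul_le_mul_of_nonneg_left e5 hC
      linarith
    rw [e1] at e2
    have e6 : K * μ ^ 2 ≤ K * μ := by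
      have : μ ^ 2 ≤ μ := pow_le_of_le_one hμ.1.le hμ1.le (by norm_num)
      gcongr
    have e7 := mul_le_mul_of_nonneg_left a2 (show 0 ≤ 2 * C by positivity)
    have e8 := mul_le_mul_of_nonneg_left (b2.trans e6) (show 0 ≤ 2 * C by positivity)
    linarith
  have h3 : SteadyLimit (fun μ i => ∫ ω, (D.noiseCov P μ k i (D.combine (D.iter μ i) k) ω a b -
      D.noiseCov P μ k i (fun _ => D.wo) ω a b) ∂P) 0 :=
    h2.of_abs_le (Eventually.of_forall fun μ => Eventually.of_forall fun i => by rw [sub_zero])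
  rw [← zero_add (G k a b)]
  refine (h3.add h1).congr (Eventually.of_forall fun μ => Eventually.of_forall fun i => ?_)
  have e1 : ∀ v, Integrable (fun ω => D.noiseCov P μ k i v ω a b) P := fun v => integrable_condExp
  rw [integral_sub (e1 _) (e1 _), sub_add_cancel]
  exact (integral_condExp (h.past_le μ i)).symm

end Setting

end NoiseCovariance

end CoordDiffusion

namespace CoordDiffusion

/-! ### Second moments of the network average in the steady state -/

section SecondMoments

open scoped InnerProductSpace

variable {N M : ℕ} {Ω : Type*}

namespace Model

/-- The matrix `S` per unit of the largest step-size. -/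
noncomputable def Shat (D : Model N M Ω) (p : Fin N → ℝ) : Matrix (Fin M) (Fin M) ℝ :=
  ∑ k, (D.qhat p k * (1 - D.r k)) • D.H k

/-- The masked noise covariance `∑ q_k² G'_k` per squared unit of the largest step-size. -/
noncomputable def Khat (D : Model N M Ω) (p : Fin N → ℝ)
    (G : Fin N → Matrix (Fin M) (Fin M) ℝ) : Matrix (Fin M) (Fin M) ℝ :=
  ∑ k, D.qhat p k ^ 2 • Matrix.of fun a b => D.maskCorr (k, a) (k, b) * G k a b

/-- The direction in which iteration `i` moves the network average. -/
noncomputable def push (D : Model N M Ω) (p : Fin N → ℝ) (μ : ℝ) (i : ℕ) (ω : Ω) : Vec M :=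
  ∑ l, D.qhat p l • hmul (D.maskAt i ω l) (D.descent (D.err μ i ω) (D.noiseAt μ i ω) l)

lemma avg_err_succ (D : Model N M Ω) (hnet : NetworkConditions D) {p : Fin N → ℝ}
    (hp : IsPerronVector D p) (μ : ℝ) (i : ℕ) (ω : Ω) :
    avg p (D.err μ (i + 1) ω) = avg p (D.err μ i ω) - μ • D.push p μ i ω := by
  rw [D.err_succ hnet, D.avg_next hp.1, push]

lemma inner_Shat (D : Model N M Ω) (p : Fin N → ℝ) (u v : Vec M) :
    ⟪u, op (D.Shat p) v⟫_ℝ = ∑ l, D.qhat p l * (1 - D.r l) * ⟪u, op (D.H l) v⟫_ℝ := by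
  rw [Shat, op, map_sum, sum_apply, inner_sum]
  refine Finset.sum_congr rfl fun l _ => ?_
  rw [map_smul, smul_apply, inner_smul_right]

lemma inner_Khat (D : Model N M Ω) (p : Fin N → ℝ) (G : Fin N → Matrix (Fin M) (Fin M) ℝ)
    (u v : Vec M) : ⟪u, op (D.Khat p G) v⟫_ℝ = ∑ x : Fin N × Fin M, ∑ y : Fin N × Fin M,
      D.qhat p x.1 * u x.2 * (D.qhat p y.1 * v y.2) * (D.maskCorr x y * stackedCov G x y) := by
  rw [Khat, op, map_sum, sum_apply, inner_sum]
  simp only [Fintype.sum_prod_type]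
  refine Finset.sum_congr rfl fun l _ => ?_
  rw [map_smul, smul_apply, inner_smul_right, inner_vec, Finset.mul_sum]
  refine Finset.sum_congr rfl fun a _ => ?_
  rw [Finset.sum_eq_single l (fun l' _ hne => Finset.sum_eq_zero fun b _ => by
    simp [stackedCov, hne.symm]) (by simp)]
  change _ * (u a * op _ v a) = _
  rw [op_apply, Finset.mul_sum, Finset.mul_sum]
  refine Finset.sum_congr rfl fun b _ => ?_
  simp only [stackedCov, Matrix.of_apply, if_true]
  ring

end Model

lemma growth_inner_avg {D : Model N M Ω} {p : Fin N → ℝ} (hp : IsPerronVector D p)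
    (hnet : NetworkConditions D) (u : Vec M) :
    PolyGrowth 1 (fun x : Fin N → Vec M => ⟪u, avg p x⟫_ℝ) :=
  PolyGrowth.of_le (by fun_prop) (C := ‖u‖ * N) fun x => by
    rw [mul_assoc]
    exact (abs_real_inner_le_norm _ _).trans (mul_le_mul_of_nonneg_left
      ((norm_avg_le hp hnet x).trans (sum_norm_le x)) (norm_nonneg u))

variable [MeasurableSpace Ω]

namespace Setting

variable {D : Model N M Ω} {P : Measure Ω} {μbar : ℝ} [IsProbabilityMeasure P]

/-- The mean of the masked push, weighted by a coordinate of the network average: the noise drops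
out and the masks turn into their means. -/
lemma integral_inner_mul_push (h : Setting D P μbar) {p : Fin N → ℝ} (hp : IsPerronVector D p)
    {μ : ℝ} (hμ : μ ∈ Set.Ioo 0 μbar) (i : ℕ) (u v : Vec M) :
    Integrable (fun ω => ⟪u, avg p (D.err μ i ω)⟫_ℝ * ⟪v, D.push p μ i ω⟫_ℝ) P ∧
    ∫ ω, ⟪u, avg p (D.err μ i ω)⟫_ℝ * ⟪v, D.push p μ i ω⟫_ℝ ∂P =
      ∫ ω, ⟪u, avg p (D.err μ i ω)⟫_ℝ * -∑ l, D.qhat p l * (1 - D.r l) *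
        ⟪v, gradient (D.J l) (D.wo - mix D.A₁ (D.err μ i ω) l)⟫_ℝ ∂P := by
  obtain ⟨ν, δ, C, hb⟩ := h.exists_bounds
  have hu := growth_inner_avg hp h.net u
  set Y : Fin N → Fin M → Ω → ℝ := fun l m ω => ⟪u, avg p (D.err μ i ω)⟫_ℝ * v m *
    D.descent (D.err μ i ω) (D.noiseAt μ i ω) l m with hY
  have hYg : ∀ l m, PolyGrowth 4 (fun z : (Fin N → Vec M) × (Fin N → Vec M) =>
      ⟪u, avg p z.1⟫_ℝ * v m * D.descent z.1 z.2 l m) := fun l m =>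
    ((hu.fst.mul (PolyGrowth.const (n := 0) (v m))).mul
      (growth_descent_coord hb h.net h.continuous_grad l m)).mono (by norm_num)
  have e1 : ∀ ω, ⟪u, avg p (D.err μ i ω)⟫_ℝ * ⟪v, D.push p μ i ω⟫_ℝ =
      ∑ l, D.qhat p l * ∑ m, D.maskAt i ω l m * Y l m ω := fun ω => by
    rw [Model.push, inner_sum_hmul, Finset.mul_sum]
    refine Finset.sum_congr rfl fun l _ => ?_
    rw [Finset.mul_sum, Finset.mul_sum, Finset.mul_sum]
    refine Finset.sum_congr rfl fun m _ => ?_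
    simp only [hY]
    ring
  obtain ⟨h1, h2⟩ := h.integral_masked_sum hμ i (D.qhat p)
    (fun l m => h.measurable_comp_avail (hYg l m).1 μ i)
    (fun l m => h.integrable_state hμ i (hYg l m))
  simp only [e1]
  refine ⟨h1, Eq.trans h2 ?_⟩
  have hgl : ∀ l m, PolyGrowth 2 (fun x : Fin N → Vec M => ⟪u, avg p x⟫_ℝ * v m *
      gradient (D.J l) (D.wo - mix D.A₁ x l) m) := fun l m =>
    (hu.mul (PolyGrowth.const (n := 0) (v m))).mul
      (growth_grad_coord hb h.net h.continuous_grad l m)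
  have igl : ∀ l m, Integrable (fun ω => ⟪u, avg p (D.err μ i ω)⟫_ℝ * v m *
      gradient (D.J l) (D.wo - mix D.A₁ (D.err μ i ω) l) m) P := fun l m =>
    h.integrable_err hμ i ((hgl l m).mono (by norm_num))
  have e2 : ∀ l m, ∫ ω, Y l m ω ∂P = -∫ ω, ⟪u, avg p (D.err μ i ω)⟫_ℝ * v m *
      gradient (D.J l) (D.wo - mix D.A₁ (D.err μ i ω) l) m ∂P := fun l m => by
    have g1 := hu.mul (PolyGrowth.const (n := 0) (v m))
    have i2 : Integrable (fun ω => ⟪u, avg p (D.err μ i ω)⟫_ℝ * v m * D.noiseAt μ i ω l m) P :=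
      h.integrable_state hμ i ((g1.fst.mul (growth_noise_coord l m)).mono (by norm_num))
    have e3 := h.integral_mul_noise hμ i l m (measurable_comp_past g1.1 D μ i) i2
    have e4 : ∀ ω, Y l m ω = -(⟪u, avg p (D.err μ i ω)⟫_ℝ * v m *
        gradient (D.J l) (D.wo - mix D.A₁ (D.err μ i ω) l) m) -
        ⟪u, avg p (D.err μ i ω)⟫_ℝ * v m * D.noiseAt μ i ω l m := fun ω => by
      simp [hY, Model.descent]; ring
    simp only [e4]
    refine (integral_sub (igl l m).neg i2).trans ?_
    rw [e3, sub_zero]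
    exact integral_neg _
  refine (Finset.sum_congr rfl fun l _ => congrArg (fun z => D.qhat p l * (1 - D.r l) * z)
    (Finset.sum_congr rfl fun m _ => e2 l m)).trans ?_
  have e5 : ∀ ω, ⟪u, avg p (D.err μ i ω)⟫_ℝ * -∑ l, D.qhat p l * (1 - D.r l) *
      ⟪v, gradient (D.J l) (D.wo - mix D.A₁ (D.err μ i ω) l)⟫_ℝ =
      ∑ l, D.qhat p l * (1 - D.r l) * ∑ m, -(⟪u, avg p (D.err μ i ω)⟫_ℝ * v m *
        gradient (D.J l) (D.wo - mix D.A₁ (D.err μ i ω) l) m) := fun ω => by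
    rw [← Finset.sum_neg_distrib, Finset.mul_sum]
    refine Finset.sum_congr rfl fun l _ => ?_
    rw [inner_vec v, Finset.sum_neg_distrib]
    simp only [mul_assoc, ← Finset.mul_sum]
    ring
  simp only [e5]
  have i3 : ∀ l, Integrable (fun ω => ∑ m, -(⟪u, avg p (D.err μ i ω)⟫_ℝ * v m *
      gradient (D.J l) (D.wo - mix D.A₁ (D.err μ i ω) l) m)) P := fun l =>
    integrable_finsetSum Finset.univ fun m _ => (igl l m).neg
  rw [integral_finsetSum Finset.univ fun l _ => (i3 l).const_mul _]
  refine Finset.sum_congr rfl fun l _ => ?_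
  rw [integral_const_mul, integral_finsetSum Finset.univ fun m _ => Integrable.fun_neg (igl l m)]
  simp only [integral_neg]

/-- To first order the push is the linear map `Shat` of the network average. -/
lemma steady_drift (h : Setting D P μbar) (hμbar : 0 < μbar) {p : Fin N → ℝ}
    (W : ConsensusGauge M (D.A₁ * D.A₂) p) (hp : IsPerronVector D p) (u v : Vec M) :
    SteadyLimit (fun μ i => 1 / μ * (∫ ω, ⟪u, avg p (D.err μ i ω)⟫_ℝ * ⟪v, D.push p μ i ω⟫_ℝ ∂P -
      ∫ ω, ⟪u, avg p (D.err μ i ω)⟫_ℝ * ⟪v, op (D.Shat p) (avg p (D.err μ i ω))⟫_ℝ ∂P)) 0 := by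
  obtain ⟨ν, δ, C, hb⟩ := h.exists_bounds
  have hδ := hb.δ_pos
  have hC := hb.C_nonneg
  have hU := growth_avg hp h.net (M := M)
  have hV := W.growth
  have hu := growth_inner_avg hp h.net u
  set κ : ℝ := ‖u‖ * (N * (‖v‖ * (δ + C))) with hκ
  have hκ0 : 0 ≤ κ := by positivity
  have hst := (h.steady_cross hμbar W hp).const_mul κ
  rw [mul_zero] at hst
  refine hst.of_abs_le ?_
  filter_upwards [Ioo_mem_nhdsGT hμbar] with μ hμ
  refine Eventually.of_forall fun i => ?_
  have hμ0 : 0 < μ := hμ.1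
  have i1 : Integrable (fun ω => ⟪u, avg p (D.err μ i ω)⟫_ℝ * -∑ l, D.qhat p l * (1 - D.r l) *
        ⟪v, gradient (D.J l) (D.wo - mix D.A₁ (D.err μ i ω) l)⟫_ℝ) P := by
    have g1 : ∀ l, PolyGrowth 1 (fun x : Fin N → Vec M =>
        ⟪v, gradient (D.J l) (D.wo - mix D.A₁ x l)⟫_ℝ) := fun l => by
      simp only [inner_vec]
      exact PolyGrowth.sum Finset.univ fun m _ =>
        (growth_grad_coord hb h.net h.continuous_grad l m).const_mul (v m)
    have g2 := (PolyGrowth.sum Finset.univ fun l _ =>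
      (g1 l).const_mul (D.qhat p l * (1 - D.r l))).const_mul (-1)
    simp only [neg_one_mul] at g2
    exact h.integrable_err hμ i ((hu.mul g2).mono (by norm_num))
  have i2 : Integrable (fun ω => ⟪u, avg p (D.err μ i ω)⟫_ℝ *
      ⟪v, op (D.Shat p) (avg p (D.err μ i ω))⟫_ℝ) P := by
    have g1 := (growth_inner_avg hp h.net ((op (D.Shat p)).adjoint v))
    simp only [ContinuousLinearMap.adjoint_inner_left] at g1
    exact h.integrable_err hμ i ((hu.mul g1).mono (by norm_num))
  rw [(h.integral_inner_mul_push hp hμ i u v).2, ← integral_sub i1 i2, sub_zero, abs_mul,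
    abs_of_pos (show 0 < 1 / μ by positivity), mul_left_comm]
  refine mul_le_mul_of_nonneg_left (abs_integral_le_integral_abs.trans ?_) (by positivity)
  rw [← integral_const_mul]
  refine integral_mono (i1.sub i2).abs (Integrable.const_mul (h.integrable_err hμ i
    ((((hU.add hV).mul ((hV.mono (by norm_num)).add ((hU.add hV).pow 2)))).mono (by norm_num))) _)
    fun ω => ?_
  simp only
  set x := D.err μ i ω
  have hV0 := W.nonneg x
  rw [Model.inner_Shat, ← mul_sub, abs_mul, ← Finset.sum_neg_distrib, ← Finset.sum_sub_distrib]
  have e1 : |⟪u, avg p x⟫_ℝ| ≤ ‖u‖ * (‖avg p x‖ + W.V x) :=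
    (abs_real_inner_le_norm _ _).trans
      (mul_le_mul_of_nonneg_left (by linarith) (norm_nonneg u))
  have e2 : ∀ l, |-(D.qhat p l * (1 - D.r l) * ⟪v, gradient (D.J l) (D.wo - mix D.A₁ x l)⟫_ℝ) -
      D.qhat p l * (1 - D.r l) * ⟪v, op (D.H l) (avg p x)⟫_ℝ| ≤
      ‖v‖ * (δ + C) * (W.V x + (‖avg p x‖ + W.V x) ^ 2) := fun l => by
    have hc0 : 0 ≤ D.qhat p l * (1 - D.r l) :=
      mul_nonneg (qhat_nonneg hp h.net l) (by linarith [h.net.r_lt l])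
    have hc1 : D.qhat p l * (1 - D.r l) ≤ 1 :=
      mul_le_one₀ (qhat_le_one hp h.net l) (by linarith [h.net.r_lt l])
        (by linarith [h.net.r_nonneg l])
    have f1 : -(D.qhat p l * (1 - D.r l) * ⟪v, gradient (D.J l) (D.wo - mix D.A₁ x l)⟫_ℝ) -
      D.qhat p l * (1 - D.r l) * ⟪v, op (D.H l) (avg p x)⟫_ℝ = D.qhat p l * (1 - D.r l) *
      ⟪v, op (D.H l) (mix D.A₁ x l - avg p x) -
        (gradient (D.J l) (D.wo - mix D.A₁ x l) + op (D.H l) (mix D.A₁ x l))⟫_ℝ := by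
      simp only [inner_sub_right, inner_add_right, map_sub]
      ring
    rw [f1, abs_mul, abs_of_nonneg hc0]
    refine (mul_le_of_le_one_left (abs_nonneg _) hc1).trans
      ((abs_real_inner_le_norm _ _).trans ?_)
    rw [mul_assoc]
    refine mul_le_mul_of_nonneg_left ((norm_sub_le _ _).trans ?_) (norm_nonneg v)
    have f2 : ‖op (D.H l) (mix D.A₁ x l - avg p x)‖ ≤ δ * W.V x :=
      ((op (D.H l)).le_of_opNorm_le (hb.hess_norm l) _).trans
        (mul_le_mul_of_nonneg_left (W.mix_sub_le h.net.A₁_stoch x l) hδ.le)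
    have f3 : ‖gradient (D.J l) (D.wo - mix D.A₁ x l) + op (D.H l) (mix D.A₁ x l)‖ ≤
        C * (‖avg p x‖ + W.V x) ^ 2 :=
      (hb.expand l _).trans (mul_le_mul_of_nonneg_left
        (pow_le_pow_left₀ (norm_nonneg _) (W.mix_le h.net.A₁_stoch x l) 2) hC)
    have f4 : 0 ≤ δ * (‖avg p x‖ + W.V x) ^ 2 := by positivity
    have f5 : 0 ≤ C * W.V x := by positivity
    linarith
  have e3 := (Finset.abs_sum_le_sum_abs _ Finset.univ).trans
    (Finset.sum_le_sum fun l (_ : l ∈ Finset.univ) => e2 l)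
  rw [Finset.sum_const, Finset.card_univ, Fintype.card_fin, nsmul_eq_mul] at e3
  refine (mul_le_mul e1 e3 (abs_nonneg _) (by positivity)).trans (le_of_eq ?_)
  rw [hκ]; ring

end Setting

end SecondMoments

end CoordDiffusion

namespace CoordDiffusion

section SecondMoments

open scoped InnerProductSpace

variable {N M : ℕ} {Ω : Type*} [MeasurableSpace Ω]

namespace Setting

variable {D : Model N M Ω} {P : Measure Ω} {μbar : ℝ} [IsProbabilityMeasure P]

/-- The second moments of the push in terms of those of the gradients and of the noise: the cross
terms vanish, and the masks enter through `maskCorr`. -/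
lemma integral_push_mul (h : Setting D P μbar) (p : Fin N → ℝ)
    {μ : ℝ} (hμ : μ ∈ Set.Ioo 0 μbar) (i : ℕ) (u v : Vec M) :
    Integrable (fun ω => ⟪u, D.push p μ i ω⟫_ℝ * ⟪v, D.push p μ i ω⟫_ℝ) P ∧
    ∫ ω, ⟪u, D.push p μ i ω⟫_ℝ * ⟪v, D.push p μ i ω⟫_ℝ ∂P =
      ∑ x : Fin N × Fin M, ∑ y : Fin N × Fin M,
        D.qhat p x.1 * u x.2 * (D.qhat p y.1 * v y.2) * (D.maskCorr x y *
          (∫ ω, gradient (D.J x.1) (D.wo - mix D.A₁ (D.err μ i ω) x.1) x.2 *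
              gradient (D.J y.1) (D.wo - mix D.A₁ (D.err μ i ω) y.1) y.2 ∂P +
            ∫ ω, D.noiseAt μ i ω x.1 x.2 * D.noiseAt μ i ω y.1 y.2 ∂P)) := by
  obtain ⟨ν, δ, C, hb⟩ := h.exists_bounds
  have hd := fun x : Fin N × Fin M => growth_descent_coord hb h.net h.continuous_grad x.1 x.2
  have hg := fun x : Fin N × Fin M => growth_grad_coord hb h.net h.continuous_grad x.1 x.2
  set d : Fin N × Fin M → Ω → ℝ := fun x ω => D.descent (D.err μ i ω) (D.noiseAt μ i ω) x.1 x.2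
    with hddef
  set g : Fin N × Fin M → Ω → ℝ := fun x ω =>
    gradient (D.J x.1) (D.wo - mix D.A₁ (D.err μ i ω) x.1) x.2 with hgdef
  set s : Fin N × Fin M → Ω → ℝ := fun x ω => D.noiseAt μ i ω x.1 x.2 with hsdef
  have hdm : ∀ x y, Measurable[D.avail μ i] (fun ω => d x ω * d y ω) := fun x y =>
    h.measurable_comp_avail ((hd x).mul (hd y)).1 μ i
  have hdi : ∀ x y, Integrable (fun ω => d x ω * d y ω) P := fun x y =>
    h.integrable_state hμ i (((hd x).mul (hd y)).mono (by norm_num))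
  have hmi : ∀ x y : Fin N × Fin M, Integrable (fun ω => D.mask x.1 i x.2 ω * D.mask y.1 i y.2 ω *
      (d x ω * d y ω)) P := fun x y =>
    (hdi x y).bdd_mul (c := 1) ((h.reg.mask_meas x.1 i x.2).mul
      (h.reg.mask_meas y.1 i y.2)).aestronglyMeasurable (Eventually.of_forall fun ω => by
        rw [norm_mul]
        exact mul_le_one₀ (h.abs_mask_le x.1 i x.2 ω) (norm_nonneg _) (h.abs_mask_le y.1 i y.2 ω))
  have e1 : ∀ w ω, ⟪w, D.push p μ i ω⟫_ℝ = ∑ x : Fin N × Fin M, D.qhat p x.1 * w x.2 *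
      (D.mask x.1 i x.2 ω * d x ω) := fun w ω => by
    rw [Model.push, inner_sum_hmul, Fintype.sum_prod_type]
    refine Finset.sum_congr rfl fun l _ => ?_
    rw [Finset.mul_sum]
    refine Finset.sum_congr rfl fun m _ => ?_
    simp only [hddef, Model.maskAt]
    ring
  have e2 : ∀ ω, ⟪u, D.push p μ i ω⟫_ℝ * ⟪v, D.push p μ i ω⟫_ℝ = ∑ x : Fin N × Fin M,
      ∑ y : Fin N × Fin M, D.qhat p x.1 * u x.2 * (D.qhat p y.1 * v y.2) *
        (D.mask x.1 i x.2 ω * D.mask y.1 i y.2 ω * (d x ω * d y ω)) := fun ω => by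
    rw [e1, e1, Finset.sum_mul_sum]
    exact Finset.sum_congr rfl fun x _ => Finset.sum_congr rfl fun y _ => by ring
  simp only [e2]
  have h3 := fun x y => (hmi x y).const_mul (D.qhat p x.1 * u x.2 * (D.qhat p y.1 * v y.2))
  have h4 := fun x => integrable_finsetSum Finset.univ fun y (_ : y ∈ Finset.univ) => h3 x y
  refine ⟨integrable_finsetSum Finset.univ fun x _ => h4 x, ?_⟩
  rw [integral_finsetSum Finset.univ fun x _ => h4 x]
  refine Finset.sum_congr rfl fun x _ => ?_
  rw [integral_finsetSum Finset.univ fun y _ => h3 x y]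
  refine Finset.sum_congr rfl fun y _ => ?_
  rw [integral_const_mul, h.integral_mask_mul_mask_mul hμ i x y (hdm x y)]
  congr 2
  have igg : Integrable (fun ω => g x ω * g y ω) P :=
    h.integrable_err hμ i (((hg x).mul (hg y)).mono (by norm_num))
  have igs : ∀ x y, Integrable (fun ω => g x ω * s y ω) P := fun x y =>
    h.integrable_state hμ i (((hg x).fst.mul (growth_noise_coord y.1 y.2)).mono (by norm_num))
  have iss : Integrable (fun ω => s x ω * s y ω) P :=
    h.integrable_state hμ i (((growth_noise_coord x.1 x.2).mul
      (growth_noise_coord y.1 y.2)).mono (by norm_num))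
  have z : ∀ x y, ∫ ω, g x ω * s y ω ∂P = 0 := fun x y =>
    h.integral_mul_noise hμ i y.1 y.2 (measurable_comp_past (hg x).1 D μ i) (igs x y)
  have e3 : ∀ ω, d x ω * d y ω = (g x ω * g y ω + s x ω * s y ω) +
      (g x ω * s y ω + g y ω * s x ω) := fun ω => by
    simp only [hddef, hgdef, hsdef, Model.descent, PiLp.neg_apply, PiLp.add_apply]
    ring
  simp only [e3]
  have j1 : Integrable (fun ω => g x ω * g y ω + s x ω * s y ω) P := igg.add iss
  have j2 : Integrable (fun ω => g x ω * s y ω + g y ω * s x ω) P := (igs x y).add (igs y x)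
  rw [integral_add j1 j2, integral_add igg iss, integral_add (igs x y) (igs y x), z, z, add_zero,
    add_zero]

/-- The covariance of the push settles at the masked noise covariance. -/
lemma steady_push_mul (h : Setting D P μbar) (hμbar : 0 < μbar) {p : Fin N → ℝ}
    (W : ConsensusGauge M (D.A₁ * D.A₂) p) (hp : IsPerronVector D p)
    {G : Fin N → Matrix (Fin M) (Fin M) ℝ} (hG : IsLimitCov D P μbar G) (u v : Vec M) :
    SteadyLimit (fun μ i => ∫ ω, ⟪u, D.push p μ i ω⟫_ℝ * ⟪v, D.push p μ i ω⟫_ℝ ∂P)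
      (⟪u, op (D.Khat p G) v⟫_ℝ) := by
  obtain ⟨ν, δ, C, hb⟩ := h.exists_bounds
  have hδ := hb.δ_pos
  have hgrad : ∀ x y : Fin N × Fin M, SteadyLimit (fun μ i =>
      ∫ ω, gradient (D.J x.1) (D.wo - mix D.A₁ (D.err μ i ω) x.1) x.2 *
              gradient (D.J y.1) (D.wo - mix D.A₁ (D.err μ i ω) y.1) y.2 ∂P) 0 := fun x y => by
    obtain ⟨K, hK, hbd⟩ := h.exists_moment_bounds hμbar W hp
    have h0 : SteadyLimit (fun μ i =>
      |∫ ω, gradient (D.J x.1) (D.wo - mix D.A₁ (D.err μ i ω) x.1) x.2 *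
              gradient (D.J y.1) (D.wo - mix D.A₁ (D.err μ i ω) y.1) y.2 ∂P|) 0 := by
      refine SteadyLimit.of_le_add 0 (fun μ i _ => abs_nonneg _) fun η _ => ⟨4 * δ ^ 2 * K, ?_⟩
      filter_upwards [hbd] with μ ⟨hμ, hμ1, hμi⟩
      filter_upwards [hμi] with i ⟨_, _, a2, b2⟩
      have i2 := h.integrable_err hμ i (((growth_avg hp h.net (M := M)).pow 2).mono
        (by norm_num : 1 * 2 ≤ 4))
      have j2 := h.integrable_err hμ i ((W.growth.pow 2).mono (by norm_num : 1 * 2 ≤ 4))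
      have igg := h.integrable_err hμ i
        (((growth_grad_coord hb h.net h.continuous_grad x.1 x.2).mul
          (growth_grad_coord hb h.net h.continuous_grad y.1 y.2)).mono (by norm_num : 1 + 1 ≤ 4))
      have e1 : ∫ ω, |gradient (D.J x.1) (D.wo - mix D.A₁ (D.err μ i ω) x.1) x.2 *
          gradient (D.J y.1) (D.wo - mix D.A₁ (D.err μ i ω) y.1) y.2| ∂P ≤
          ∫ ω, (2 * δ ^ 2 * ‖avg p (D.err μ i ω)‖ ^ 2 + 2 * δ ^ 2 * W.V (D.err μ i ω) ^ 2) ∂P := by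
        refine integral_mono igg.abs ((i2.const_mul _).add (j2.const_mul _)) fun ω => ?_
        simp only
        have f : ∀ z : Fin N × Fin M, |gradient (D.J z.1) (D.wo - mix D.A₁ (D.err μ i ω) z.1) z.2| ≤
            δ * (‖avg p (D.err μ i ω)‖ + W.V (D.err μ i ω)) := fun z =>
          (abs_coord_le _ _).trans ((hb.grad_le z.1 _).trans
            (mul_le_mul_of_nonneg_left (W.mix_le h.net.A₁_stoch _ z.1) hδ.le))
        rw [abs_mul]
        have hV0 := W.nonneg (D.err μ i ω)
        refine (mul_le_mul (f x) (f y) (abs_nonneg _) (by positivity)).trans ?_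
        have := mul_nonneg (sq_nonneg δ) (sq_nonneg (‖avg p (D.err μ i ω)‖ - W.V (D.err μ i ω)))
        linarith
      rw [integral_add (i2.const_mul _) (j2.const_mul _), integral_const_mul,
        integral_const_mul] at e1
      refine abs_integral_le_integral_abs.trans (e1.trans ?_)
      have e6 : K * μ ^ 2 ≤ K * μ := by
        have : μ ^ 2 ≤ μ := pow_le_of_le_one hμ.1.le hμ1.le (by norm_num)
        gcongr
      have e7 := mul_le_mul_of_nonneg_left a2 (show 0 ≤ 2 * δ ^ 2 by positivity)
      have e8 := mul_le_mul_of_nonneg_left (b2.trans e6) (show 0 ≤ 2 * δ ^ 2 by positivity)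
      linarith
    exact h0.of_abs_le (Eventually.of_forall fun μ => Eventually.of_forall fun i => by
      rw [sub_zero])
  rw [Model.inner_Khat]
  have hsum : SteadyLimit (fun μ i => ∑ x : Fin N × Fin M, ∑ y : Fin N × Fin M,
        D.qhat p x.1 * u x.2 * (D.qhat p y.1 * v y.2) * (D.maskCorr x y *
          (∫ ω, gradient (D.J x.1) (D.wo - mix D.A₁ (D.err μ i ω) x.1) x.2 *
              gradient (D.J y.1) (D.wo - mix D.A₁ (D.err μ i ω) y.1) y.2 ∂P +
            ∫ ω, D.noiseAt μ i ω x.1 x.2 * D.noiseAt μ i ω y.1 y.2 ∂P)))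
      (∑ x : Fin N × Fin M, ∑ y : Fin N × Fin M,
        D.qhat p x.1 * u x.2 * (D.qhat p y.1 * v y.2) *
          (D.maskCorr x y * (0 + stackedCov G x y))) :=
    SteadyLimit.sum _ fun x _ => SteadyLimit.sum _ fun y _ =>
      (((hgrad x y).add (h.steady_noise_mul hμbar W hp hG x y)).const_mul _).const_mul _
  simp only [zero_add] at hsum
  refine hsum.congr ?_
  filter_upwards [Ioo_mem_nhdsGT hμbar] with μ hμ
  exact Eventually.of_forall fun i => (h.integral_push_mul p hμ i u v).2

/-- Second moments of the network average along eigenvectors of `Shat`. -/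
lemma steady_avg_mul (h : Setting D P μbar) (hμbar : 0 < μbar) {p : Fin N → ℝ}
    (W : ConsensusGauge M (D.A₁ * D.A₂) p) (hp : IsPerronVector D p)
    {G : Fin N → Matrix (Fin M) (Fin M) ℝ} (hG : IsLimitCov D P μbar G) {u v : Vec M} {a b : ℝ}
    (hu : ∀ x, ⟪u, op (D.Shat p) x⟫_ℝ = a * ⟪u, x⟫_ℝ)
    (hv : ∀ x, ⟪v, op (D.Shat p) x⟫_ℝ = b * ⟪v, x⟫_ℝ) (hab : 0 < a + b) :
    SteadyLimit (fun μ i => 1 / μ * ∫ ω, ⟪u, avg p (D.err μ i ω)⟫_ℝ *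
      ⟪v, avg p (D.err μ i ω)⟫_ℝ ∂P) (⟪u, op (D.Khat p G) v⟫_ℝ / (a + b)) := by
  set k := ⟪u, op (D.Khat p G) v⟫_ℝ
  set f : ℝ → ℕ → ℝ := fun μ i => ∫ ω, ⟪u, avg p (D.err μ i ω)⟫_ℝ *
      ⟪v, avg p (D.err μ i ω)⟫_ℝ ∂P with hf
  set c : Vec M → Vec M → ℝ → ℕ → ℝ := fun u v μ i =>
    1 / μ * (∫ ω, ⟪u, avg p (D.err μ i ω)⟫_ℝ * ⟪v, D.push p μ i ω⟫_ℝ ∂P -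
      ∫ ω, ⟪u, avg p (D.err μ i ω)⟫_ℝ * ⟪v, op (D.Shat p) (avg p (D.err μ i ω))⟫_ℝ ∂P) with hc
  set g : ℝ → ℕ → ℝ := fun μ i => ∫ ω, ⟪u, D.push p μ i ω⟫_ℝ * ⟪v, D.push p μ i ω⟫_ℝ ∂P with hg
  have hd := fun u v => h.steady_drift hμbar W hp u v
  -- `f` contracts at the rate `1 - μ (a + b)` and is driven by `μ²` times the covariance of the
  -- push
  have he := (((hd u v).const_mul (-1)).add ((hd v u).const_mul (-1))).add
    ((h.steady_push_mul hμbar W hp hG u v).add (SteadyLimit.const (-k)))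
  rw [mul_zero, add_zero, zero_add, add_neg_cancel] at he
  refine SteadyLimit.of_recursion hab he ?_
  filter_upwards [Ioo_mem_nhdsGT hμbar] with μ hμ
  intro i
  have hμ0 : μ ≠ 0 := hμ.1.ne'
  have gu := growth_inner_avg hp h.net u
  have gv := growth_inner_avg hp h.net v
  have i1 : Integrable (fun ω => ⟪u, avg p (D.err μ i ω)⟫_ℝ * ⟪v, avg p (D.err μ i ω)⟫_ℝ) P :=
    h.integrable_err hμ i ((gu.mul gv).mono (by norm_num))
  have i2 := (h.integral_inner_mul_push hp hμ i u v).1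
  have i3 := (h.integral_inner_mul_push hp hμ i v u).1
  have i4 := (h.integral_push_mul p hμ i u v).1
  have e1 : f μ (i + 1) = f μ i + (-μ * ∫ ω, ⟪u, avg p (D.err μ i ω)⟫_ℝ * ⟪v, D.push p μ i ω⟫_ℝ ∂P +
      -μ * ∫ ω, ⟪v, avg p (D.err μ i ω)⟫_ℝ * ⟪u, D.push p μ i ω⟫_ℝ ∂P + μ ^ 2 * g μ i) := by
    rw [← integral_linear₃ _ _ _ i2 i3 i4, ← integral_add i1 (integrable_linear₃ _ _ _ i2 i3 i4)]
    refine integral_congr_ae (Eventually.of_forall fun ω => ?_)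
    simp only [D.avg_err_succ h.net hp, inner_sub_right, inner_smul_right]
    ring
  have e2 : ∫ ω, ⟪u, avg p (D.err μ i ω)⟫_ℝ * ⟪v, D.push p μ i ω⟫_ℝ ∂P =
      μ * c u v μ i + b * f μ i := by
    have e3 : ∫ ω, ⟪u, avg p (D.err μ i ω)⟫_ℝ * ⟪v, op (D.Shat p) (avg p (D.err μ i ω))⟫_ℝ ∂P =
        b * f μ i := by
      rw [hf, ← integral_const_mul]
      exact integral_congr_ae (Eventually.of_forall fun ω => by simp only [hv]; ring)
    simp only [hc]
    rw [e3]
    field_simp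
    ring
  have e3 : ∫ ω, ⟪v, avg p (D.err μ i ω)⟫_ℝ * ⟪u, D.push p μ i ω⟫_ℝ ∂P =
      μ * c v u μ i + a * f μ i := by
    have e4 : ∫ ω, ⟪v, avg p (D.err μ i ω)⟫_ℝ * ⟪u, op (D.Shat p) (avg p (D.err μ i ω))⟫_ℝ ∂P =
        a * f μ i := by
      rw [hf, ← integral_const_mul]
      exact integral_congr_ae (Eventually.of_forall fun ω => by simp only [hu]; ring)
    simp only [hc]
    rw [e4]
    field_simp
    ring
  change f μ (i + 1) = (1 - μ * (a + b)) * f μ i +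
    μ ^ 2 * (k + (-1 * c u v μ i + -1 * c v u μ i + (g μ i + -k)))
  rw [e1, e2, e3]
  ring

end Setting

end SecondMoments

end CoordDiffusion

namespace CoordDiffusion

/-! ### The Lyapunov equation -/

section Lyapunov

open scoped InnerProductSpace

variable {N M : ℕ} {Ω : Type*}

lemma op_mul_apply (A B : Matrix (Fin M) (Fin M) ℝ) (v : Vec M) : op (A * B) v = op A (op B v) := by
  rw [op, map_mul]; rfl

lemma op_eigenvectorBasis {S : Matrix (Fin M) (Fin M) ℝ} (hS : S.IsHermitian) (j : Fin M) :
    op S (hS.eigenvectorBasis j) = hS.eigenvalues j • hS.eigenvectorBasis j := by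
  ext m
  have := congrFun (hS.mulVec_eigenvectorBasis j) m
  simpa [op, Matrix.ofLp_toEuclideanCLM] using this

lemma inner_eigenvectorBasis_op {S : Matrix (Fin M) (Fin M) ℝ} (hS : S.IsHermitian) (j : Fin M)
    (v : Vec M) : ⟪hS.eigenvectorBasis j, op S v⟫_ℝ =
      hS.eigenvalues j * ⟪hS.eigenvectorBasis j, v⟫_ℝ := by
  rw [← inner_op_comm hS, op_eigenvectorBasis, inner_smul_left]
  rfl

lemma inner_op_expand (b : OrthonormalBasis (Fin M) ℝ (Vec M)) (Q : Matrix (Fin M) (Fin M) ℝ)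
    (u v : Vec M) : ⟪u, op Q v⟫_ℝ = ∑ j, ∑ l, ⟪b j, op Q (b l)⟫_ℝ * (⟪b j, u⟫_ℝ * ⟪b l, v⟫_ℝ) := by
  rw [← b.sum_inner_mul_inner]
  refine Finset.sum_congr rfl fun j _ => ?_
  conv_lhs => rw [← b.sum_repr' v]
  rw [map_sum, inner_sum, Finset.mul_sum]
  refine Finset.sum_congr rfl fun l _ => ?_
  rw [map_smul, inner_smul_right, real_inner_comm]
  ring

/-- The trace of a product in an orthonormal basis. -/
lemma trace_mul_eq (b : OrthonormalBasis (Fin M) ℝ (Vec M)) (X K : Matrix (Fin M) (Fin M) ℝ) :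
    (X * K).trace = ∑ j, ∑ l, ⟪b j, op X (b l)⟫_ℝ * ⟪b l, op K (b j)⟫_ℝ := by
  have h1 : (X * K).trace = LinearMap.trace ℝ (Vec M) (op (X * K)).toLinearMap := by
    rw [LinearMap.trace_eq_sum_inner _ (EuclideanSpace.basisFun (Fin M) ℝ), Matrix.trace]
    refine Finset.sum_congr rfl fun m _ => ?_
    rw [ContinuousLinearMap.coe_coe, inner_vec]
    simp [op_apply, Matrix.mul_apply]
  rw [h1, LinearMap.trace_eq_sum_inner _ b]
  refine Finset.sum_congr rfl fun j _ => ?_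
  rw [ContinuousLinearMap.coe_coe, op_mul_apply, inner_op_expand b X]
  rw [Finset.sum_eq_single j (fun i _ hij => Finset.sum_eq_zero fun l _ => by
    rw [b.inner_eq_zero hij]; ring) (by simp)]
  refine Finset.sum_congr rfl fun l _ => ?_
  rw [b.inner_eq_one, one_mul]

/-- In an eigenbasis of `S` the Lyapunov operator multiplies the entry at `j, l` by `λ_j + λ_l`. -/
lemma inner_lyapunov {S X Q : Matrix (Fin M) (Fin M) ℝ} (hS : S.IsHermitian)
    (hX : X * S + S * X = Q) (j l : Fin M) :
    ⟪hS.eigenvectorBasis j, op Q (hS.eigenvectorBasis l)⟫_ℝ =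
      (hS.eigenvalues j + hS.eigenvalues l) *
        ⟪hS.eigenvectorBasis j, op X (hS.eigenvectorBasis l)⟫_ℝ := by
  rw [← hX, op, map_add, add_apply, inner_add_right]
  change ⟪_, op (X * S) _⟫_ℝ + ⟪_, op (S * X) _⟫_ℝ = _
  rw [op_mul_apply, op_mul_apply, op_eigenvectorBasis, map_smul, inner_smul_right,
    inner_eigenvectorBasis_op]
  ring

/-- The Lyapunov operator of a positive definite matrix is injective, hence bijective. -/
lemma exists_unique_lyapunov {S : Matrix (Fin M) (Fin M) ℝ} (hS : S.IsHermitian)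
    (hpos : ∀ j, 0 < hS.eigenvalues j) (Q : Matrix (Fin M) (Fin M) ℝ) :
    ∃ X : Matrix (Fin M) (Fin M) ℝ, X * S + S * X = Q ∧
      ∀ Y, Y * S + S * Y = Q → Y = X := by
  let L : Matrix (Fin M) (Fin M) ℝ →ₗ[ℝ] Matrix (Fin M) (Fin M) ℝ :=
    LinearMap.mulRight ℝ S + LinearMap.mulLeft ℝ S
  have hinj : Function.Injective L := by
    refine (injective_iff_map_eq_zero L).2 fun X hX => ?_
    have h0 : ∀ j l, ⟪hS.eigenvectorBasis j, op X (hS.eigenvectorBasis l)⟫_ℝ = 0 := fun j l => by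
      have := inner_lyapunov hS (show X * S + S * X = 0 from hX) j l
      rw [op, map_zero] at this
      simp only [zero_apply, inner_zero_right] at this
      exact (mul_eq_zero.1 this.symm).resolve_left (add_pos (hpos j) (hpos l)).ne'
    have h1 : op X = 0 := by
      ext1 v
      refine ext_inner_left ℝ fun u => ?_
      rw [inner_op_expand hS.eigenvectorBasis]
      simp [h0]
    exact (Matrix.toEuclideanCLM (n := Fin M) (𝕜 := ℝ)).injective (h1.trans (map_zero _).symm)
  obtain ⟨X, hX⟩ := LinearMap.surjective_of_injective hinj Q
  exact ⟨X, hX, fun Y hY => hinj ((show L Y = Q from hY).trans hX.symm)⟩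

lemma eigenvalues_pos {S : Matrix (Fin M) (Fin M) ℝ} (hS : S.IsHermitian) {c : ℝ} (hc : 0 < c)
    (h : ∀ v : Vec M, c * ‖v‖ ^ 2 ≤ ⟪v, op S v⟫_ℝ) (j : Fin M) : 0 < hS.eigenvalues j := by
  have h1 := h (hS.eigenvectorBasis j)
  rw [inner_eigenvectorBasis_op, real_inner_self_eq_norm_sq, hS.eigenvectorBasis.norm_eq_one] at h1
  linarith

section

variable {D : Model N M Ω} {ν δ C : ℝ}

lemma CostBounds.isHermitian_Shat (hb : CostBounds D ν δ C) (p : Fin N → ℝ) :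
    (D.Shat p).IsHermitian := by
  unfold Model.Shat
  refine isSelfAdjoint_sum (R := Matrix (Fin M) (Fin M) ℝ) Finset.univ fun k _ => ?_
  exact Matrix.IsHermitian.smul (hb.herm k) (IsSelfAdjoint.all (D.qhat p k * (1 - D.r k)))

lemma CostBounds.Shat_lower (hb : CostBounds D ν δ C) (hnet : NetworkConditions D)
    {p : Fin N → ℝ} (hp : IsPerronVector D p) (v : Vec M) :
    (∑ l, D.qhat p l * (1 - D.r l)) * ν * ‖v‖ ^ 2 ≤ ⟪v, op (D.Shat p) v⟫_ℝ := by
  rw [Model.inner_Shat, mul_assoc, Finset.sum_mul]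
  exact Finset.sum_le_sum fun l _ => mul_le_mul_of_nonneg_left (hb.hess_lower l v)
    (mul_nonneg (qhat_nonneg hp hnet l) (by linarith [hnet.r_lt l]))

lemma CostBounds.Shat_eigenvalues_pos (hb : CostBounds D ν δ C) (hnet : NetworkConditions D)
    {p : Fin N → ℝ} (hp : IsPerronVector D p) (j : Fin M) :
    0 < (hb.isHermitian_Shat p).eigenvalues j :=
  eigenvalues_pos _ (mul_pos (pull_pos hnet hp) hb.ν_pos) (hb.Shat_lower hnet hp) j

end

end Lyapunov

/-! ### Steady-state performance of the agents -/

section Performance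

open scoped InnerProductSpace

variable {N M : ℕ} {Ω : Type*} [MeasurableSpace Ω]

namespace Setting

variable {D : Model N M Ω} {P : Measure Ω} {μbar : ℝ} [IsProbabilityMeasure P]

/-- Quadratic functions of the network average in the steady state. -/
lemma steady_avg_quadratic (h : Setting D P μbar) (hμbar : 0 < μbar) {p : Fin N → ℝ}
    (W : ConsensusGauge M (D.A₁ * D.A₂) p) (hp : IsPerronVector D p)
    {G : Fin N → Matrix (Fin M) (Fin M) ℝ} (hG : IsLimitCov D P μbar G)
    {X Q : Matrix (Fin M) (Fin M) ℝ} (hX : X * D.Shat p + D.Shat p * X = Q) :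
    SteadyLimit (fun μ i => 1 / μ * ∫ ω, ⟪avg p (D.err μ i ω), op Q (avg p (D.err μ i ω))⟫_ℝ ∂P)
      (X * D.Khat p G).trace := by
  obtain ⟨ν, δ, C, hb⟩ := h.exists_bounds
  set hS := hb.isHermitian_Shat p
  set b := hS.eigenvectorBasis with hbdef
  have hpos := hb.Shat_eigenvalues_pos h.net hp
  -- the moments along pairs of eigenvectors tend to `⟪b l, K b j⟫ / (λ_l + λ_j)`, and the Lyapunov
  -- equation cancels the denominators
  have h1 := SteadyLimit.sum Finset.univ fun j (_ : j ∈ Finset.univ) =>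
    SteadyLimit.sum Finset.univ fun l (_ : l ∈ Finset.univ) =>
      (h.steady_avg_mul hμbar W hp hG (inner_eigenvectorBasis_op hS l)
        (inner_eigenvectorBasis_op hS j) (add_pos (hpos l) (hpos j))).const_mul
          ⟪b j, op Q (b l)⟫_ℝ
  have h2 : (∑ j, ∑ l, ⟪b j, op Q (b l)⟫_ℝ * (⟪b l, op (D.Khat p G) (b j)⟫_ℝ /
      (hS.eigenvalues l + hS.eigenvalues j))) = (X * D.Khat p G).trace := by
    rw [trace_mul_eq b]
    refine Finset.sum_congr rfl fun j _ => Finset.sum_congr rfl fun l _ => ?_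
    rw [inner_lyapunov hS hX j l]
    have := (add_pos (hpos l) (hpos j)).ne'
    field_simp
    ring
  rw [← h2]
  refine h1.congr ?_
  filter_upwards [Ioo_mem_nhdsGT hμbar] with μ hμ
  refine Eventually.of_forall fun i => ?_
  have i1 : ∀ j l, Integrable (fun ω => ⟪b j, op Q (b l)⟫_ℝ * (⟪b j, avg p (D.err μ i ω)⟫_ℝ *
      ⟪b l, avg p (D.err μ i ω)⟫_ℝ)) P := fun j l =>
    (h.integrable_err hμ i (((growth_inner_avg hp h.net (b j)).mul
      (growth_inner_avg hp h.net (b l))).mono (by norm_num))).const_mul _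
  have i2 := fun j => integrable_finsetSum Finset.univ fun l (_ : l ∈ Finset.univ) => i1 j l
  simp only [inner_op_expand b Q (avg p _)]
  rw [integral_finsetSum Finset.univ fun j _ => i2 j, Finset.mul_sum]
  refine Finset.sum_congr rfl fun j _ => ?_
  rw [integral_finsetSum Finset.univ fun l _ => i1 j l, Finset.mul_sum]
  refine Finset.sum_congr rfl fun l _ => ?_
  rw [integral_const_mul, mul_left_comm]
  congr 3
  funext ω
  exact mul_comm _ _

/-- Functions of the error of one agent that are quadratic up to third order, in the steady
state: the agents do not differ to first order in the step-size. -/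
lemma steady_agent (h : Setting D P μbar) (hμbar : 0 < μbar) {p : Fin N → ℝ}
    (W : ConsensusGauge M (D.A₁ * D.A₂) p) (hp : IsPerronVector D p)
    {G : Fin N → Matrix (Fin M) (Fin M) ℝ} (hG : IsLimitCov D P μbar G)
    {X Q : Matrix (Fin M) (Fin M) ℝ} (hX : X * D.Shat p + D.Shat p * X = Q)
    {F : Vec M → ℝ} {C : ℝ} (hC : 0 ≤ C) (hF : ∀ v, |F v - ⟪v, op Q v⟫_ℝ| ≤ C * ‖v‖ ^ 3)
    (k : Fin N) (hFi : ∀ μ ∈ Set.Ioo 0 μbar, ∀ i, Integrable (fun ω => F (D.err μ i ω k)) P) :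
    SteadyLimit (fun μ i => 1 / μ * ∫ ω, F (D.err μ i ω k) ∂P) (X * D.Khat p G).trace := by
  have hq := h.steady_avg_quadratic hμbar W hp hG hX
  have hU := growth_avg hp h.net (M := M)
  have hV := W.growth
  have hst := (h.steady_cross hμbar W hp).const_mul (C + 2 * ‖op Q‖)
  rw [mul_zero] at hst
  have hdiff : SteadyLimit (fun μ i => 1 / μ * (∫ ω, F (D.err μ i ω k) ∂P -
      ∫ ω, ⟪avg p (D.err μ i ω), op Q (avg p (D.err μ i ω))⟫_ℝ ∂P)) 0 := by
    refine hst.of_abs_le ?_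
    filter_upwards [Ioo_mem_nhdsGT hμbar] with μ hμ
    refine Eventually.of_forall fun i => ?_
    have hμ0 : 0 < μ := hμ.1
    have i2 : Integrable (fun ω => ⟪avg p (D.err μ i ω), op Q (avg p (D.err μ i ω))⟫_ℝ) P := by
      have hc := continuous_avg (M := M) p
      have g : PolyGrowth 2 (fun x : Fin N → Vec M => ⟪avg p x, op Q (avg p x)⟫_ℝ) := by
        simp only [inner_vec, op_apply]
        exact PolyGrowth.sum Finset.univ fun m _ => (growth_avg_coord hp h.net m).mul
          (PolyGrowth.sum Finset.univ fun m' _ => (growth_avg_coord hp h.net m').const_mul _)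
      exact h.integrable_err hμ i (g.mono (by norm_num))
    rw [← integral_sub (hFi μ hμ i) i2, sub_zero, abs_mul,
      abs_of_pos (show 0 < 1 / μ by positivity), mul_left_comm]
    refine mul_le_mul_of_nonneg_left (abs_integral_le_integral_abs.trans ?_) (by positivity)
    rw [← integral_const_mul]
    refine integral_mono ((hFi μ hμ i).sub i2).abs (Integrable.const_mul (h.integrable_err hμ i
      ((((hU.add hV).mul ((hV.mono (by norm_num)).add ((hU.add hV).pow 2)))).mono
        (by norm_num))) _) fun ω => ?_
    simp only
    set x := D.err μ i ω
    have hV0 := W.nonneg x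
    have hd : ‖x k - avg p x‖ ≤ W.V x := W.dist_le x k
    have hx : ‖x k‖ ≤ ‖avg p x‖ + W.V x := by
      have := norm_le_norm_add_norm_sub' (x k) (avg p x)
      linarith
    have e1 : |F (x k) - ⟪x k, op Q (x k)⟫_ℝ| ≤ C * (‖avg p x‖ + W.V x) ^ 3 :=
      (hF (x k)).trans (by gcongr)
    have e2 : ⟪x k, op Q (x k)⟫_ℝ - ⟪avg p x, op Q (avg p x)⟫_ℝ =
        ⟪x k, op Q (x k - avg p x)⟫_ℝ + ⟪x k - avg p x, op Q (avg p x)⟫_ℝ := by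
      simp only [map_sub, inner_sub_left, inner_sub_right]; ring
    have e3 : |⟪x k, op Q (x k - avg p x)⟫_ℝ| ≤ (‖avg p x‖ + W.V x) * (‖op Q‖ * W.V x) := by
      refine (abs_real_inner_le_norm _ _).trans (mul_le_mul hx ?_ (norm_nonneg _) (by positivity))
      exact ((op Q).le_opNorm _).trans (by gcongr)
    have e4 : |⟪x k - avg p x, op Q (avg p x)⟫_ℝ| ≤ W.V x * (‖op Q‖ * (‖avg p x‖ + W.V x)) := by
      refine (abs_real_inner_le_norm _ _).trans (mul_le_mul hd ?_ (norm_nonneg _) hV0)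
      exact ((op Q).le_opNorm _).trans (by gcongr; linarith)
    have e5 : F (x k) - ⟪avg p x, op Q (avg p x)⟫_ℝ = (F (x k) - ⟪x k, op Q (x k)⟫_ℝ) +
        (⟪x k, op Q (x k - avg p x)⟫_ℝ + ⟪x k - avg p x, op Q (avg p x)⟫_ℝ) := by
      rw [← e2]; ring
    rw [e5]
    refine (abs_add_le _ _).trans ((add_le_add e1 ((abs_add_le _ _).trans
      (add_le_add e3 e4))).trans ?_)
    have : 0 ≤ C * ((‖avg p x‖ + W.V x) * W.V x) := by positivity
    have : 0 ≤ ‖op Q‖ * (‖avg p x‖ + W.V x) ^ 3 := by positivity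
    nlinarith
  have := hdiff.add hq
  rw [zero_add] at this
  refine this.congr (Eventually.of_forall fun μ => Eventually.of_forall fun i => ?_)
  ring

end Setting

end Performance

end CoordDiffusion

namespace CoordDiffusion

section Performance

open scoped InnerProductSpace

variable {N M : ℕ} {Ω : Type*}

namespace Model

/-- The share of agent `k` in the aggregate risk; it does not depend on the step-size. -/
noncomputable def share (D : Model N M Ω) (p : Fin N → ℝ) (k : Fin N) : ℝ :=
  (∑ l, D.qhat p l)⁻¹ * D.qhat p k

lemma S_eq (D : Model N M Ω) (p : Fin N → ℝ) (μ : ℝ) : D.S p μ = μ • D.Shat p := by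
  rw [S, Shat, Finset.smul_sum]
  refine Finset.sum_congr rfl fun k _ => ?_
  rw [q_eq, smul_smul, mul_assoc]

lemma share_eq (D : Model N M Ω) (p : Fin N → ℝ) {μ : ℝ} (hμ : μ ≠ 0) (k : Fin N) :
    (∑ l, D.q p μ l)⁻¹ * D.q p μ k = D.share p k := by
  simp only [q_eq, share, ← Finset.mul_sum, mul_inv]
  field_simp

lemma Jbar_eq (D : Model N M Ω) (p : Fin N → ℝ) {μ : ℝ} (hμ : μ ≠ 0) (v : Vec M) :
    D.Jbar p μ v = ∑ k, D.share p k * D.J k v := by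
  simp only [Jbar, Finset.mul_sum, ← mul_assoc, D.share_eq p hμ]

lemma Hbar_eq (D : Model N M Ω) (p : Fin N → ℝ) {μ : ℝ} (hμ : μ ≠ 0) :
    D.Hbar p μ = ∑ k, D.share p k • D.H k := by
  simp only [Hbar, Finset.smul_sum, smul_smul, D.share_eq p hμ]

lemma share_nonneg (D : Model N M Ω) (hnet : NetworkConditions D) {p : Fin N → ℝ}
    (hp : IsPerronVector D p) (k : Fin N) : 0 ≤ D.share p k :=
  mul_nonneg (inv_nonneg.2 (Finset.sum_nonneg fun l _ => qhat_nonneg hp hnet l))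
    (qhat_nonneg hp hnet k)

lemma sum_share (D : Model N M Ω) (hnet : NetworkConditions D) {p : Fin N → ℝ}
    (hp : IsPerronVector D p) : ∑ k, D.share p k = 1 := by
  obtain ⟨k, hk⟩ := exists_qhat_pos hp hnet
  simp only [share, ← Finset.mul_sum]
  refine inv_mul_cancel₀ (ne_of_gt ?_)
  exact Finset.sum_pos' (fun l _ => qhat_nonneg hp hnet l) ⟨k, Finset.mem_univ k, hk⟩

end Model

/-- By the second-order expansion at the minimizer; third-order growth suffices, since the
iterates have fourth moments. -/
lemma CostBounds.growth_risk {D : Model N M Ω} {ν δ C : ℝ} (hb : CostBounds D ν δ C)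
    (hc : ∀ k, Continuous (D.J k)) (k : Fin N) :
    PolyGrowth 3 (fun v : Vec M => D.J k (D.wo - v)) := by
  refine ⟨(hc k).comp (by fun_prop), |D.J k D.wo| + δ + C, by
    have := hb.δ_pos; have := hb.C_nonneg; positivity, fun v => ?_⟩
  have h1 := hb.expand_risk k v
  have h2 : |⟪v, op (D.H k) v⟫_ℝ| ≤ δ * ‖v‖ ^ 2 :=
    (abs_real_inner_le_norm _ _).trans (by
      have := (op (D.H k)).le_of_opNorm_le (hb.hess_norm k) v
      nlinarith [norm_nonneg v])
  have h3 : D.J k (D.wo - v) = (D.J k (D.wo - v) - D.J k D.wo - 1 / 2 * ⟪v, op (D.H k) v⟫_ℝ) +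
      (D.J k D.wo + 1 / 2 * ⟪v, op (D.H k) v⟫_ℝ) := by ring
  have h4 : |1 / 2 * ⟪v, op (D.H k) v⟫_ℝ| = 1 / 2 * |⟪v, op (D.H k) v⟫_ℝ| := by
    rw [abs_mul, abs_of_pos (by norm_num : (0 : ℝ) < 1 / 2)]
  simp only
  rw [h3]
  refine (abs_add_le _ _).trans ((add_le_add h1 (abs_add_le _ _)).trans ?_)
  rw [h4]
  have hv := norm_nonneg v
  have g1 : 1 ≤ (1 + ‖v‖) ^ 3 := one_le_pow₀ (by linarith)
  have g2 : ‖v‖ ^ 2 ≤ (1 + ‖v‖) ^ 3 := by nlinarith [pow_nonneg hv 3, pow_nonneg hv 2]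
  have g3 : ‖v‖ ^ 3 ≤ (1 + ‖v‖) ^ 3 := by gcongr; linarith
  have f1 := mul_le_mul_of_nonneg_left g1 (abs_nonneg (D.J k D.wo))
  have f2 := mul_le_mul_of_nonneg_left g2 hb.δ_pos.le
  have f3 := mul_le_mul_of_nonneg_left g3 hb.C_nonneg
  have : 0 ≤ δ * ‖v‖ ^ 2 := mul_nonneg hb.δ_pos.le (by positivity)
  nlinarith

variable [MeasurableSpace Ω]

namespace Setting

variable {D : Model N M Ω} {P : Measure Ω} {μbar : ℝ}

lemma growth_aggregate (h : Setting D P μbar) (p : Fin N → ℝ) :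
    PolyGrowth 3 (fun v : Vec M => ∑ k, D.share p k * D.J k (D.wo - v)) := by
  obtain ⟨ν, δ, C, hb⟩ := h.exists_bounds
  exact PolyGrowth.sum Finset.univ fun k _ =>
    (hb.growth_risk (fun k => (h.cost.diff k).continuous) k).const_mul (D.share p k)

lemma inv_mul_Shat (h : Setting D P μbar) {p : Fin N → ℝ} (hp : IsPerronVector D p) :
    (D.Shat p)⁻¹ * D.Shat p = 1 ∧ D.Shat p * (D.Shat p)⁻¹ = 1 := by
  obtain ⟨ν, δ, C, hb⟩ := h.exists_bounds
  have h1 : (D.Shat p).PosDef :=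
    (hb.isHermitian_Shat p).posDef_iff_eigenvalues_pos.2 (hb.Shat_eigenvalues_pos h.net hp)
  have h2 := (Matrix.isUnit_iff_isUnit_det _).1 h1.isUnit
  exact ⟨Matrix.nonsing_inv_mul _ h2, Matrix.mul_nonsing_inv _ h2⟩

variable [IsProbabilityMeasure P]

lemma maskedCovSum_eq (h : Setting D P μbar) (p : Fin N → ℝ)
    (G : Fin N → Matrix (Fin M) (Fin M) ℝ) (μ : ℝ) (i : ℕ) :
    D.maskedCovSum P p G μ i = μ ^ 2 • D.Khat p G := by
  rw [Model.maskedCovSum, Model.Khat, Finset.smul_sum]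
  refine Finset.sum_congr rfl fun k _ => ?_
  rw [D.q_eq, smul_smul, mul_pow]
  congr 1
  ext a b
  rw [Model.maskedCov, Matrix.of_apply, Matrix.of_apply,
    ← h.integral_mask_mul_mask i (k, a) (k, b), ← integral_mul_const]
  refine integral_congr_ae (Eventually.of_forall fun ω => ?_)
  simp only [Matrix.mul_diagonal, Matrix.diagonal_mul]
  ring

lemma integrable_agent (h : Setting D P μbar) {μ : ℝ} (hμ : μ ∈ Set.Ioo 0 μbar) (i : ℕ)
    (k : Fin N) {F : Vec M → ℝ} (hF : PolyGrowth 4 F) :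
    Integrable (fun ω => F (D.err μ i ω k)) P :=
  h.integrable_err hμ i (F := fun x => F (x k)) (hF.comp (PolyGrowth.of_norm_le
    (continuous_apply k) (C := 1) fun x => by rw [one_mul]; exact norm_le_pi_norm x k)
    (continuous_apply k))

lemma integrable_moments (h : Setting D P μbar) (p : Fin N → ℝ) {μ : ℝ}
    (hμ : μ ∈ Set.Ioo 0 μbar) (k : Fin N) (i : ℕ) :
    Integrable (fun ω => ‖D.wo - D.iter μ i k ω‖ ^ 2) P ∧
      Integrable (fun ω => D.Jbar p μ (D.iter μ i k ω)) P := by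
  constructor
  · have g : PolyGrowth 1 (fun v : Vec M => ‖v‖) :=
      PolyGrowth.of_norm_le continuous_id (C := 1) fun z => by simp
    exact h.integrable_agent hμ i k ((g.pow 2).mono (by norm_num))
  · have := h.integrable_agent hμ i k ((h.growth_aggregate p).mono (by norm_num : 3 ≤ 4))
    refine this.congr (Eventually.of_forall fun ω => ?_)
    simp only [Model.err, sub_sub_cancel]
    exact (D.Jbar_eq p hμ.1.ne' _).symm

/-- The square of the norm is the quadratic form of `I`, whose Lyapunov solution is `S⁻¹ / 2`. -/
lemma exists_msd (h : Setting D P μbar) (hμbar : 0 < μbar) {p : Fin N → ℝ}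
    (W : ConsensusGauge M (D.A₁ * D.A₂) p) (hp : IsPerronVector D p)
    {G : Fin N → Matrix (Fin M) (Fin M) ℝ} (hG : IsLimitCov D P μbar G) :
    ∃ MSD : Fin N → ℝ → ℝ,
      (∀ k, IsFirstOrderValue (fun μ i => ∫ ω, ‖D.wo - D.iter μ i k ω‖ ^ 2 ∂P) (MSD k)) ∧
      ∀ μ : ℝ, 0 < μ → ∀ k i,
        MSD k μ = 1 / N * ∑ l, MSD l μ ∧
        MSD k μ = 1 / 2 * ((D.S p μ)⁻¹ * D.maskedCovSum P p G μ i).trace := by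
  obtain ⟨hl, hr⟩ := h.inv_mul_Shat hp
  set L := 1 / 2 * ((D.Shat p)⁻¹ * D.Khat p G).trace with hL
  refine ⟨fun _ μ => μ * L, fun k => ⟨L, ?_, fun μ _ => rfl⟩, fun μ hμ k i => ⟨?_, ?_⟩⟩
  · refine SteadyLimit.tendsto_limsup ?_
    have hX : ((1 / 2 : ℝ) • (D.Shat p)⁻¹) * D.Shat p + D.Shat p * ((1 / 2 : ℝ) • (D.Shat p)⁻¹) =
        1 := by
      rw [Matrix.smul_mul, Matrix.mul_smul, hl, hr, ← add_smul]
      norm_num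
    have := h.steady_agent hμbar W hp hG hX (F := fun v => ‖v‖ ^ 2) le_rfl (fun v => by
      rw [op, map_one, one_apply_eq_self, real_inner_self_eq_norm_sq]
      simp) k fun μ hμ i => (h.integrable_moments p hμ k i).1
    rwa [Matrix.smul_mul, Matrix.trace_smul, smul_eq_mul] at this
  · have : (N : ℝ) ≠ 0 := by
      have : 0 < N := k.pos
      positivity
    simp
    field_simp
  · have : (D.S p μ)⁻¹ = μ⁻¹ • (D.Shat p)⁻¹ := by
      refine Matrix.inv_eq_left_inv ?_
      rw [D.S_eq, Matrix.smul_mul, Matrix.mul_smul, hl, smul_smul, inv_mul_cancel₀ hμ.ne',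
        one_smul]
    rw [this, h.maskedCovSum_eq, Matrix.smul_mul, Matrix.mul_smul, Matrix.trace_smul,
      Matrix.trace_smul, hL, smul_eq_mul, smul_eq_mul]
    field_simp

/-- The aggregate risk is the quadratic form of half the aggregate Hessian up to third order. The
Lyapunov solution scales with the inverse of the step-size. -/
lemma exists_er (h : Setting D P μbar) (hμbar : 0 < μbar) {p : Fin N → ℝ}
    (W : ConsensusGauge M (D.A₁ * D.A₂) p) (hp : IsPerronVector D p)
    {G : Fin N → Matrix (Fin M) (Fin M) ℝ} (hG : IsLimitCov D P μbar G) :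
    ∃ ER : Fin N → ℝ → ℝ,
      (∀ k, IsFirstOrderValue
        (fun μ i => ∫ ω, (D.Jbar p μ (D.iter μ i k ω) - D.Jbar p μ D.wo) ∂P) (ER k)) ∧
      ∀ μ : ℝ, 0 < μ → ∃ X : Matrix (Fin M) (Fin M) ℝ,
        X * D.S p μ + D.S p μ * X = D.Hbar p μ ∧
        (∀ Y, Y * D.S p μ + D.S p μ * Y = D.Hbar p μ → Y = X) ∧
        ∀ k i,
          ER k μ = 1 / N * ∑ l, ER l μ ∧
          ER k μ = 1 / 2 * (X * D.maskedCovSum P p G μ i).trace := by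
  obtain ⟨ν, δ, C, hb⟩ := h.exists_bounds
  set H₁ := ∑ k, D.share p k • D.H k with hH₁
  obtain ⟨X, hX, hXu⟩ := exists_unique_lyapunov (hb.isHermitian_Shat p)
    (hb.Shat_eigenvalues_pos h.net hp) H₁
  set L := 1 / 2 * (X * D.Khat p G).trace with hL
  refine ⟨fun _ μ => μ * L, fun k => ⟨L, ?_, fun μ _ => rfl⟩, fun μ hμ =>
    ⟨μ⁻¹ • X, ?_, fun Y hY => ?_, fun k i => ⟨?_, ?_⟩⟩⟩
  · refine SteadyLimit.tendsto_limsup ?_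
    have hX' : ((1 / 2 : ℝ) • X) * D.Shat p + D.Shat p * ((1 / 2 : ℝ) • X) =
        (1 / 2 : ℝ) • H₁ := by
      rw [Matrix.smul_mul, Matrix.mul_smul, ← smul_add, hX]
    have hF : ∀ v : Vec M, |∑ k, D.share p k * (D.J k (D.wo - v) - D.J k D.wo) -
        ⟪v, op ((1 / 2 : ℝ) • H₁) v⟫_ℝ| ≤ C * ‖v‖ ^ 3 := fun v => by
      have e1 : ⟪v, op ((1 / 2 : ℝ) • H₁) v⟫_ℝ =
          ∑ k, D.share p k * (1 / 2 * ⟪v, op (D.H k) v⟫_ℝ) := by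
        rw [op, map_smul, hH₁, map_sum, smul_apply, sum_apply, inner_smul_right, inner_sum,
          Finset.mul_sum]
        refine Finset.sum_congr rfl fun l _ => ?_
        rw [map_smul, smul_apply, inner_smul_right]
        ring
      rw [e1, ← Finset.sum_sub_distrib]
      refine (Finset.abs_sum_le_sum_abs _ _).trans ?_
      calc _ ≤ ∑ k, D.share p k * (C * ‖v‖ ^ 3) := Finset.sum_le_sum fun k _ => by
            rw [← mul_sub, abs_mul, abs_of_nonneg (D.share_nonneg h.net hp k)]
            exact mul_le_mul_of_nonneg_left (hb.expand_risk k v) (D.share_nonneg h.net hp k)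
        _ = _ := by rw [← Finset.sum_mul, D.sum_share h.net hp, one_mul]
    have e2 : ∀ μ i ω, ∑ l, D.share p l * (D.J l (D.wo - D.err μ i ω k) - D.J l D.wo) =
        ∑ l, D.share p l * D.J l (D.wo - D.err μ i ω k) - ∑ l, D.share p l * D.J l D.wo :=
      fun μ i ω => by simp only [mul_sub, Finset.sum_sub_distrib]
    have := h.steady_agent hμbar W hp hG hX' hb.C_nonneg hF k fun μ hμ i => by
      simp only [e2]
      exact (h.integrable_agent hμ i k ((h.growth_aggregate p).mono (by norm_num : 3 ≤ 4))).sub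
        (integrable_const _)
    rw [Matrix.smul_mul, Matrix.trace_smul, smul_eq_mul] at this
    refine this.congr ?_
    filter_upwards [Ioo_mem_nhdsGT hμbar] with μ hμ
    refine Eventually.of_forall fun i => ?_
    simp only [e2]
    simp only [D.Jbar_eq p hμ.1.ne', Model.err, sub_sub_cancel]
  · rw [D.S_eq, D.Hbar_eq p hμ.ne', Matrix.smul_mul, Matrix.mul_smul, Matrix.smul_mul,
      Matrix.mul_smul, smul_smul, smul_smul, inv_mul_cancel₀ hμ.ne', mul_inv_cancel₀ hμ.ne',
      one_smul, one_smul, hX]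
  · rw [D.S_eq, D.Hbar_eq p hμ.ne', Matrix.smul_mul, Matrix.mul_smul] at hY
    rw [← hXu (μ • Y) (by rw [Matrix.smul_mul, Matrix.mul_smul]; exact hY), smul_smul,
      inv_mul_cancel₀ hμ.ne', one_smul]
  · have : (N : ℝ) ≠ 0 := by
      have : 0 < N := k.pos
      positivity
    simp
    field_simp
  · rw [h.maskedCovSum_eq, Matrix.smul_mul, Matrix.mul_smul, Matrix.trace_smul,
      Matrix.trace_smul, hL, smul_eq_mul, smul_eq_mul]
    field_simp

end Setting

end Performance

end CoordDiffusion

namespace CoordDiffusion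

/-! ### Second moments of the long-term model -/

section LongTerm

variable {N M : ℕ} {Ω : Type*}

namespace Model

/-- The part of the entries of the transition matrix that does not depend on the masks. -/
def Bfix (D : Model N M Ω) : Matrix (Fin N × Fin M) (Fin N × Fin M) ℝ :=
  (D.A₂ ⊗ₖ (1 : Matrix (Fin M) (Fin M) ℝ))ᵀ * (D.A₁ ⊗ₖ (1 : Matrix (Fin M) (Fin M) ℝ))ᵀ

/-- The coefficient of the mask `z` in the entries of the transition matrix. -/
noncomputable def Bcoef (D : Model N M Ω) (μ : ℝ) (z a b : Fin N × Fin M) : ℝ :=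
  -((D.A₂ ⊗ₖ (1 : Matrix (Fin M) (Fin M) ℝ))ᵀ a z * (μ * D.τ z.1) *
    (D.blockH * (D.A₁ ⊗ₖ (1 : Matrix (Fin M) (Fin M) ℝ))ᵀ) z b)

/-- The contribution of the gradient noise to one step of the long-term model. -/
noncomputable def drive (D : Model N M Ω) (μ : ℝ) (i : ℕ) (ω : Ω) : Fin N × Fin M → ℝ :=
  (D.A₂ ⊗ₖ (1 : Matrix (Fin M) (Fin M) ℝ))ᵀ *ᵥ (D.stepMask μ i ω *ᵥ D.noiseVec μ i ω)

lemma B_apply (D : Model N M Ω) (μ : ℝ) (i : ℕ) (ω : Ω) (a b : Fin N × Fin M) :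
    D.B μ i ω a b = D.Bfix a b + ∑ z : Fin N × Fin M, D.Bcoef μ z a b * D.mask z.1 i z.2 ω := by
  rw [B, mul_sub, sub_mul, mul_one, Matrix.sub_apply, sub_eq_add_neg, ← Bfix, mul_assoc, mul_assoc,
    Matrix.mul_apply (N := D.stepMask μ i ω * _), ← Finset.sum_neg_distrib]
  congr 1
  refine Finset.sum_congr rfl fun z _ => ?_
  rw [stepMask, Matrix.diagonal_mul, Bcoef]
  ring

lemma drive_apply (D : Model N M Ω) (μ : ℝ) (i : ℕ) (ω : Ω) (a : Fin N × Fin M) :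
    D.drive μ i ω a = ∑ z : Fin N × Fin M,
      (D.A₂ ⊗ₖ (1 : Matrix (Fin M) (Fin M) ℝ))ᵀ a z * (μ * D.τ z.1) *
        (D.mask z.1 i z.2 ω * D.noiseAt μ i ω z.1 z.2) := by
  rw [drive, Matrix.mulVec, dotProduct]
  refine Finset.sum_congr rfl fun z _ => ?_
  rw [stepMask, Matrix.mulVec_diagonal, noiseVec, noiseAt]
  ring

lemma drive_eq (D : Model N M Ω) (μ : ℝ) (i : ℕ) (ω : Ω) (k : Fin N) (m : Fin M) :
    D.drive μ i ω (k, m) = ∑ l, D.A₂ l k *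
      (μ * D.τ l * (D.mask l i m ω * D.noiseAt μ i ω l m)) := by
  rw [drive_apply, Fintype.sum_prod_type]
  refine Finset.sum_congr rfl fun l _ => ?_
  rw [Finset.sum_eq_single m (fun m' _ hne => by
    simp [hne]) (by simp)]
  simp
  ring

/-- The noise term is the difference between the update with the exact gradients and the actual
update, so it is known after the iteration. -/
lemma drive_eq_sub (D : Model N M Ω) (μ : ℝ) (i : ℕ) (ω : Ω) (k : Fin N) (m : Fin M) :
    D.drive μ i ω (k, m) = (∑ l, D.A₂ l k * D.combine (D.iter μ i) l ω m) -
      D.iter μ (i + 1) k ω m - ∑ l, D.A₂ l k * (μ * D.τ l * (D.mask l i m ω *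
        gradient (D.J l) (D.combine (D.iter μ i) l ω) m)) := by
  have h1 : D.iter μ (i + 1) k ω m = ∑ l, D.A₂ l k * (D.combine (D.iter μ i) l ω m -
      μ * D.τ l * (D.mask l i m ω * D.gradEst l i ω (D.combine (D.iter μ i) l ω) m)) := by
    simp [iter, maskedGrad]
  rw [drive_eq, h1, ← Finset.sum_sub_distrib, ← Finset.sum_sub_distrib]
  refine Finset.sum_congr rfl fun l _ => ?_
  simp only [noiseAt, noise, PiLp.sub_apply]
  ring

lemma longTerm_succ (D : Model N M Ω) (μ : ℝ) (x₀ : Ω → Fin N × Fin M → ℝ) (i : ℕ) (ω : Ω) :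
    D.longTerm μ x₀ (i + 1) ω = D.B μ i ω *ᵥ D.longTerm μ x₀ i ω + D.drive μ i ω := rfl

end Model

lemma measurable_mask_past (D : Model N M Ω) (μ : ℝ) (i : ℕ) (k : Fin N) (m : Fin M) :
    Measurable[D.past μ (i + 1)] (D.mask k i m) :=
  (measurable_mask_maskAlg D i k m).mono (maskAlg_le_past D μ i) le_rfl

lemma measurable_B_maskAlg (D : Model N M Ω) (μ : ℝ) (i : ℕ) (a b : Fin N × Fin M) :
    Measurable[D.maskAlg i] (fun ω => D.B μ i ω a b) := by
  simp only [D.B_apply]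
  exact (Finset.measurable_sum _ fun z _ =>
    (measurable_mask_maskAlg D i z.1 z.2).const_mul (D.Bcoef μ z a b)).const_add _

lemma measurable_mulVec_past (D : Model N M Ω) (μ : ℝ) (i : ℕ) {x : Ω → Fin N × Fin M → ℝ}
    (hx : Measurable[D.past μ i] x) :
    Measurable[D.past μ (i + 1)] (fun ω => D.B μ i ω *ᵥ x ω) := by
  refine @measurable_pi_lambda _ _ _ (D.past μ (i + 1)) _ _ fun a => ?_
  exact Finset.measurable_sum _ fun b _ =>
    ((measurable_B_maskAlg D μ i a b).mono (maskAlg_le_past D μ i) le_rfl).mul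
      (((measurable_pi_apply b).comp hx).mono (past_mono D μ i.le_succ) le_rfl)

variable [MeasurableSpace Ω]

namespace Setting

variable {D : Model N M Ω} {P : Measure Ω} {μbar μ : ℝ}

lemma abs_B_le (h : Setting D P μbar) (μ : ℝ) (i : ℕ) (ω : Ω) (a b : Fin N × Fin M) :
    |D.B μ i ω a b| ≤ |D.Bfix a b| + ∑ z : Fin N × Fin M, |D.Bcoef μ z a b| := by
  rw [D.B_apply]
  refine (abs_add_le _ _).trans (add_le_add le_rfl ((Finset.abs_sum_le_sum_abs _ _).trans
    (Finset.sum_le_sum fun z _ => ?_)))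
  rw [abs_mul]
  exact mul_le_of_le_one_right (abs_nonneg _) (h.abs_mask_le _ _ _ _)

lemma measurable_drive (h : Setting D P μbar) (μ : ℝ) (i : ℕ) :
    Measurable[D.past μ (i + 1)] (D.drive μ i) := by
  refine @measurable_pi_lambda _ _ _ (D.past μ (i + 1)) _ _ fun a => ?_
  obtain ⟨k, m⟩ := a
  have hcoord : Measurable (fun v : Vec M => v m) :=
    (continuous_apply m).measurable.comp (PiLp.continuous_ofLp 2 _).measurable
  have hc : ∀ l, Measurable[D.past μ (i + 1)] (D.combine (D.iter μ i) l) := fun l =>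
    (measurable_combine_past D μ i l).mono (past_mono D μ i.le_succ) le_rfl
  simp only [D.drive_eq_sub]
  refine Measurable.sub (Measurable.sub (Finset.measurable_sum _ fun l _ =>
    (hcoord.comp (hc l)).const_mul (D.A₂ l k))
    (hcoord.comp (measurable_iter_past D μ (i + 1) k))) (Finset.measurable_sum _ fun l _ => ?_)
  exact (((measurable_mask_past D μ i l m).mul (hcoord.comp ((h.continuous_grad l).measurable.comp
    (hc l)))).const_mul (μ * D.τ l)).const_mul (D.A₂ l k)

lemma measurable_longTerm (h : Setting D P μbar) (μ : ℝ) {x₀ : Ω → Fin N × Fin M → ℝ}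
    (hx : Measurable[D.past μ 0] x₀) (i : ℕ) : Measurable[D.past μ i] (D.longTerm μ x₀ i) := by
  induction i with
  | zero => exact hx
  | succ i ih => exact (measurable_mulVec_past D μ i ih).add (h.measurable_drive μ i)

lemma memLp_mulVec (h : Setting D P μbar) (μ : ℝ) (i : ℕ) {x : Ω → Fin N × Fin M → ℝ}
    (hx : MemLp x 2 P) : MemLp (fun ω => D.B μ i ω *ᵥ x ω) 2 P := by
  refine memLp_pi_iff.2 fun a => memLp_finsetSum _ fun b _ => ?_
  have h1 : MemLp (fun ω => x ω b) 2 P := memLp_pi_iff.1 hx b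
  refine h1.of_le_mul (c := |D.Bfix a b| + ∑ z : Fin N × Fin M, |D.Bcoef μ z a b|)
    (((measurable_B_maskAlg D μ i a b).mono (h.maskAlg_le i) le_rfl).aestronglyMeasurable.mul h1.1)
    (Eventually.of_forall fun ω => ?_)
  rw [norm_mul]
  exact mul_le_mul_of_nonneg_right (h.abs_B_le μ i ω a b) (norm_nonneg _)

variable [IsProbabilityMeasure P]

lemma memLp_drive (h : Setting D P μbar) (hμ : μ ∈ Set.Ioo 0 μbar) (i : ℕ) (a : Fin N × Fin M) :
    MemLp (fun ω => D.drive μ i ω a) 2 P := by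
  simp only [D.drive_apply]
  refine memLp_finsetSum _ fun z _ => MemLp.const_mul ?_ _
  have h1 : MemLp (fun ω => D.noiseAt μ i ω z.1 z.2) 2 P :=
    (EuclideanSpace.proj (𝕜 := ℝ) z.2).comp_memLp'
      ((memLp_pi_iff.1 (h.memLp_noiseAt hμ i) z.1).mono_exponent (by norm_num))
  refine h1.of_le ((h.reg.mask_meas _ _ _).aestronglyMeasurable.mul h1.1)
    (Eventually.of_forall fun ω => ?_)
  rw [norm_mul]
  exact mul_le_of_le_one_left (norm_nonneg _) (h.abs_mask_le _ _ _ _)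

lemma memLp_longTerm (h : Setting D P μbar) (hμ : μ ∈ Set.Ioo 0 μbar)
    {x₀ : Ω → Fin N × Fin M → ℝ} (hx : MemLp x₀ 2 P) (i : ℕ) : MemLp (D.longTerm μ x₀ i) 2 P := by
  induction i with
  | zero => exact hx
  | succ i ih => exact (h.memLp_mulVec μ i ih).add (memLp_pi_iff.2 fun a => h.memLp_drive hμ i a)

/-- The second moments of the transition matrix are the same at all iterations. -/
lemma integral_B_mul_B (h : Setting D P μbar) (μ : ℝ) (i j : ℕ) (a b c d : Fin N × Fin M) :
    ∫ ω, D.B μ i ω a b * D.B μ i ω c d ∂P = ∫ ω, D.B μ j ω a b * D.B μ j ω c d ∂P := by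
  have key : ∀ i, ∫ ω, D.B μ i ω a b * D.B μ i ω c d ∂P = D.Bfix a b * D.Bfix c d +
      (∑ z : Fin N × Fin M, (D.Bfix a b * D.Bcoef μ z c d + D.Bfix c d * D.Bcoef μ z a b) *
        (1 - D.r z.1)) + ∑ z : Fin N × Fin M, ∑ z' : Fin N × Fin M,
          D.Bcoef μ z a b * D.Bcoef μ z' c d * D.maskCorr z z' := by
    intro i
    have e1 : ∀ ω, D.B μ i ω a b * D.B μ i ω c d = D.Bfix a b * D.Bfix c d +
      (∑ z : Fin N × Fin M, (D.Bfix a b * D.Bcoef μ z c d + D.Bfix c d * D.Bcoef μ z a b) *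
        D.mask z.1 i z.2 ω) + ∑ z : Fin N × Fin M, ∑ z' : Fin N × Fin M,
          D.Bcoef μ z a b * D.Bcoef μ z' c d * (D.mask z.1 i z.2 ω * D.mask z'.1 i z'.2 ω) := by
      intro ω
      have e2 := Finset.sum_mul_sum (Finset.univ : Finset (Fin N × Fin M))
        (Finset.univ : Finset (Fin N × Fin M)) (fun z => D.Bcoef μ z a b * D.mask z.1 i z.2 ω)
        (fun z => D.Bcoef μ z c d * D.mask z.1 i z.2 ω)
      rw [D.B_apply, D.B_apply, add_mul, mul_add, mul_add, e2]
      simp only [add_mul, Finset.sum_add_distrib, Finset.mul_sum, Finset.sum_mul]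
      have e3 : ∀ z z' : Fin N × Fin M, D.Bcoef μ z a b * D.mask z.1 i z.2 ω *
          (D.Bcoef μ z' c d * D.mask z'.1 i z'.2 ω) = D.Bcoef μ z a b * D.Bcoef μ z' c d *
          (D.mask z.1 i z.2 ω * D.mask z'.1 i z'.2 ω) := fun z z' => by ring
      have e4 : ∀ z : Fin N × Fin M, D.Bcoef μ z a b * D.mask z.1 i z.2 ω * D.Bfix c d =
        D.Bfix c d * D.Bcoef μ z a b * D.mask z.1 i z.2 ω := fun z => by ring
      simp only [e3, e4, mul_assoc]
      ring
    have im : ∀ z : Fin N × Fin M, Integrable (D.mask z.1 i z.2) P := fun z =>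
      h.integrable_mask z.1 i z.2
    have imm : ∀ z z' : Fin N × Fin M, Integrable (fun ω => D.mask z.1 i z.2 ω *
        D.mask z'.1 i z'.2 ω) P := fun z z' =>
      (im z').bdd_mul (c := 1) (h.reg.mask_meas _ _ _).aestronglyMeasurable
        (Eventually.of_forall fun ω => h.abs_mask_le _ _ _ _)
    have s1 := integrable_finsetSum Finset.univ fun z (_ : z ∈ Finset.univ) =>
      (im z).const_mul (D.Bfix a b * D.Bcoef μ z c d + D.Bfix c d * D.Bcoef μ z a b)
    have s2 := fun z => integrable_finsetSum Finset.univ fun z' (_ : z' ∈ Finset.univ) =>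
      (imm z z').const_mul (D.Bcoef μ z a b * D.Bcoef μ z' c d)
    have s3 := integrable_finsetSum Finset.univ fun z (_ : z ∈ Finset.univ) => s2 z
    have s4 : Integrable (fun ω => D.Bfix a b * D.Bfix c d + ∑ z : Fin N × Fin M,
      (D.Bfix a b * D.Bcoef μ z c d + D.Bfix c d * D.Bcoef μ z a b) * D.mask z.1 i z.2 ω) P :=
      (integrable_const _).add s1
    simp only [e1]
    rw [integral_add s4 s3, integral_add (integrable_const _) s1, integral_const, probReal_univ,
      one_smul]
    congr 1
    · congr 1
      rw [integral_finsetSum Finset.univ fun z _ => (im z).const_mul _]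
      refine Finset.sum_congr rfl fun z _ => ?_
      rw [integral_const_mul, h.integral_mask]
    · rw [integral_finsetSum Finset.univ fun z _ => s2 z]
      refine Finset.sum_congr rfl fun z _ => ?_
      rw [integral_finsetSum Finset.univ fun z' _ => (imm z z').const_mul _]
      refine Finset.sum_congr rfl fun z' _ => ?_
      rw [integral_const_mul, h.integral_mask_mul_mask]
  rw [key i, key j]

end Setting

end LongTerm

end CoordDiffusion

namespace CoordDiffusion

section LongTerm

variable {N M : ℕ} {Ω : Type*} [MeasurableSpace Ω]

/-- The mixed second moments of two random vectors, listed as a vector. -/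
noncomputable def moments (P : Measure Ω) (x y : Ω → Fin N × Fin M → ℝ)
    (e : (Fin N × Fin M) × (Fin N × Fin M)) : ℝ :=
  ∫ ω, x ω e.1 * y ω e.2 ∂P

namespace Setting

variable {D : Model N M Ω} {P : Measure Ω} {μbar μ : ℝ} [IsProbabilityMeasure P]

/-- One step with the transition matrix acts on second moments as `Fᵀ`. -/
lemma moments_mulVec (h : Setting D P μbar) (hμ : μ ∈ Set.Ioo 0 μbar) (i j : ℕ)
    {x y : Ω → Fin N × Fin M → ℝ} (hx : Measurable[D.past μ i] x) (hx2 : MemLp x 2 P)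
    (hy : Measurable[D.past μ i] y) (hy2 : MemLp y 2 P) :
    moments P (fun ω => D.B μ i ω *ᵥ x ω) (fun ω => D.B μ i ω *ᵥ y ω) =
      (D.F P μ j)ᵀ *ᵥ moments P x y := by
  funext ⟨a, c⟩
  have hc : ∀ b, MemLp (fun ω => x ω b) 2 P := fun b => memLp_pi_iff.1 hx2 b
  have hc' : ∀ b, MemLp (fun ω => y ω b) 2 P := fun b => memLp_pi_iff.1 hy2 b
  have hxx : ∀ b d, Integrable (fun ω => x ω b * y ω d) P := fun b d =>
    (hc b).integrable_mul (hc' d)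
  have hxm : ∀ b d, Measurable[D.avail μ i] (fun ω => x ω b * y ω d) := fun b d =>
    (((measurable_pi_apply b).comp hx).mul ((measurable_pi_apply d).comp hy)).mono
      (past_le_avail D μ i) le_rfl
  have hBm : ∀ b d, Measurable[D.maskAlg i] (fun ω => D.B μ i ω a b * D.B μ i ω c d) :=
    fun b d => (measurable_B_maskAlg D μ i a b).mul (measurable_B_maskAlg D μ i c d)
  have hint : ∀ b d, Integrable (fun ω => D.B μ i ω a b * D.B μ i ω c d * (x ω b * y ω d)) P := by
    intro b d
    refine (hxx b d).bdd_mul (c := (|D.Bfix a b| + ∑ z : Fin N × Fin M, |D.Bcoef μ z a b|) *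
      (|D.Bfix c d| + ∑ z : Fin N × Fin M, |D.Bcoef μ z c d|))
      ((hBm b d).mono (h.maskAlg_le i) le_rfl).aestronglyMeasurable
      (Eventually.of_forall fun ω => ?_)
    rw [norm_mul]
    exact mul_le_mul (h.abs_B_le μ i ω a b) (h.abs_B_le μ i ω c d) (norm_nonneg _) (by positivity)
  have e1 : ∀ ω, (D.B μ i ω *ᵥ x ω) a * (D.B μ i ω *ᵥ y ω) c = ∑ b, ∑ d,
      D.B μ i ω a b * D.B μ i ω c d * (x ω b * y ω d) := fun ω => by
    rw [Matrix.mulVec, Matrix.mulVec, dotProduct, dotProduct, Finset.sum_mul_sum]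
    exact Finset.sum_congr rfl fun b _ => Finset.sum_congr rfl fun d _ => by ring
  have hint' := fun b => integrable_finsetSum Finset.univ fun d (_ : d ∈ Finset.univ) => hint b d
  simp only [moments, e1]
  rw [integral_finsetSum Finset.univ fun b _ => hint' b]
  refine Eq.trans ?_ (Fintype.sum_prod_type
    (fun e => (D.F P μ j)ᵀ (a, c) e * ∫ ω, x ω e.1 * y ω e.2 ∂P)).symm
  refine Finset.sum_congr rfl fun b _ => ?_
  rw [integral_finsetSum Finset.univ fun d _ => hint b d]
  refine Finset.sum_congr rfl fun d _ => ?_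
  rw [h.integral_mul_of_maskAlg hμ i (hBm b d) (hxm b d), h.integral_B_mul_B μ i j]
  rfl

/-- The gradient noise is uncorrelated with the propagated state. -/
lemma integral_mulVec_mul_drive (h : Setting D P μbar) (hμ : μ ∈ Set.Ioo 0 μbar) (i : ℕ)
    {x : Ω → Fin N × Fin M → ℝ} (hx : Measurable[D.past μ i] x) (hx2 : MemLp x 2 P)
    (a c : Fin N × Fin M) : ∫ ω, (D.B μ i ω *ᵥ x ω) a * D.drive μ i ω c ∂P = 0 := by
  have hc : ∀ b, MemLp (fun ω => x ω b) 2 P := fun b => memLp_pi_iff.1 hx2 b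
  have hs : ∀ z : Fin N × Fin M, MemLp (fun ω => D.noiseAt μ i ω z.1 z.2) 2 P := fun z =>
    (EuclideanSpace.proj (𝕜 := ℝ) z.2).comp_memLp'
      ((memLp_pi_iff.1 (h.memLp_noiseAt hμ i) z.1).mono_exponent (by norm_num))
  have hxs : ∀ b (z : Fin N × Fin M),
      Integrable (fun ω => x ω b * D.noiseAt μ i ω z.1 z.2) P := fun b z =>
    (hc b).integrable_mul (hs z)
  have hxb : ∀ b, Measurable[D.past μ i] (fun ω => x ω b) := fun b =>
    (measurable_pi_apply b).comp hx
  have hcoord : ∀ m : Fin M, Measurable (fun v : Vec M => v m) := fun m =>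
    (continuous_apply m).measurable.comp (PiLp.continuous_ofLp 2 _).measurable
  have hxm : ∀ b (z : Fin N × Fin M), Measurable[D.avail μ i]
      (fun ω => x ω b * D.noiseAt μ i ω z.1 z.2) := fun b z =>
    ((hxb b).mono (past_le_avail D μ i) le_rfl).mul
      ((hcoord z.2).comp ((measurable_pi_apply z.1).comp (h.measurable_noiseAt μ i)))
  have hBm : ∀ b (z : Fin N × Fin M), Measurable[D.maskAlg i]
      (fun ω => D.B μ i ω a b * D.mask z.1 i z.2 ω) := fun b z =>
    (measurable_B_maskAlg D μ i a b).mul (measurable_mask_maskAlg D i z.1 z.2)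
  have hint : ∀ b (z : Fin N × Fin M), Integrable (fun ω => D.B μ i ω a b * D.mask z.1 i z.2 ω *
      (x ω b * D.noiseAt μ i ω z.1 z.2)) P := by
    intro b z
    refine (hxs b z).bdd_mul (c := |D.Bfix a b| + ∑ z : Fin N × Fin M, |D.Bcoef μ z a b|)
      ((hBm b z).mono (h.maskAlg_le i) le_rfl).aestronglyMeasurable
      (Eventually.of_forall fun ω => ?_)
    rw [norm_mul]
    exact (mul_le_of_le_one_right (norm_nonneg _) (h.abs_mask_le _ _ _ _)).trans
      (h.abs_B_le μ i ω a b)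
  have e1 : ∀ ω, (D.B μ i ω *ᵥ x ω) a * D.drive μ i ω c = ∑ b, ∑ z : Fin N × Fin M,
      (D.A₂ ⊗ₖ (1 : Matrix (Fin M) (Fin M) ℝ))ᵀ c z * (μ * D.τ z.1) *
      (D.B μ i ω a b * D.mask z.1 i z.2 ω * (x ω b * D.noiseAt μ i ω z.1 z.2)) := fun ω => by
    rw [D.drive_apply, Matrix.mulVec, dotProduct, Finset.sum_mul_sum]
    exact Finset.sum_congr rfl fun b _ => Finset.sum_congr rfl fun z _ => by ring
  simp only [e1]
  have hint' := fun b => integrable_finsetSum Finset.univ fun z (_ : z ∈ Finset.univ) =>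
    (hint b z).const_mul
      ((D.A₂ ⊗ₖ (1 : Matrix (Fin M) (Fin M) ℝ))ᵀ c z * (μ * D.τ z.1))
  rw [integral_finsetSum Finset.univ fun b _ => hint' b]
  refine Finset.sum_eq_zero fun b _ => ?_
  rw [integral_finsetSum Finset.univ fun z _ => (hint b z).const_mul _]
  refine Finset.sum_eq_zero fun z _ => ?_
  rw [integral_const_mul, h.integral_mul_of_maskAlg hμ i (hBm b z) (hxm b z),
    h.integral_mul_noise hμ i z.1 z.2 (hxb b) (hxs b z), mul_zero, mul_zero]

lemma moments_longTerm_succ (h : Setting D P μbar) (hμ : μ ∈ Set.Ioo 0 μbar)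
    {x₀ : Ω → Fin N × Fin M → ℝ} (hx : Measurable[D.past μ 0] x₀) (hx2 : MemLp x₀ 2 P)
    (i j : ℕ) : moments P (D.longTerm μ x₀ (i + 1)) (D.longTerm μ x₀ (i + 1)) =
      (D.F P μ j)ᵀ *ᵥ moments P (D.longTerm μ x₀ i) (D.longTerm μ x₀ i) +
        moments P (D.drive μ i) (D.drive μ i) := by
  have hm := h.measurable_longTerm μ hx i
  have hL := h.memLp_longTerm hμ hx2 i
  rw [← h.moments_mulVec hμ i j hm hL hm hL]
  funext ⟨a, c⟩
  have hB := h.memLp_mulVec μ i hL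
  have hBc : ∀ a, MemLp (fun ω => (D.B μ i ω *ᵥ D.longTerm μ x₀ i ω) a) 2 P := fun a =>
    memLp_pi_iff.1 hB a
  have hd := h.memLp_drive hμ i
  have i1 : Integrable (fun ω => (D.B μ i ω *ᵥ D.longTerm μ x₀ i ω) a *
      (D.B μ i ω *ᵥ D.longTerm μ x₀ i ω) c) P := (hBc a).integrable_mul (hBc c)
  have i2 : Integrable (fun ω => D.drive μ i ω a * D.drive μ i ω c) P :=
    (hd a).integrable_mul (hd c)
  have i3 : ∀ a c, Integrable (fun ω => (D.B μ i ω *ᵥ D.longTerm μ x₀ i ω) a *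
      D.drive μ i ω c) P := fun a c => (hBc a).integrable_mul (hd c)
  have i4 : Integrable (fun ω => (D.B μ i ω *ᵥ D.longTerm μ x₀ i ω) a * D.drive μ i ω c +
      (D.B μ i ω *ᵥ D.longTerm μ x₀ i ω) c * D.drive μ i ω a) P := (i3 a c).add (i3 c a)
  have i5 : Integrable (fun ω => (D.B μ i ω *ᵥ D.longTerm μ x₀ i ω) a *
      (D.B μ i ω *ᵥ D.longTerm μ x₀ i ω) c + D.drive μ i ω a * D.drive μ i ω c) P := i1.add i2
  have e1 : ∀ ω, D.longTerm μ x₀ (i + 1) ω a * D.longTerm μ x₀ (i + 1) ω c =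
      ((D.B μ i ω *ᵥ D.longTerm μ x₀ i ω) a * (D.B μ i ω *ᵥ D.longTerm μ x₀ i ω) c +
        D.drive μ i ω a * D.drive μ i ω c) +
      ((D.B μ i ω *ᵥ D.longTerm μ x₀ i ω) a * D.drive μ i ω c +
        (D.B μ i ω *ᵥ D.longTerm μ x₀ i ω) c * D.drive μ i ω a) := fun ω => by
    rw [D.longTerm_succ, Pi.add_apply, Pi.add_apply]
    ring
  simp only [moments, Pi.add_apply, e1]
  rw [integral_add i5 i4, integral_add i1 i2, integral_add (i3 a c) (i3 c a),
    h.integral_mulVec_mul_drive hμ i hm hL, h.integral_mulVec_mul_drive hμ i hm hL, add_zero,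
    add_zero]

/-- The part of the second moments that depends on the initial error is propagated by `Fᵀ`. -/
lemma moments_longTerm_sub (h : Setting D P μbar) (hμ : μ ∈ Set.Ioo 0 μbar)
    {x₀ : Ω → Fin N × Fin M → ℝ} (hx : Measurable[D.past μ 0] x₀) (hx2 : MemLp x₀ 2 P)
    (i j : ℕ) : moments P (D.longTerm μ x₀ i) (D.longTerm μ x₀ i) -
      moments P (D.longTerm μ 0 i) (D.longTerm μ 0 i) =
      (D.F P μ j)ᵀ ^ i *ᵥ moments P x₀ x₀ := by
  have h0 : Measurable[D.past μ 0] (0 : Ω → Fin N × Fin M → ℝ) := measurable_const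
  induction i with
  | zero =>
    have : moments P (D.longTerm μ 0 0) (D.longTerm μ 0 0) = 0 := by
      funext e
      simp [moments, Model.longTerm]
    rw [this, sub_zero, pow_zero, Matrix.one_mulVec]
    rfl
  | succ i ih =>
    rw [h.moments_longTerm_succ hμ hx hx2 i j, h.moments_longTerm_succ hμ h0 MemLp.zero i j,
      add_sub_add_right_eq_sub, ← Matrix.mulVec_sub, ih, Matrix.mulVec_mulVec, ← pow_succ']

lemma longTermVar_eq (h : Setting D P μbar) (hμ : μ ∈ Set.Ioo 0 μbar)
    {x₀ : Ω → Fin N × Fin M → ℝ} (hx2 : MemLp x₀ 2 P) (k : Fin N) (i : ℕ) :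
    D.longTermVar P μ x₀ k i =
      ∑ m, moments P (D.longTerm μ x₀ i) (D.longTerm μ x₀ i) ((k, m), (k, m)) := by
  have hL := h.memLp_longTerm hμ hx2 i
  have hc : ∀ a, MemLp (fun ω => D.longTerm μ x₀ i ω a) 2 P := fun a => memLp_pi_iff.1 hL a
  simp only [Model.longTermVar, moments, pow_two]
  exact integral_finsetSum Finset.univ fun m _ => (hc (k, m)).integrable_mul (hc (k, m))

lemma longTermVar_sub (h : Setting D P μbar) (hμ : μ ∈ Set.Ioo 0 μbar)
    {x₀ : Ω → Fin N × Fin M → ℝ} (hx : Measurable[D.past μ 0] x₀) (hx2 : MemLp x₀ 2 P)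
    (k : Fin N) (i j : ℕ) : D.longTermVar P μ x₀ k i - D.longTermVar P μ 0 k i =
      ∑ m, ((D.F P μ j)ᵀ ^ i *ᵥ moments P x₀ x₀) ((k, m), (k, m)) := by
  rw [h.longTermVar_eq hμ hx2, h.longTermVar_eq hμ MemLp.zero, ← Finset.sum_sub_distrib,
    ← h.moments_longTerm_sub hμ hx hx2 i j]
  rfl

/-- The weighted variance relation of the long-term model. -/
lemma sum_longTermVar (h : Setting D P μbar) (hμ : μ ∈ Set.Ioo 0 μbar)
    {x₀ : Ω → Fin N × Fin M → ℝ} (hx : Measurable[D.past μ 0] x₀) (hx2 : MemLp x₀ 2 P)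
    (i j : ℕ) : ∑ k, D.longTermVar P μ x₀ k i =
      ∫ ω, weightedSq (x₀ ω) ((D.F P μ j ^ i) *ᵥ vecOne (Fin N × Fin M)) ∂P +
        ∑ k, D.longTermVar P μ 0 k i := by
  have hc : ∀ b, MemLp (fun ω => x₀ ω b) 2 P := fun b => memLp_pi_iff.1 hx2 b
  rw [← sub_eq_iff_eq_add, ← Finset.sum_sub_distrib,
    Finset.sum_congr rfl fun k _ => h.longTermVar_sub hμ hx hx2 k i j]
  set v := (D.F P μ j)ᵀ ^ i *ᵥ moments P x₀ x₀ with hv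
  have e1 : ∑ k, ∑ m, v ((k, m), (k, m)) = vecOne (Fin N × Fin M) ⬝ᵥ v := by
    rw [dotProduct, Fintype.sum_prod_type, ← Fintype.sum_prod_type']
    refine Finset.sum_congr rfl fun a _ => ?_
    rw [Finset.sum_eq_single a (fun b _ hb => by simp [vecOne, hb.symm])
      (by simp)]
    simp [vecOne]
  rw [e1, hv, ← Matrix.transpose_pow, Matrix.dotProduct_mulVec, Matrix.vecMul_transpose]
  set σ := (D.F P μ j ^ i) *ᵥ vecOne (Fin N × Fin M) with hσ
  have i1 : ∀ a b, Integrable (fun ω => x₀ ω a * σ (a, b) * x₀ ω b) P := fun a b => by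
    have : Integrable (fun ω => σ (a, b) * (x₀ ω a * x₀ ω b)) P :=
      ((hc a).integrable_mul (hc b)).const_mul _
    refine this.congr (Eventually.of_forall fun ω => ?_)
    ring
  have i2 := fun a => integrable_finsetSum Finset.univ fun b (_ : b ∈ Finset.univ) => i1 a b
  simp only [weightedSq]
  rw [integral_finsetSum Finset.univ fun a _ => i2 a, dotProduct, Fintype.sum_prod_type]
  refine Finset.sum_congr rfl fun a _ => ?_
  rw [integral_finsetSum Finset.univ fun b _ => i1 a b]
  refine Finset.sum_congr rfl fun b _ => ?_
  rw [moments, ← integral_const_mul]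
  refine integral_congr_ae (Eventually.of_forall fun ω => ?_)
  simp only
  ring

end Setting

end LongTerm

end CoordDiffusion

namespace CoordDiffusion

/-! ### The long-term model without noise -/

section FreeRun

variable {N M : ℕ} {Ω : Type*}

/-- The entries of the vectors of all agents, stacked. -/
def flat (y : Fin N → Vec M) (z : Fin N × Fin M) : ℝ := y z.1 z.2

lemma kronecker_one_mulVec_flat (A : Matrix (Fin N) (Fin N) ℝ) (y : Fin N → Vec M) :
    (A ⊗ₖ (1 : Matrix (Fin M) (Fin M) ℝ))ᵀ *ᵥ flat y = flat (mix A y) := by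
  funext ⟨k, m⟩
  rw [Matrix.mulVec, dotProduct, Fintype.sum_prod_type]
  simp only [flat, mix, WithLp.ofLp_sum, Finset.sum_apply]
  refine Finset.sum_congr rfl fun l _ => ?_
  rw [Finset.sum_eq_single m (fun m' _ hne => by simp [hne]) (by simp)]
  simp

namespace Model

/-- One step of the long-term model without noise, with masks `g`. -/
noncomputable def free (D : Model N M Ω) (μ : ℝ) (g : Fin N → Fin M → ℝ) (x : Fin N → Vec M) :
    Fin N → Vec M :=
  D.next μ g x fun l => op (D.H l) (mix D.A₁ x l)

/-- The long-term model without noise, started from the errors `x`. -/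
noncomputable def freeRun (D : Model N M Ω) (μ : ℝ) (x : Fin N → Vec M) :
    ℕ → Ω → Fin N → Vec M
  | 0 => fun _ => x
  | i + 1 => fun ω => D.free μ (D.maskAt i ω) (D.freeRun μ x i ω)

/-- The transition matrix acts on stacked vectors as one step without noise. -/
lemma B_mulVec_flat (D : Model N M Ω) (μ : ℝ) (i : ℕ) (ω : Ω) (y : Fin N → Vec M) :
    D.B μ i ω *ᵥ flat y = flat (D.free μ (D.maskAt i ω) y) := by
  have h1 : D.blockH *ᵥ flat (mix D.A₁ y) = flat fun l => op (D.H l) (mix D.A₁ y l) := by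
    funext ⟨k, m⟩
    rw [Matrix.mulVec, dotProduct, Fintype.sum_prod_type,
      Finset.sum_eq_single k (fun l _ hne => by simp [blockH, hne.symm]) (by simp)]
    simp only [flat, op_apply, blockH, Matrix.of_apply, if_true]
  have h2 : ∀ d : Fin N → Vec M, D.stepMask μ i ω *ᵥ flat d =
      flat fun l => (μ * D.τ l) • hmul (D.maskAt i ω l) (d l) := fun d => by
    funext ⟨k, m⟩
    rw [stepMask, Matrix.mulVec_diagonal]
    simp [flat, maskAt, mul_assoc]
  have h3 : ∀ u v : Fin N → Vec M, flat u - flat v = flat (fun l => u l - v l) := fun u v => rfl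
  rw [B, ← Matrix.mulVec_mulVec, ← Matrix.mulVec_mulVec, kronecker_one_mulVec_flat,
    Matrix.sub_mulVec, Matrix.one_mulVec, ← Matrix.mulVec_mulVec, h1, h2, h3,
    kronecker_one_mulVec_flat]
  rfl

end Model

lemma measurable_freeRun (D : Model N M Ω) (μ : ℝ) (x : Fin N → Vec M) (i : ℕ) :
    Measurable[D.past μ i] (D.freeRun μ x i) := by
  have hcoord : ∀ m : Fin M, Measurable (fun v : Vec M => v m) := fun m =>
    (continuous_apply m).measurable.comp (PiLp.continuous_ofLp 2 _).measurable
  induction i with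
  | zero => exact measurable_const
  | succ i ih =>
    have h1 : Measurable[D.past μ (i + 1)] (fun ω => flat (D.freeRun μ x (i + 1) ω)) := by
      have : (fun ω => flat (D.freeRun μ x (i + 1) ω)) =
          fun ω => D.B μ i ω *ᵥ flat (D.freeRun μ x i ω) := by
        funext ω
        rw [D.B_mulVec_flat]
        rfl
      rw [this]
      refine measurable_mulVec_past D μ i ?_
      refine @measurable_pi_lambda _ _ _ (D.past μ i) _ _ fun z => ?_
      exact (hcoord z.2).comp ((measurable_pi_apply z.1).comp ih)
    refine @measurable_pi_lambda _ _ _ (D.past μ (i + 1)) _ _ fun k => ?_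
    refine (WithLp.measurable_toLp 2 (Fin M → ℝ)).comp ?_
    refine @measurable_pi_lambda _ _ _ (D.past μ (i + 1)) _ _ fun m => ?_
    exact (measurable_pi_apply (k, m)).comp h1

variable [MeasurableSpace Ω]

namespace Setting

variable {D : Model N M Ω} {P : Measure Ω} {μbar μ : ℝ}

/-- Runs without noise are bounded at each time, since the masks are bounded. -/
lemma exists_norm_freeRun_le (h : Setting D P μbar) (μ : ℝ) (x : Fin N → Vec M) (i : ℕ) :
    ∃ C, ∀ ω, ‖D.freeRun μ x i ω‖ ≤ C := by
  have hmix : ∀ {A : Matrix (Fin N) (Fin N) ℝ} (hA : IsLeftStochastic A) (y : Fin N → Vec M),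
      ‖mix A y‖ ≤ N * ‖y‖ := fun hA y =>
    (pi_norm_le_iff_of_nonneg (by positivity)).2 fun k => (norm_mix_le hA y k).trans (sum_norm_le y)
  induction i with
  | zero => exact ⟨‖x‖, fun ω => le_rfl⟩
  | succ i ih =>
    obtain ⟨C, hC⟩ := ih
    have hC0 : 0 ≤ C ∨ IsEmpty Ω := by
      rcases isEmpty_or_nonempty Ω with h | ⟨⟨ω⟩⟩
      · exact Or.inr h
      · exact Or.inl ((norm_nonneg _).trans (hC ω))
    rcases hC0 with hC0 | hemp
    swap
    · exact ⟨0, fun ω => hemp.elim ω⟩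
    set K := ∑ l, |μ * D.τ l| * ‖op (D.H l)‖ with hK
    have hK0 : 0 ≤ K := by positivity
    refine ⟨N * (N * C + K * (N * C)), fun ω => (hmix h.net.A₂_stoch _).trans ?_⟩
    refine mul_le_mul_of_nonneg_left ?_ N.cast_nonneg
    refine (pi_norm_le_iff_of_nonneg (by positivity)).2 fun l => ?_
    have h1 : ‖mix D.A₁ (D.freeRun μ x i ω) l‖ ≤ N * C :=
      (norm_le_pi_norm _ l).trans ((hmix h.net.A₁_stoch _).trans
        (mul_le_mul_of_nonneg_left (hC ω) N.cast_nonneg))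
    refine (norm_sub_le _ _).trans (add_le_add h1 ?_)
    rw [norm_smul, Real.norm_eq_abs]
    calc _ ≤ |μ * D.τ l| * (‖op (D.H l)‖ * (N * C)) := by
          refine mul_le_mul_of_nonneg_left ((norm_hmul_le (fun m => h.abs_mask_le l i m ω) _).trans
            ((ContinuousLinearMap.le_opNorm _ _).trans ?_)) (abs_nonneg _)
          exact mul_le_mul_of_nonneg_left h1 (norm_nonneg _)
      _ = |μ * D.τ l| * ‖op (D.H l)‖ * (N * C) := by ring
      _ ≤ K * (N * C) := by
          refine mul_le_mul_of_nonneg_right ?_ (by positivity)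
          exact Finset.single_le_sum (f := fun l => |μ * D.τ l| * ‖op (D.H l)‖)
            (fun l _ => by positivity) (Finset.mem_univ l)

variable [IsProbabilityMeasure P]

lemma memLp_freeRun (h : Setting D P μbar) (μ : ℝ) (x : Fin N → Vec M) (i : ℕ) (q : ENNReal) :
    MemLp (D.freeRun μ x i) q P := by
  obtain ⟨C, hC⟩ := h.exists_norm_freeRun_le μ x i
  exact MemLp.of_bound ((measurable_freeRun D μ x i).mono (h.past_le μ i)
    le_rfl).aestronglyMeasurable C (Eventually.of_forall hC)

lemma integrable_freeRun (h : Setting D P μbar) (μ : ℝ) (x : Fin N → Vec M) (i : ℕ) {n : ℕ}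
    {F : (Fin N → Vec M) → ℝ} (hF : PolyGrowth n F) :
    Integrable (fun ω => F (D.freeRun μ x i ω)) P :=
  hF.integrable (h.memLp_freeRun μ x i n)

lemma memLp_flat_freeRun (h : Setting D P μbar) (μ : ℝ) (x : Fin N → Vec M) (i : ℕ) :
    MemLp (fun ω => flat (D.freeRun μ x i ω)) 2 P :=
  memLp_pi_iff.2 fun z => (EuclideanSpace.proj (𝕜 := ℝ) z.2).comp_memLp'
    (memLp_pi_iff.1 (h.memLp_freeRun μ x i 2) z.1)

/-- The mixed moments of two runs without noise are governed by the powers of `Fᵀ`. -/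
lemma moments_freeRun (h : Setting D P μbar) (hμ : μ ∈ Set.Ioo 0 μbar) (x y : Fin N → Vec M)
    (i j : ℕ) : moments P (fun ω => flat (D.freeRun μ x i ω)) (fun ω => flat (D.freeRun μ y i ω)) =
      (D.F P μ j)ᵀ ^ i *ᵥ fun e => flat x e.1 * flat y e.2 := by
  have hm : ∀ (x : Fin N → Vec M) (i : ℕ),
      Measurable[D.past μ i] (fun ω => flat (D.freeRun μ x i ω)) := fun x i => by
    refine @measurable_pi_lambda _ _ _ (D.past μ i) _ _ fun z => ?_
    exact ((continuous_apply z.2).measurable.comp (PiLp.continuous_ofLp 2 _).measurable).comp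
      ((measurable_pi_apply z.1).comp (measurable_freeRun D μ x i))
  induction i with
  | zero =>
    funext e
    simp [moments, Model.freeRun]
  | succ i ih =>
    rw [pow_succ', ← Matrix.mulVec_mulVec, ← ih, ← h.moments_mulVec hμ i j (hm x i)
      (h.memLp_flat_freeRun μ x i) (hm y i) (h.memLp_flat_freeRun μ y i)]
    simp only [D.B_mulVec_flat]
    rfl

/-- The transient part of the error variance of an agent is the error variance of the run without
noise. -/
lemma longTermVar_sub_eq (h : Setting D P μbar) (hμ : μ ∈ Set.Ioo 0 μbar) (x : Fin N → Vec M)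
    (k : Fin N) (i : ℕ) : D.longTermVar P μ (fun _ => flat x) k i - D.longTermVar P μ 0 k i =
      ∫ ω, ‖D.freeRun μ x i ω k‖ ^ 2 ∂P := by
  have hc : ∀ m, Integrable (fun ω => flat (D.freeRun μ x i ω) (k, m) *
      flat (D.freeRun μ x i ω) (k, m)) P := fun m =>
    (memLp_pi_iff.1 (h.memLp_flat_freeRun μ x i) (k, m)).integrable_mul
      (memLp_pi_iff.1 (h.memLp_flat_freeRun μ x i) (k, m))
  have h1 : moments P (fun _ => flat x) (fun _ => flat x) = fun e => flat x e.1 * flat x e.2 := by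
    funext e
    simp [moments]
  rw [h.longTermVar_sub hμ measurable_const (memLp_const _) k i 0, h1,
    ← h.moments_freeRun hμ x x i 0]
  simp only [norm_sq_vec, moments]
  rw [← integral_finsetSum Finset.univ fun m _ => hc m]
  refine integral_congr_ae (Eventually.of_forall fun ω => ?_)
  exact Finset.sum_congr rfl fun m _ => (pow_two _).symm

end Setting

end FreeRun

end CoordDiffusion

namespace CoordDiffusion

/-! ### Decay of the runs without noise -/

section FreeRun

open scoped InnerProductSpace

variable {N M : ℕ} {Ω : Type*} {D : Model N M Ω} {ν δ C : ℝ}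

lemma CostBounds.norm_op_H_le (hb : CostBounds D ν δ C) (k : Fin N) (v : Vec M) :
    ‖op (D.H k) v‖ ≤ δ * ‖v‖ :=
  ((op (D.H k)).le_opNorm v).trans (mul_le_mul_of_nonneg_right (hb.hess_norm k) (norm_nonneg v))

lemma sum_op_mix_le (hb : CostBounds D ν δ C) (hnet : NetworkConditions D) {p : Fin N → ℝ}
    (W : ConsensusGauge M (D.A₁ * D.A₂) p) (x : Fin N → Vec M) :
    ∑ l, ‖op (D.H l) (mix D.A₁ x l)‖ ≤ N * δ * (‖avg p x‖ + W.V x) := by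
  calc _ ≤ ∑ _l : Fin N, δ * (‖avg p x‖ + W.V x) := Finset.sum_le_sum fun l _ =>
        (hb.norm_op_H_le l _).trans (mul_le_mul_of_nonneg_left (W.mix_le hnet.A₁_stoch x l)
          hb.δ_pos.le)
    _ = _ := by simp; ring

lemma gauge_free_le (hb : CostBounds D ν δ C) (hnet : NetworkConditions D) {p : Fin N → ℝ}
    (W : ConsensusGauge M (D.A₁ * D.A₂) p) {μ : ℝ} (hμ : 0 ≤ μ) {g : Fin N → Fin M → ℝ}
    (hg : ∀ l m, |g l m| ≤ 1) (x : Fin N → Vec M) :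
    W.V (D.free μ g x) ≤ W.ρ * W.V x + μ * (W.C * N * (N * δ)) * (‖avg p x‖ + W.V x) := by
  refine (W.next_le hnet hμ hg x _).trans (add_le_add le_rfl ?_)
  have hC := W.C_nonneg
  calc _ ≤ μ * (W.C * N) * (N * δ * (‖avg p x‖ + W.V x)) :=
        mul_le_mul_of_nonneg_left (sum_op_mix_le hb hnet W x) (by positivity)
    _ = _ := by ring

lemma norm_pull_le (hb : CostBounds D ν δ C) (hnet : NetworkConditions D) {p : Fin N → ℝ}
    (hp : IsPerronVector D p) (W : ConsensusGauge M (D.A₁ * D.A₂) p) {g : Fin N → Fin M → ℝ}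
    (hg : ∀ l m, |g l m| ≤ 1) (x : Fin N → Vec M) :
    ‖∑ l, D.qhat p l • hmul (g l) (op (D.H l) (mix D.A₁ x l))‖ ≤
      N * δ * (‖avg p x‖ + W.V x) :=
  (norm_sum_hmul_le (qhat_nonneg hp hnet) (qhat_le_one hp hnet) hg _).trans
    (sum_op_mix_le hb hnet W x)

lemma growth_op_mix_coord (hb : CostBounds D ν δ C) (hnet : NetworkConditions D) (l : Fin N)
    (m : Fin M) : PolyGrowth 1 (fun x : Fin N → Vec M => op (D.H l) (mix D.A₁ x l) m) := by
  refine (growth_coord m).comp (PolyGrowth.of_norm_le (by fun_prop) (C := δ * N) fun x => ?_)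
    (by fun_prop)
  rw [mul_assoc]
  exact (hb.norm_op_H_le l _).trans (mul_le_mul_of_nonneg_left
    ((norm_mix_le hnet.A₁_stoch x l).trans (sum_norm_le x)) hb.δ_pos.le)

lemma measurable_comp_freeRun {F : (Fin N → Vec M) → ℝ} (hF : Continuous F) (D : Model N M Ω)
    (μ : ℝ) (x : Fin N → Vec M) (i : ℕ) [MeasurableSpace Ω] :
    Measurable[D.avail μ i] (fun ω => F (D.freeRun μ x i ω)) :=
  hF.measurable.comp ((measurable_freeRun D μ x i).mono (past_le_avail D μ i) le_rfl)

variable [MeasurableSpace Ω]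

namespace Setting

variable {P : Measure Ω} {μbar : ℝ} [IsProbabilityMeasure P]

/-- The mean pull of the masked linearized gradients towards the origin. -/
lemma integral_free_pull_ge (h : Setting D P μbar) {p : Fin N → ℝ}
    (W : ConsensusGauge M (D.A₁ * D.A₂) p) (hp : IsPerronVector D p) (hb : CostBounds D ν δ C)
    {lam : ℝ} (hlam : ∀ u : Vec M, lam * ‖u‖ ^ 2 ≤ ⟪u, op (D.Shat p) u⟫_ℝ) {μ : ℝ}
    (hμ : μ ∈ Set.Ioo 0 μbar) (x : Fin N → Vec M) (i : ℕ) :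
    Integrable (fun ω => ⟪avg p (D.freeRun μ x i ω), ∑ l, D.qhat p l •
      hmul (D.maskAt i ω l) (op (D.H l) (mix D.A₁ (D.freeRun μ x i ω) l))⟫_ℝ) P ∧
    ∫ ω, (lam * ‖avg p (D.freeRun μ x i ω)‖ ^ 2 -
      N * δ * (‖avg p (D.freeRun μ x i ω)‖ * W.V (D.freeRun μ x i ω))) ∂P ≤
    ∫ ω, ⟪avg p (D.freeRun μ x i ω), ∑ l, D.qhat p l •
      hmul (D.maskAt i ω l) (op (D.H l) (mix D.A₁ (D.freeRun μ x i ω) l))⟫_ℝ ∂P := by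
  have hU := growth_avg hp h.net (M := M)
  have hV := W.growth
  have hYg : ∀ l m, PolyGrowth 2 (fun y : Fin N → Vec M =>
      avg p y m * op (D.H l) (mix D.A₁ y l) m) := fun l m =>
    (growth_avg_coord hp h.net m).mul (growth_op_mix_coord hb h.net l m)
  have hi := fun l m => h.integrable_freeRun μ x i (hYg l m)
  obtain ⟨i1, e1⟩ := h.integral_masked_sum hμ i (D.qhat p)
    (fun l m => measurable_comp_freeRun (hYg l m).1 D μ x i) hi
  simp only [inner_sum_hmul]
  refine ⟨i1, ?_⟩
  have e2 : ∀ l, ∑ m, ∫ ω, avg p (D.freeRun μ x i ω) m *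
      op (D.H l) (mix D.A₁ (D.freeRun μ x i ω) l) m ∂P = ∫ ω, ⟪avg p (D.freeRun μ x i ω),
        op (D.H l) (mix D.A₁ (D.freeRun μ x i ω) l)⟫_ℝ ∂P := fun l => by
    rw [← integral_finsetSum Finset.univ fun m _ => hi l m]
    simp only [inner_vec]
  have i2 : ∀ l, Integrable (fun ω => ⟪avg p (D.freeRun μ x i ω),
      op (D.H l) (mix D.A₁ (D.freeRun μ x i ω) l)⟫_ℝ) P := fun l => by
    simp only [inner_vec]
    exact integrable_finsetSum Finset.univ fun m _ => hi l m
  have i3 := fun l => (i2 l).const_mul (D.qhat p l * (1 - D.r l))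
  have i4 : Integrable (fun ω => lam * ‖avg p (D.freeRun μ x i ω)‖ ^ 2 -
      N * δ * (‖avg p (D.freeRun μ x i ω)‖ * W.V (D.freeRun μ x i ω))) P :=
    ((h.integrable_freeRun μ x i (hU.pow 2)).const_mul _).sub
      ((h.integrable_freeRun μ x i (hU.mul hV)).const_mul _)
  simp only [e1, e2, ← integral_const_mul]
  rw [← integral_finsetSum Finset.univ fun l _ => i3 l]
  refine integral_mono i4 (integrable_finsetSum Finset.univ fun l _ => i3 l) fun ω => ?_
  simp only
  set y := D.freeRun μ x i ω
  have e3 := hlam (avg p y)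
  rw [D.inner_Shat] at e3
  have e4 : ∑ l, D.qhat p l * (1 - D.r l) * ⟪avg p y, op (D.H l) (avg p y)⟫_ℝ ≤
      ∑ l, (D.qhat p l * (1 - D.r l) * ⟪avg p y, op (D.H l) (mix D.A₁ y l)⟫_ℝ +
        δ * (‖avg p y‖ * W.V y)) := by
    refine Finset.sum_le_sum fun l _ => ?_
    have f1 : ⟪avg p y, op (D.H l) (avg p y)⟫_ℝ - ⟪avg p y, op (D.H l) (mix D.A₁ y l)⟫_ℝ ≤
        δ * (‖avg p y‖ * W.V y) := by
      rw [← inner_sub_right, ← map_sub]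
      refine (real_inner_le_norm _ _).trans ?_
      have := (hb.norm_op_H_le l (avg p y - mix D.A₁ y l)).trans (mul_le_mul_of_nonneg_left
        ((norm_sub_rev _ _).trans_le (W.mix_sub_le h.net.A₁_stoch y l)) hb.δ_pos.le)
      calc _ ≤ ‖avg p y‖ * (δ * W.V y) := mul_le_mul_of_nonneg_left this (norm_nonneg _)
        _ = _ := by ring
    have hq0 := qhat_nonneg hp h.net l
    have hq1 := qhat_le_one hp h.net l
    have hr0 := h.net.r_nonneg l
    have hr1 := h.net.r_lt l
    have f2 : 0 ≤ D.qhat p l * (1 - D.r l) := mul_nonneg hq0 (by linarith)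
    have f3 : D.qhat p l * (1 - D.r l) ≤ 1 := mul_le_one₀ hq1 (by linarith) (by linarith)
    have f4 : 0 ≤ δ * (‖avg p y‖ * W.V y) :=
      mul_nonneg hb.δ_pos.le (mul_nonneg (norm_nonneg _) (W.nonneg _))
    have f5 := mul_le_mul_of_nonneg_left f1 f2
    have f6 := mul_le_mul_of_nonneg_right f3 f4
    linarith
  rw [Finset.sum_add_distrib] at e4
  simp only [Finset.sum_const, Finset.card_univ, Fintype.card_fin, nsmul_eq_mul] at e4
  linarith

/-- One step of the second moments of the network average and of the disagreement of a run without
noise. -/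
lemma exists_free_step (h : Setting D P μbar) {p : Fin N → ℝ}
    (W : ConsensusGauge M (D.A₁ * D.A₂) p) (hp : IsPerronVector D p)
    {lam : ℝ} (hlam : ∀ u : Vec M, lam * ‖u‖ ^ 2 ≤ ⟪u, op (D.Shat p) u⟫_ℝ) :
    ∃ K ρ : ℝ, 0 ≤ K ∧ 0 ≤ ρ ∧ ρ < 1 ∧ ∀ μ ∈ Set.Ioo 0 μbar, μ < 1 → ∀ x i,
      ∫ ω, ‖avg p (D.freeRun μ x (i + 1) ω)‖ ^ 2 ∂P ≤
        (1 - 2 * μ * lam + K * μ ^ 2) * ∫ ω, ‖avg p (D.freeRun μ x i ω)‖ ^ 2 ∂P +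
          K * ∫ ω, W.V (D.freeRun μ x i ω) ^ 2 ∂P ∧
      ∫ ω, W.V (D.freeRun μ x (i + 1) ω) ^ 2 ∂P ≤
        (ρ + K * μ ^ 2) * ∫ ω, W.V (D.freeRun μ x i ω) ^ 2 ∂P +
          K * μ ^ 2 * ∫ ω, ‖avg p (D.freeRun μ x i ω)‖ ^ 2 ∂P := by
  obtain ⟨ν, δ, C, hb⟩ := h.exists_bounds
  have hδ := hb.δ_pos
  have hU := growth_avg hp h.net (M := M)
  have hV := W.growth
  have hρ1 := W.ρ_lt
  have hρ0 := W.ρ_nonneg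
  have hC := W.C_nonneg
  set ρ₁ := (1 + W.ρ) / 2 with hρ₁
  obtain ⟨K₁, hK₁, hpow⟩ := exists_pow_add_le 2 (by norm_num) hρ0
    (show W.ρ < ρ₁ by rw [hρ₁]; linarith) (show ρ₁ ≤ 1 by rw [hρ₁]; linarith)
  set A := N * δ with hA
  have hA0 : 0 ≤ A := by positivity
  set E := W.C * N * A with hE
  have hE0 : 0 ≤ E := by positivity
  refine ⟨1 + 3 * A ^ 2 + 2 * K₁ * E ^ 2, ρ₁, by positivity, by positivity, by
    rw [hρ₁]; linarith, fun μ hμ hμ1 x i => ?_⟩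
  have hμ0 : 0 < μ := hμ.1
  have ia : ∀ i, Integrable (fun ω => ‖avg p (D.freeRun μ x i ω)‖ ^ 2) P := fun i =>
    h.integrable_freeRun μ x i (hU.pow 2)
  have ib : ∀ i, Integrable (fun ω => W.V (D.freeRun μ x i ω) ^ 2) P := fun i =>
    h.integrable_freeRun μ x i (hV.pow 2)
  have iab : Integrable (fun ω => ‖avg p (D.freeRun μ x i ω)‖ * W.V (D.freeRun μ x i ω)) P :=
    h.integrable_freeRun μ x i (hU.mul hV)
  have ha0 : 0 ≤ ∫ ω, ‖avg p (D.freeRun μ x i ω)‖ ^ 2 ∂P := integral_nonneg fun ω => sq_nonneg _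
  have hb0 : 0 ≤ ∫ ω, W.V (D.freeRun μ x i ω) ^ 2 ∂P := integral_nonneg fun ω => sq_nonneg _
  have hmask : ∀ ω l m, |D.maskAt i ω l m| ≤ 1 := fun ω l m => h.abs_mask_le l i m ω
  have hμ2 : μ ^ 2 ≤ 1 := pow_le_one₀ hμ0.le hμ1.le
  constructor
  · obtain ⟨ip, hpull⟩ := h.integral_free_pull_ge W hp hb hlam hμ x i
    rw [← hA, integral_sub ((ia i).const_mul _) (iab.const_mul _), integral_const_mul,
      integral_const_mul] at hpull
    set Q : Ω → ℝ := fun ω => ⟪avg p (D.freeRun μ x i ω), ∑ l, D.qhat p l •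
      hmul (D.maskAt i ω l) (op (D.H l) (mix D.A₁ (D.freeRun μ x i ω) l))⟫_ℝ with hQ
    have e2 : ∫ ω, ‖avg p (D.freeRun μ x (i + 1) ω)‖ ^ 2 ∂P ≤
        ∫ ω, ((1 + 2 * A ^ 2 * μ ^ 2) * ‖avg p (D.freeRun μ x i ω)‖ ^ 2 + -(2 * μ) * Q ω +
          2 * A ^ 2 * μ ^ 2 * W.V (D.freeRun μ x i ω) ^ 2) ∂P := by
      refine integral_mono (ia (i + 1)) (integrable_linear₃ _ _ _ (ia i) ip (ib i)) fun ω => ?_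
      simp only [Model.freeRun, Model.free, hQ]
      rw [D.avg_next hp.1, norm_sub_sq_real, inner_smul_right, norm_smul,
        Real.norm_of_nonneg hμ0.le, mul_pow]
      have f1 := norm_pull_le hb h.net hp W (hmask ω) (D.freeRun μ x i ω)
      rw [← hA] at f1
      have f2 := pow_le_pow_left₀ (norm_nonneg _) f1 2
      set u := ‖avg p (D.freeRun μ x i ω)‖
      set v := W.V (D.freeRun μ x i ω)
      have f3 : (A * (u + v)) ^ 2 ≤ 2 * A ^ 2 * (u ^ 2 + v ^ 2) := by
        nlinarith [sq_nonneg (A * u - A * v)]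
      have f4 := mul_le_mul_of_nonneg_left (f2.trans f3) (sq_nonneg μ)
      linarith
    rw [integral_linear₃ _ _ _ (ia i) ip (ib i)] at e2
    -- the mixed moment is split so that its weight on the average is of second order
    have e3 : 2 * μ * (A * ∫ ω, ‖avg p (D.freeRun μ x i ω)‖ * W.V (D.freeRun μ x i ω) ∂P) ≤
        μ ^ 2 * ∫ ω, ‖avg p (D.freeRun μ x i ω)‖ ^ 2 ∂P +
          A ^ 2 * ∫ ω, W.V (D.freeRun μ x i ω) ^ 2 ∂P := by
      rw [← integral_const_mul, ← integral_const_mul, ← integral_const_mul, ← integral_const_mul,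
        ← integral_add ((ia i).const_mul _) ((ib i).const_mul _)]
      refine integral_mono ((iab.const_mul A).const_mul (2 * μ))
        (((ia i).const_mul _).add ((ib i).const_mul _)) fun ω => ?_
      simp only
      nlinarith [sq_nonneg (μ * ‖avg p (D.freeRun μ x i ω)‖ - A * W.V (D.freeRun μ x i ω))]
    set a := ∫ ω, ‖avg p (D.freeRun μ x i ω)‖ ^ 2 ∂P
    set b := ∫ ω, W.V (D.freeRun μ x i ω) ^ 2 ∂P
    have e4 := mul_le_mul_of_nonneg_left hpull (show 0 ≤ 2 * μ by positivity)
    have e5 : 2 * A ^ 2 * μ ^ 2 * b ≤ 2 * A ^ 2 * b := by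
      have := mul_le_mul_of_nonneg_left hμ2 (show 0 ≤ 2 * A ^ 2 * b by positivity)
      linarith
    have e6 : 0 ≤ (A ^ 2 + 2 * K₁ * E ^ 2) * μ ^ 2 * a + (1 + 2 * K₁ * E ^ 2) * b := by
      positivity
    linarith
  · have e1 : ∫ ω, W.V (D.freeRun μ x (i + 1) ω) ^ 2 ∂P ≤
        ∫ ω, ((ρ₁ + 2 * K₁ * E ^ 2 * μ ^ 2) * W.V (D.freeRun μ x i ω) ^ 2 +
          2 * K₁ * E ^ 2 * μ ^ 2 * ‖avg p (D.freeRun μ x i ω)‖ ^ 2) ∂P := by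
      refine integral_mono (ib (i + 1)) (((ib i).const_mul _).add ((ia i).const_mul _)) fun ω => ?_
      simp only
      have f1 := gauge_free_le hb h.net W hμ0.le (hmask ω) (D.freeRun μ x i ω)
      rw [← hA, ← hE] at f1
      have f0 : 0 ≤ W.V (D.freeRun μ x i ω) := W.nonneg _
      have f2 := hpow (W.V (D.freeRun μ x i ω)) (μ * E * (‖avg p (D.freeRun μ x i ω)‖ +
        W.V (D.freeRun μ x i ω))) f0 (by positivity)
      refine (pow_le_pow_left₀ (W.nonneg _) f1 2).trans (f2.trans ?_)
      set u := ‖avg p (D.freeRun μ x i ω)‖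
      set v := W.V (D.freeRun μ x i ω)
      have f3 : (μ * E * (u + v)) ^ 2 ≤ μ ^ 2 * E ^ 2 * (2 * (u ^ 2 + v ^ 2)) := by
        rw [mul_pow, mul_pow]
        refine mul_le_mul_of_nonneg_left ?_ (by positivity)
        nlinarith [sq_nonneg (u - v)]
      have f4 := mul_le_mul_of_nonneg_left f3 hK₁
      linarith
    rw [integral_add ((ib i).const_mul _) ((ia i).const_mul _), integral_const_mul,
      integral_const_mul] at e1
    set a := ∫ ω, ‖avg p (D.freeRun μ x i ω)‖ ^ 2 ∂P
    set b := ∫ ω, W.V (D.freeRun μ x i ω) ^ 2 ∂P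
    have e6 : 0 ≤ (1 + 3 * A ^ 2) * μ ^ 2 * (a + b) := by positivity
    linarith

/-- Runs without noise decay at least at the rate `1 - 2 μ λ + O(μ²)`, for every lower bound `λ`
of the weighted Hessian. -/
lemma exists_freeRun_le (h : Setting D P μbar) {p : Fin N → ℝ}
    (W : ConsensusGauge M (D.A₁ * D.A₂) p) (hp : IsPerronVector D p)
    {lam : ℝ} (hlam : ∀ u : Vec M, lam * ‖u‖ ^ 2 ≤ ⟪u, op (D.Shat p) u⟫_ℝ) :
    ∃ K μ₀ : ℝ, 0 ≤ K ∧ 0 < μ₀ ∧ ∀ μ ∈ Set.Ioo 0 μbar, μ < μ₀ →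
      0 ≤ 1 - 2 * μ * lam + K * μ ^ 2 ∧ ∀ x, ∃ T, 0 ≤ T ∧ ∀ i k,
        ∫ ω, ‖D.freeRun μ x i ω k‖ ^ 2 ∂P ≤ T * (1 - 2 * μ * lam + K * μ ^ 2) ^ i := by
  obtain ⟨K, ρ, hK, hρ0, hρ, hstep⟩ := h.exists_free_step W hp hlam
  have hU := growth_avg hp h.net (M := M)
  have hV := W.growth
  have h1 : 0 < 1 - ρ := sub_pos.2 hρ
  -- the weight of the disagreement absorbs its influence on the average
  set w := 2 * K / (1 - ρ) + 1 with hw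
  have hw1 : 1 ≤ w := by rw [hw]; linarith [show 0 ≤ 2 * K / (1 - ρ) by positivity]
  have hwK : K ≤ w * ((1 - ρ) / 2) := by
    rw [hw, add_mul, div_mul_div_comm, mul_comm (1 - ρ) 2, mul_div_mul_right _ _ h1.ne',
      mul_div_cancel_left₀ _ two_ne_zero]
    linarith
  refine ⟨K + w * K, min 1 ((1 - ρ) / (4 * |lam| + 1)), by positivity,
    lt_min one_pos (by positivity), fun μ hμ hμ₀ => ?_⟩
  obtain ⟨m1, m2⟩ := lt_min_iff.1 hμ₀
  rw [lt_div_iff₀ (by positivity)] at m2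
  have hμ0 : 0 < μ := hμ.1
  have m3 : 2 * μ * lam ≤ (1 - ρ) / 2 := by
    have := mul_le_mul_of_nonneg_left (le_abs_self lam) hμ0.le
    linarith
  set θ := 1 - 2 * μ * lam + (K + w * K) * μ ^ 2 with hθ
  have hθ0 : 0 ≤ θ := by
    have : 0 ≤ (K + w * K) * μ ^ 2 := by positivity
    rw [hθ]; linarith
  refine ⟨hθ0, fun x => ?_⟩
  set a := fun i => ∫ ω, ‖avg p (D.freeRun μ x i ω)‖ ^ 2 ∂P with ha
  set b := fun i => ∫ ω, W.V (D.freeRun μ x i ω) ^ 2 ∂P with hbdef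
  have ha0 : ∀ i, 0 ≤ a i := fun i => integral_nonneg fun ω => sq_nonneg _
  have hb0 : ∀ i, 0 ≤ b i := fun i => integral_nonneg fun ω => sq_nonneg _
  have hT : ∀ i, a i + w * b i ≤ (a 0 + w * b 0) * θ ^ i := by
    intro i
    induction i with
    | zero => simp
    | succ i ih =>
      obtain ⟨s1, s2⟩ := hstep μ hμ m1 x i
      have e1 : a (i + 1) ≤ (1 - 2 * μ * lam + K * μ ^ 2) * a i + K * b i := s1
      have e2 : b (i + 1) ≤ (ρ + K * μ ^ 2) * b i + K * μ ^ 2 * a i := s2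
      have e3 := mul_le_mul_of_nonneg_left e2 (show 0 ≤ w by linarith)
      have e4 := mul_le_mul_of_nonneg_right hwK (hb0 i)
      have e5 : w * (ρ + (1 - ρ) / 2 + K * μ ^ 2) * b i ≤ w * θ * b i := by
        refine mul_le_mul_of_nonneg_right (mul_le_mul_of_nonneg_left ?_ (by linarith)) (hb0 i)
        have : 0 ≤ w * K * μ ^ 2 := by positivity
        rw [hθ]; linarith
      calc a (i + 1) + w * b (i + 1) ≤ θ * (a i + w * b i) := by
            rw [hθ] at e5 ⊢; linarith
        _ ≤ θ * ((a 0 + w * b 0) * θ ^ i) := mul_le_mul_of_nonneg_left ih hθ0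
        _ = _ := by ring
  have hw0 : 0 ≤ w := by linarith
  refine ⟨2 * (a 0 + w * b 0), by have := ha0 0; have := hb0 0; positivity, fun i k => ?_⟩
  have ia := h.integrable_freeRun μ x i (hU.pow 2)
  have ib := h.integrable_freeRun μ x i (hV.pow 2)
  have ik : Integrable (fun ω => ‖D.freeRun μ x i ω k‖ ^ 2) P :=
    (memLp_pi_iff.1 (h.memLp_freeRun μ x i 2) k).integrable_norm_pow (by norm_num)
  have e1 : ∫ ω, ‖D.freeRun μ x i ω k‖ ^ 2 ∂P ≤ 2 * a i + 2 * b i := by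
    rw [ha, hbdef]
    simp only
    rw [← integral_const_mul, ← integral_const_mul,
      ← integral_add (ia.const_mul _) (ib.const_mul _)]
    refine integral_mono ik ((ia.const_mul _).add (ib.const_mul _)) fun ω => ?_
    simp only
    have f1 := W.dist_le (D.freeRun μ x i ω) k
    have f2 := norm_le_norm_add_norm_sub' (D.freeRun μ x i ω k) (avg p (D.freeRun μ x i ω))
    have f3 := pow_le_pow_left₀ (norm_nonneg _) (f2.trans (add_le_add le_rfl f1)) 2
    nlinarith [sq_nonneg (‖avg p (D.freeRun μ x i ω)‖ - W.V (D.freeRun μ x i ω))]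
  have e2 := mul_le_mul_of_nonneg_right hw1 (hb0 i)
  linarith [hT i]

end Setting

end FreeRun

end CoordDiffusion

namespace CoordDiffusion

/-! ### The slowest mode -/

section MeanRun

open scoped InnerProductSpace

variable {N M : ℕ} {Ω : Type*}

namespace Model

/-- The mean of a run without noise: the masks are replaced by their expected values. -/
noncomputable def meanRun (D : Model N M Ω) (μ : ℝ) (x : Fin N → Vec M) : ℕ → Fin N → Vec M
  | 0 => x
  | i + 1 => D.free μ (fun l _ => 1 - D.r l) (D.meanRun μ x i)

lemma free_apply (D : Model N M Ω) (μ : ℝ) (g : Fin N → Fin M → ℝ) (x : Fin N → Vec M) (k : Fin N)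
    (m : Fin M) : D.free μ g x k m = ∑ l, D.A₂ l k * (mix D.A₁ x l m -
      μ * D.τ l * (g l m * op (D.H l) (mix D.A₁ x l) m)) := by
  simp [free, next, mix]

/-- In the mean, the network average moves by the weighted Hessian, up to the disagreement. -/
lemma avg_free_mean (D : Model N M Ω) {p : Fin N → ℝ} (hp : (D.A₁ * D.A₂) *ᵥ p = p) (μ : ℝ)
    (x : Fin N → Vec M) : avg p (D.free μ (fun l _ => 1 - D.r l) x) =
      avg p x - μ • op (D.Shat p) (avg p x) -
        μ • ∑ l, (D.qhat p l * (1 - D.r l)) • op (D.H l) (mix D.A₁ x l - avg p x) := by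
  have h1 : ∀ l, hmul (fun _ => 1 - D.r l) (op (D.H l) (mix D.A₁ x l)) =
      (1 - D.r l) • op (D.H l) (mix D.A₁ x l) := fun l => by
    ext m
    simp
  have h2 : op (D.Shat p) (avg p x) =
      ∑ l, (D.qhat p l * (1 - D.r l)) • op (D.H l) (avg p x) := by
    rw [Shat, op, map_sum, sum_apply]
    refine Finset.sum_congr rfl fun l _ => ?_
    rw [map_smul, smul_apply]
  rw [free, D.avg_next hp, sub_sub, ← smul_add, h2, ← Finset.sum_add_distrib]
  congr 2
  refine Finset.sum_congr rfl fun l _ => ?_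
  rw [h1, smul_smul, ← smul_add, ← map_add, add_sub_cancel]

end Model

/-- The part of the mean drift that is not linear in the network average is bounded by the
disagreement. -/
lemma mean_defect_le {D : Model N M Ω} {ν δ C : ℝ} (hb : CostBounds D ν δ C)
    (hnet : NetworkConditions D) {p : Fin N → ℝ} (hp : IsPerronVector D p)
    (W : ConsensusGauge M (D.A₁ * D.A₂) p) (x : Fin N → Vec M) :
    ‖∑ l, (D.qhat p l * (1 - D.r l)) • op (D.H l) (mix D.A₁ x l - avg p x)‖ ≤
      N * δ * W.V x := by
  calc _ ≤ ∑ _l : Fin N, δ * W.V x := by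
        refine (norm_sum_le _ _).trans (Finset.sum_le_sum fun l _ => ?_)
        have hq0 := qhat_nonneg hp hnet l
        have hq1 := qhat_le_one hp hnet l
        have hr0 := hnet.r_nonneg l
        have hr1 := hnet.r_lt l
        have f2 : 0 ≤ D.qhat p l * (1 - D.r l) := mul_nonneg hq0 (by linarith)
        have f3 : D.qhat p l * (1 - D.r l) ≤ 1 := mul_le_one₀ hq1 (by linarith) (by linarith)
        rw [norm_smul, Real.norm_of_nonneg f2]
        exact (mul_le_of_le_one_left (norm_nonneg _) f3).trans ((hb.norm_op_H_le l _).trans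
          (mul_le_mul_of_nonneg_left (W.mix_sub_le hnet.A₁_stoch x l) hb.δ_pos.le))
    _ = _ := by simp; ring

lemma repr_op {S : Matrix (Fin M) (Fin M) ℝ} (hS : S.IsHermitian) (v : Vec M) :
    hS.eigenvectorBasis.repr (op S v) = hmul hS.eigenvalues (hS.eigenvectorBasis.repr v) := by
  ext j
  rw [hmul_apply, OrthonormalBasis.repr_apply_apply, OrthonormalBasis.repr_apply_apply,
    inner_eigenvectorBasis_op]

/-- The gap between the smallest value and the others; the smallest value may be attained several
times. -/
lemma exists_eigenvalue_gap (f : Fin M → ℝ) (j₀ : Fin M) (h : ∀ j, f j₀ ≤ f j) :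
    ∃ g, 0 < g ∧ ∀ j, f j = f j₀ ∨ f j₀ + g ≤ f j := by
  classical
  have : Nonempty (Fin M) := ⟨j₀⟩
  obtain ⟨j₁, hj₁⟩ := Finite.exists_min fun j => if f j = f j₀ then (1 : ℝ) else f j - f j₀
  refine ⟨if f j₁ = f j₀ then 1 else f j₁ - f j₀, ?_, fun j => ?_⟩
  · split_ifs with h1
    · exact one_pos
    · exact sub_pos.2 (lt_of_le_of_ne (h j₁) (Ne.symm h1))
  · by_cases hj : f j = f j₀
    · exact Or.inl hj
    · have := hj₁ j
      simp only [hj, if_false] at this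
      exact Or.inr (by linarith)

/-- One step of a slow mode under a small perturbation `f`: the component of `z` in the
eigenspace of the smallest eigenvalue `lam` shrinks slowly, the rest faster. Coordinates are taken
in the eigenbasis, and `χ` is the indicator of the eigenspace. -/
lemma slow_mode_step {e : Fin M → ℝ} {lam g μ : ℝ} (hμ : 0 ≤ μ)
    (hgap : ∀ j, e j = lam ∨ lam + g ≤ e j) (hμe : ∀ j, μ * e j ≤ 1) (hl : μ * lam ≤ 1)
    (hg : μ * (lam + g) ≤ 1)
    {χ : Fin M → ℝ} (hχ : ∀ j, χ j = if e j = lam then 1 else 0) (z f : Vec M) :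
    (1 - μ * lam) * ‖hmul χ z‖ - μ * ‖f‖ ≤ ‖hmul χ (z - μ • hmul e z - μ • f)‖ ∧
    ‖hmul (fun j => 1 - χ j) (z - μ • hmul e z - μ • f)‖ ≤
      (1 - μ * (lam + g)) * ‖hmul (fun j => 1 - χ j) z‖ + μ * ‖f‖ := by
  have hχ1 : ∀ j, |χ j| ≤ 1 := fun j => by rw [hχ]; split_ifs <;> simp
  have hχ2 : ∀ j, |1 - χ j| ≤ 1 := fun j => by rw [hχ]; split_ifs <;> simp
  constructor
  · have h1 : hmul χ (z - μ • hmul e z - μ • f) = (1 - μ * lam) • hmul χ z - μ • hmul χ f := by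
      ext j
      by_cases hj : e j = lam
      · simp [hχ, hj]; ring
      · simp [hχ, hj]
    rw [h1]
    have h2 := norm_sub_norm_le ((1 - μ * lam) • hmul χ z) (μ • hmul χ f)
    rw [norm_smul, norm_smul, Real.norm_of_nonneg hμ, Real.norm_of_nonneg (by linarith)] at h2
    have h3 := mul_le_mul_of_nonneg_left (norm_hmul_le hχ1 f) hμ
    linarith
  · have h1 : hmul (fun j => 1 - χ j) (z - μ • hmul e z - μ • f) =
        hmul (fun j => (1 - χ j) * (1 - μ * e j)) z - μ • hmul (fun j => 1 - χ j) f := by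
      ext j
      simp
      ring
    rw [h1]
    refine (norm_sub_le _ _).trans (add_le_add ?_ ?_)
    · refine le_of_sq_le_sq ?_ (mul_nonneg (by linarith) (norm_nonneg _))
      rw [mul_pow, norm_sq_vec, norm_sq_vec, Finset.mul_sum]
      refine Finset.sum_le_sum fun j _ => ?_
      rw [hmul_apply, hmul_apply, mul_pow, mul_pow, mul_pow, ← mul_assoc,
        mul_comm ((1 - χ j) ^ 2)]
      rcases hgap j with hj | hj
      · simp [hχ, hj]
      · refine mul_le_mul_of_nonneg_right (mul_le_mul_of_nonneg_right ?_ (sq_nonneg _))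
          (sq_nonneg _)
        refine pow_le_pow_left₀ (by linarith [hμe j]) ?_ 2
        have := mul_le_mul_of_nonneg_left hj hμ
        linarith
    · rw [norm_smul, Real.norm_of_nonneg hμ]
      exact mul_le_mul_of_nonneg_left (norm_hmul_le hχ2 f) hμ

lemma ConsensusGauge.V_const {A : Matrix (Fin N) (Fin N) ℝ} {p : Fin N → ℝ}
    (W : ConsensusGauge M A p) (hA : IsLeftStochastic A) (v : Vec M) : W.V (fun _ => v) = 0 := by
  have h1 : mix A (fun _ => v) = fun _ => v := by
    funext k
    rw [mix, ← Finset.sum_smul, hA.2, one_smul]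
  have h2 := W.contract (fun _ => v)
  rw [h1] at h2
  have h3 := W.nonneg (fun _ => v)
  have h4 := W.ρ_lt
  nlinarith

/-- In the mean, a run that starts from an eigenvector of the smallest eigenvalue `λ` of the
weighted Hessian decays no faster than `1 - μ λ - O(μ²)`: the eigenspace of `λ` keeps dominating the
rest of the network average, and the disagreement stays `O(μ)` in proportion to it. -/
lemma exists_slow_mode {D : Model N M Ω} {ν δ C : ℝ} (hb : CostBounds D ν δ C)
    (hnet : NetworkConditions D) {p : Fin N → ℝ} (hp : IsPerronVector D p)
    (W : ConsensusGauge M (D.A₁ * D.A₂) p) {j₀ : Fin M}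
    (hmin : ∀ j, (hb.isHermitian_Shat p).eigenvalues j₀ ≤ (hb.isHermitian_Shat p).eigenvalues j) :
    ∃ κ μ₀ : ℝ, 0 ≤ κ ∧ 0 < μ₀ ∧ ∀ μ, 0 < μ → μ < μ₀ →
      0 ≤ 1 - μ * (hb.isHermitian_Shat p).eigenvalues j₀ - κ * μ ^ 2 ∧ ∃ x, ∀ i k,
        (1 - μ * (hb.isHermitian_Shat p).eigenvalues j₀ - κ * μ ^ 2) ^ i / 2 ≤
          ‖D.meanRun μ x i k‖ := by
  set hS := hb.isHermitian_Shat p with hSdef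
  set b := hS.eigenvectorBasis with hbas
  set e := hS.eigenvalues with he
  set lam := e j₀ with hlam
  have hpos : ∀ j, 0 < e j := hb.Shat_eigenvalues_pos hnet hp
  have hlam0 : 0 < lam := hpos j₀
  obtain ⟨g, hg0, hgap⟩ := exists_eigenvalue_gap e j₀ hmin
  rw [← hlam] at hgap
  set χ : Fin M → ℝ := fun j => if e j = lam then 1 else 0 with hχdef
  have hχ : ∀ j, χ j = if e j = lam then 1 else 0 := fun j => rfl
  have hχ1 : ∀ j, |χ j| ≤ 1 := fun j => by rw [hχ]; split_ifs <;> simp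
  have hδ := hb.δ_pos
  have hC := W.C_nonneg
  have hρ := W.ρ_lt
  set A := N * δ with hA
  have hA0 : 0 ≤ A := by positivity
  set E := W.C * N * A with hE
  have hE0 : 0 ≤ E := by positivity
  have h1ρ : 0 < 1 - W.ρ := sub_pos.2 hρ
  -- for this `K` the contraction of the disagreement keeps it below `K μ` times the slow component
  set K := 4 * E / (1 - W.ρ) + 1 with hK
  have hK0 : 0 < K := by positivity
  have hKE : 2 * E ≤ K * ((1 - W.ρ) / 2) := by
    rw [hK, add_mul, div_mul_div_comm, show 4 * E * (1 - W.ρ) / ((1 - W.ρ) * 2) = 2 * E by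
      field_simp; ring]
    linarith
  set κ := A * K with hκ
  have hκ0 : 0 ≤ κ := by positivity
  set L := ∑ j, e j with hL
  have hL0 : 0 ≤ L := Finset.sum_nonneg fun j _ => (hpos j).le
  have hLj : ∀ j, e j ≤ L := fun j =>
    Finset.single_le_sum (f := e) (fun j _ => (hpos j).le) (Finset.mem_univ j)
  refine ⟨κ, min (min 1 (1 / (2 * (L + g + κ + K) + 1)))
    (min (g / (2 * κ + 1)) ((1 - W.ρ) / (2 * (E + lam + κ) + 1))), hκ0, by positivity,
    fun μ hμ0 hμ => ?_⟩
  obtain ⟨m1, m2⟩ := lt_min_iff.1 hμ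
  obtain ⟨m1, m3⟩ := lt_min_iff.1 m1
  obtain ⟨m2, m4⟩ := lt_min_iff.1 m2
  rw [lt_div_iff₀ (by positivity)] at m2 m3 m4
  have hμL : 0 ≤ μ * L := by positivity
  have hμg : 0 ≤ μ * g := by positivity
  have hμκ : 0 ≤ μ * κ := by positivity
  have hμK : 0 ≤ μ * K := by positivity
  have hμj : ∀ j, μ * e j ≤ μ * L := fun j => mul_le_mul_of_nonneg_left (hLj j) hμ0.le
  have hμl : μ * lam ≤ μ * L := hμj j₀
  have hκμ : κ * μ ^ 2 ≤ μ * κ := by nlinarith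
  have hθ0 : 0 ≤ 1 - μ * lam - κ * μ ^ 2 := by linarith
  refine ⟨hθ0, fun _ => b j₀, ?_⟩
  set y := D.meanRun μ (fun _ => b j₀) with hy
  set a : ℕ → ℝ := fun i => ‖hmul χ (b.repr (avg p (y i)))‖ with ha
  set c : ℕ → ℝ := fun i => ‖hmul (fun j => 1 - χ j) (b.repr (avg p (y i)))‖ with hc
  have ha0 : ∀ i, 0 ≤ a i := fun i => norm_nonneg _
  have hle : ∀ i, ‖avg p (y i)‖ ≤ a i + c i := fun i => by
    rw [← b.repr.norm_map]
    refine le_trans (le_of_eq ?_) (norm_add_le _ _)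
    congr 1
    ext j
    simp
    ring
  have hge : ∀ i, a i ≤ ‖avg p (y i)‖ := fun i => by
    rw [← b.repr.norm_map]
    exact norm_hmul_le hχ1 _
  have hmask : ∀ (l : Fin N) (m : Fin M), |1 - D.r l| ≤ 1 := fun l _ => by
    rw [abs_le]
    constructor <;> linarith [hnet.r_nonneg l, hnet.r_lt l]
  -- the slow component `a` dominates the other component `c` of the average at all times; at time
  -- zero the state is the same eigenvector at all agents, so `c` and the disagreement vanish
  have hcone : ∀ i, c i ≤ a i ∧ W.V (y i) ≤ K * μ * a i ∧
      (1 - μ * lam - κ * μ ^ 2) ^ i ≤ a i := by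
    intro i
    induction i with
    | zero =>
      have h1 : avg p (y 0) = b j₀ := by
        simp only [hy, Model.meanRun, avg]
        rw [← Finset.sum_smul, hp.2, one_smul]
      have h2 : hmul χ (b.repr (avg p (y 0))) = EuclideanSpace.single j₀ 1 := by
        rw [h1, b.repr_self]
        ext j
        by_cases hj : j = j₀
        · simp [hj, hχ, hlam]
        · simp [hj]
      have h3 : hmul (fun j => 1 - χ j) (b.repr (avg p (y 0))) = 0 := by
        rw [h1, b.repr_self]
        ext j
        by_cases hj : j = j₀
        · simp [hj, hχ, hlam]
        · simp [hj]
      have h4 : a 0 = 1 := by rw [ha]; simp only; rw [h2]; simp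
      have h5 : c 0 = 0 := by rw [hc]; simp only; rw [h3]; simp
      have h6 : W.V (y 0) = 0 := W.V_const (hnet.A₁_stoch.mul hnet.A₂_stoch) _
      rw [h4, h5, h6, pow_zero]
      exact ⟨zero_le_one, by positivity, le_rfl⟩
    | succ i ih =>
      obtain ⟨i1, i2, i3⟩ := ih
      set f := ∑ l, (D.qhat p l * (1 - D.r l)) • op (D.H l) (mix D.A₁ (y i) l - avg p (y i))
        with hf
      have s0 : b.repr (avg p (y (i + 1))) = b.repr (avg p (y i)) -
          μ • hmul e (b.repr (avg p (y i))) - μ • b.repr f := by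
        rw [← repr_op, hy]
        simp only [Model.meanRun]
        rw [D.avg_free_mean hp.1, map_sub, map_sub, map_smul, map_smul]
      have hf1 : ‖b.repr f‖ ≤ κ * μ * a i := by
        rw [b.repr.norm_map]
        have h1 := mean_defect_le hb hnet hp W (y i)
        have h2 := mul_le_mul_of_nonneg_left i2 hA0
        calc _ ≤ A * W.V (y i) := h1
          _ ≤ A * (K * μ * a i) := h2
          _ = _ := by rw [hκ]; ring
      obtain ⟨s1, s2⟩ := slow_mode_step hμ0.le hgap (fun j => by linarith [hμj j])
        (by linarith) (by linarith) hχ (b.repr (avg p (y i))) (b.repr f)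
      rw [← s0] at s1 s2
      have hf2 := mul_le_mul_of_nonneg_left hf1 hμ0.le
      have t1 : (1 - μ * lam - κ * μ ^ 2) * a i ≤ a (i + 1) := by
        have : (1 - μ * lam) * a i - μ * ‖b.repr f‖ ≤ a (i + 1) := s1
        linarith
      refine ⟨?_, ?_, ?_⟩
      · have t2 : c (i + 1) ≤ (1 - μ * (lam + g)) * c i + μ * ‖b.repr f‖ := s2
        have t3 := mul_le_mul_of_nonneg_left i1 (show 0 ≤ 1 - μ * (lam + g) by linarith)
        have t4 : 0 ≤ μ * a i * (g - 2 * κ * μ) :=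
          mul_nonneg (mul_nonneg hμ0.le (ha0 i)) (by linarith)
        linarith
      · have t2 := gauge_free_le hb hnet W hμ0.le hmask (y i)
        rw [← hA, ← hE] at t2
        have t3 : ‖avg p (y i)‖ + W.V (y i) ≤ (2 + K * μ) * a i := by linarith [hle i]
        have t4 := mul_le_mul_of_nonneg_left t3 (show 0 ≤ μ * E by positivity)
        have t5 := mul_le_mul_of_nonneg_left i2 W.ρ_nonneg
        have t6 := mul_le_mul_of_nonneg_left t1 (show 0 ≤ K * μ by positivity)
        have t7 : W.V (y (i + 1)) ≤ W.ρ * W.V (y i) + μ * E * (‖avg p (y i)‖ + W.V (y i)) := t2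
        have t8 : 2 * E + E * K * μ ≤ K * (1 - W.ρ - μ * lam - κ * μ ^ 2) := by
          have := mul_le_mul_of_nonneg_left (show μ * (E + lam + κ) ≤ (1 - W.ρ) / 2 by
            linarith) hK0.le
          have := mul_le_mul_of_nonneg_left hκμ hK0.le
          linarith
        have t9 := mul_le_mul_of_nonneg_left t8 (show 0 ≤ μ * a i from mul_nonneg hμ0.le (ha0 i))
        linarith
      · rw [pow_succ']
        exact (mul_le_mul_of_nonneg_left i3 hθ0).trans t1
  intro i k
  obtain ⟨-, i2, i3⟩ := hcone i
  have h1 := W.dist_le (y i) k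
  have h2 := norm_sub_norm_le (avg p (y i)) (y i k)
  rw [norm_sub_rev] at h2
  have h3 := hge i
  have h4 : K * μ * a i ≤ 1 / 2 * a i := mul_le_mul_of_nonneg_right (by linarith) (ha0 i)
  linarith

variable [MeasurableSpace Ω]

namespace Setting

variable {D : Model N M Ω} {P : Measure Ω} {μbar μ : ℝ} [IsProbabilityMeasure P]

lemma integral_freeRun (h : Setting D P μbar) (hμ : μ ∈ Set.Ioo 0 μbar) (x : Fin N → Vec M)
    (i : ℕ) (k : Fin N) (m : Fin M) : ∫ ω, D.freeRun μ x i ω k m ∂P = D.meanRun μ x i k m := by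
  obtain ⟨ν, δ, C, hb⟩ := h.exists_bounds
  have hm : ∀ l m, PolyGrowth 1 (fun y : Fin N → Vec M => mix D.A₁ y l m) := fun l m =>
    (growth_coord m).comp (growth_mix h.net.A₁_stoch l) (by fun_prop)
  have hH := growth_op_mix_coord hb h.net
  induction i generalizing k m with
  | zero => simp [Model.freeRun, Model.meanRun]
  | succ i ih =>
    have hv : ∀ k, ∫ ω, D.freeRun μ x i ω k ∂P = D.meanRun μ x i k := fun k => by
      ext m
      rw [← ih k m]
      exact ((EuclideanSpace.proj (𝕜 := ℝ) m).integral_comp_comm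
        ((memLp_pi_iff.1 (h.memLp_freeRun μ x i 1) k).integrable le_rfl)).symm
    have hi : ∀ k, Integrable (fun ω => D.freeRun μ x i ω k) P := fun k =>
      (memLp_pi_iff.1 (h.memLp_freeRun μ x i 1) k).integrable le_rfl
    have his : ∀ l l', Integrable (fun ω => D.A₁ l' l • D.freeRun μ x i ω l') P := fun l l' =>
      (hi l').smul (D.A₁ l' l)
    have im : ∀ l, Integrable (fun ω => mix D.A₁ (D.freeRun μ x i ω) l) P := fun l =>
      integrable_finsetSum Finset.univ fun l' _ => his l l'
    have hmix : ∀ l, ∫ ω, mix D.A₁ (D.freeRun μ x i ω) l ∂P = mix D.A₁ (D.meanRun μ x i) l :=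
      fun l => by
      simp only [mix]
      rw [integral_finsetSum Finset.univ fun l' _ => his l l']
      refine Finset.sum_congr rfl fun l' _ => ?_
      rw [← hv l']
      exact integral_smul (D.A₁ l' l) _
    have e1 : ∀ l m, ∫ ω, mix D.A₁ (D.freeRun μ x i ω) l m ∂P = mix D.A₁ (D.meanRun μ x i) l m :=
      fun l m => by
      rw [← hmix l]
      exact (EuclideanSpace.proj (𝕜 := ℝ) m).integral_comp_comm (im l)
    have e2 : ∀ l m, ∫ ω, op (D.H l) (mix D.A₁ (D.freeRun μ x i ω) l) m ∂P =
        op (D.H l) (mix D.A₁ (D.meanRun μ x i) l) m := fun l m => by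
      rw [← hmix l]
      exact ((EuclideanSpace.proj (𝕜 := ℝ) m).comp (op (D.H l))).integral_comp_comm (im l)
    have i1 := fun l m => h.integrable_freeRun μ x i (hm l m)
    have i2 := fun l m => h.integrable_freeRun μ x i (hH l m)
    have i3 : ∀ l, Integrable (fun ω => D.maskAt i ω l m *
        op (D.H l) (mix D.A₁ (D.freeRun μ x i ω) l) m) P := fun l =>
      (i2 l m).bdd_mul (c := 1) (h.reg.mask_meas l i m).aestronglyMeasurable
        (Eventually.of_forall fun ω => h.abs_mask_le l i m ω)
    have i4 : ∀ l, Integrable (fun ω => D.A₂ l k * (mix D.A₁ (D.freeRun μ x i ω) l m -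
      μ * D.τ l * (D.maskAt i ω l m * op (D.H l) (mix D.A₁ (D.freeRun μ x i ω) l) m))) P :=
      fun l => ((i1 l m).sub ((i3 l).const_mul _)).const_mul _
    simp only [Model.freeRun, Model.meanRun, D.free_apply]
    rw [integral_finsetSum Finset.univ fun l _ => i4 l]
    refine Finset.sum_congr rfl fun l _ => ?_
    rw [integral_const_mul, integral_sub (i1 l m) ((i3 l).const_mul _), integral_const_mul, e1,
      ← e2]
    congr 3
    exact h.integral_mask_mul hμ i l m (measurable_comp_freeRun (hH l m).1 D μ x i)

/-- The second moment of a run dominates the square of its mean, because variances are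
nonnegative. -/
lemma norm_meanRun_sq_le (h : Setting D P μbar) (hμ : μ ∈ Set.Ioo 0 μbar) (x : Fin N → Vec M)
    (i : ℕ) (k : Fin N) : ‖D.meanRun μ x i k‖ ^ 2 ≤ ∫ ω, ‖D.freeRun μ x i ω k‖ ^ 2 ∂P := by
  have h2 : ∀ m, MemLp (fun ω => D.freeRun μ x i ω k m) 2 P := fun m =>
    (EuclideanSpace.proj (𝕜 := ℝ) m).comp_memLp' (memLp_pi_iff.1 (h.memLp_freeRun μ x i 2) k)
  simp only [norm_sq_vec]
  rw [integral_finsetSum Finset.univ fun m _ => (h2 m).integrable_sq]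
  refine Finset.sum_le_sum fun m _ => ?_
  rw [← h.integral_freeRun hμ]
  have h3 := variance_nonneg (fun ω => D.freeRun μ x i ω k m) P
  rw [variance_eq_sub (h2 m)] at h3
  exact sub_nonneg.1 h3

/-- Some run without noise decays no faster than at the rate `1 - 2 μ λ - O(μ²)`, with the smallest
eigenvalue `λ` of the weighted Hessian. -/
lemma exists_le_freeRun (h : Setting D P μbar) {ν δ C : ℝ} (hb : CostBounds D ν δ C)
    {p : Fin N → ℝ} (W : ConsensusGauge M (D.A₁ * D.A₂) p) (hp : IsPerronVector D p) {j₀ : Fin M}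
    (hmin : ∀ j, (hb.isHermitian_Shat p).eigenvalues j₀ ≤ (hb.isHermitian_Shat p).eigenvalues j) :
    ∃ K μ₀ : ℝ, 0 ≤ K ∧ 0 < μ₀ ∧ ∀ μ ∈ Set.Ioo 0 μbar, μ < μ₀ →
      0 ≤ 1 - 2 * μ * (hb.isHermitian_Shat p).eigenvalues j₀ - K * μ ^ 2 ∧ ∃ x, ∀ i k,
        1 / 4 * (1 - 2 * μ * (hb.isHermitian_Shat p).eigenvalues j₀ - K * μ ^ 2) ^ i ≤
          ∫ ω, ‖D.freeRun μ x i ω k‖ ^ 2 ∂P := by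
  obtain ⟨κ, μ₀, hκ, hμ₀, hrun⟩ := exists_slow_mode hb h.net hp W hmin
  set lam := (hb.isHermitian_Shat p).eigenvalues j₀ with hlam
  have hlam0 : 0 < lam := hb.Shat_eigenvalues_pos h.net hp j₀
  refine ⟨2 * κ, min μ₀ (min 1 (1 / (2 * (lam + κ) + 1))), by positivity, by positivity,
    fun μ hμ hlt => ?_⟩
  obtain ⟨m1, m2⟩ := lt_min_iff.1 hlt
  obtain ⟨m2, m3⟩ := lt_min_iff.1 m2
  rw [lt_div_iff₀ (by positivity)] at m3
  have hμ0 : 0 < μ := hμ.1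
  obtain ⟨hθ, x, hx⟩ := hrun μ hμ.1 m1
  have hκμ : κ * μ ^ 2 ≤ μ * κ := by nlinarith [mul_nonneg hκ hμ0.le]
  have h0 : 0 ≤ 1 - 2 * μ * lam - 2 * κ * μ ^ 2 := by linarith
  refine ⟨h0, x, fun i k => le_trans ?_ (h.norm_meanRun_sq_le hμ x i k)⟩
  have h1 : 1 - 2 * μ * lam - 2 * κ * μ ^ 2 ≤ (1 - μ * lam - κ * μ ^ 2) ^ 2 := by
    nlinarith [sq_nonneg (μ * lam + κ * μ ^ 2)]
  have h2 := pow_le_pow_left₀ h0 h1 i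
  have h3 := pow_le_pow_left₀ (by positivity) (hx i k) 2
  rw [div_pow, ← pow_mul, mul_comm i 2, pow_mul] at h3
  linarith

end Setting

end MeanRun

end CoordDiffusion

namespace CoordDiffusion

/-! ### Convergence rates -/

section Rates

lemma tendsto_const_mul_pow_root {c θ : ℝ} (hc : 0 < c) (hθ : 0 ≤ θ) :
    Tendsto (fun i : ℕ => ENNReal.ofReal ((c * θ ^ i) ^ ((1 : ℝ) / i))) atTop
      (𝓝 (ENNReal.ofReal θ)) := by
  refine ENNReal.tendsto_ofReal ?_
  have h1 : Tendsto (fun i : ℕ => c ^ ((1 : ℝ) / i) * θ) atTop (𝓝 (c ^ (0 : ℝ) * θ)) :=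
    (((Real.continuousAt_const_rpow hc.ne').tendsto.comp
      tendsto_one_div_atTop_nhds_zero_nat)).mul_const θ
  rw [Real.rpow_zero, one_mul] at h1
  refine h1.congr' ?_
  filter_upwards [eventually_ge_atTop 1] with i hi
  rw [Real.mul_rpow hc.le (pow_nonneg hθ i), one_div, Real.pow_rpow_inv_natCast hθ (by lia)]

/-- Geometric upper bounds bound the exponential rate, whatever the constant factor; it is replaced
by a positive one to take roots. -/
lemma limsup_root_le {u : ℕ → ℝ} {c θ : ℝ} (hθ : 0 ≤ θ) (hu : ∀ i, 0 ≤ u i)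
    (h : ∀ i, u i ≤ c * θ ^ i) :
    limsup (fun i : ℕ => ENNReal.ofReal (u i ^ ((1 : ℝ) / i))) atTop ≤ ENNReal.ofReal θ := by
  rw [← (tendsto_const_mul_pow_root (show 0 < max c 1 from lt_max_of_lt_right one_pos)
    hθ).limsup_eq]
  refine limsup_le_limsup (Eventually.of_forall fun i => ENNReal.ofReal_le_ofReal ?_)
  refine Real.rpow_le_rpow (hu i) ((h i).trans ?_) (by positivity)
  exact mul_le_mul_of_nonneg_right (le_max_left c 1) (pow_nonneg hθ i)

lemma le_limsup_root {u : ℕ → ℝ} {c θ : ℝ} (hθ : 0 ≤ θ) (hc : 0 < c)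
    (h : ∀ i, c * θ ^ i ≤ u i) :
    ENNReal.ofReal θ ≤ limsup (fun i : ℕ => ENNReal.ofReal (u i ^ ((1 : ℝ) / i))) atTop := by
  rw [← (tendsto_const_mul_pow_root hc hθ).limsup_eq]
  refine limsup_le_limsup (Eventually.of_forall fun i => ENNReal.ofReal_le_ofReal ?_)
  exact Real.rpow_le_rpow (by positivity) (h i) (by positivity)

/-- Geometric bounds for the entries of the powers of a matrix bound its spectral radius, by
Gelfand's formula. -/
lemma specRadius_mem_Icc {ι : Type*} [Fintype ι] [DecidableEq ι] {A : Matrix ι ι ℝ}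
    {c T θ θ' : ℝ} (hθ : 0 ≤ θ) (hθ' : 0 ≤ θ') (hc : 0 < c)
    (hle : ∀ i a b, |(A ^ i) a b| ≤ T * θ ^ i)
    (hge : ∀ i, c * θ' ^ i ≤ ∑ a, ∑ b, |(A ^ i) a b|) : specRadius A ∈ Set.Icc θ' θ := by
  let := Matrix.linftyOpNormedRing (n := ι) (α := ℂ)
  let := Matrix.linftyOpNormedAlgebra (R := ℂ) (n := ι) (α := ℂ)
  have := FiniteDimensional.complete ℂ (Matrix ι ι ℂ)
  set B := A.map (algebraMap ℝ ℂ) with hB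
  have hlim := (spectrum.pow_norm_pow_one_div_tendsto_nhds_spectralRadius B).limsup_eq
  have hBi : ∀ i a b, ‖(B ^ i) a b‖ = |(A ^ i) a b| := fun i a b => by
    rw [hB, ← Matrix.map_pow, Matrix.map_apply, Complex.coe_algebraMap, Complex.norm_real,
      Real.norm_eq_abs]
  have hrow : ∀ i a, ∑ b, |(A ^ i) a b| ≤ ‖B ^ i‖ := fun i a => by
    rw [Matrix.linfty_opNorm_def]
    have := Finset.le_sup (f := fun a => ∑ b, ‖(B ^ i) a b‖₊) (Finset.mem_univ a)
    have h2 := NNReal.coe_le_coe.2 this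
    refine le_trans (le_of_eq ?_) h2
    push_cast
    exact Finset.sum_congr rfl fun b _ => (hBi i a b).symm
  have hup : ∀ i, ‖B ^ i‖ ≤ Fintype.card ι * |T| * θ ^ i := fun i => by
    rw [Matrix.linfty_opNorm_def]
    have h0 : 0 ≤ Fintype.card ι * |T| * θ ^ i := by positivity
    lift Fintype.card ι * |T| * θ ^ i to NNReal using h0 with t ht
    refine NNReal.coe_le_coe.2 (Finset.sup_le fun a _ => NNReal.coe_le_coe.1 ?_)
    rw [ht]
    push_cast
    calc ∑ b, ‖(B ^ i) a b‖ ≤ ∑ _b : ι, |T| * θ ^ i := Finset.sum_le_sum fun b _ => by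
          rw [hBi]
          exact (hle i a b).trans (mul_le_mul_of_nonneg_right (le_abs_self T) (by positivity))
      _ = _ := by simp [mul_assoc]
  have h1 : spectralRadius ℂ B ≤ ENNReal.ofReal θ := by
    rw [← hlim]
    exact limsup_root_le hθ (fun i => norm_nonneg _) hup
  have h2 : ENNReal.ofReal θ' ≤ spectralRadius ℂ B := by
    rw [← hlim]
    have hcard : (0 : ℝ) < Fintype.card ι + 1 := by positivity
    refine le_limsup_root hθ' (div_pos hc hcard) fun i => ?_
    rw [div_mul_eq_mul_div, div_le_iff₀ hcard]
    refine (hge i).trans ((Finset.sum_le_sum fun a _ => hrow i a).trans ?_)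
    rw [Finset.sum_const, Finset.card_univ, nsmul_eq_mul, mul_comm]
    exact mul_le_mul_of_nonneg_left (by linarith) (norm_nonneg _)
  have h3 : spectralRadius ℂ B ≠ ⊤ := ne_top_of_le_ne_top ENNReal.ofReal_ne_top h1
  exact ⟨(ENNReal.ofReal_le_iff_le_toReal h3).1 h2, ENNReal.toReal_le_of_le_ofReal hθ h1⟩

lemma lambdaMin_smul {M : ℕ} {S : Matrix (Fin M) (Fin M) ℝ} (hS : S.IsHermitian) {j₀ : Fin M}
    (hmin : ∀ j, hS.eigenvalues j₀ ≤ hS.eigenvalues j) {μ : ℝ} (hμ : 0 ≤ μ) :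
    lambdaMin (μ • S) = μ * hS.eigenvalues j₀ := by
  have h1 : sInf (spectrum ℝ S) = hS.eigenvalues j₀ := by
    rw [hS.spectrum_real_eq_range_eigenvalues]
    exact IsLeast.csInf_eq ⟨⟨j₀, rfl⟩, by rintro _ ⟨j, rfl⟩; exact hmin j⟩
  have h2 : (spectrum ℝ S).Nonempty := by
    rw [hS.spectrum_real_eq_range_eigenvalues]
    exact ⟨_, j₀, rfl⟩
  have : Nonempty (Fin M) := ⟨j₀⟩
  rw [lambdaMin, spectrum.smul_eq_smul μ S h2, Real.sInf_smul_of_nonneg hμ, h1, smul_eq_mul]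

variable {N M : ℕ} {Ω : Type*}

open scoped InnerProductSpace

lemma min_eigenvalue_le {S : Matrix (Fin M) (Fin M) ℝ} (hS : S.IsHermitian) {j₀ : Fin M}
    (hmin : ∀ j, hS.eigenvalues j₀ ≤ hS.eigenvalues j) (u : Vec M) :
    hS.eigenvalues j₀ * ‖u‖ ^ 2 ≤ ⟪u, op S u⟫_ℝ := by
  rw [← hS.eigenvectorBasis.sum_inner_mul_inner u (op S u), ← real_inner_self_eq_norm_sq,
    ← hS.eigenvectorBasis.sum_inner_mul_inner u u, Finset.mul_sum]
  refine Finset.sum_le_sum fun j _ => ?_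
  rw [inner_eigenvectorBasis_op, real_inner_comm]
  have := mul_le_mul_of_nonneg_right (hmin j) (mul_self_nonneg ⟪hS.eigenvectorBasis j, u⟫_ℝ)
  linarith

variable [MeasurableSpace Ω]

namespace Setting

variable {D : Model N M Ω} {P : Measure Ω} {μbar μ : ℝ} [IsProbabilityMeasure P]

/-- The entries of the powers of `F` are mixed moments of runs that start from unit vectors. -/
lemma exists_abs_F_pow_le (h : Setting D P μbar) (hμ : μ ∈ Set.Ioo 0 μbar) {θ : ℝ} (hθ : 0 ≤ θ)
    (hle : ∀ x, ∃ T, 0 ≤ T ∧ ∀ i k, ∫ ω, ‖D.freeRun μ x i ω k‖ ^ 2 ∂P ≤ T * θ ^ i) (j : ℕ) :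
    ∃ T, ∀ i e f, |(D.F P μ j ^ i) e f| ≤ T * θ ^ i := by
  choose T hT0 hT using hle
  -- unit vectors of the stacked space
  set E : Fin N × Fin M → Fin N → Vec M := fun b k =>
    WithLp.toLp 2 fun m => if (k, m) = b then 1 else 0 with hE
  refine ⟨∑ b, T (E b), fun i e f => ?_⟩
  have h1 : (D.F P μ j ^ i) e f = moments P (fun ω => flat (D.freeRun μ (E e.1) i ω))
      (fun ω => flat (D.freeRun μ (E e.2) i ω)) f := by
    have h2 : (fun d => flat (E e.1) d.1 * flat (E e.2) d.2) = Pi.single e 1 := by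
      funext d
      by_cases hd : d = e
      · subst hd; simp [flat, hE]
      · rw [Pi.single_eq_of_ne hd]
        simp only [flat, hE, mul_ite, mul_one, mul_zero]
        split_ifs with h3 h4
        · exact absurd (Prod.ext h4 h3) hd
        · rfl
        · rfl
    rw [h.moments_freeRun hμ (E e.1) (E e.2) i j, h2, Matrix.mulVec_single_one,
      ← Matrix.transpose_pow]
    rfl
  have hc : ∀ b : Fin N × Fin M, ∀ z : Fin N × Fin M,
      MemLp (fun ω => flat (D.freeRun μ (E b) i ω) z) 2 P := fun b z =>
    memLp_pi_iff.1 (h.memLp_flat_freeRun μ (E b) i) z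
  have hsq : ∀ b z : Fin N × Fin M, ∫ ω, flat (D.freeRun μ (E b) i ω) z ^ 2 ∂P ≤
      (∑ b, T (E b)) * θ ^ i := fun b z => by
    have ik : Integrable (fun ω => ‖D.freeRun μ (E b) i ω z.1‖ ^ 2) P :=
      (memLp_pi_iff.1 (h.memLp_freeRun μ (E b) i 2) z.1).integrable_norm_pow (by norm_num)
    refine (integral_mono (hc b z).integrable_sq ik fun ω => ?_).trans ((hT (E b) i z.1).trans
      (mul_le_mul_of_nonneg_right (Finset.single_le_sum (f := fun b => T (E b))
        (fun b _ => hT0 (E b)) (Finset.mem_univ b)) (by positivity)))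
    refine sq_le_sq' ?_ ?_
    · exact (abs_le.1 (abs_coord_le _ z.2)).1
    · exact (abs_le.1 (abs_coord_le _ z.2)).2
  rw [h1, moments]
  refine abs_integral_le_integral_abs.trans ?_
  have i1 : Integrable (fun ω => 1 / 2 * flat (D.freeRun μ (E e.1) i ω) f.1 ^ 2 +
      1 / 2 * flat (D.freeRun μ (E e.2) i ω) f.2 ^ 2) P :=
    ((hc _ _).integrable_sq.const_mul _).add ((hc _ _).integrable_sq.const_mul _)
  refine (integral_mono ((hc e.1 f.1).integrable_mul (hc e.2 f.2)).abs i1 fun ω => ?_).trans ?_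
  · simp only [Pi.mul_apply]
    rw [abs_le]
    constructor <;>
    nlinarith [sq_nonneg (flat (D.freeRun μ (E e.1) i ω) f.1 + flat (D.freeRun μ (E e.2) i ω) f.2),
      sq_nonneg (flat (D.freeRun μ (E e.1) i ω) f.1 - flat (D.freeRun μ (E e.2) i ω) f.2)]
  · rw [integral_add ((hc _ _).integrable_sq.const_mul _) ((hc _ _).integrable_sq.const_mul _),
      integral_const_mul, integral_const_mul]
    linarith [hsq e.1 f.1, hsq e.2 f.2]

/-- A slowly decaying run bounds the entries of the powers of `F` from below. -/
lemma exists_le_sum_abs_F_pow (h : Setting D P μbar) (hμ : μ ∈ Set.Ioo 0 μbar) {θ c : ℝ}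
    (hc : 0 < c) (k : Fin N) {x : Fin N → Vec M}
    (hx : ∀ i, c * θ ^ i ≤ ∫ ω, ‖D.freeRun μ x i ω k‖ ^ 2 ∂P) (j : ℕ) :
    ∃ c', 0 < c' ∧ ∀ i, c' * θ ^ i ≤ ∑ e, ∑ f, |(D.F P μ j ^ i) e f| := by
  set X := ∑ e : (Fin N × Fin M) × (Fin N × Fin M), |flat x e.1 * flat x e.2| with hX
  have hX0 : 0 ≤ X := Finset.sum_nonneg fun e _ => abs_nonneg _
  refine ⟨c / (X + 1), by positivity, fun i => ?_⟩
  set Q := ∑ e, ∑ f, |(D.F P μ j ^ i) e f| with hQ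
  have hQ0 : 0 ≤ Q := Finset.sum_nonneg fun e _ => Finset.sum_nonneg fun f _ => abs_nonneg _
  rw [div_mul_eq_mul_div, div_le_iff₀ (by positivity)]
  have h1 := hx i
  have hm : ∀ m, Integrable (fun ω => flat (D.freeRun μ x i ω) (k, m) *
      flat (D.freeRun μ x i ω) (k, m)) P := fun m =>
    (memLp_pi_iff.1 (h.memLp_flat_freeRun μ x i) (k, m)).integrable_mul
      (memLp_pi_iff.1 (h.memLp_flat_freeRun μ x i) (k, m))
  have h2 : ∫ ω, ‖D.freeRun μ x i ω k‖ ^ 2 ∂P =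
      ∑ m, ∑ e, (D.F P μ j ^ i) e ((k, m), (k, m)) * (flat x e.1 * flat x e.2) := by
    have e1 : ∀ ω, ‖D.freeRun μ x i ω k‖ ^ 2 = ∑ m, flat (D.freeRun μ x i ω) (k, m) *
        flat (D.freeRun μ x i ω) (k, m) := fun ω => by
      rw [norm_sq_vec]
      exact Finset.sum_congr rfl fun m _ => pow_two _
    simp only [e1]
    rw [integral_finsetSum Finset.univ fun m _ => hm m]
    refine Finset.sum_congr rfl fun m _ => ?_
    have := congrFun (h.moments_freeRun hμ x x i j) ((k, m), (k, m))
    rw [← Matrix.transpose_pow] at this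
    exact this
  have h3 : ∀ e, ∑ m, |(D.F P μ j ^ i) e ((k, m), (k, m))| ≤ ∑ f, |(D.F P μ j ^ i) e f| :=
    fun e => by
    have hinj : Function.Injective fun m : Fin M => (((k, m), (k, m)) :
        (Fin N × Fin M) × (Fin N × Fin M)) := fun m m' hmm => by
      simpa using hmm
    rw [← Finset.sum_image (f := fun f => |(D.F P μ j ^ i) e f|)
      (fun m _ m' _ hmm => hinj hmm)]
    exact Finset.sum_le_sum_of_subset_of_nonneg (Finset.subset_univ _) fun f _ _ => abs_nonneg _
  have h4 : ∀ e : (Fin N × Fin M) × (Fin N × Fin M), |flat x e.1 * flat x e.2| ≤ X := fun e =>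
    Finset.single_le_sum (f := fun e : (Fin N × Fin M) × (Fin N × Fin M) =>
      |flat x e.1 * flat x e.2|) (fun e _ => abs_nonneg _) (Finset.mem_univ e)
  have h5 : ∫ ω, ‖D.freeRun μ x i ω k‖ ^ 2 ∂P ≤ Q * X := by
    rw [h2, Finset.sum_comm, hQ, Finset.sum_mul]
    refine Finset.sum_le_sum fun e _ => ?_
    rw [← Finset.sum_mul]
    refine (le_abs_self _).trans ?_
    rw [abs_mul]
    exact mul_le_mul ((Finset.abs_sum_le_sum_abs _ _).trans (h3 e)) (h4 e) (abs_nonneg _)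
      (Finset.sum_nonneg fun f _ => abs_nonneg _)
  linarith

/-- Geometric bounds for the runs without noise bound the rate of every agent. -/
lemma rate_mem_Icc (h : Setting D P μbar) (hμ : μ ∈ Set.Ioo 0 μbar) {θ θ' c : ℝ} (hθ : 0 ≤ θ)
    (hle : ∀ x, ∃ T, 0 ≤ T ∧ ∀ i k, ∫ ω, ‖D.freeRun μ x i ω k‖ ^ 2 ∂P ≤ T * θ ^ i)
    (hθ' : 0 ≤ θ') (hc : 0 < c) (k : Fin N) {x : Fin N → Vec M}
    (hx : ∀ i, c * θ' ^ i ≤ ∫ ω, ‖D.freeRun μ x i ω k‖ ^ 2 ∂P) :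
    ∃ α, α ∈ Set.Icc θ' θ ∧ D.rate P μ k = ENNReal.ofReal α := by
  have hnn : ∀ x i, 0 ≤ ∫ ω, ‖D.freeRun μ x i ω k‖ ^ 2 ∂P := fun x i =>
    integral_nonneg fun ω => sq_nonneg _
  have h1 : D.rate P μ k ≤ ENNReal.ofReal θ := by
    refine iSup_le fun z => ?_
    set y : Fin N → Vec M := fun k => WithLp.toLp 2 fun m => z (k, m) with hy
    have hz : z = flat y := rfl
    obtain ⟨T, -, hT⟩ := hle y
    simp only [hz, h.longTermVar_sub_eq hμ]
    exact limsup_root_le hθ (fun i => abs_nonneg _) (c := T) fun i => by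
      rw [abs_of_nonneg (hnn y i)]
      exact hT i k
  have h2 : ENNReal.ofReal θ' ≤ D.rate P μ k := by
    refine le_iSup_of_le (flat x) ?_
    simp only [h.longTermVar_sub_eq hμ]
    exact le_limsup_root hθ' hc fun i => by
      rw [abs_of_nonneg (hnn x i)]
      exact hx i
  have h3 : D.rate P μ k ≠ ⊤ := ne_top_of_le_ne_top ENNReal.ofReal_ne_top h1
  exact ⟨(D.rate P μ k).toReal, ⟨(ENNReal.ofReal_le_iff_le_toReal h3).1 h2,
    ENNReal.toReal_le_of_le_ofReal hθ h1⟩, (ENNReal.ofReal_toReal h3).symm⟩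

/-- The spectral radius of `F` and the rates of the agents agree with `1 - 2 λ_min` up to
`O(μ²)`. -/
lemma exists_rates (h : Setting D P μbar) (hM : 0 < M) (hμbar : 0 < μbar) {p : Fin N → ℝ}
    (W : ConsensusGauge M (D.A₁ * D.A₂) p) (hp : IsPerronVector D p) :
    ∃ C : ℝ, ∀ᶠ μ in 𝓝[>] (0 : ℝ),
      (∀ j, |specRadius (D.F P μ j) - (1 - 2 * lambdaMin (D.S p μ))| ≤
        C * μ ^ (((N : ℝ) + 1) / N)) ∧
      ∀ k, ∃ α : ℝ, 0 ≤ α ∧ D.rate P μ k = ENNReal.ofReal α ∧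
        |α - (1 - 2 * lambdaMin (D.S p μ))| ≤ C * μ ^ (((N : ℝ) + 1) / N) := by
  obtain ⟨ν, δ, C, hb⟩ := h.exists_bounds
  have hMne : Nonempty (Fin M) := ⟨⟨0, hM⟩⟩
  obtain ⟨k₀, -⟩ := exists_qhat_pos hp h.net
  have hN : 0 < N := k₀.pos
  set hS := hb.isHermitian_Shat p with hSdef
  obtain ⟨j₀, hmin⟩ := Finite.exists_min hS.eigenvalues
  obtain ⟨K₁, μ₁, hK₁, hμ₁, hup⟩ := h.exists_freeRun_le W hp (min_eigenvalue_le hS hmin)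
  obtain ⟨K₂, μ₂, hK₂, hμ₂, hlow⟩ := h.exists_le_freeRun hb W hp hmin
  rw [← hSdef] at hlow
  refine ⟨K₁ + K₂, ?_⟩
  filter_upwards [Ioo_mem_nhdsGT (lt_min (lt_min hμbar one_pos) (lt_min hμ₁ hμ₂))] with μ hμ
  obtain ⟨m1, m2⟩ := lt_min_iff.1 hμ.2
  obtain ⟨m1, m3⟩ := lt_min_iff.1 m1
  obtain ⟨m2, m4⟩ := lt_min_iff.1 m2
  have hμ0 : 0 < μ := hμ.1
  have hμI : μ ∈ Set.Ioo 0 μbar := ⟨hμ0, m1⟩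
  obtain ⟨hθ, hle⟩ := hup μ hμI m2
  obtain ⟨hθ', x, hx⟩ := hlow μ hμI m4
  -- `(N + 1) / N ≤ 2`, and `μ < 1`
  have hpow : μ ^ 2 ≤ μ ^ (((N : ℝ) + 1) / N) := by
    rw [← Real.rpow_natCast]
    refine Real.rpow_le_rpow_of_exponent_ge hμ0 m3.le ?_
    have hN1 : (1 : ℝ) ≤ N := by exact_mod_cast hN
    rw [div_le_iff₀ (by linarith)]
    push_cast
    linarith
  have hfin : ∀ α ∈ Set.Icc (1 - 2 * μ * hS.eigenvalues j₀ - K₂ * μ ^ 2)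
      (1 - 2 * μ * hS.eigenvalues j₀ + K₁ * μ ^ 2),
      |α - (1 - 2 * lambdaMin (D.S p μ))| ≤ (K₁ + K₂) * μ ^ (((N : ℝ) + 1) / N) := by
    rintro α ⟨a1, a2⟩
    rw [D.S_eq, lambdaMin_smul hS hmin hμ0.le]
    refine le_trans ?_ (mul_le_mul_of_nonneg_left hpow (by positivity))
    rw [abs_le]
    have : 0 ≤ K₁ * μ ^ 2 := by positivity
    have : 0 ≤ K₂ * μ ^ 2 := by positivity
    constructor <;> linarith
  refine ⟨fun j => ?_, fun k => ?_⟩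
  · obtain ⟨T, hT⟩ := h.exists_abs_F_pow_le hμI hθ hle j
    obtain ⟨c', hc', hge⟩ := h.exists_le_sum_abs_F_pow hμI (by norm_num) k₀
      (fun i => hx i k₀) j
    exact hfin _ (specRadius_mem_Icc hθ hθ' hc' hT hge)
  · obtain ⟨α, hα, hr⟩ := h.rate_mem_Icc hμI hθ hle hθ' (by norm_num) k fun i => hx i k
    exact ⟨α, hθ'.trans hα.1, hr, hfin α hα⟩

end Setting

end Rates

end CoordDiffusion

theorem theorem2 {N M : ℕ} (hM : 0 < M) {Ω : Type*} [MeasurableSpace Ω]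
    (P : Measure Ω) [IsProbabilityMeasure P] (D : Model N M Ω) (μbar : ℝ) (hμbar : 0 < μbar)
    (hnet : NetworkConditions D) (hcost : CostConditions D) (hreg : Regularity D P)
    (hmask : MaskConditions D P μbar) (hnoise : NoiseConditions D P μbar)
    (hsmooth : SmoothnessConditions D P μbar)
    (G : Fin N → Matrix (Fin M) (Fin M) ℝ) (hG : IsLimitCov D P μbar G)
    (p : Fin N → ℝ) (hp : IsPerronVector D p) :
    -- the moments in the performance measures are finite
    (∀ μ ∈ Set.Ioo 0 μbar, ∀ k i,
      Integrable (fun ω => ‖D.wo - D.iter μ i k ω‖ ^ 2) P ∧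
      Integrable (fun ω => D.Jbar p μ (D.iter μ i k ω)) P) ∧
    -- mean-square deviation
    (∃ MSD : Fin N → ℝ → ℝ,
      (∀ k, IsFirstOrderValue (fun μ i => ∫ ω, ‖D.wo - D.iter μ i k ω‖ ^ 2 ∂P) (MSD k)) ∧
      ∀ μ : ℝ, 0 < μ → ∀ k i,
        MSD k μ = 1 / N * ∑ l, MSD l μ ∧
        MSD k μ = 1 / 2 * ((D.S p μ)⁻¹ * D.maskedCovSum P p G μ i).trace) ∧
    -- excess risk
    (∃ ER : Fin N → ℝ → ℝ,
      (∀ k, IsFirstOrderValue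
        (fun μ i => ∫ ω, (D.Jbar p μ (D.iter μ i k ω) - D.Jbar p μ D.wo) ∂P) (ER k)) ∧
      ∀ μ : ℝ, 0 < μ → ∃ X : Matrix (Fin M) (Fin M) ℝ,
        X * D.S p μ + D.S p μ * X = D.Hbar p μ ∧
        (∀ Y, Y * D.S p μ + D.S p μ * Y = D.Hbar p μ → Y = X) ∧
        ∀ k i,
          ER k μ = 1 / N * ∑ l, ER l μ ∧
          ER k μ = 1 / 2 * (X * D.maskedCovSum P p G μ i).trace) ∧
    -- the error variance of the long-term model is a transient term governed by the powers of `F`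
    -- plus a term that does not depend on the initial error
    (∀ μ ∈ Set.Ioo 0 μbar, ∀ x₀ : Ω → Fin N × Fin M → ℝ,
      Measurable[D.past μ 0] x₀ → MemLp x₀ 2 P → ∀ i j : ℕ,
        ∑ k, D.longTermVar P μ x₀ k i =
          ∫ ω, weightedSq (x₀ ω) ((D.F P μ j ^ i) *ᵥ vecOne (Fin N × Fin M)) ∂P +
            ∑ k, D.longTermVar P μ 0 k i) ∧
    -- convergence rate
    (∃ C : ℝ, ∀ᶠ μ in 𝓝[>] (0 : ℝ),
      (∀ j, |specRadius (D.F P μ j) - (1 - 2 * lambdaMin (D.S p μ))| ≤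
        C * μ ^ (((N : ℝ) + 1) / N)) ∧
      ∀ k, ∃ α : ℝ, 0 ≤ α ∧ D.rate P μ k = ENNReal.ofReal α ∧
        |α - (1 - 2 * lambdaMin (D.S p μ))| ≤ C * μ ^ (((N : ℝ) + 1) / N)) := by
  have h : Setting D P μbar := ⟨hnet, hcost, hreg, hmask, hnoise, hsmooth⟩
  obtain ⟨W⟩ := (hnet.A₁_stoch.mul hnet.A₂_stoch).exists_consensusGauge M hnet.primitive hp.1 hp.2
  exact ⟨fun μ hμ k i => h.integrable_moments p hμ k i, h.exists_msd hμbar W hp hG,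
    h.exists_er hμbar W hp hG, fun μ hμ x₀ hx hx2 i j => h.sum_longTermVar hμ hx hx2 i j,
    h.exists_rates hM hμbar W hp⟩
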